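/- **Setting.** Let $P=\{u\in\mathbb R^n : \ell_j(u)=\langle u,\boldsymbol b_j\rangle-\lambda_j\ge 0,\ j=1,\dots,m\}$ be a labelled simple rational convex polytope with $m$ facets, where $\boldsymbol b_j=c_j\boldsymbol v_j\in N=\mathbb Z^n$, $\boldsymbol v_j$ is the primitive inward normal of the $j$-th facet, and $c_j\ge 1$ is its integer label. Let $\Sigma=\Sigma(P)$ be its (simplicial) normal fan, $Z(\Sigma)\subset\mathbb C^m$ the union of the subspaces $\{z_j=0,\ j\in S\}$ over all primitive collections $S$, $K_{\mathbb C}=\ker\big((\mathbb C^*)^m\to(\mathbb C^*)^n,\ t\mapsto(\prod_j t_j^{b_{ja}})_a\big)$, and $\mathcal X=(\mathbb C^m\setminus Z(\Sigma))/K_{\mathbb C}$ the associated compact toric orbifold. For an $n$-dimensional cone $\sigma$ with rays $i_1,\dots,i_n$ let $N_\sigma=\bigoplus_l\mathbb Z\boldsymbol b_{i_l}$ and let $(\boldsymbol u_{i_l})$ be the basis dual to $(\boldsymbol b_{i_l})$. The uniformizing chart of $\mathcal X$ for $\sigma$ is $\mathbb C^n$, mapped to $\mathcal X$ by $z_{i_l}=x_l$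 and $z_j=1$ for the other $j$; the group $G_\sigma=N/N_\sigma$ acts on it by $\nu\cdot x=(e^{2\pi i\langle\nu,\boldsymbol u_{i_l}\rangle}x_l)_l$. Put $Box_\sigma=\{\sum_l c_l\boldsymbol b_{i_l}\in N: c_l\in[0,1)\}$ (it represents $G_\sigma$) and $Box=\bigcup_\sigma Box_\sigma$, which indexes the twisted sectors. The age of $\nu=\sum_l c_l\boldsymbol b_{i_l}\in Box_\sigma$ is $\iota(\nu)=\sum_l c_l$. Let $L\subset\mathcal X$ be the Lagrangian torus fiber over an interior point $u$ of $P$, that is, the image of $\{z:|z_j|^2/2=\ell_j(u)\ \forall j\}$, and let $\widetilde L\subset\mathbb C^m\setminus Z(\Sigma)$ be an orbit of $(S^1)^m$ whose image in $\mathcal X$ is $L$. Let $\mathcal D$ be the closed unit disc $D^2$ with distinct interior marked points $z_1^+,\dots,z_k^+$ and orbifold structure $\mathbb Z/m_i$ at $z_i^+$ ($m_i\ge1$). A continuous map $w:(D^2,\partial D^2)\to(\mathcal X,L)$ is a *holomorphic map from $\mathcal D$* if near every point $p$ it lifts, through the branched covering $y\mapsto p+y^{e}$ ($e=m_i$ if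 $p=z_i^+$, and $e=1$ if $p$ is not marked), to a map into a uniformizing chart of $\mathcal X$ that is holomorphic over the open disc and smooth up to the boundary. The *sector* of $w$ at $z_i^+$ is the $\nu^i\in N$ such that every lift $\widetilde f$ at $z_i^+$, to any chart $\sigma$, satisfies $\nu^i\in Box_\sigma$ and $\widetilde f(e^{2\pi i/m_i}y)=\nu^i\cdot\widetilde f(y)$; equivalently, the homomorphism of local groups $\mathbb Z/m_i\to G_{w(z_i^+)}$ sends $1$ to $\nu^i$. The map $w$ is *representable* if these homomorphisms are injective. The bundle pair of $w$ is the complex orbibundle $w^*T\mathcal X$ with the subbundle $w|_{\partial D^2}^*TL$. The *desingularized Maslov index* $\mu^{de}(w)$ is the Maslov index (rotation number of $\det^2/|\det|^2$ along the boundary in a global trivialization) of the desingularization $|w^*T\mathcal X|$, the bundle on $D^2$ that extends $w^*T\mathcal X$ across $z_i^+$ by $(y,\xi_1,\dots,\xi_n)\mapsto(y^{m_i},y^{-m_{i,1}}\xi_1,\dots,y^{-m_{i,n}}\xi_n)$, where the local generator acts on the fibre by $\mathrm{diag}(e^{2\pi i m_{i,l}/m_i})$ with $0\le m_{i,l}<m_i$.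 The *Chern–Weil Maslov index* is $\mu_{CW}(w)=\frac{\sqrt{-1}}{\pi}\int_{\mathcal D}\mathrm{tr}\,F_\nabla$ for a Hermitian metric on the orbibundle for which the boundary condition is Lagrangian and any unitary orbibundle connection $\nabla$ that preserves the Lagrangian subbundle along $\partial D^2$. (Part of the claim is that such trivializations, metrics and connections exist and that the indices do not depend on them.) **Theorem.** 1. Let $w:(\mathcal D,\partial\mathcal D)\to(\mathcal X,L)$ be holomorphic. Then $w$ has a unique sector $\nu^i$ at each marked point $z_i^+$, and $\nu^i\in Box$. Write $\nu^i=\sum_{j=1}^m c_{ij}\boldsymbol b_j$ with rational $c_{ij}\in[0,1)$ and with $\{j: c_{ij}\neq0\}$ contained in the set of rays of one cone. 2. There are integers $d_j\ge0$, points $\alpha_{j,s}\in\mathrm{int}(D^2)$ ($1\le s\le d_j$) and $a=(a_1,\dots,a_m)\in\widetilde L$ (in particular $a_j\in\mathbb C^*$) such that for all $z\in D^2$ the vector $\widetilde w(z)=(\widetilde w_1(z),\dots,\widetilde w_m(z))$, $$\widetilde w_j(z)=a_j\prod_{s=1}^{d_j}\frac{z-\alpha_{j,s}}{1-\overline{\alpha}_{j,s}z}\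 \prod_{i=1}^k\Big(\frac{z-z_i^+}{1-\overline{z_i^+}z}\Big)^{c_{ij}},$$ lies in $\mathbb C^m\setminus Z(\Sigma)$ and represents $w(z)$ modulo $K_{\mathbb C}$. (The fractional powers are principal values, with $0^0=1$ and $0^{c}=0$ for $c>0$.) Moreover the order of $\nu^i$ in the local group, which is the least common multiple of the denominators of $c_{i1},\dots,c_{im}$, divides $m_i$. 3. Conversely, let $\nu^i=\sum_j c_{ij}\boldsymbol b_j\in Box$ with $c_{ij}$ as in 1 and with order dividing $m_i$, let $d_j\ge0$, $\alpha_{j,s}\in\mathrm{int}(D^2)$ and $a\in\widetilde L$, and suppose that $\widetilde w(z)\in\mathbb C^m\setminus Z(\Sigma)$ for all $z\in D^2$. Then $w=[\widetilde w]$ is a holomorphic map $(\mathcal D,\partial\mathcal D)\to(\mathcal X,L)$ with sector $\nu^i$ at $z_i^+$, and it is representable if and only if $m_i$ equals the order of $\nu^i$ for every $i$. 4. For every $w$ as in 2 or 3, $$\mu^{de}(w)=\sum_{j=1}^m 2d_j,\qquad \mu_{CW}(w)=\sum_{j=1}^m 2d_j+2\sum_{i=1}^k\iota(\nu^i).$$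 -/

import Mathlib

open scoped ContDiff Topology ComplexConjugate ComplexOrder
open Complex

/-- The orbit of `z` under the real torus `(S¹)ᵐ`. -/
def realTorusOrbit {m : ℕ} (z : Fin m → ℂ) : Set (Fin m → ℂ) :=
  {y | ∃ t : Fin m → Circle, ∀ j, y j = t j * z j}

/-! ### Labelled polytopes, their stacky fans, and the associated toric orbifolds -/

/-- A labelled simple rational convex polytope in `ℝⁿ` with `m` facets: primitive integral inward
normals `v j`, positive integer labels, and offsets `off j`; the stacky vectors are
`b j = label j • v j`, and the polytope is `{u | ⟨u, b j⟩ ≥ off j for all j}`. -/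
structure LabeledPolytope (n m : ℕ) where
  v : Fin m → Fin n → ℤ
  label : Fin m → ℕ
  off : Fin m → ℝ
  primitive : ∀ j, ∀ q : ℤ, (∀ a, q ∣ v j a) → IsUnit q
  label_pos : ∀ j, 0 < label j
  bounded : Bornology.IsBounded
    {u : Fin n → ℝ | ∀ j, 0 ≤ ∑ a, u a * ((label j : ℝ) * (v j a : ℝ)) - off j}
  fullDim : (interior
    {u : Fin n → ℝ | ∀ j, 0 ≤ ∑ a, u a * ((label j : ℝ) * (v j a : ℝ)) - off j}).Nonempty
  /-- each of the `m` inequalities defines a facet, and these facets are distinct -/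
  facet : ∀ j, ∃ u : Fin n → ℝ, ∑ a, u a * ((label j : ℝ) * (v j a : ℝ)) - off j = 0 ∧
    ∀ i, i ≠ j → 0 < ∑ a, u a * ((label i : ℝ) * (v i a : ℝ)) - off i
  /-- exactly `n` facets meet at every vertex -/
  simple : ∀ u ∈ Set.extremePoints ℝ
    {u : Fin n → ℝ | ∀ j, 0 ≤ ∑ a, u a * ((label j : ℝ) * (v j a : ℝ)) - off j},
    {j | ∑ a, u a * ((label j : ℝ) * (v j a : ℝ)) - off j = 0}.ncard = n

namespace LabeledPolytope

variable {n m : ℕ} (P : LabeledPolytope n m)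

/-- The stacky vectors `b_j = c_j v_j`. -/
def b (j : Fin m) (a : Fin n) : ℤ := (P.label j : ℤ) * P.v j a

/-- `ℓ_j(u) = ⟨u, b_j⟩ - λ_j`. -/
def ell (j : Fin m) (u : Fin n → ℝ) : ℝ := ∑ a, u a * (P.b j a : ℝ) - P.off j

/-- The moment polytope. -/
def polytope : Set (Fin n → ℝ) := {u | ∀ j, 0 ≤ P.ell j u}

/-- The cones of the (simplicial) normal fan: a cone is recorded by the set of its rays. The cone
of a face is spanned by the normals of the facets containing it, that is, of the facets that are
active at a relative interior point `u` of the face. -/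
def IsCone (I : Finset (Fin m)) : Prop := ∃ u ∈ P.polytope, ∀ j, j ∈ I ↔ P.ell j u = 0

def IsPrimitiveCollection (S : Finset (Fin m)) : Prop :=
  ¬ P.IsCone S ∧ ∀ T, T ⊂ S → P.IsCone T

/-- The exceptional set `Z(Σ)`. -/
def Z : Set (Fin m → ℂ) := {z | ∃ S, P.IsPrimitiveCollection S ∧ ∀ j ∈ S, z j = 0}

/-- `U(Σ) = ℂᵐ ∖ Z(Σ)`. -/
def U : Set (Fin m → ℂ) := P.Zᶜ

/-- The group `K_ℂ`, the kernel of `(ℂ*)ᵐ → (ℂ*)ⁿ`, `λ ↦ (∏ λ_j ^ b_{ja})_a`. -/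
def KC : Subgroup (Fin m → ℂˣ) where
  carrier := {t | ∀ a, ∏ j, t j ^ P.b j a = 1}
  mul_mem' := by
    intro s t hs ht a
    have h1 : ∏ j, s j ^ P.b j a = 1 := hs a
    have h2 : ∏ j, t j ^ P.b j a = 1 := ht a
    simp [mul_zpow, Finset.prod_mul_distrib, h1, h2]
  one_mem' := by intro a; simp
  inv_mem' := by
    intro t ht a
    have h2 : ∏ j, t j ^ P.b j a = 1 := ht a
    simp [h2]

/-- Two points of `ℂᵐ` lie in the same `K_ℂ`-orbit. -/
def SameOrbit (z z' : Fin m → ℂ) : Prop := ∃ t ∈ P.KC, ∀ j, z' j = (t j : ℂ) * z j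

instance orbitSetoid : Setoid P.U where
  r z z' := P.SameOrbit z.1 z'.1
  iseqv :=
    { refl := fun z => ⟨1, P.KC.one_mem, fun j => by simp⟩
      symm := by
        rintro z z' ⟨t, ht, h⟩
        exact ⟨t⁻¹, P.KC.inv_mem ht, fun j => by simp [h j]⟩
      trans := by
        rintro z z' z'' ⟨t, ht, h⟩ ⟨s, hs, h'⟩
        exact ⟨s * t, P.KC.mul_mem hs ht, fun j => by simp [h j, h' j, mul_assoc]⟩ }

/-- The underlying topological space `U(Σ) / K_ℂ` of the toric orbifold (quotient topology). -/
abbrev X : Type := Quotient P.orbitSetoid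

/-- `z` lies in `U(Σ)` and is a vector of homogeneous coordinates of the point `x`. -/
def Rep (x : P.X) (z : Fin m → ℂ) : Prop := ∃ h : z ∈ P.U, x = Quotient.mk P.orbitSetoid ⟨z, h⟩

/-- The torus fibre `L(u) = μ_T⁻¹(u)`: points with homogeneous coordinates `z` on the level
`|z_j|² / 2 = ℓ_j(u)`. -/
def torusFiber (u : Fin n → ℝ) : Set P.X :=
  {x | ∃ z, P.Rep x z ∧ ∀ j, ‖z j‖ ^ 2 / 2 = P.ell j u}

/-! ### Uniformizing charts, the box, and ages -/

/-- An `n`-dimensional cone with an ordering `i_1, …, i_n` of its rays. It carries the uniformizing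
chart `U'_σ = ℂⁿ`. -/
structure Chart where
  ray : Fin n ↪ Fin m
  isCone : P.IsCone (Finset.univ.map ray)

variable {P}

/-- Homogeneous coordinates of the image in `X` of the point `x` of `U'_σ = ℂⁿ`:
`z_{i_l} = x_l`, and `z_j = 1` for the rays `j` outside the cone. -/
noncomputable def Chart.homog (s : P.Chart) (x : Fin n → ℂ) : Fin m → ℂ :=
  Function.extend s.ray x 1

/-- `⟨ν, u_{i_l}⟩`, where `u_{i_1}, …, u_{i_n}` is the basis dual to `b_{i_1}, …, b_{i_n}`. -/
noncomputable def Chart.coeff (s : P.Chart) (ν : Fin n → ℤ) (l : Fin n) : ℚ :=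
  ∑ a, (ν a : ℚ) * (Matrix.of fun (r a : Fin n) => (P.b (s.ray r) a : ℚ))⁻¹ a l

/-- The action of (the class of) `ν ∈ N` in `G_σ = N / N_σ` on the chart `U'_σ`. -/
noncomputable def Chart.act (s : P.Chart) (ν : Fin n → ℤ) (x : Fin n → ℂ) : Fin n → ℂ :=
  fun l => exp (2 * Real.pi * I * ((s.coeff ν l : ℚ) : ℂ)) * x l

/-- `Box_σ`: lattice vectors `∑ c_l b_{i_l}` with `c_l ∈ [0, 1)`. -/
def Chart.box (s : P.Chart) : Set (Fin n → ℤ) :=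
  {ν | ∃ c : Fin n → ℚ, (∀ l, 0 ≤ c l ∧ c l < 1) ∧
    ∀ a, (ν a : ℚ) = ∑ l, c l * (P.b (s.ray l) a : ℚ)}

variable (P)

/-- `Box`, the index set of the twisted sectors. -/
def Box : Set (Fin n → ℤ) := {ν | ∃ s : P.Chart, ν ∈ s.box}

open Classical in
/-- The age (degree shifting number) of the sector `ν`: the sum of the numbers `θ_l ∈ [0, 1)` such
that `ν` acts on the tangent space of a chart with eigenvalues `exp (2πi θ_l)`. -/
noncomputable def age (ν : Fin n → ℤ) : ℚ :=
  if h : ∃ s : P.Chart, ν ∈ s.box then ∑ l, Int.fract (h.choose.coeff ν l) else 0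

/-- `ν = ∑_j c_j b_j` with `c_j ∈ [0, 1)`, the `c_j` being supported on the rays of one cone. -/
def IsBoxCoeff (ν : Fin n → ℤ) (c : Fin m → ℚ) : Prop :=
  (∀ j, 0 ≤ c j ∧ c j < 1) ∧ (∀ a, (ν a : ℚ) = ∑ j, c j * (P.b j a : ℚ)) ∧
    ∃ s : P.Chart, ∀ j, j ∉ Set.range s.ray → c j = 0

end LabeledPolytope

/-- The order of `∑_j c_j b_j` in the local group: the least common multiple of the denominators
of the `c_j`. -/
def sectorOrder {m : ℕ} (c : Fin m → ℚ) : ℕ := Finset.univ.lcm fun j => (c j).den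

/-! ### Orbifold discs and holomorphic maps from them -/

/-- The closed unit disc with `k` distinct interior marked points `pts i` and a local group
`ℤ / ord i` at `pts i` (`ord i = 1` for a smooth marked point). -/
structure MarkedOrbiDisc (k : ℕ) where
  pts : Fin k → ℂ
  ord : Fin k → ℕ
  pts_mem : ∀ i, pts i ∈ Metric.ball (0 : ℂ) 1
  pts_inj : Function.Injective pts
  ord_pos : ∀ i, 0 < ord i

/-- `e` is the order of the local group at the point `p` of the disc. -/
def MarkedOrbiDisc.IsLocalOrder {k : ℕ} (D : MarkedOrbiDisc k) (p : ℂ) (e : ℕ) : Prop :=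
  p ∈ Metric.closedBall (0 : ℂ) 1 ∧
    ((∃ i, p = D.pts i ∧ e = D.ord i) ∨ ((∀ i, p ≠ D.pts i) ∧ e = 1))

namespace LabeledPolytope

variable {n m k : ℕ} (P : LabeledPolytope n m)

/-- A local holomorphic lift of `w` at the point `p` of the orbifold disc, to a uniformizing chart
of the toric orbifold. The neighbourhood of `p` is uniformized by the branched covering
`y ↦ p + y ^ e`, with `e` the order of the local group at `p`, and it contains no marked point other
than (possibly) `p`. At the boundary the lift is smooth up to the boundary. -/
structure LocalLift (D : MarkedOrbiDisc k) (w : ℂ → P.X) where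
  p : ℂ
  e : ℕ
  chart : P.Chart
  f : ℂ → Fin n → ℂ
  ε : ℝ
  localOrder : D.IsLocalOrder p e
  ε_pos : 0 < ε
  isolated : ∀ y, ‖y‖ < ε → ∀ i, p + y ^ e = D.pts i → y = 0
  lifts : ∀ y, ‖y‖ < ε → p + y ^ e ∈ Metric.closedBall (0 : ℂ) 1 →
    P.Rep (w (p + y ^ e)) (chart.homog (f y))
  smooth : ContDiffOn ℝ ∞ f {y | ‖y‖ < ε ∧ p + y ^ e ∈ Metric.closedBall (0 : ℂ) 1}
  holo : DifferentiableOn ℂ f {y | ‖y‖ < ε ∧ p + y ^ e ∈ Metric.ball (0 : ℂ) 1}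

/-- `w` is a holomorphic map from the orbifold disc to the toric orbifold, with boundary on `L`. -/
def IsHolomorphic (D : MarkedOrbiDisc k) (L : Set P.X) (w : ℂ → P.X) : Prop :=
  ContinuousOn w (Metric.closedBall 0 1) ∧
  (∀ p ∈ Metric.closedBall (0 : ℂ) 1, ∃ F : P.LocalLift D w, F.p = p) ∧
  ∀ p ∈ Metric.sphere (0 : ℂ) 1, w p ∈ L

variable {P} {D : MarkedOrbiDisc k} {w : ℂ → P.X}

namespace LocalLift

/-- The branched covering. -/
def br (F : P.LocalLift D w) (y : ℂ) : ℂ := F.p + y ^ F.e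

/-- The domain of the lift. -/
def dom (F : P.LocalLift D w) : Set ℂ := {y | ‖y‖ < F.ε ∧ F.br y ∈ Metric.closedBall (0 : ℂ) 1}

/-- The part of the domain over the open disc. -/
def inner (F : P.LocalLift D w) : Set ℂ := {y | ‖y‖ < F.ε ∧ F.br y ∈ Metric.ball (0 : ℂ) 1}

/-- The standard generator of the local group. -/
noncomputable def gen (F : P.LocalLift D w) : ℂ := exp (2 * Real.pi * I / F.e)

end LocalLift

variable (P) (D) (w)

/-- The homomorphism `ℤ / ord i → G_{w (pts i)}` attached to `w` at the `i`-th marked point sends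
the standard generator to `ν`. -/
def IsSector (i : Fin k) (ν : Fin n → ℤ) : Prop :=
  ∀ F : P.LocalLift D w, F.p = D.pts i →
    ν ∈ F.chart.box ∧ ∀ y ∈ F.dom, F.f (F.gen * y) = F.chart.act ν (F.f y)

/-- `w` is injective on local groups. -/
def IsRepresentable : Prop :=
  ∀ i, ∀ F : P.LocalLift D w, F.p = D.pts i → ∀ ζ : ℂ, ζ ^ D.ord i = 1 →
    (∀ y ∈ F.dom, F.f (ζ * y) = F.f y) → ζ = 1

variable {P} {D} {w}

/-! ### The pull-back of the tangent orbibundle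

A local lift `F` trivializes the pull-back `w^* T X` over `F.dom` by `T ℂⁿ = ℂⁿ`. Two such
trivializations are glued by the derivative of a transition map `φ` between the uniformizing
charts. (With `F = F'` this includes the action of the local groups.) -/

/-- `α` is a local transition between the uniformizing discs of `F` and `F'` with `α y = y'`, at a
point over an interior unmarked point of the disc, and `φ` is a local transition between the
uniformizing charts of the toric orbifold which carries the lift `F` to the lift `F'`. -/
def IsGluing (F F' : P.LocalLift D w) (y y' : ℂ) (α : ℂ → ℂ) (φ : (Fin n → ℂ) → Fin n → ℂ) : Prop :=
  y ∈ F.inner ∧ y' ∈ F'.inner ∧ (∀ i, F.br y ≠ D.pts i) ∧ α y = y' ∧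
  AnalyticAt ℂ α y ∧ (∀ᶠ t in 𝓝 y, F'.br (α t) = F.br t) ∧ AnalyticAt ℂ φ (F.f y) ∧
  (∀ᶠ x in 𝓝 (F.f y), P.SameOrbit (F.chart.homog x) (F'.chart.homog (φ x))) ∧
  ∀ᶠ t in 𝓝 y, F'.f (α t) = φ (F.f t)

/-- The complex Jacobian matrix of `φ` at `x`. -/
noncomputable def jac (φ : (Fin n → ℂ) → Fin n → ℂ) (x : Fin n → ℂ) : Matrix (Fin n) (Fin n) ℂ :=
  Matrix.of fun a c => fderiv ℂ φ x (Pi.single c 1) a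

/-- The tangent space at `x` of the torus `{|x_l| = const}`, that is, of the Lagrangian fibre in a
uniformizing chart. -/
def torusTangent (x : Fin n → ℂ) : Set (Fin n → ℂ) := {ξ | ∃ t : Fin n → ℝ, ∀ l, ξ l = I * t l * x l}

/-! ### The desingularized Maslov index -/

/-- The generator of the local group acts on the fibre of `w^* T X` at the centre of the lift by
`diag (exp (2πi μ_l / e))`, where `0 ≤ μ_l < e`. -/
def IsWeights (F : P.LocalLift D w) (μ : Fin n → ℕ) : Prop :=
  ∀ l, μ l < F.e ∧ ∀ y ∈ F.dom, F.f (F.gen * y) l = F.gen ^ μ l * F.f y l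

variable (D w) in
/-- A global (continuous, complex) trivialization of the desingularization `|w^* T X|`: a frame
`A F y`, written in the trivialization of each local lift `F`. At a marked point, `|w^* T X|` is
the extension of `w^* T X` across the puncture given by
`(y, ξ_1, …, ξ_n) ↦ (y ^ e, y ^ (-μ_1) ξ_1, …, y ^ (-μ_n) ξ_n)`. -/
structure DesingFrame where
  A : P.LocalLift D w → ℂ → Matrix (Fin n) (Fin n) ℂ
  continuousOn : ∀ F, ContinuousOn (A F) {y | y ∈ F.dom ∧ ∀ i, F.br y ≠ D.pts i}
  det_ne_zero : ∀ F, ∀ y ∈ F.dom, (∀ i, F.br y ≠ D.pts i) → (A F y).det ≠ 0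
  glue : ∀ F F' y y' α φ, IsGluing F F' y y' α φ → A F' y' = jac φ (F.f y) * A F y
  extend : ∀ i, ∀ F : P.LocalLift D w, F.p = D.pts i →
    ∃ (μ : Fin n → ℕ) (B : ℂ → Matrix (Fin n) (Fin n) ℂ), IsWeights F μ ∧ ContinuousAt B 0 ∧
      (B 0).det ≠ 0 ∧
      ∀ᶠ y in 𝓝[≠] (0 : ℂ), A F y = Matrix.diagonal (fun l => y ^ μ l) * B (y ^ F.e)

/-- `Λ` is the boundary loop of totally real subspaces of `ℂⁿ` given by the tangent spaces of the
Lagrangian fibre in the trivialization `T`. -/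
def DesingFrame.IsBoundaryLoop (T : DesingFrame D w) (Λ : ℝ → Set (Fin n → ℂ)) : Prop :=
  ∀ θ : ℝ, ∀ F : P.LocalLift D w, F.p = exp (θ * I) →
    Λ θ = {ξ | (T.A F 0).mulVec ξ ∈ torusTangent (F.f 0)}

/-- The Maslov index of a loop `θ ↦ Λ θ`, `θ ∈ [0, 2π]`, of totally real subspaces of `ℂⁿ`: the
rotation number of `det² / |det|²`. -/
def IsMaslovIndex (Λ : ℝ → Set (Fin n → ℂ)) (μ : ℤ) : Prop :=
  ∃ (R : ℝ → Matrix (Fin n) (Fin n) ℂ) (ψ : ℝ → ℝ), Continuous R ∧ Continuous ψ ∧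
    (∀ θ, (R θ).det ≠ 0) ∧
    (∀ θ, Λ θ = {ξ | ∃ t : Fin n → ℝ, ξ = (R θ).mulVec fun l => (t l : ℂ)}) ∧
    (∀ θ, (R θ).det ^ 2 = (‖(R θ).det‖ : ℂ) ^ 2 * exp (ψ θ * I)) ∧
    ψ (2 * Real.pi) - ψ 0 = 2 * Real.pi * μ

variable (D w) in
/-- The desingularized Maslov index of `w` is `μ`: there are trivializations of `|w^* T X|`, and
in every one of them the boundary loop has Maslov index `μ`. -/
def HasDesingularizedMaslovIndex (μ : ℤ) : Prop :=
  (∃ (T : DesingFrame D w) (Λ : ℝ → Set (Fin n → ℂ)), T.IsBoundaryLoop Λ) ∧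
  ∀ (T : DesingFrame D w) (Λ : ℝ → Set (Fin n → ℂ)), T.IsBoundaryLoop Λ → IsMaslovIndex Λ μ

/-! ### The Chern-Weil Maslov index -/

variable (D w) in
/-- A Hermitian metric on the orbibundle `w^* T X` for which the boundary condition is Lagrangian,
with a unitary connection that preserves the Lagrangian subbundle along the boundary. In the
trivialization of a local lift `F` the metric is `(ξ, η) ↦ ξᴴ (h F y) η`, and the connection
is `d + Γ F`. Both are smooth on the uniformizing discs and invariant under all transitions. -/
structure OrthogonalConnection where
  h : P.LocalLift D w → ℂ → Matrix (Fin n) (Fin n) ℂ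
  Γ : P.LocalLift D w → ℂ → ℂ →ₗ[ℝ] Matrix (Fin n) (Fin n) ℂ
  h_smooth : ∀ F a c, ContDiffOn ℝ ∞ (fun y => h F y a c) F.dom
  Γ_smooth : ∀ F v a c, ContDiffOn ℝ ∞ (fun y => Γ F y v a c) F.dom
  h_posDef : ∀ F, ∀ y ∈ F.dom, (h F y).PosDef
  h_glue : ∀ F F' y y' α φ, IsGluing F F' y y' α φ →
    (jac φ (F.f y)).conjTranspose * h F' y' * jac φ (F.f y) = h F y
  Γ_glue : ∀ F F' y y' α φ, IsGluing F F' y y' α φ → ∀ v : ℂ,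
    Γ F' y' (deriv α y * v) * jac φ (F.f y) = jac φ (F.f y) * Γ F y v -
      Matrix.of fun a c => fderiv ℝ (fun t => jac φ (F.f t) a c) y v
  unitary : ∀ F, ∀ y ∈ F.inner, ∀ v : ℂ,
    (Matrix.of fun a c => fderiv ℝ (fun t => h F t a c) y v) =
      (Γ F y v).conjTranspose * h F y + h F y * Γ F y v
  /-- the imaginary part of the metric vanishes on the boundary condition -/
  lagrangian : ∀ F : P.LocalLift D w, F.e = 1 → ∀ y ∈ F.dom, ‖F.br y‖ = 1 →
    ∀ ξ ∈ torusTangent (F.f y), ∀ η ∈ torusTangent (F.f y), (star ξ ⬝ᵥ (h F y).mulVec η).im = 0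
  /-- the covariant derivatives along the boundary of the basis sections `i f_c e_c` of the
  Lagrangian subbundle are again in the Lagrangian subbundle -/
  preserves : ∀ F : P.LocalLift D w, F.e = 1 → ∀ y ∈ F.dom, ‖F.br y‖ = 1 → ∀ c : Fin n,
    Pi.single c (deriv (fun t : ℝ => I * F.f (F.br y * exp (t * I) - F.p) c) 0) +
      (Γ F y (I * F.br y)).mulVec (Pi.single c (I * F.f y c)) ∈ torusTangent (F.f y)

/-- The value of the curvature `dΓ + Γ ∧ Γ` on the pair of tangent vectors `(1, i)` at `y`. -/
noncomputable def curvature (Γ : ℂ → ℂ →ₗ[ℝ] Matrix (Fin n) (Fin n) ℂ) (y : ℂ) :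
    Matrix (Fin n) (Fin n) ℂ :=
  (Matrix.of fun a c =>
    fderiv ℝ (fun t => Γ t I a c) y 1 - fderiv ℝ (fun t => Γ t 1 a c) y I) +
    (Γ y 1 * Γ y I - Γ y I * Γ y 1)

/-- `tr F_∇ = κ dx ∧ dy` at the interior unmarked points of the disc. -/
def OrthogonalConnection.IsCurvatureDensity (C : OrthogonalConnection D w) (κ : ℂ → ℂ) : Prop :=
  ∀ F : P.LocalLift D w, F.p ∈ Metric.ball (0 : ℂ) 1 → (∀ i, F.p ≠ D.pts i) →
    κ F.p = (curvature (C.Γ F) 0).trace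

variable (D w) in
/-- The Chern-Weil Maslov index of `w` is `μ`: there are orthogonal connections on the bundle pair,
and for each of them `(i / π) ∫ tr F_∇ = μ`. -/
def HasChernWeilMaslovIndex (μ : ℝ) : Prop :=
  (∃ (C : OrthogonalConnection D w) (κ : ℂ → ℂ), C.IsCurvatureDensity κ) ∧
  ∀ (C : OrthogonalConnection D w) (κ : ℂ → ℂ), C.IsCurvatureDensity κ →
    MeasureTheory.IntegrableOn κ (Metric.ball 0 1) ∧
      I / Real.pi * ∫ z in Metric.ball (0 : ℂ) 1, κ z = μ

end LabeledPolytope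

/-! ### The standard form -/

/-- The Blaschke factor `(z - α) / (1 - ᾱ z)`. -/
noncomputable def blaschke (α z : ℂ) : ℂ := (z - α) / (1 - conj α * z)

/-- The homogeneous coordinates
`a_j ∏_s (z - α_{js}) / (1 - ᾱ_{js} z) ∏_i ((z - z_i) / (1 - z̄_i z)) ^ c_{ij}`, with principal
values of the fractional powers. -/
noncomputable def blaschkeMap {k m : ℕ} (pts : Fin k → ℂ) (c : Fin k → Fin m → ℚ) (d : Fin m → ℕ)
    (α : (j : Fin m) → Fin (d j) → ℂ) (a : Fin m → ℂ) (z : ℂ) : Fin m → ℂ :=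
  fun j => a j * (∏ s, blaschke (α j s) z) * ∏ i, blaschke (pts i) z ^ ((c i j : ℚ) : ℂ)

/-- `w` is given modulo `K_ℂ` by the standard expression with the box elements `ν i = ∑ c_{ij} b_j`
and the remaining parameters `d`, `α`, `a`, where `a` lies on the orbit of `z₀` under the real
torus. The order of each `ν i` is required to divide the order of the local group of the disc. -/
structure LabeledPolytope.IsStandardForm {n m k : ℕ} (P : LabeledPolytope n m)
    (z₀ : Fin m → ℂ) (D : MarkedOrbiDisc k) (w : ℂ → P.X) (ν : Fin k → Fin n → ℤ)
    (c : Fin k → Fin m → ℚ) (d : Fin m → ℕ) (α : (j : Fin m) → Fin (d j) → ℂ)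
    (a : Fin m → ℂ) : Prop where
  boxCoeff : ∀ i, P.IsBoxCoeff (ν i) (c i)
  order_dvd : ∀ i, sectorOrder (c i) ∣ D.ord i
  zeros_mem : ∀ j s, α j s ∈ Metric.ball (0 : ℂ) 1
  const_mem : a ∈ realTorusOrbit z₀
  rep : ∀ z ∈ Metric.closedBall (0 : ℂ) 1, P.Rep (w z) (blaschkeMap D.pts c d α a z)

/-!
A holomorphic orbifold disc with boundary on a torus fibre is compared with a Blaschke product in
homogeneous coordinates. It meets the toric divisors in finitely many points of the open disc, since
near the circle it lies in the torus. At each of them the vanishing orders of the coordinates of a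
local lift, divided by the order of the local group, split into an integral part, which gives the
zeros `α j s`, and, at a marked point, a fractional part, which gives the coefficients of the sector.
The Blaschke product `W` with these orders is single-valued modulo `K_ℂ`, because
`∑ j, c i j • b j` is a lattice vector. The characters `∏ j, z j ^ b j a`, which separate the orbits
of `K_ℂ` in the torus, have a quotient along `w` and `W` that extends to a nonvanishing holomorphic
function on the disc, of constant modulus on the circle; so it is constant, and `w` is `W` up to
constants (`LabeledPolytope.IsHolomorphic.exists_isStandardForm`).

Conversely, a map in standard form has explicit local lifts (`exists_localLift`). A coordinate of any
lift has the modulus of a product of real powers of the moduli of the homogeneous coordinates, and an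
analytic germ is determined by its modulus up to a constant. This yields the sectors
(`IsStandardForm.isSector`), the representability criterion (`IsStandardForm.isRepresentable_iff`) and
the logarithmic derivatives of all lifts (`IsStandardForm.exists_f_eq_exp`).

For the desingularized Maslov index, the infinitesimal action of the complex torus frames the
pulled-back tangent bundle off the zeros and the marked points, and the boundary condition is its
imaginary part. A matrix function `G` on the disc such that `G b_j` vanishes at the zeros `α j s`,
built by elementary modifications (`exists_elementary_modification`), turns this frame into a
trivialization of the desingularized bundle. In every trivialization the determinant of the torus
frame is a product of `∑ d j` Blaschke factors and a nonvanishing function on the disc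
(`IsStandardForm.exists_transfer`), which gives the rotation number.

For the Chern-Weil index, the trace of a connection in a lift becomes independent of the lift once a
holomorphic correction is added (`OrthogonalConnection.connForm_eq_connForm`). The resulting form on
the disc has the trace of the curvature as its exterior derivative and only weak singularities at the
marked points, so Stokes' theorem applies (`OrthogonalConnection.integral_curvature`). On the circle
its imaginary part is prescribed by the Lagrangian condition: it is minus that of the sum of the
logarithmic derivatives of all homogeneous coordinates, whose integral counts each `α j s` with weight
`1` and the `i`-th marked point with weight `∑ j, c i j`, the age of the sector. A connection exists:
with the metric dual to `∑ j, b_j ⊗ b̄_j`, suitably weighted in the interior, the Chern connection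
makes the torus frame parallel near the circle, and hence preserves the Lagrangian subbundle
(`IsStandardForm.nonempty_orthogonalConnection`).
-/

/-! ### The labelled polytope and its normal fan -/

namespace LabeledPolytope

variable {n m k : ℕ} {P : LabeledPolytope n m}

theorem polytope_eq : P.polytope =
    {u : Fin n → ℝ | ∀ j, 0 ≤ ∑ a, u a * ((P.label j : ℝ) * (P.v j a : ℝ)) - P.off j} := by
  ext u
  simp [polytope, ell, b]

theorem ell_eq (j : Fin m) (u : Fin n → ℝ) :
    P.ell j u = ∑ a, u a * ((P.label j : ℝ) * (P.v j a : ℝ)) - P.off j := by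
  simp [ell, b]

theorem ell_lineMap (j : Fin m) (x y : Fin n → ℝ) (s t : ℝ) (h : s + t = 1) :
    P.ell j (s • x + t • y) = s * P.ell j x + t * P.ell j y := by
  have : P.off j = (s + t) * P.off j := by rw [h, one_mul]
  simp only [ell, Pi.add_apply, Pi.smul_apply, smul_eq_mul, add_mul, Finset.sum_add_distrib]
  simp only [mul_assoc, ← Finset.mul_sum]
  linear_combination -this

theorem ell_add_smul (j : Fin m) (x v : Fin n → ℝ) (t : ℝ) :
    P.ell j (x + t • v) = P.ell j x + t * ∑ a, v a * (P.b j a : ℝ) := by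
  simp only [ell, Pi.add_apply, Pi.smul_apply, smul_eq_mul, add_mul, Finset.sum_add_distrib]
  simp only [mul_assoc, ← Finset.mul_sum]
  ring

theorem continuous_ell (j : Fin m) : Continuous (P.ell j) := by
  unfold ell; fun_prop

theorem isCompact_polytope : IsCompact P.polytope := by
  refine Metric.isCompact_of_isClosed_isBounded ?_ (polytope_eq (P := P) ▸ P.bounded)
  rw [show P.polytope = ⋂ j, {u | 0 ≤ P.ell j u} by ext; simp [polytope]]
  exact isClosed_iInter fun j => isClosed_le continuous_const (continuous_ell j)

/-- Every point of the polytope degenerates to a vertex of its minimal face. -/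
theorem exists_extremePoint {u : Fin n → ℝ} (hu : u ∈ P.polytope) :
    ∃ u' ∈ Set.extremePoints ℝ P.polytope, ∀ j, P.ell j u = 0 → P.ell j u' = 0 := by
  set F : Set (Fin n → ℝ) := {x ∈ P.polytope | ∀ j, P.ell j u = 0 → P.ell j x = 0} with hF
  have hFc : IsCompact F := by
    refine isCompact_polytope.of_isClosed_subset ?_ (fun x hx => hx.1)
    rw [show F = P.polytope ∩ ⋂ j, ⋂ (_ : P.ell j u = 0), {x | P.ell j x = 0} by ext; simp [hF]]
    exact isCompact_polytope.isClosed.inter (isClosed_iInter fun j => isClosed_iInter fun _ =>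
      isClosed_eq (continuous_ell j) continuous_const)
  have hext : IsExtreme ℝ P.polytope F := by
    constructor
    · exact fun x hx => hx.1
    · intro x1 h1 x2 h2 x hx hseg
      refine ⟨h1, fun j hj => ?_⟩
      obtain ⟨s, t, hs, ht, hst, rfl⟩ := hseg
      have := hx.2 j hj
      rw [ell_lineMap j _ _ _ _ hst] at this
      have a1 := mul_nonneg hs.le (h1 j)
      have a2 := mul_nonneg ht.le (h2 j)
      have : s * P.ell j x1 = 0 := by linarith
      rcases mul_eq_zero.1 this with h | h
      · exact absurd h hs.ne'
      · exact h
  obtain ⟨u', hu'⟩ := hFc.extremePoints_nonempty ⟨u, hu, fun j h => h⟩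
  exact ⟨u', hext.extremePoints_subset_extremePoints hu', (extremePoints_subset hu').2⟩

/-- The normals of the facets through a vertex span: otherwise the vertex could be moved in both
directions inside its face. -/
theorem eq_zero_of_extremePoint {u : Fin n → ℝ} (hu : u ∈ Set.extremePoints ℝ P.polytope)
    (v : Fin n → ℝ) (hv : ∀ j, P.ell j u = 0 → ∑ a, v a * (P.b j a : ℝ) = 0) : v = 0 := by
  have hmem : u ∈ P.polytope := extremePoints_subset hu
  have key : ∀ v : Fin n → ℝ, (∀ j, P.ell j u = 0 → ∑ a, v a * (P.b j a : ℝ) = 0) →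
      ∀ᶠ t in 𝓝 (0 : ℝ), u + t • v ∈ P.polytope := by
    intro v hv
    have : ∀ j, ∀ᶠ t in 𝓝 (0 : ℝ), 0 ≤ P.ell j (u + t • v) := by
      intro j
      by_cases hj : P.ell j u = 0
      · exact Filter.Eventually.of_forall fun t => by rw [ell_add_smul, hj, hv j hj]; simp
      · have hpos : 0 < P.ell j (u + (0 : ℝ) • v) := by
          simpa using lt_of_le_of_ne (hmem j) (Ne.symm hj)
        have hc : Continuous fun t : ℝ => P.ell j (u + t • v) :=
          (continuous_ell j).comp (by fun_prop)
        exact (hc.continuousAt.eventually (lt_mem_nhds hpos)).mono fun t h => h.le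
    exact (Filter.eventually_all.2 this).mono fun t h => h
  have h1 := key v hv
  have h2 := key (-v) (fun j hj => by simp [hv j hj])
  obtain ⟨ε, hε, H⟩ := Metric.eventually_nhds_iff.1 (h1.and h2)
  have h3 := H (y := ε / 2) (by rw [Real.dist_eq, sub_zero, abs_of_pos (by linarith)]; linarith)
  have hseg : u ∈ openSegment ℝ (u + (ε / 2) • v) (u + (ε / 2) • (-v)) :=
    ⟨1 / 2, 1 / 2, by norm_num, by norm_num, by norm_num, by ext a; simp; ring⟩
  have := (mem_extremePoints.1 hu).2 _ h3.1 _ h3.2 hseg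
  have h4 : (ε / 2) • v = 0 := by simpa using this.1
  exact (smul_eq_zero.1 h4).resolve_left (by linarith)

theorem ncard_active {u : Fin n → ℝ} (hu : u ∈ Set.extremePoints ℝ P.polytope) :
    {j | P.ell j u = 0}.ncard = n := by
  have := P.simple u (polytope_eq (P := P) ▸ hu)
  simpa only [ell_eq] using this

theorem exists_chart_of_extremePoint {u : Fin n → ℝ} (hu : u ∈ Set.extremePoints ℝ P.polytope) :
    ∃ s : P.Chart, ∀ j, j ∈ Set.range s.ray ↔ P.ell j u = 0 := by
  classical
  have hc : (Finset.univ.filter fun j => P.ell j u = 0).card = n := by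
    refine Eq.trans ?_ (ncard_active hu)
    rw [← Set.ncard_coe_finset]; simp
  set e := (Finset.univ.filter fun j => P.ell j u = 0).orderEmbOfFin hc
  have he : ∀ j, j ∈ Set.range e.toEmbedding ↔ P.ell j u = 0 := fun j => by
    have := Finset.range_orderEmbOfFin (Finset.univ.filter fun j => P.ell j u = 0) hc
    have h2 : j ∈ Set.range e ↔ P.ell j u = 0 := by rw [this]; simp
    exact h2
  exact ⟨⟨e.toEmbedding, u, extremePoints_subset hu, fun j => by
    rw [← he j]; simp⟩, he⟩

theorem exists_chart_of_isCone {I : Finset (Fin m)} (hI : P.IsCone I) :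
    ∃ s : P.Chart, ∀ j ∈ I, j ∈ Set.range s.ray := by
  obtain ⟨u, hu, h⟩ := hI
  obtain ⟨u', hu', h'⟩ := exists_extremePoint hu
  obtain ⟨s, hs⟩ := exists_chart_of_extremePoint hu'
  exact ⟨s, fun j hj => (hs j).2 (h' j ((h j).1 hj))⟩

namespace Chart

theorem exists_vertex (s : P.Chart) : ∃ u ∈ Set.extremePoints ℝ P.polytope,
    ∀ j, j ∈ Set.range s.ray ↔ P.ell j u = 0 := by
  obtain ⟨u, hu, h⟩ := s.isCone
  obtain ⟨u', hu', h'⟩ := exists_extremePoint hu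
  have hsub : Set.range s.ray ⊆ {j | P.ell j u' = 0} := fun j hj =>
    h' j ((h j).1 (by simpa using hj))
  have heq : Set.range s.ray = {j | P.ell j u' = 0} := by
    refine Set.eq_of_subset_of_ncard_le hsub ?_ (Set.toFinite _)
    rw [ncard_active hu', Set.ncard_range_of_injective s.ray.injective]; simp
  exact ⟨u', hu', fun j => by rw [heq]; rfl⟩

/-- The matrix with the stacky vectors of the cone as its rows. -/
def mat (s : P.Chart) : Matrix (Fin n) (Fin n) ℚ :=
  Matrix.of fun (r a : Fin n) => (P.b (s.ray r) a : ℚ)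

theorem det_mat_ne_zero (s : P.Chart) : s.mat.det ≠ 0 := by
  intro h0
  obtain ⟨u, hu, h⟩ := s.exists_vertex
  have hR : (s.mat.map (algebraMap ℚ ℝ)).det = 0 := by
    have := RingHom.map_det (algebraMap ℚ ℝ) s.mat
    rw [h0, map_zero] at this
    exact this.symm
  obtain ⟨v, hv, hv0⟩ := Matrix.exists_mulVec_eq_zero_iff.2 hR
  refine hv (eq_zero_of_extremePoint hu v fun j hj => ?_)
  obtain ⟨l, rfl⟩ := (h j).2 hj
  have := congrFun hv0 l
  simpa [Matrix.mulVec, dotProduct, mat, mul_comm] using this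

theorem isUnit_det (s : P.Chart) : IsUnit s.mat.det := isUnit_iff_ne_zero.2 s.det_mat_ne_zero

theorem coeff_def (s : P.Chart) (ν : Fin n → ℤ) (l : Fin n) :
    s.coeff ν l = ∑ a, (ν a : ℚ) * s.mat⁻¹ a l := rfl

theorem coeff_eq_of_sum (s : P.Chart) {ν : Fin n → ℤ} {c : Fin n → ℚ}
    (h : ∀ a, (ν a : ℚ) = ∑ l, c l * (P.b (s.ray l) a : ℚ)) (l : Fin n) : s.coeff ν l = c l := by
  have h1 : (fun a => (ν a : ℚ)) = Matrix.vecMul c s.mat := by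
    ext a; simp [Matrix.vecMul, dotProduct, mat, h a]
  have h2 : s.coeff ν = Matrix.vecMul (fun a => (ν a : ℚ)) s.mat⁻¹ := by
    ext l; simp [Matrix.vecMul, dotProduct, coeff_def]
  rw [h2, h1, Matrix.vecMul_vecMul, Matrix.mul_nonsing_inv _ s.isUnit_det, Matrix.vecMul_one]

theorem sum_coeff (s : P.Chart) (ν : Fin n → ℤ) (a : Fin n) :
    ∑ l, s.coeff ν l * (P.b (s.ray l) a : ℚ) = ν a := by
  have h2 : s.coeff ν = Matrix.vecMul (fun a => (ν a : ℚ)) s.mat⁻¹ := by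
    ext l; simp [Matrix.vecMul, dotProduct, coeff_def]
  have : Matrix.vecMul (s.coeff ν) s.mat = fun a => (ν a : ℚ) := by
    rw [h2, Matrix.vecMul_vecMul, Matrix.nonsing_inv_mul _ s.isUnit_det, Matrix.vecMul_one]
  have := congrFun this a
  simpa [Matrix.vecMul, dotProduct, mat] using this

theorem coeff_ray (s : P.Chart) (r l : Fin n) :
    s.coeff (P.b (s.ray r)) l = if r = l then 1 else 0 := by
  have := s.coeff_eq_of_sum (ν := P.b (s.ray r)) (c := fun l => if r = l then 1 else 0)
    (fun a => by simp) l
  exact this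

/-- A vector annihilated by the rows of the chart matrix, over any field of characteristic zero. -/
theorem eq_zero_of_sum {K : Type*} [Field K] [CharZero K] (s : P.Chart) {x : Fin n → K}
    (h : ∀ a, ∑ l, x l * (P.b (s.ray l) a : K) = 0) : x = 0 := by
  have hdet : (s.mat.map (algebraMap ℚ K)).det ≠ 0 := by
    have := RingHom.map_det (algebraMap ℚ K) s.mat
    intro h0
    exact s.det_mat_ne_zero ((map_eq_zero (algebraMap ℚ K)).1 (this.trans h0))
  have : Matrix.vecMul x (s.mat.map (algebraMap ℚ K)) = 0 := by
    ext a; simpa [Matrix.vecMul, dotProduct, mat] using h a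
  exact Matrix.eq_zero_of_vecMul_eq_zero hdet this

theorem eq_of_sum_eq {K : Type*} [Field K] [CharZero K] (s : P.Chart) {x y : Fin n → K}
    (h : ∀ a, ∑ l, x l * (P.b (s.ray l) a : K) = ∑ l, y l * (P.b (s.ray l) a : K)) : x = y := by
  have := s.eq_zero_of_sum (x := x - y) (fun a => by simp [sub_mul, h a])
  exact sub_eq_zero.1 this

theorem sum_coeff_cast {K : Type*} [Field K] [CharZero K] (s : P.Chart) (ν : Fin n → ℤ)
    (a : Fin n) : ∑ l, (s.coeff ν l : K) * (P.b (s.ray l) a : K) = ν a := by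
  have := congrArg (Rat.cast (K := K)) (s.sum_coeff ν a)
  push_cast at this
  exact this

/-- Pairing a relation among the stacky vectors with the dual basis of a cone. -/
theorem sum_coeff_mul {K : Type*} [Field K] [CharZero K] (s : P.Chart) {x : Fin m → K}
    {y : Fin n → K} (h : ∀ a, ∑ j, x j * (P.b j a : K) = ∑ l, y l * (P.b (s.ray l) a : K))
    (l : Fin n) : ∑ j, x j * (s.coeff (P.b j) l : K) = y l := by
  have : (fun l => ∑ j, x j * (s.coeff (P.b j) l : K)) = y := by
    refine s.eq_of_sum_eq fun a => ?_
    rw [← h a]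
    simp only [Finset.sum_mul]
    rw [Finset.sum_comm]
    refine Finset.sum_congr rfl fun j _ => ?_
    rw [← s.sum_coeff_cast (P.b j) a, Finset.mul_sum]
    exact Finset.sum_congr rfl fun l _ => by ring
  exact congrFun this l

theorem sum_eq_sum_ray {M : Type*} [AddCommMonoid M] (s : P.Chart) (f : Fin m → M)
    (h : ∀ j, j ∉ Set.range s.ray → f j = 0) : ∑ j, f j = ∑ l, f (s.ray l) := by
  rw [← Finset.sum_map Finset.univ s.ray f]
  exact (Finset.sum_subset (Finset.subset_univ _) fun j _ hj => h j (by simpa using hj)).symm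

theorem prod_eq_prod_ray {M : Type*} [CommMonoid M] (s : P.Chart) (f : Fin m → M)
    (h : ∀ j, j ∉ Set.range s.ray → f j = 1) : ∏ j, f j = ∏ l, f (s.ray l) :=
  sum_eq_sum_ray (M := Additive M) s f h

@[simp] theorem homog_ray (s : P.Chart) (x : Fin n → ℂ) (l : Fin n) :
    s.homog x (s.ray l) = x l := s.ray.injective.extend_apply _ _ _

theorem homog_of_notMem (s : P.Chart) (x : Fin n → ℂ) {j : Fin m} (h : j ∉ Set.range s.ray) :
    s.homog x j = 1 := Function.extend_apply' _ _ _ h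

theorem mem_box_iff (s : P.Chart) {ν : Fin n → ℤ} :
    ν ∈ s.box ↔ ∀ l, 0 ≤ s.coeff ν l ∧ s.coeff ν l < 1 := by
  constructor
  · rintro ⟨c, hc, h⟩ l
    rw [s.coeff_eq_of_sum h]; exact hc l
  · intro h
    exact ⟨s.coeff ν, h, fun a => (s.sum_coeff ν a).symm⟩

end Chart

/-- The faces of a cone of the normal fan are cones: the polytope is simple, so that its vertices can be
moved into the relative interior of any face through them. -/
theorem isCone_mono {I J : Finset (Fin m)} (hJ : P.IsCone J) (h : I ⊆ J) : P.IsCone I := by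
  classical
  obtain ⟨s, hs⟩ := exists_chart_of_isCone hJ
  obtain ⟨u, hu, hv⟩ := s.exists_vertex
  -- move off the facets not in `I`, along the dual basis of the vertex
  let v : Fin n → ℝ := fun a => ∑ l, if s.ray l ∈ I then 0 else ((s.mat⁻¹ a l : ℚ) : ℝ)
  have hvb : ∀ r, ∑ a, v a * (P.b (s.ray r) a : ℝ) = if s.ray r ∈ I then 0 else 1 := by
    intro r
    have h1 : ∀ l, ∑ a, ((s.mat⁻¹ a l : ℚ) : ℝ) * (P.b (s.ray r) a : ℝ) =
        if r = l then 1 else 0 := fun l => by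
      have := congrArg (Rat.cast (K := ℝ)) (s.coeff_ray r l)
      rw [Chart.coeff_def] at this
      push_cast at this
      have h3 : ((if r = l then (1 : ℚ) else 0 : ℚ) : ℝ) = if r = l then 1 else 0 := by
        split_ifs <;> simp
      rw [← h3, ← this]
      exact Finset.sum_congr rfl fun a _ => mul_comm _ _
    calc ∑ a, v a * (P.b (s.ray r) a : ℝ)
        = ∑ l, if s.ray l ∈ I then 0 else
            ∑ a, ((s.mat⁻¹ a l : ℚ) : ℝ) * (P.b (s.ray r) a : ℝ) := by
          simp only [v, Finset.sum_mul]
          rw [Finset.sum_comm]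
          refine Finset.sum_congr rfl fun l _ => ?_
          split_ifs <;> simp
      _ = _ := by
          simp only [h1]
          rw [Finset.sum_eq_single r]
          · simp
          · intro l _ hl; simp [hl.symm]
          · simp
  have hev : ∀ j, ∀ᶠ t in 𝓝[>] (0 : ℝ), (0 ≤ P.ell j (u + t • v) ∧
      (j ∈ I ↔ P.ell j (u + t • v) = 0)) := by
    intro j
    by_cases hj : P.ell j u = 0
    · obtain ⟨r, rfl⟩ := (hv j).2 hj
      filter_upwards [self_mem_nhdsWithin] with t ht
      have ht : 0 < t := ht
      rw [ell_add_smul, hj, hvb]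
      split_ifs with hI
      · simp [hI]
      · simp [hI, ht.le, ht.ne']
    · have hpos : 0 < P.ell j (u + (0 : ℝ) • v) := by
        simpa using lt_of_le_of_ne (extremePoints_subset hu j) (Ne.symm hj)
      have hc : Continuous fun t : ℝ => P.ell j (u + t • v) :=
        (continuous_ell j).comp (by fun_prop)
      have hjI : j ∉ I := fun hI => hj ((hv j).1 (hs j (h hI)))
      filter_upwards [nhdsWithin_le_nhds (hc.continuousAt.eventually (lt_mem_nhds hpos))] with t ht
      exact ⟨ht.le, by simp [hjI, ht.ne']⟩
  obtain ⟨t, ht⟩ := (Filter.eventually_all.2 hev).exists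
  exact ⟨u + t • v, fun j => (ht j).1, fun j => (ht j).2⟩

theorem Chart.isCone_of_subset (s : P.Chart) {I : Finset (Fin m)}
    (h : ∀ j ∈ I, j ∈ Set.range s.ray) : P.IsCone I :=
  isCone_mono s.isCone fun j hj => by simpa using h j hj

/-- A point lies in `U(Σ)` if and only if its vanishing coordinates are rays of one cone. -/
theorem mem_U_iff {z : Fin m → ℂ} : z ∈ P.U ↔ ∃ s : P.Chart, ∀ j, z j = 0 → j ∈ Set.range s.ray := by
  classical
  constructor
  · intro hz
    by_contra hcon
    have hnc : ¬ P.IsCone (Finset.univ.filter fun j => z j = 0) := fun hc => by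
      obtain ⟨s, hs⟩ := exists_chart_of_isCone hc
      exact hcon ⟨s, fun j hj => hs j (by simp [hj])⟩
    obtain ⟨S, hS, hmin⟩ :=
      (Set.toFinite {S : Finset (Fin m) | ¬ P.IsCone S}).exists_le_minimal hnc
    refine hz ⟨S, ⟨hmin.1, fun T hT => ?_⟩, fun j hj => by simpa using hS hj⟩
    by_contra hTc
    exact hT.not_subset (hmin.2 hTc hT.subset)
  · rintro ⟨s, hs⟩ ⟨S, hS, hz⟩
    exact hS.1 (s.isCone_of_subset fun j hj => hs j (hz j hj))

/-- The fan property: a vector determines its coefficients among those supported on cones. -/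
theorem isBoxCoeff_unique {ν : Fin n → ℤ} {c c' : Fin m → ℚ} (h : P.IsBoxCoeff ν c)
    (h' : P.IsBoxCoeff ν c') : c = c' := by
  classical
  -- a linear function with gradient `∑ c_j b_j` attains its minimum on the face of the cone
  have key : ∀ {c c' : Fin m → ℚ}, P.IsBoxCoeff ν c → P.IsBoxCoeff ν c' →
      ∃ u ∈ P.polytope, (∀ j, c j ≠ 0 ↔ P.ell j u = 0) ∧
        ∑ j, (c' j : ℝ) * P.ell j u = ∑ j, (c j : ℝ) * P.off j - ∑ j, (c' j : ℝ) * P.off j := by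
    intro c c' h h'
    obtain ⟨s, hs⟩ := h.2.2
    obtain ⟨u, hu, hI⟩ := s.isCone_of_subset (I := Finset.univ.filter fun j => c j ≠ 0)
      (fun j hj => by by_contra hn; simp [hs j hn] at hj)
    have hI' : ∀ j, c j ≠ 0 ↔ P.ell j u = 0 := fun j => by rw [← hI j]; simp
    refine ⟨u, hu, hI', ?_⟩
    have hval : ∀ {c : Fin m → ℚ}, P.IsBoxCoeff ν c →
        ∑ j, (c j : ℝ) * P.ell j u = ∑ a, u a * ν a - ∑ j, (c j : ℝ) * P.off j := by
      intro c h
      have : ∀ a, (ν a : ℝ) = ∑ j, (c j : ℝ) * (P.b j a : ℝ) := fun a => by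
        exact_mod_cast congrArg (Rat.cast (K := ℝ)) (h.2.1 a)
      simp only [this, ell, mul_sub, Finset.sum_sub_distrib, Finset.mul_sum]
      rw [Finset.sum_comm]
      congr 1
      exact Finset.sum_congr rfl fun a _ => Finset.sum_congr rfl fun j _ => by ring
    have h0 : ∑ j, (c j : ℝ) * P.ell j u = 0 := Finset.sum_eq_zero fun j _ => by
      by_cases hc : c j = 0
      · simp [hc]
      · simp [(hI' j).1 hc]
    have := hval h
    rw [hval h', ← sub_eq_zero]
    linarith
  have sub : ∀ {c c' : Fin m → ℚ}, P.IsBoxCoeff ν c → P.IsBoxCoeff ν c' →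
      ∀ j, c' j ≠ 0 → c j ≠ 0 := by
    intro c c' h h' j hj
    obtain ⟨u, hu, hI, e⟩ := key h h'
    obtain ⟨u', hu', -, e'⟩ := key h' h
    have n1 : 0 ≤ ∑ j, (c j : ℝ) * P.ell j u' := Finset.sum_nonneg fun j _ =>
      mul_nonneg (by exact_mod_cast (h.1 j).1) (hu' j)
    have n2 : ∀ j ∈ Finset.univ, 0 ≤ (c' j : ℝ) * P.ell j u := fun j _ =>
      mul_nonneg (by exact_mod_cast (h'.1 j).1) (hu j)
    have z : ∑ j, (c' j : ℝ) * P.ell j u = 0 :=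
      le_antisymm (by linarith) (Finset.sum_nonneg n2)
    have := (Finset.sum_eq_zero_iff_of_nonneg n2).1 z j (Finset.mem_univ _)
    refine (hI j).2 ((mul_eq_zero.1 this).resolve_left (by exact_mod_cast hj))
  obtain ⟨s, hs⟩ := h.2.2
  have hs' : ∀ j, j ∉ Set.range s.ray → c' j = 0 := fun j hj => by
    by_contra hc; exact sub h h' j hc (hs j hj)
  have e : (fun l => c (s.ray l)) = fun l => c' (s.ray l) := by
    refine s.eq_of_sum_eq fun a => ?_
    rw [← s.sum_eq_sum_ray (fun j => c j * (P.b j a : ℚ)) (fun j hj => by simp [hs j hj]),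
      ← s.sum_eq_sum_ray (fun j => c' j * (P.b j a : ℚ)) (fun j hj => by simp [hs' j hj]),
      ← h.2.1 a, ← h'.2.1 a]
  ext1 j
  by_cases hj : j ∈ Set.range s.ray
  · obtain ⟨l, rfl⟩ := hj; exact congrFun e l
  · rw [hs j hj, hs' j hj]

theorem Chart.isBoxCoeff_of_mem_box (s : P.Chart) {ν : Fin n → ℤ} (h : ν ∈ s.box) :
    P.IsBoxCoeff ν (Function.extend s.ray (s.coeff ν) 0) := by
  have h1 : ∀ l, Function.extend s.ray (s.coeff ν) 0 (s.ray l) = s.coeff ν l :=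
    fun l => s.ray.injective.extend_apply _ _ _
  have h2 : ∀ j, j ∉ Set.range s.ray → Function.extend s.ray (s.coeff ν) 0 j = 0 :=
    fun j hj => Function.extend_apply' _ _ _ hj
  refine ⟨fun j => ?_, fun a => ?_, s, h2⟩
  · by_cases hj : j ∈ Set.range s.ray
    · obtain ⟨l, rfl⟩ := hj; rw [h1]; exact s.mem_box_iff.1 h l
    · rw [h2 j hj]; norm_num
  · rw [s.sum_eq_sum_ray _ (fun j hj => by rw [h2 j hj, zero_mul])]
    simp only [h1]
    exact (s.sum_coeff ν a).symm

theorem IsBoxCoeff.age_eq {ν : Fin n → ℤ} {c : Fin m → ℚ} (h : P.IsBoxCoeff ν c) :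
    P.age ν = ∑ j, c j := by
  classical
  obtain ⟨s, hs⟩ := h.2.2
  have hex : ∃ s : P.Chart, ν ∈ s.box := ⟨s, fun l => c (s.ray l), fun l => h.1 _, fun a => by
    rw [h.2.1 a]; exact s.sum_eq_sum_ray _ (fun j hj => by rw [hs j hj, zero_mul])⟩
  rw [age, dif_pos hex]
  set s' := hex.choose
  have hb : ν ∈ s'.box := hex.choose_spec
  have e := isBoxCoeff_unique h (s'.isBoxCoeff_of_mem_box hb)
  rw [e, s'.sum_eq_sum_ray (Function.extend s'.ray (s'.coeff ν) 0)
    (fun j hj => Function.extend_apply' _ _ _ hj)]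
  refine Finset.sum_congr rfl fun l _ => ?_
  rw [s'.ray.injective.extend_apply]
  exact Int.fract_eq_self.2 (s'.mem_box_iff.1 hb l)

/-! ### Orbits of `K_ℂ` and characters -/

/-- The characters `z ↦ ∏_j z_j ^ b_{ja}` that define `K_ℂ`. -/
noncomputable def chi (P : LabeledPolytope n m) (z : Fin m → ℂ) (a : Fin n) : ℂ := ∏ j, z j ^ P.b j a

theorem chi_mul (z z' : Fin m → ℂ) (a : Fin n) :
    P.chi (fun j => z j * z' j) a = P.chi z a * P.chi z' a := by
  simp [chi, mul_zpow, Finset.prod_mul_distrib]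

theorem chi_div (z z' : Fin m → ℂ) (a : Fin n) :
    P.chi (fun j => z j / z' j) a = P.chi z a / P.chi z' a := by
  simp [chi, div_zpow, Finset.prod_div_distrib]

theorem chi_ne_zero {z : Fin m → ℂ} (hz : ∀ j, z j ≠ 0) (a : Fin n) : P.chi z a ≠ 0 :=
  Finset.prod_ne_zero_iff.2 fun j _ => zpow_ne_zero _ (hz j)

theorem mem_KC_iff {t : Fin m → ℂˣ} : t ∈ P.KC ↔ ∀ a, P.chi (fun j => (t j : ℂ)) a = 1 := by
  have : t ∈ P.KC ↔ ∀ a, ∏ j, t j ^ P.b j a = 1 := Iff.rfl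
  rw [this]
  refine forall_congr' fun a => ?_
  rw [← Units.val_inj]
  simp [chi]

theorem sameOrbit_of_chi {z z' t : Fin m → ℂ} (ht : ∀ j, t j ≠ 0) (h : ∀ j, z' j = t j * z j)
    (hchi : ∀ a, P.chi t a = 1) : P.SameOrbit z z' :=
  ⟨fun j => Units.mk0 (t j) (ht j), mem_KC_iff.2 hchi, h⟩

theorem sameOrbit_iff {z z' : Fin m → ℂ} :
    P.SameOrbit z z' ↔ ∃ t : Fin m → ℂ, (∀ j, t j ≠ 0) ∧ (∀ a, P.chi t a = 1) ∧
      ∀ j, z' j = t j * z j := by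
  constructor
  · rintro ⟨t, ht, h⟩
    exact ⟨fun j => t j, fun j => (t j).ne_zero, mem_KC_iff.1 ht, h⟩
  · rintro ⟨t, h1, h2, h3⟩
    exact sameOrbit_of_chi h1 h3 h2

theorem SameOrbit.symm {z z' : Fin m → ℂ} (h : P.SameOrbit z z') : P.SameOrbit z' z := by
  obtain ⟨t, ht, h⟩ := h
  exact ⟨t⁻¹, P.KC.inv_mem ht, fun j => by simp [h j]⟩

theorem SameOrbit.trans {z z' z'' : Fin m → ℂ} (h : P.SameOrbit z z') (h' : P.SameOrbit z' z'') :
    P.SameOrbit z z'' := by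
  obtain ⟨t, ht, h⟩ := h
  obtain ⟨s, hs, h'⟩ := h'
  exact ⟨s * t, P.KC.mul_mem hs ht, fun j => by simp [h j, h' j, mul_assoc]⟩

theorem SameOrbit.chi_eq {z z' : Fin m → ℂ} (h : P.SameOrbit z z') (a : Fin n) :
    P.chi z' a = P.chi z a := by
  obtain ⟨t, -, ht, h⟩ := sameOrbit_iff.1 h
  rw [show z' = fun j => t j * z j from funext h, chi_mul, ht, one_mul]

theorem SameOrbit.eq_zero_iff {z z' : Fin m → ℂ} (h : P.SameOrbit z z') (j : Fin m) :
    z' j = 0 ↔ z j = 0 := by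
  obtain ⟨t, ht, -, h⟩ := sameOrbit_iff.1 h
  simp [h j, ht j]

theorem SameOrbit.mem_U {z z' : Fin m → ℂ} (h : P.SameOrbit z z') (hz : z ∈ P.U) : z' ∈ P.U := by
  obtain ⟨s, hs⟩ := mem_U_iff.1 hz
  exact mem_U_iff.2 ⟨s, fun j hj => hs j ((h.eq_zero_iff j).1 hj)⟩

/-- On the torus, the characters separate the orbits of `K_ℂ`. -/
theorem sameOrbit_of_chi_eq {z z' : Fin m → ℂ} (hz : ∀ j, z j ≠ 0) (hz' : ∀ j, z' j ≠ 0)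
    (h : ∀ a, P.chi z' a = P.chi z a) : P.SameOrbit z z' :=
  sameOrbit_of_chi (t := fun j => z' j / z j) (fun j => div_ne_zero (hz' j) (hz j))
    (fun j => by field_simp [hz j]) fun a => by
      rw [chi_div, h a, div_self (chi_ne_zero hz a)]

theorem Rep.sameOrbit {x : P.X} {z z' : Fin m → ℂ} (h : P.Rep x z) (h' : P.Rep x z') :
    P.SameOrbit z z' := by
  obtain ⟨hz, rfl⟩ := h
  obtain ⟨hz', e⟩ := h'
  exact Quotient.exact e

theorem Rep.of_sameOrbit {x : P.X} {z z' : Fin m → ℂ} (h : P.Rep x z) (h' : P.SameOrbit z z') :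
    P.Rep x z' := by
  obtain ⟨hz, rfl⟩ := h
  exact ⟨h'.mem_U hz, Quotient.sound h'⟩

theorem exists_rep (x : P.X) : ∃ z, P.Rep x z :=
  Quotient.inductionOn x fun z => ⟨z.1, z.2, rfl⟩

/-- The moduli of an element of `K_ℂ` in the coordinates of a cone are determined by the others. -/
theorem sum_coeff_log_norm {t : Fin m → ℂ} (ht : ∀ j, t j ≠ 0) (hchi : ∀ a, P.chi t a = 1)
    (s : P.Chart) (l : Fin n) : ∑ j, Real.log ‖t j‖ * (s.coeff (P.b j) l : ℝ) = 0 := by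
  have := s.sum_coeff_mul (K := ℝ) (x := fun j => Real.log ‖t j‖) (y := 0) (fun a => ?_) l
  · simpa using this
  · have h1 := congrArg (fun x : ℂ => Real.log ‖x‖) (hchi a)
    simp only [chi, norm_prod, norm_zpow, norm_one, Real.log_one] at h1
    rw [Real.log_prod fun j _ => zpow_ne_zero _ (norm_ne_zero_iff.2 (ht j))] at h1
    simp only [Real.log_zpow] at h1
    rw [show (∑ l, (0 : Fin n → ℝ) l * (P.b (s.ray l) a : ℝ)) = 0 by simp, ← h1]
    exact Finset.sum_congr rfl fun j _ => mul_comm _ _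

theorem chi_exp (x : Fin m → ℂ) (a : Fin n) :
    P.chi (fun j => exp (x j)) a = exp (∑ j, x j * (P.b j a : ℂ)) := by
  simp only [chi, Complex.exp_sum]
  exact Finset.prod_congr rfl fun j _ => by rw [← Complex.exp_int_mul, mul_comm]

theorem ell_pos_of_mem_interior {u : Fin n → ℝ} (hu : u ∈ interior P.polytope) (j : Fin m) :
    0 < P.ell j u := by
  refine lt_of_le_of_ne (interior_subset hu j) fun h0 => ?_
  -- the normal of a facet is nonzero, so `ℓ_j` changes sign near a zero
  have hb : ∃ a, P.b j a ≠ 0 := by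
    by_contra hcon
    push Not at hcon
    have h2 := P.primitive j 2 fun a => by
      have := hcon a
      simp only [b, mul_eq_zero, Int.natCast_eq_zero, (P.label_pos j).ne', false_or] at this
      simp [this]
    exact absurd h2 (by decide)
  obtain ⟨a, ha⟩ := hb
  have hpos : 0 < ∑ a, (P.b j a : ℝ) * (P.b j a : ℝ) :=
    Finset.sum_pos' (fun a _ => mul_self_nonneg _) ⟨a, Finset.mem_univ _, by
      have : (P.b j a : ℝ) ≠ 0 := by exact_mod_cast ha
      exact mul_self_pos.2 this⟩
  have hc : Continuous fun t : ℝ => u + t • fun a => (P.b j a : ℝ) := by fun_prop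
  have h1 : ∀ᶠ t in 𝓝 (0 : ℝ), u + t • (fun a => (P.b j a : ℝ)) ∈ P.polytope := by
    have : P.polytope ∈ 𝓝 (u + (0 : ℝ) • fun a => (P.b j a : ℝ)) := by
      simpa using mem_interior_iff_mem_nhds.1 hu
    exact hc.continuousAt.eventually this
  obtain ⟨t, ht, ht0⟩ := ((h1.filter_mono nhdsWithin_le_nhds).and
    (self_mem_nhdsWithin (a := (0:ℝ)) (s := Set.Iio 0))).exists
  have := ht j
  rw [ell_add_smul, ← h0] at this
  have ht0 : t < 0 := ht0
  nlinarith [mul_neg_of_neg_of_pos ht0 hpos]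

end LabeledPolytope

/-! ### Local function theory -/

/-- A nonvanishing analytic germ has an analytic logarithm. -/
theorem exists_analyticAt_log {f : ℂ → ℂ} {z₀ : ℂ} (hf : AnalyticAt ℂ f z₀) (h0 : f z₀ ≠ 0) :
    ∃ L : ℂ → ℂ, AnalyticAt ℂ L z₀ ∧ ∀ᶠ z in 𝓝 z₀, exp (L z) = f z := by
  refine ⟨fun z => log (f z / f z₀) + log (f z₀), ?_, ?_⟩
  · refine ((hf.div analyticAt_const h0).clog ?_).add analyticAt_const
    simp [div_self h0]
  · filter_upwards [hf.continuousAt.eventually_ne h0] with z hz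
    rw [Complex.exp_add, exp_log (div_ne_zero hz h0), exp_log h0]
    field_simp

/-- Analytic germs whose quotient has continuous positive modulus differ by a nonvanishing analytic
factor. -/
theorem exists_analyticAt_factor {f N : ℂ → ℂ} {ψ : ℂ → ℝ} {z₀ : ℂ} (hf : AnalyticAt ℂ f z₀)
    (hN : AnalyticAt ℂ N z₀) (hN0 : ∀ᶠ z in 𝓝[≠] z₀, N z ≠ 0) (hψ : ContinuousAt ψ z₀)
    (hψ0 : 0 < ψ z₀) (h : ∀ᶠ z in 𝓝 z₀, ‖f z‖ = ‖N z‖ * ψ z) :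
    ∃ g : ℂ → ℂ, AnalyticAt ℂ g z₀ ∧ g z₀ ≠ 0 ∧ ∀ᶠ z in 𝓝 z₀, f z = N z * g z := by
  have hψe : ∀ᶠ z in 𝓝 z₀, 0 < ψ z := hψ.eventually (lt_mem_nhds hψ0)
  have hNz : ¬ ∀ᶠ z in 𝓝 z₀, N z = 0 := fun hc => by
    obtain ⟨z, h1, h2⟩ := (hN0.and (hc.filter_mono nhdsWithin_le_nhds)).exists
    exact h1 h2
  have hfz : ¬ ∀ᶠ z in 𝓝 z₀, f z = 0 := fun hc => by
    obtain ⟨z, h1, h2, h3, h4⟩ := (hN0.and ((hc.and (h.and hψe)).filter_mono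
      nhdsWithin_le_nhds)).exists
    rw [h2, norm_zero] at h3
    exact (mul_pos (norm_pos_iff.2 h1) h4).ne h3
  obtain ⟨p, u, hu, hu0, hfu⟩ := hf.exists_eventuallyEq_pow_smul_nonzero_iff.2 hfz
  obtain ⟨q, v, hv, hv0, hNv⟩ := hN.exists_eventuallyEq_pow_smul_nonzero_iff.2 hNz
  have hpq : p = q := by
    -- the modulus of `(z - z₀) ^ p / (z - z₀) ^ q` is bounded above and below
    have e : ∀ᶠ z in 𝓝[≠] z₀, ‖z - z₀‖ ^ p = ‖z - z₀‖ ^ q * (‖v z‖ * ψ z / ‖u z‖) := by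
      filter_upwards [(hfu.and (hNv.and (h.and (hu.continuousAt.eventually_ne hu0)))).filter_mono
        nhdsWithin_le_nhds] with z ⟨h1, h2, h3, h4⟩
      rw [h1, h2] at h3
      simp only [norm_smul, norm_pow] at h3
      field_simp [norm_ne_zero_iff.2 h4]
      linarith
    have hw : Filter.Tendsto (fun z => ‖v z‖ * ψ z / ‖u z‖) (𝓝[≠] z₀)
        (𝓝 (‖v z₀‖ * ψ z₀ / ‖u z₀‖)) :=
      ((hv.continuousAt.norm.mul hψ).div hu.continuousAt.norm (norm_ne_zero_iff.2 hu0)).tendsto.mono_left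
        nhdsWithin_le_nhds
    have hwp : 0 < ‖v z₀‖ * ψ z₀ / ‖u z₀‖ :=
      div_pos (mul_pos (norm_pos_iff.2 hv0) hψ0) (norm_pos_iff.2 hu0)
    have hsub : Filter.Tendsto (fun z => ‖z - z₀‖) (𝓝[≠] z₀) (𝓝 0) := by
      have : Continuous fun z : ℂ => ‖z - z₀‖ := by fun_prop
      simpa using (this.tendsto z₀).mono_left nhdsWithin_le_nhds
    rcases lt_trichotomy p q with hlt | heq | hlt
    · exfalso
      have e2 : ∀ᶠ z in 𝓝[≠] z₀, ‖z - z₀‖ ^ (q - p) * (‖v z‖ * ψ z / ‖u z‖) = 1 := by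
        filter_upwards [e, self_mem_nhdsWithin] with z hz hne
        have hn : ‖z - z₀‖ ^ p ≠ 0 := pow_ne_zero _ (norm_ne_zero_iff.2 (sub_ne_zero.2 hne))
        obtain ⟨r, rfl⟩ := Nat.exists_eq_add_of_lt hlt
        rw [show p + r + 1 = p + (r + 1) by ring, pow_add, mul_assoc] at hz
        rw [show p + r + 1 - p = r + 1 by omega]
        exact mul_left_cancel₀ hn (by rw [← hz, mul_one])
      have t := (hsub.pow (q - p)).mul hw
      rw [zero_pow (by omega), zero_mul] at t
      have := tendsto_nhds_unique (t.congr' e2) tendsto_const_nhds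
      exact zero_ne_one this
    · exact heq
    · exfalso
      have e2 : ∀ᶠ z in 𝓝[≠] z₀, ‖z - z₀‖ ^ (p - q) = ‖v z‖ * ψ z / ‖u z‖ := by
        filter_upwards [e, self_mem_nhdsWithin] with z hz hne
        have hn : ‖z - z₀‖ ^ q ≠ 0 := pow_ne_zero _ (norm_ne_zero_iff.2 (sub_ne_zero.2 hne))
        obtain ⟨r, rfl⟩ := Nat.exists_eq_add_of_lt hlt
        rw [show q + r + 1 = q + (r + 1) by ring, pow_add] at hz
        rw [show q + r + 1 - q = r + 1 by omega]
        exact mul_left_cancel₀ hn hz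
      have t := hsub.pow (p - q)
      rw [zero_pow (by omega)] at t
      exact hwp.ne (tendsto_nhds_unique (t.congr' e2) hw)
  subst hpq
  refine ⟨fun z => u z / v z, hu.div hv hv0, div_ne_zero hu0 hv0, ?_⟩
  filter_upwards [hfu, hNv, hv.continuousAt.eventually_ne hv0] with z h1 h2 h3
  rw [h1, h2, smul_eq_mul, smul_eq_mul]
  field_simp

theorem eventually_eq_of_norm_eq {f : ℂ → ℂ} {z₀ : ℂ} (hf : AnalyticAt ℂ f z₀)
    (h : ∀ᶠ z in 𝓝 z₀, ‖f z‖ = ‖f z₀‖) : ∀ᶠ z in 𝓝 z₀, f z = f z₀ :=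
  Complex.eventually_eq_of_isLocalMax_norm
    (hf.eventually_analyticAt.mono fun _ hz => hz.differentiableAt)
    (h.mono fun _ hz => hz.le)

/-! ### Blaschke factors -/

theorem one_sub_conj_mul_ne_zero {α z : ℂ} (hα : α ∈ Metric.ball (0 : ℂ) 1)
    (hz : z ∈ Metric.closedBall (0 : ℂ) 1) : 1 - conj α * z ≠ 0 := by
  intro h
  have h1 : ‖conj α * z‖ = 1 := by rw [← sub_eq_zero.1 h, norm_one]
  rw [norm_mul, RCLike.norm_conj] at h1
  have h2 : ‖α‖ < 1 := by simpa using hα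
  have h3 : ‖z‖ ≤ 1 := by simpa using hz
  nlinarith [norm_nonneg α, norm_nonneg z]

theorem blaschke_eq_zero_iff {α z : ℂ} (hα : α ∈ Metric.ball (0 : ℂ) 1)
    (hz : z ∈ Metric.closedBall (0 : ℂ) 1) : blaschke α z = 0 ↔ z = α := by
  rw [blaschke, div_eq_zero_iff, or_iff_left (one_sub_conj_mul_ne_zero hα hz), sub_eq_zero]

theorem analyticAt_blaschke {α z : ℂ} (hα : α ∈ Metric.ball (0 : ℂ) 1)
    (hz : z ∈ Metric.closedBall (0 : ℂ) 1) : AnalyticAt ℂ (blaschke α) z := by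
  unfold blaschke
  exact (analyticAt_id.sub analyticAt_const).div
    (analyticAt_const.sub (analyticAt_const.mul analyticAt_id)) (one_sub_conj_mul_ne_zero hα hz)

theorem norm_blaschke_of_norm_eq_one {α z : ℂ} (hα : α ∈ Metric.ball (0 : ℂ) 1) (hz : ‖z‖ = 1) :
    ‖blaschke α z‖ = 1 := by
  have hne := one_sub_conj_mul_ne_zero hα (z := z) (by simp [hz])
  have h1 : z * conj z = 1 := by rw [Complex.mul_conj, Complex.normSq_eq_norm_sq, hz]; simp
  have h2 : ‖z - α‖ = ‖1 - conj α * z‖ := by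
    have : z - α = z * conj (1 - conj α * z) := by
      simp only [map_sub, map_one, map_mul, Complex.conj_conj]
      linear_combination α * h1
    rw [this, norm_mul, hz, one_mul, RCLike.norm_conj]
  rw [blaschke, norm_div, h2, div_self (norm_ne_zero_iff.2 hne)]

/-- A Blaschke factor in the branched coordinate `y ↦ p + y ^ e`. -/
theorem exists_blaschke_branch {α p : ℂ} (hα : α ∈ Metric.ball (0 : ℂ) 1)
    (hp : p ∈ Metric.closedBall (0 : ℂ) 1) {e : ℕ} (he : 0 < e) :
    ∃ L : ℂ → ℂ, AnalyticAt ℂ L 0 ∧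
      ∀ᶠ y in 𝓝 0, blaschke α (p + y ^ e) = y ^ (if p = α then e else 0) * exp (L y) := by
  have hbr : AnalyticAt ℂ (fun y : ℂ => p + y ^ e) 0 := by fun_prop
  have h0 : p + (0 : ℂ) ^ e = p := by simp [he.ne']
  split_ifs with h
  · subst h
    have hd : (1 : ℂ) - conj p * (p + 0 ^ e) ≠ 0 := by
      rw [h0]; exact one_sub_conj_mul_ne_zero hα hp
    obtain ⟨L, hL, hLe⟩ := exists_analyticAt_log (f := fun y : ℂ => 1 / (1 - conj p * (p + y ^ e)))
      (z₀ := 0) (analyticAt_const.div (analyticAt_const.sub (analyticAt_const.mul hbr)) hd)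
      (one_div_ne_zero hd)
    refine ⟨L, hL, ?_⟩
    filter_upwards [hLe] with y hy
    rw [hy, blaschke]
    ring
  · obtain ⟨L, hL, hLe⟩ := exists_analyticAt_log (f := fun y : ℂ => blaschke α (p + y ^ e))
      (z₀ := 0) (AnalyticAt.fun_comp (by rw [h0]; exact analyticAt_blaschke hα hp) hbr)
      (by rw [h0, Ne, blaschke_eq_zero_iff hα hp]; exact h)
    refine ⟨L, hL, ?_⟩
    filter_upwards [hLe] with y hy
    rw [hy, pow_zero, one_mul]

/-- The principal value of a fractional power differs from any other branch by a root of unity. -/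
theorem exists_int_cpow_eq {x y L : ℂ} {E : ℕ} (hx : x = y ^ E * exp L) :
    ∃ r : ℤ, ∀ (c : ℚ) (q : ℕ), (q : ℚ) = E * c →
      x ^ ((c : ℚ) : ℂ) = exp (2 * Real.pi * I * (r * c)) * (y ^ q * exp (c * L)) := by
  by_cases hx0 : x = 0
  · refine ⟨0, fun c q hq => ?_⟩
    have hy : y ^ E = 0 := by
      rw [hx] at hx0; exact (mul_eq_zero.1 hx0).resolve_right (exp_ne_zero _)
    have hE : E ≠ 0 := fun h => by simp [h] at hy
    have hy0 : y = 0 := eq_zero_of_pow_eq_zero hy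
    by_cases hc : c = 0
    · have : q = 0 := by rw [hc, mul_zero] at hq; exact_mod_cast hq
      simp [hc, this]
    · have : q ≠ 0 := fun h => by
        rw [h] at hq
        have : (E : ℚ) * c = 0 := by rw [← hq]; simp
        simp [hc, hE] at this
      rw [hx0, zero_cpow (by exact_mod_cast hc), hy0, zero_pow this]
      simp
  · have hyE : y ^ E ≠ 0 := fun h => hx0 (by rw [hx, h, zero_mul])
    have hlog : y ^ E = exp (E * log y) := by
      by_cases hE : E = 0
      · simp [hE]
      · have hy : y ≠ 0 := fun h => hyE (by rw [h, zero_pow hE])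
        rw [mul_comm, ← Complex.cpow_def_of_ne_zero hy, Complex.cpow_natCast]
    have h1 : exp (log x) = exp (E * log y + L) := by
      rw [exp_log hx0, Complex.exp_add, ← hlog, hx]
    obtain ⟨r, hr⟩ := Complex.exp_eq_exp_iff_exists_int.1 h1
    refine ⟨r, fun c q hq => ?_⟩
    have hyq : y ^ q = exp (q * log y) := by
      by_cases hq0 : q = 0
      · simp [hq0]
      · have hE : E ≠ 0 := fun h => hq0 (by
          rw [h] at hq; simp at hq; exact hq)
        have hy : y ≠ 0 := fun h => hyE (by rw [h, zero_pow hE])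
        rw [mul_comm, ← Complex.cpow_def_of_ne_zero hy, Complex.cpow_natCast]
    rw [Complex.cpow_def_of_ne_zero hx0, hyq, ← Complex.exp_add, ← Complex.exp_add, hr]
    congr 1
    have : (q : ℂ) = E * c := by exact_mod_cast congrArg (Rat.cast (K := ℂ)) hq
    rw [this]
    ring

/-! ### Local branches of the standard form -/

namespace LabeledPolytope

variable {n m k : ℕ} {P : LabeledPolytope n m} {D : MarkedOrbiDisc k} {w : ℂ → P.X}

/-- The fractional part of the vanishing order of the `j`-th coordinate of the standard form at
`p`. -/
noncomputable def ramExp (D : MarkedOrbiDisc k) (c : Fin k → Fin m → ℚ) (p : ℂ) (j : Fin m) : ℚ :=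
  open Classical in ∑ i, if p = D.pts i then c i j else 0

/-- The multiplicity of `p` among the zeros `α j s`. -/
noncomputable def zeroCount {d : Fin m → ℕ} (α : (j : Fin m) → Fin (d j) → ℂ) (p : ℂ)
    (j : Fin m) : ℕ :=
  open Classical in (Finset.univ.filter fun s => p = α j s).card

theorem ramExp_pts (c : Fin k → Fin m → ℚ) (i : Fin k) (j : Fin m) :
    ramExp D c (D.pts i) j = c i j := by
  classical
  rw [ramExp, Finset.sum_eq_single i]
  · simp
  · intro i' _ hi'; rw [if_neg fun h => hi' (D.pts_inj h).symm]
  · simp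

theorem ramExp_of_ne (c : Fin k → Fin m → ℚ) {p : ℂ} (hp : ∀ i, p ≠ D.pts i) (j : Fin m) :
    ramExp D c p j = 0 := by
  classical
  rw [ramExp]; exact Finset.sum_eq_zero fun i _ => if_neg (hp i)

end LabeledPolytope

theorem MarkedOrbiDisc.IsLocalOrder.pos {k : ℕ} {D : MarkedOrbiDisc k} {p : ℂ} {e : ℕ}
    (h : D.IsLocalOrder p e) : 0 < e := by
  rcases h.2 with ⟨i, -, rfl⟩ | ⟨-, rfl⟩
  · exact D.ord_pos i
  · exact one_pos

theorem MarkedOrbiDisc.IsLocalOrder.eq_ord {k : ℕ} {D : MarkedOrbiDisc k} {p : ℂ} {e : ℕ}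
    (h : D.IsLocalOrder p e) {i : Fin k} (hi : p = D.pts i) : e = D.ord i := by
  rcases h.2 with ⟨i', h1, rfl⟩ | ⟨h1, -⟩
  · rw [D.pts_inj (hi.symm.trans h1)]
  · exact absurd hi (h1 i)

theorem MarkedOrbiDisc.IsLocalOrder.eq_one {k : ℕ} {D : MarkedOrbiDisc k} {p : ℂ} {e : ℕ}
    (h : D.IsLocalOrder p e) (hp : ∀ i, p ≠ D.pts i) : e = 1 := by
  rcases h.2 with ⟨i', h1, -⟩ | ⟨-, h1⟩
  · exact absurd h1 (hp i')
  · exact h1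

theorem MarkedOrbiDisc.exists_isLocalOrder {k : ℕ} (D : MarkedOrbiDisc k) {p : ℂ}
    (hp : p ∈ Metric.closedBall (0 : ℂ) 1) : ∃ e, D.IsLocalOrder p e := by
  by_cases h : ∃ i, p = D.pts i
  · obtain ⟨i, hi⟩ := h
    exact ⟨D.ord i, hp, Or.inl ⟨i, hi, rfl⟩⟩
  · exact ⟨1, hp, Or.inr ⟨fun i hi => h ⟨i, hi⟩, rfl⟩⟩

theorem MarkedOrbiDisc.ne_pts_of_norm_eq_one {k : ℕ} (D : MarkedOrbiDisc k) {p : ℂ}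
    (hp : ‖p‖ = 1) (i : Fin k) : p ≠ D.pts i := fun h => by
  have := D.pts_mem i
  rw [← h] at this
  simp [hp] at this

theorem exists_nat_eq_mul_of_sectorOrder_dvd {m : ℕ} {c : Fin m → ℚ} {e : ℕ}
    (h : sectorOrder c ∣ e) {j : Fin m} (hc : 0 ≤ c j) : ∃ q : ℕ, (q : ℚ) = e * c j := by
  have h1 : (c j).den ∣ e := (Finset.dvd_lcm (Finset.mem_univ j)).trans h
  obtain ⟨r, hr⟩ := h1
  refine ⟨r * (c j).num.toNat, ?_⟩
  have h2 : (((c j).num.toNat : ℤ) : ℚ) = (c j).num := by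
    rw [Int.toNat_of_nonneg (Rat.num_nonneg.2 hc)]
  have h3 : (c j) * (c j).den = (c j).num := Rat.mul_den_eq_num _
  push_cast at h2 ⊢
  rw [hr, h2, ← h3]
  push_cast
  ring

namespace LabeledPolytope

variable {n m k : ℕ} {P : LabeledPolytope n m} {D : MarkedOrbiDisc k} {w : ℂ → P.X}

/-- In the branched coordinate at `p`, the standard form agrees with an honest analytic map, up to
the action of elements of `K_ℂ` (which depend on the point, because of the branch cuts of the
principal values). -/
theorem exists_blaschkeMap_branch {ν : Fin k → Fin n → ℤ} {c : Fin k → Fin m → ℚ} {d : Fin m → ℕ}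
    {α : (j : Fin m) → Fin (d j) → ℂ} {a : Fin m → ℂ}
    (hbox : ∀ i, P.IsBoxCoeff (ν i) (c i)) (hord : ∀ i, sectorOrder (c i) ∣ D.ord i)
    (hα : ∀ j s, α j s ∈ Metric.ball (0 : ℂ) 1) (ha : ∀ j, a j ≠ 0) {p : ℂ} {e : ℕ}
    (hp : D.IsLocalOrder p e) :
    ∃ (κ : Fin m → ℕ) (V : Fin m → ℂ → ℂ), (∀ j, AnalyticAt ℂ (V j) 0) ∧
      (∀ j, (κ j : ℚ) = e * (ramExp D c p j + zeroCount α p j)) ∧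
      ∀ᶠ y in 𝓝 (0 : ℂ), ∃ ζ : Fin m → ℂ, (∀ j, ‖ζ j‖ = 1) ∧ (∀ a, P.chi ζ a = 1) ∧
        ∀ j, blaschkeMap D.pts c d α a (p + y ^ e) j = ζ j * (y ^ κ j * exp (V j y)) := by
  classical
  have he := hp.pos
  choose L hL hLe using fun j s => exists_blaschke_branch (hα j s) hp.1 he
  choose M hM hMe using fun i => exists_blaschke_branch (D.pts_mem i) hp.1 he
  have hq : ∀ i j, ∃ q : ℕ, (q : ℚ) = ((if p = D.pts i then e else 0 : ℕ) : ℚ) * c i j := by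
    intro i j
    split_ifs with h
    · rw [hp.eq_ord h]
      exact exists_nat_eq_mul_of_sectorOrder_dvd (hord i) ((hbox i).1 j).1
    · exact ⟨0, by simp⟩
  choose q hq using hq
  refine ⟨fun j => e * zeroCount α p j + ∑ i, q i j,
    fun j y => log (a j) + ∑ s, L j s y + ∑ i, (c i j : ℂ) * M i y, fun j => ?_, fun j => ?_, ?_⟩
  · exact (analyticAt_const.add (Finset.analyticAt_fun_sum _ fun s _ => hL j s)).add
      (Finset.analyticAt_fun_sum _ fun i _ => analyticAt_const.mul (hM i))
  · push_cast
    rw [ramExp, mul_add, add_comm]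
    congr 1
    rw [Finset.mul_sum]
    refine Finset.sum_congr rfl fun i _ => ?_
    rw [hq]
    split_ifs <;> simp
  · have h1 : ∀ᶠ y in 𝓝 (0 : ℂ), ∀ j s, blaschke (α j s) (p + y ^ e) =
        y ^ (if p = α j s then e else 0) * exp (L j s y) :=
      Filter.eventually_all.2 fun j => Filter.eventually_all.2 fun s => hLe j s
    have h2 : ∀ᶠ y in 𝓝 (0 : ℂ), ∀ i, blaschke (D.pts i) (p + y ^ e) =
        y ^ (if p = D.pts i then e else 0) * exp (M i y) := Filter.eventually_all.2 hMe
    filter_upwards [h1, h2] with y h1 h2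
    choose r hr using fun i => exists_int_cpow_eq (h2 i)
    refine ⟨fun j => exp (∑ i, 2 * Real.pi * I * (r i * c i j)), fun j => ?_,
      fun a => ?_, fun j => ?_⟩
    · have : ∑ i, 2 * (Real.pi : ℂ) * I * (r i * c i j) =
          ((2 * Real.pi * ∑ i, (r i : ℝ) * (c i j : ℝ) : ℝ) : ℂ) * I := by
        push_cast
        rw [Finset.mul_sum, Finset.sum_mul]
        exact Finset.sum_congr rfl fun i _ => by ring
      simp only [this, Complex.norm_exp_ofReal_mul_I]
    · rw [chi_exp]
      refine Complex.exp_eq_one_iff.2 ⟨∑ i, r i * ν i a, ?_⟩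
      have : ∀ i, (ν i a : ℂ) = ∑ j, (c i j : ℂ) * (P.b j a : ℂ) := fun i => by
        exact_mod_cast congrArg (Rat.cast (K := ℂ)) ((hbox i).2.1 a)
      push_cast
      simp only [this, Finset.sum_mul, Finset.mul_sum]
      rw [Finset.sum_comm]
      exact Finset.sum_congr rfl fun i _ => Finset.sum_congr rfl fun j _ => by ring
    · have e1 : ∏ s, blaschke (α j s) (p + y ^ e) =
          y ^ (e * zeroCount α p j) * exp (∑ s, L j s y) := by
        simp only [h1, Finset.prod_mul_distrib, Finset.prod_pow_eq_pow_sum, Complex.exp_sum]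
        congr 2
        rw [zeroCount, Finset.card_filter, Finset.mul_sum]
        exact Finset.sum_congr rfl fun s _ => by split_ifs <;> simp
      have e2 : ∏ i, blaschke (D.pts i) (p + y ^ e) ^ ((c i j : ℚ) : ℂ) =
          exp (∑ i, 2 * Real.pi * I * (r i * c i j)) *
            (y ^ (∑ i, q i j) * exp (∑ i, (c i j : ℂ) * M i y)) := by
        rw [Complex.exp_sum, Complex.exp_sum, ← Finset.prod_pow_eq_pow_sum,
          ← Finset.prod_mul_distrib, ← Finset.prod_mul_distrib]
        exact Finset.prod_congr rfl fun i _ => hr i (c i j) (q i j) (hq i j)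
      simp only [blaschkeMap]
      rw [e1, e2, Complex.exp_add, Complex.exp_add, exp_log (ha j), pow_add]
      ring

theorem blaschkeMap_eq_zero_iff {ν : Fin k → Fin n → ℤ} {c : Fin k → Fin m → ℚ} {d : Fin m → ℕ}
    {α : (j : Fin m) → Fin (d j) → ℂ} {a : Fin m → ℂ}
    (hbox : ∀ i, P.IsBoxCoeff (ν i) (c i))
    (hα : ∀ j s, α j s ∈ Metric.ball (0 : ℂ) 1) (ha : ∀ j, a j ≠ 0) {p : ℂ}
    (hp : p ∈ Metric.closedBall (0 : ℂ) 1) (j : Fin m) :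
    blaschkeMap D.pts c d α a p j = 0 ↔ ramExp D c p j + zeroCount α p j ≠ 0 := by
  classical
  have h1 : ∏ s, blaschke (α j s) p = 0 ↔ zeroCount α p j ≠ 0 := by
    rw [Finset.prod_eq_zero_iff, zeroCount, Finset.card_ne_zero]
    simp only [Finset.mem_univ, true_and, blaschke_eq_zero_iff (hα j _) hp]
    exact ⟨fun ⟨s, hs⟩ => ⟨s, by simpa using hs⟩, fun ⟨s, hs⟩ => ⟨s, by simpa using hs⟩⟩
  have h2 : ∏ i, blaschke (D.pts i) p ^ ((c i j : ℚ) : ℂ) = 0 ↔ ramExp D c p j ≠ 0 := by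
    rw [Finset.prod_eq_zero_iff, ramExp]
    simp only [Finset.mem_univ, true_and, Complex.cpow_eq_zero_iff,
      blaschke_eq_zero_iff (D.pts_mem _) hp]
    rw [Ne, Finset.sum_eq_zero_iff_of_nonneg fun i _ => by
      split_ifs
      · exact ((hbox i).1 j).1
      · exact le_rfl]
    push Not
    refine exists_congr fun i => ?_
    simp only [Finset.mem_univ, true_and]
    split_ifs with h <;> simp [h]
  have h3 : (0 : ℚ) ≤ ramExp D c p j := Finset.sum_nonneg fun i _ => by
      split_ifs
      · exact ((hbox i).1 j).1
      · exact le_rfl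
  simp only [blaschkeMap]
  rw [mul_eq_zero, mul_eq_zero, or_iff_right (ha j), h1, h2]
  constructor
  · rintro (h | h)
    · have : (0 : ℚ) < zeroCount α p j := by exact_mod_cast Nat.pos_of_ne_zero h
      linarith
    · have : (0 : ℚ) ≤ zeroCount α p j := by positivity
      have := lt_of_le_of_ne h3 (Ne.symm h)
      linarith
  · intro h
    by_contra hc
    push Not at hc
    rw [hc.1, hc.2] at h
    simp at h

theorem eventually_br_eq_pts {p : ℂ} {e : ℕ} (he : 0 < e) :
    ∀ᶠ y in 𝓝 (0 : ℂ), ∀ i, p + y ^ e = D.pts i → y = 0 := by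
  refine Filter.eventually_all.2 fun i => ?_
  by_cases h : p = D.pts i
  · refine Filter.Eventually.of_forall fun y hy => ?_
    rw [h] at hy
    exact eq_zero_of_pow_eq_zero (by simpa using hy : y ^ e = 0)
  · have hc : ContinuousAt (fun y : ℂ => p + y ^ e) 0 := by fun_prop
    have : p + (0 : ℂ) ^ e ≠ D.pts i := by simpa [he.ne'] using h
    filter_upwards [hc.eventually_ne this] with y hy hy'
    exact absurd hy' hy

/-- An analytic germ of homogeneous coordinates in a chart is a local lift. -/
theorem exists_localLift_of_analyticAt {p : ℂ} {e : ℕ} (hp : D.IsLocalOrder p e) (s : P.Chart)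
    {f : ℂ → Fin n → ℂ} (hf : ∀ l, AnalyticAt ℂ (fun y => f y l) 0)
    (h : ∀ᶠ y in 𝓝 (0 : ℂ), p + y ^ e ∈ Metric.closedBall (0 : ℂ) 1 →
      P.Rep (w (p + y ^ e)) (s.homog (f y))) :
    ∃ F : P.LocalLift D w, F.p = p ∧ F.chart = s ∧ F.f = f := by
  have hfa : AnalyticAt ℂ f 0 := analyticAt_pi_iff.2 hf
  obtain ⟨ε, hε, H⟩ := Metric.eventually_nhds_iff.1
    (hfa.eventually_analyticAt.and (h.and (eventually_br_eq_pts (D := D) (p := p) hp.pos)))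
  have H' : ∀ y : ℂ, ‖y‖ < ε → _ := fun y hy => H (y := y) (by simpa using hy)
  exact ⟨⟨p, e, s, f, ε, hp, hε, fun y hy => (H' y hy).2.2, fun y hy => (H' y hy).2.1,
    fun y hy => ((H' y hy.1).1.contDiffAt.restrict_scalars ℝ).contDiffWithinAt,
    fun y hy => (H' y hy.1).1.differentiableAt.differentiableWithinAt⟩, rfl, rfl, rfl⟩

/-- The coordinates of the chart that contains the vanishing ones, the other homogeneous coordinates
being normalized to `1` by an element of `K_ℂ`, form a local lift of a map in standard form. -/
theorem exists_localLift {z₀ : Fin m → ℂ} {ν : Fin k → Fin n → ℤ} {c : Fin k → Fin m → ℚ}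
    {d : Fin m → ℕ} {α : (j : Fin m) → Fin (d j) → ℂ} {a : Fin m → ℂ}
    (hst : P.IsStandardForm z₀ D w ν c d α a) (ha : ∀ j, a j ≠ 0) {p : ℂ}
    (hp : p ∈ Metric.closedBall (0 : ℂ) 1) : ∃ F : P.LocalLift D w, F.p = p := by
  obtain ⟨e, he⟩ := D.exists_isLocalOrder hp
  obtain ⟨κ, V, hV, hκ, hW⟩ := exists_blaschkeMap_branch hst.boxCoeff hst.order_dvd
    hst.zeros_mem ha he
  obtain ⟨hU, -⟩ := hst.rep p hp
  obtain ⟨s, hs⟩ := mem_U_iff.1 hU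
  have hκ0 : ∀ j, j ∉ Set.range s.ray → κ j = 0 := by
    intro j hj
    by_contra hne
    refine hj (hs j ((blaschkeMap_eq_zero_iff hst.boxCoeff hst.zeros_mem ha hp j).2 fun h0 => ?_))
    have := hκ j
    rw [h0, mul_zero] at this
    exact hne (by exact_mod_cast this)
  have hf : ∀ l, AnalyticAt ℂ
      (fun y => y ^ κ (s.ray l) * exp (∑ j, V j y * (s.coeff (P.b j) l : ℂ))) 0 := fun l =>
    (analyticAt_id.pow _).mul (AnalyticAt.cexp
      (Finset.analyticAt_fun_sum _ fun j _ => (hV j).mul analyticAt_const))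
  obtain ⟨F, hF, -⟩ := exists_localLift_of_analyticAt (w := w) (f := fun y l =>
    y ^ κ (s.ray l) * exp (∑ j, V j y * (s.coeff (P.b j) l : ℂ))) he s hf (by
      filter_upwards [hW] with y ⟨ζ, hζ1, hζ, hy⟩ hmem
      have hζ0 : ∀ j, ζ j ≠ 0 := fun j h => by simpa [h] using hζ1 j
      refine (hst.rep _ hmem).of_sameOrbit ?_
      let T : Fin m → ℂ := Function.extend s.ray (fun l => ∑ j, V j y * (s.coeff (P.b j) l : ℂ)) 0
      have hT1 : ∀ l, T (s.ray l) = ∑ j, V j y * (s.coeff (P.b j) l : ℂ) :=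
        fun l => s.ray.injective.extend_apply _ _ _
      have hT2 : ∀ j, j ∉ Set.range s.ray → T j = 0 := fun j hj => Function.extend_apply' _ _ _ hj
      refine sameOrbit_of_chi (t := fun j => exp (T j - V j y) / ζ j)
        (fun j => div_ne_zero (exp_ne_zero _) (hζ0 j)) (fun j => ?_) fun a => ?_
      · rw [hy j]
        have := hζ0 j
        by_cases hj : j ∈ Set.range s.ray
        · obtain ⟨l, rfl⟩ := hj
          rw [s.homog_ray, hT1, Complex.exp_sub]
          field_simp
        · rw [s.homog_of_notMem _ hj, hT2 j hj, hκ0 j hj, Complex.exp_sub]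
          simp only [exp_zero, pow_zero]
          field_simp
      · rw [chi_div, hζ, chi_exp, div_one]
        simp only [sub_mul, Finset.sum_sub_distrib]
        rw [s.sum_eq_sum_ray (fun j => T j * (P.b j a : ℂ)) (fun j hj => by rw [hT2 j hj, zero_mul])]
        simp only [hT1, Finset.sum_mul]
        rw [Finset.sum_comm, Complex.exp_eq_one_iff]
        refine ⟨0, ?_⟩
        rw [Int.cast_zero, zero_mul, sub_eq_zero]
        refine Finset.sum_congr rfl fun j _ => ?_
        rw [← s.sum_coeff_cast (K := ℂ) (P.b j) a, Finset.mul_sum]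
        exact Finset.sum_congr rfl fun l _ => by ring)
  exact ⟨F, hF⟩

namespace LocalLift

variable (F : P.LocalLift D w)

theorem e_pos : 0 < F.e := F.localOrder.pos

@[simp] theorem br_zero : F.br 0 = F.p := by simp [br, F.e_pos.ne']

theorem continuous_br : Continuous F.br := by unfold br; fun_prop

theorem zero_mem_dom : (0 : ℂ) ∈ F.dom :=
  ⟨by simpa using F.ε_pos, by rw [F.br_zero]; exact F.localOrder.1⟩

theorem inner_subset_dom : F.inner ⊆ F.dom := fun _ hy => ⟨hy.1, Metric.ball_subset_closedBall hy.2⟩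

theorem isOpen_inner : IsOpen F.inner :=
  (isOpen_lt continuous_norm continuous_const).inter (Metric.isOpen_ball.preimage F.continuous_br)

theorem rep {y : ℂ} (hy : y ∈ F.dom) : P.Rep (w (F.br y)) (F.chart.homog (F.f y)) :=
  F.lifts y hy.1 hy.2

theorem contDiffOn : ContDiffOn ℝ ∞ F.f F.dom := F.smooth

theorem continuousOn : ContinuousOn F.f F.dom := F.contDiffOn.continuousOn

theorem differentiableOn : DifferentiableOn ℂ F.f F.inner := F.holo

theorem analyticAt {y : ℂ} (hy : y ∈ F.inner) : AnalyticAt ℂ F.f y :=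
  F.differentiableOn.analyticAt (F.isOpen_inner.mem_nhds hy)

theorem analyticAt_apply {y : ℂ} (hy : y ∈ F.inner) (l : Fin n) :
    AnalyticAt ℂ (fun y => F.f y l) y := analyticAt_pi_iff.1 (F.analyticAt hy) l

theorem continuousOn_apply (l : Fin n) : ContinuousOn (fun y => F.f y l) F.dom :=
  (continuous_apply l).comp_continuousOn F.continuousOn

/-- Points near the centre are images of points near zero under the branched covering. -/
theorem tendsto_root : Filter.Tendsto (fun z => (z - F.p) ^ ((F.e : ℂ)⁻¹)) (𝓝 F.p) (𝓝 0) := by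
  have h1 : Filter.Tendsto (fun z => ‖z - F.p‖ ^ ((F.e : ℝ)⁻¹)) (𝓝 F.p) (𝓝 0) := by
    have hc : Continuous fun z : ℂ => ‖z - F.p‖ ^ ((F.e : ℝ)⁻¹) :=
      (by fun_prop : Continuous fun z : ℂ => ‖z - F.p‖).rpow_const
        fun z => Or.inr (by positivity)
    have := hc.tendsto F.p
    have h0 : ((F.e : ℝ)⁻¹) ≠ 0 := inv_ne_zero (by exact_mod_cast F.e_pos.ne')
    simpa [Real.zero_rpow h0] using this
  refine tendsto_zero_iff_norm_tendsto_zero.2 (h1.congr fun z => ?_)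
  rw [← Complex.norm_cpow_real]
  push_cast
  rfl

theorem br_root (z : ℂ) : F.br ((z - F.p) ^ ((F.e : ℂ)⁻¹)) = z := by
  rw [br, Complex.cpow_nat_inv_pow _ F.e_pos.ne']
  ring

theorem continuousWithinAt : ContinuousWithinAt w (Metric.closedBall 0 1) F.p := by
  have hU : ∀ y : F.dom, F.chart.homog (F.f y) ∈ P.U := fun y => (F.rep y.2).choose
  have hcont : Continuous fun y : F.dom => (Quotient.mk P.orbitSetoid ⟨_, hU y⟩ : P.X) := by
    refine continuous_quotient_mk'.comp (Continuous.subtype_mk ?_ _)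
    refine continuous_pi fun j => ?_
    by_cases hj : j ∈ Set.range F.chart.ray
    · obtain ⟨l, rfl⟩ := hj
      simp only [Chart.homog_ray]
      exact continuousOn_iff_continuous_domRestrict.1 (F.continuousOn_apply l)
    · simp only [Chart.homog_of_notMem _ _ hj]
      exact continuous_const
  have hw : ∀ y : F.dom, w (F.br y) = Quotient.mk P.orbitSetoid ⟨_, hU y⟩ :=
    fun y => (F.rep y.2).choose_spec
  have h2 : ContinuousOn (fun y => w (F.br y)) F.dom := by
    rw [continuousOn_iff_continuous_domRestrict]
    exact hcont.congr fun y => (hw y).symm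
  have h3 : Filter.Tendsto (fun z => (z - F.p) ^ ((F.e : ℂ)⁻¹)) (𝓝[Metric.closedBall 0 1] F.p)
      (𝓝[F.dom] 0) := by
    refine tendsto_nhdsWithin_iff.2 ⟨F.tendsto_root.mono_left nhdsWithin_le_nhds, ?_⟩
    have h4 := (F.tendsto_root.eventually (Metric.ball_mem_nhds 0 F.ε_pos)).filter_mono
      (nhdsWithin_le_nhds (s := Metric.closedBall 0 1))
    filter_upwards [h4, self_mem_nhdsWithin] with z hz hz'
    exact ⟨by simpa using hz, by rw [F.br_root]; exact hz'⟩
  have h5 := (h2 0 F.zero_mem_dom).tendsto.comp h3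
  rw [ContinuousWithinAt]
  simpa only [Function.comp_def, F.br_root, F.br_zero] using h5

end LocalLift

theorem IsStandardForm.isHolomorphic {z₀ : Fin m → ℂ} {L : Set P.X} {ν : Fin k → Fin n → ℤ}
    {c : Fin k → Fin m → ℚ}
    {d : Fin m → ℕ} {α : (j : Fin m) → Fin (d j) → ℂ} {a : Fin m → ℂ}
    (hst : P.IsStandardForm z₀ D w ν c d α a) (ha : ∀ j, a j ≠ 0)
    (hL : {x : P.X | ∃ z ∈ realTorusOrbit z₀, P.Rep x z} = L) : P.IsHolomorphic D L w := by
  have hl := fun p hp => exists_localLift hst ha (p := p) hp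
  refine ⟨fun p hp => ?_, hl, fun p hp => ?_⟩
  · obtain ⟨F, rfl⟩ := hl p hp
    exact F.continuousWithinAt
  · rw [← hL]
    have hp1 : ‖p‖ = 1 := by simpa using hp
    refine ⟨_, ?_, hst.rep p (Metric.sphere_subset_closedBall hp)⟩
    obtain ⟨t, ht⟩ := hst.const_mem
    have hu : ∀ j, ‖(∏ s, blaschke (α j s) p) *
        ∏ i, blaschke (D.pts i) p ^ ((c i j : ℚ) : ℂ)‖ = 1 := by
      intro j
      rw [norm_mul, norm_prod, norm_prod,
        Finset.prod_eq_one fun s _ => norm_blaschke_of_norm_eq_one (hst.zeros_mem j s) hp1,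
        Finset.prod_eq_one fun i _ => ?_, one_mul]
      have := Complex.norm_cpow_real (blaschke (D.pts i) p) (c i j : ℝ)
      rw [norm_blaschke_of_norm_eq_one (D.pts_mem i) hp1, Real.one_rpow] at this
      exact_mod_cast this
    have hC : ∀ j, ∃ r : Circle, (r : ℂ) = (∏ s, blaschke (α j s) p) *
        ∏ i, blaschke (D.pts i) p ^ ((c i j : ℚ) : ℂ) :=
      fun j => ⟨⟨_, mem_sphere_zero_iff_norm.2 (hu j)⟩, rfl⟩
    choose r hr using hC
    refine ⟨fun j => t j * r j, fun j => ?_⟩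
    simp only [blaschkeMap, ht j, Circle.coe_mul, hr]
    ring

end LabeledPolytope

/-! ### Arbitrary local lifts of a map in standard form -/

namespace LabeledPolytope

variable {n m k : ℕ} {P : LabeledPolytope n m} {D : MarkedOrbiDisc k} {w : ℂ → P.X}

theorem Chart.chi_homog (s : P.Chart) (x : Fin n → ℂ) (a : Fin n) :
    P.chi (s.homog x) a = ∏ l, x l ^ P.b (s.ray l) a := by
  rw [chi, s.prod_eq_prod_ray _ fun j hj => by rw [s.homog_of_notMem x hj, one_zpow]]
  simp

namespace LocalLift

variable (F : P.LocalLift D w)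

theorem gen_pow : F.gen ^ F.e = 1 := by
  have : (F.e : ℂ) ≠ 0 := by exact_mod_cast F.e_pos.ne'
  rw [gen, ← Complex.exp_nat_mul, mul_div_cancel₀ _ this, Complex.exp_two_pi_mul_I]

theorem isPrimitiveRoot_gen : IsPrimitiveRoot F.gen F.e :=
  Complex.isPrimitiveRoot_exp _ F.e_pos.ne'

theorem norm_of_pow {ζ : ℂ} (hζ : ζ ^ F.e = 1) : ‖ζ‖ = 1 := by
  have : ‖ζ‖ ^ F.e = 1 := by rw [← norm_pow, hζ, norm_one]
  exact (pow_eq_one_iff_of_nonneg (norm_nonneg _) F.e_pos.ne').1 this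

theorem br_mul {ζ : ℂ} (hζ : ζ ^ F.e = 1) (y : ℂ) : F.br (ζ * y) = F.br y := by
  simp [br, mul_pow, hζ]

theorem mul_mem_dom {ζ : ℂ} (hζ : ζ ^ F.e = 1) {y : ℂ} (hy : y ∈ F.dom) : ζ * y ∈ F.dom :=
  ⟨by rw [norm_mul, F.norm_of_pow hζ, one_mul]; exact hy.1, by rw [F.br_mul hζ]; exact hy.2⟩

theorem mul_mem_inner {ζ : ℂ} (hζ : ζ ^ F.e = 1) {y : ℂ} (hy : y ∈ F.inner) : ζ * y ∈ F.inner :=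
  ⟨by rw [norm_mul, F.norm_of_pow hζ, one_mul]; exact hy.1, by rw [F.br_mul hζ]; exact hy.2⟩

/-- The domain of a lift centred at an interior point is star-shaped. -/
theorem smul_mem_inner (hp : F.p ∈ Metric.ball (0 : ℂ) 1) {y : ℂ} (hy : y ∈ F.dom) {s : ℝ}
    (hs0 : 0 ≤ s) (hs1 : s < 1) : (s : ℂ) * y ∈ F.inner := by
  have hse : s ^ F.e < 1 := pow_lt_one₀ hs0 hs1 F.e_pos.ne'
  have hse0 : 0 ≤ s ^ F.e := pow_nonneg hs0 _
  refine ⟨?_, ?_⟩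
  · rw [norm_mul, Complex.norm_real, Real.norm_of_nonneg hs0]
    nlinarith [hy.1, norm_nonneg y]
  · have hb : ‖F.br y‖ ≤ 1 := by simpa using hy.2
    have hp' : ‖F.p‖ < 1 := by simpa using hp
    have : F.br (s * y) = ((1 - s ^ F.e : ℝ) : ℂ) * F.p + ((s ^ F.e : ℝ) : ℂ) * F.br y := by
      simp only [br, mul_pow]; push_cast; ring
    rw [mem_ball_zero_iff, this]
    calc _ ≤ (1 - s ^ F.e) * ‖F.p‖ + s ^ F.e * ‖F.br y‖ := by
          refine (norm_add_le _ _).trans ?_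
          rw [norm_mul, norm_mul, Complex.norm_real, Complex.norm_real,
            Real.norm_of_nonneg hse0, Real.norm_of_nonneg (by linarith)]
      _ < 1 := by nlinarith

theorem mem_inner_zero (hp : F.p ∈ Metric.ball (0 : ℂ) 1) : (0 : ℂ) ∈ F.inner :=
  ⟨by simpa using F.ε_pos, by rw [F.br_zero]; exact hp⟩

theorem isPreconnected_inner (hp : F.p ∈ Metric.ball (0 : ℂ) 1) : IsPreconnected F.inner := by
  have : StarConvex ℝ 0 F.inner := by
    rw [starConvex_zero_iff]
    intro y hy s hs0 hs1
    rcases hs1.eq_or_lt with rfl | hs1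
    · simpa using hy
    · simpa using F.smul_mem_inner hp (F.inner_subset_dom hy) hs0 hs1
  exact (StarConvex.isPathConnected this (F.mem_inner_zero hp)).isConnected.isPreconnected

/-- An equivariance of the germ at the centre propagates to the whole domain. -/
theorem eq_mul_of_eventually (hp : F.p ∈ Metric.ball (0 : ℂ) 1) {ζ ξ : ℂ} (hζ : ζ ^ F.e = 1)
    (l : Fin n) (h : ∀ᶠ y in 𝓝 (0 : ℂ), F.f (ζ * y) l = ξ * F.f y l) {y : ℂ} (hy : y ∈ F.dom) :
    F.f (ζ * y) l = ξ * F.f y l := by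
  have hin : ∀ y ∈ F.inner, F.f (ζ * y) l = ξ * F.f y l := by
    refine AnalyticOnNhd.eqOn_of_preconnected_of_eventuallyEq (𝕜 := ℂ) (f := fun y => F.f (ζ * y) l)
      (g := fun y => ξ * F.f y l) (z₀ := 0) ?_ ?_ (F.isPreconnected_inner hp)
      (F.mem_inner_zero hp) h
    · intro y hy
      exact (F.analyticAt_apply (F.mul_mem_inner hζ hy) l).fun_comp
        (analyticAt_const.mul analyticAt_id)
    · intro y hy
      exact analyticAt_const.mul (F.analyticAt_apply hy l)
  -- approach a boundary point of the domain along its radius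
  have hs : Filter.Tendsto (fun s : ℝ => (s : ℂ) * y) (𝓝[Set.Ico 0 1] 1) (𝓝[F.dom] y) := by
    refine tendsto_nhdsWithin_iff.2 ⟨?_, ?_⟩
    · have : Continuous fun s : ℝ => (s : ℂ) * y := by fun_prop
      simpa using (this.tendsto 1).mono_left nhdsWithin_le_nhds
    · filter_upwards [self_mem_nhdsWithin] with s hs
      exact F.inner_subset_dom (F.smul_mem_inner hp hy hs.1 hs.2)
  have hs' : Filter.Tendsto (fun s : ℝ => ζ * ((s : ℂ) * y)) (𝓝[Set.Ico 0 1] 1)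
      (𝓝[F.dom] (ζ * y)) := by
    refine tendsto_nhdsWithin_iff.2 ⟨?_, ?_⟩
    · exact (hs.mono_right nhdsWithin_le_nhds).const_mul ζ
    · filter_upwards [self_mem_nhdsWithin] with s hs
      exact F.mul_mem_dom hζ (F.inner_subset_dom (F.smul_mem_inner hp hy hs.1 hs.2))
  have t1 := (F.continuousOn_apply l (ζ * y) (F.mul_mem_dom hζ hy)).tendsto.comp hs'
  have t2 := ((F.continuousOn_apply l y hy).tendsto.comp hs).const_mul ξ
  have : (𝓝[Set.Ico (0 : ℝ) 1] 1).NeBot := by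
    rw [← mem_closure_iff_nhdsWithin_neBot, closure_Ico (by norm_num)]
    exact ⟨by norm_num, le_rfl⟩
  refine tendsto_nhds_unique_of_eventuallyEq t1 t2 ?_
  filter_upwards [self_mem_nhdsWithin] with s hs
  exact hin _ (F.smul_mem_inner hp hy hs.1 hs.2)

/-- A coordinate of a lift whose modulus is invariant under the local group is multiplied by a
power of the generator, the exponent being its vanishing order. -/
theorem f_gen_mul (hp : F.p ∈ Metric.ball (0 : ℂ) 1) (l : Fin n) {κ : ℕ} {g : ℂ → ℂ}
    (hg : AnalyticAt ℂ g 0) (hg0 : g 0 ≠ 0) (hf : ∀ᶠ y in 𝓝 (0 : ℂ), F.f y l = y ^ κ * g y)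
    {ζ : ℂ} (hζ : ζ ^ F.e = 1) (hn : ∀ᶠ y in 𝓝 (0 : ℂ), ‖F.f (ζ * y) l‖ = ‖F.f y l‖) {y : ℂ}
    (hy : y ∈ F.dom) : F.f (ζ * y) l = ζ ^ κ * F.f y l := by
  refine F.eq_mul_of_eventually hp hζ l ?_ hy
  have hmul : Filter.Tendsto (fun y : ℂ => ζ * y) (𝓝 0) (𝓝 0) := by
    have : Continuous fun y : ℂ => ζ * y := by fun_prop
    simpa using this.tendsto 0
  have hgz : AnalyticAt ℂ (fun y => g (ζ * y)) 0 :=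
    AnalyticAt.fun_comp (by simpa using hg) (analyticAt_const.mul analyticAt_id)
  have hq : AnalyticAt ℂ (fun y => g (ζ * y) / g y) 0 := hgz.div hg hg0
  have hnorm : ∀ᶠ y in 𝓝[≠] (0 : ℂ), ‖g (ζ * y) / g y‖ = 1 := by
    filter_upwards [(hn.and (hf.and ((hmul.eventually hf).and
      (hg.continuousAt.eventually_ne hg0)))).filter_mono nhdsWithin_le_nhds,
      self_mem_nhdsWithin] with y ⟨h1, h2, h3, h4⟩ h5
    rw [h2, h3, norm_mul, norm_mul, norm_pow, norm_pow, norm_mul, F.norm_of_pow hζ, one_mul] at h1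
    have h6 : ‖y‖ ^ κ ≠ 0 := pow_ne_zero _ (norm_ne_zero_iff.2 h5)
    rw [norm_div, mul_left_cancel₀ h6 h1, div_self (norm_ne_zero_iff.2 h4)]
  have h1 : ‖g (ζ * 0) / g 0‖ = 1 := by simp [hg0]
  have := eventually_eq_of_norm_eq hq (by
    rw [h1]
    rw [eventually_nhdsWithin_iff] at hnorm
    filter_upwards [hnorm] with y hy
    by_cases h : y = 0
    · rw [h, h1]
    · exact hy h)
  filter_upwards [this, hf, hmul.eventually hf, hg.continuousAt.eventually_ne hg0] with y h1 h2 h3 h4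
  rw [h2, h3]
  simp only [mul_zero, div_self hg0] at h1
  rw [(div_eq_one_iff_eq h4).1 h1]
  ring

end LocalLift

section Standard

variable {z₀ : Fin m → ℂ} {ν : Fin k → Fin n → ℤ} {c : Fin k → Fin m → ℚ}
    {d : Fin m → ℕ} {α : (j : Fin m) → Fin (d j) → ℂ} {a : Fin m → ℂ}

/-- The contribution of the coordinates outside the cone `s` to the logarithm of the modulus of
the `l`-th coordinate of a lift. -/
noncomputable def Chart.offLog (s : P.Chart) (W : Fin m → ℂ) (l : Fin n) : ℝ :=
  open Classical in
  ∑ j, if j ∈ Set.range s.ray then 0 else Real.log ‖W j‖ * (s.coeff (P.b j) l : ℝ)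

theorem Chart.norm_eq_of_sameOrbit (s : P.Chart) {W : Fin m → ℂ} {x : Fin n → ℂ}
    (h : P.SameOrbit W (s.homog x)) (l : Fin n) :
    ‖x l‖ = ‖W (s.ray l)‖ * Real.exp (s.offLog W l) := by
  classical
  obtain ⟨t, ht, hchi, e⟩ := sameOrbit_iff.1 h
  have h1 : x l = t (s.ray l) * W (s.ray l) := by rw [← e, s.homog_ray]
  have h2 := sum_coeff_log_norm ht hchi s l
  have h3 : ∑ j, Real.log ‖t j‖ * (s.coeff (P.b j) l : ℝ) =
      Real.log ‖t (s.ray l)‖ - s.offLog W l := by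
    have e1 : Real.log ‖t (s.ray l)‖ = ∑ j, if j ∈ Set.range s.ray then
        Real.log ‖t j‖ * (s.coeff (P.b j) l : ℝ) else 0 := by
      rw [s.sum_eq_sum_ray _ fun j hj => if_neg hj]
      simp only [Set.mem_range_self, if_true, s.coeff_ray]
      rw [Finset.sum_eq_single l]
      · simp
      · intro r _ hr; simp [hr]
      · simp
    rw [e1, Chart.offLog, ← Finset.sum_sub_distrib]
    refine Finset.sum_congr rfl fun j _ => ?_
    split_ifs with hj
    · ring
    · have : t j * W j = 1 := by rw [← e, s.homog_of_notMem _ hj]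
      have hW : W j ≠ 0 := right_ne_zero_of_mul_eq_one this
      have : ‖t j‖ = ‖W j‖⁻¹ := by
        rw [eq_inv_of_mul_eq_one_left this, norm_inv]
      rw [this, Real.log_inv]; ring
  rw [h2] at h3
  have h4 : ‖t (s.ray l)‖ = Real.exp (s.offLog W l) := by
    rw [← Real.exp_log (norm_pos_iff.2 (ht (s.ray l)))]
    congr 1
    linarith
  rw [h1, norm_mul, h4, mul_comm]

namespace IsStandardForm

theorem sameOrbit (hst : P.IsStandardForm z₀ D w ν c d α a) (F : P.LocalLift D w) {y : ℂ}
    (hy : y ∈ F.dom) : P.SameOrbit (blaschkeMap D.pts c d α a (F.br y)) (F.chart.homog (F.f y)) :=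
  (hst.rep _ hy.2).sameOrbit (F.rep hy)

theorem ne_zero_of_notMem (hst : P.IsStandardForm z₀ D w ν c d α a) (F : P.LocalLift D w) {y : ℂ}
    (hy : y ∈ F.dom) {j : Fin m} (hj : j ∉ Set.range F.chart.ray) :
    blaschkeMap D.pts c d α a (F.br y) j ≠ 0 := fun h => by
  have := ((hst.sameOrbit F hy).eq_zero_iff j).2 h
  rw [F.chart.homog_of_notMem _ hj] at this
  exact one_ne_zero this

theorem f_eq_zero_iff (hst : P.IsStandardForm z₀ D w ν c d α a) (F : P.LocalLift D w) {y : ℂ}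
    (hy : y ∈ F.dom) (l : Fin n) :
    F.f y l = 0 ↔ blaschkeMap D.pts c d α a (F.br y) (F.chart.ray l) = 0 := by
  have := (hst.sameOrbit F hy).eq_zero_iff (F.chart.ray l)
  rwa [F.chart.homog_ray] at this

theorem norm_f (hst : P.IsStandardForm z₀ D w ν c d α a) (F : P.LocalLift D w) {y : ℂ}
    (hy : y ∈ F.dom) (l : Fin n) :
    ‖F.f y l‖ = ‖blaschkeMap D.pts c d α a (F.br y) (F.chart.ray l)‖ *
      Real.exp (F.chart.offLog (blaschkeMap D.pts c d α a (F.br y)) l) :=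
  F.chart.norm_eq_of_sameOrbit (hst.sameOrbit F hy) l

theorem norm_f_mul (hst : P.IsStandardForm z₀ D w ν c d α a) (F : P.LocalLift D w) {ζ : ℂ}
    (hζ : ζ ^ F.e = 1) {y : ℂ} (hy : y ∈ F.dom) (l : Fin n) : ‖F.f (ζ * y) l‖ = ‖F.f y l‖ := by
  rw [hst.norm_f F hy, hst.norm_f F (F.mul_mem_dom hζ hy), F.br_mul hζ]

/-- The local form of a lift at its centre. -/
theorem exists_f_eq (hst : P.IsStandardForm z₀ D w ν c d α a) (ha : ∀ j, a j ≠ 0)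
    (F : P.LocalLift D w) (hp : F.p ∈ Metric.ball (0 : ℂ) 1) (l : Fin n) :
    ∃ (κ : ℕ) (g : ℂ → ℂ), (κ : ℚ) = F.e * (ramExp D c F.p (F.chart.ray l) +
      zeroCount α F.p (F.chart.ray l)) ∧ AnalyticAt ℂ g 0 ∧ g 0 ≠ 0 ∧
      ∀ᶠ y in 𝓝 (0 : ℂ), F.f y l = y ^ κ * g y := by
  classical
  obtain ⟨κ, V, hV, hκ, hW⟩ := exists_blaschkeMap_branch hst.boxCoeff hst.order_dvd
    hst.zeros_mem ha F.localOrder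
  have hκ0 : ∀ j, j ∉ Set.range F.chart.ray → κ j = 0 := by
    intro j hj
    by_contra hne
    have h1 := hst.ne_zero_of_notMem F F.zero_mem_dom hj
    rw [F.br_zero, Ne, blaschkeMap_eq_zero_iff hst.boxCoeff hst.zeros_mem ha F.localOrder.1,
      not_not] at h1
    have := hκ j
    rw [h1, mul_zero] at this
    exact hne (by exact_mod_cast this)
  have hin : ∀ᶠ y in 𝓝 (0 : ℂ), y ∈ F.inner := F.isOpen_inner.mem_nhds (F.mem_inner_zero hp)
  let ψ : ℂ → ℝ := fun y => ‖exp (V (F.chart.ray l) y)‖ *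
    Real.exp (∑ j, if j ∈ Set.range F.chart.ray then 0
      else Real.log ‖exp (V j y)‖ * (F.chart.coeff (P.b j) l : ℝ))
  have hψ : ContinuousAt ψ 0 := by
    refine ContinuousAt.mul (hV _).continuousAt.cexp.norm (ContinuousAt.rexp ?_)
    refine tendsto_finsetSum _ fun j _ => ?_
    split_ifs
    · exact tendsto_const_nhds
    · exact ((hV j).continuousAt.cexp.norm.log (norm_ne_zero_iff.2 (exp_ne_zero _))).mul
        continuousAt_const
  have hψ0 : 0 < ψ 0 := by
    have := norm_pos_iff.2 (exp_ne_zero (V (F.chart.ray l) 0))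
    positivity
  have hnorm : ∀ᶠ y in 𝓝 (0 : ℂ), ‖F.f y l‖ = ‖y ^ κ (F.chart.ray l)‖ * ψ y := by
    filter_upwards [hin, hW] with y hy ⟨ζ, hζ, _, h⟩
    have e : F.br y = F.p + y ^ F.e := rfl
    simp only [ψ]
    rw [hst.norm_f F (F.inner_subset_dom hy), e, h, norm_mul, hζ, one_mul, norm_mul, mul_assoc]
    congr 3
    refine Finset.sum_congr rfl fun j _ => ?_
    split_ifs with hj
    · rfl
    · rw [h, norm_mul, hζ, hκ0 j hj, one_mul, pow_zero, one_mul]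
  obtain ⟨g, hg, hg0, h⟩ := exists_analyticAt_factor (N := fun y => y ^ κ (F.chart.ray l))
    (F.analyticAt_apply (F.mem_inner_zero hp) l) (analyticAt_id.pow _)
    (by filter_upwards [self_mem_nhdsWithin] with y hy using pow_ne_zero _ hy) hψ hψ0 hnorm
  exact ⟨κ (F.chart.ray l), g, hκ _, hg, hg0, h⟩

theorem coeff_eq_zero_of_notMem (hst : P.IsStandardForm z₀ D w ν c d α a) (ha : ∀ j, a j ≠ 0)
    (F : P.LocalLift D w) {i : Fin k} (hi : F.p = D.pts i) {j : Fin m}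
    (hj : j ∉ Set.range F.chart.ray) : c i j = 0 := by
  have h1 := hst.ne_zero_of_notMem F F.zero_mem_dom hj
  rw [F.br_zero, Ne, blaschkeMap_eq_zero_iff hst.boxCoeff hst.zeros_mem ha F.localOrder.1,
    not_not, hi, ramExp_pts] at h1
  have h2 := ((hst.boxCoeff i).1 j).1
  have : (0 : ℚ) ≤ zeroCount α (D.pts i) j := by positivity
  linarith

theorem coeff_eq (hst : P.IsStandardForm z₀ D w ν c d α a) (ha : ∀ j, a j ≠ 0)
    (F : P.LocalLift D w) {i : Fin k} (hi : F.p = D.pts i) (l : Fin n) :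
    F.chart.coeff (ν i) l = c i (F.chart.ray l) :=
  F.chart.coeff_eq_of_sum (c := fun l => c i (F.chart.ray l)) (fun a => by
    rw [(hst.boxCoeff i).2.1 a]
    exact F.chart.sum_eq_sum_ray (fun j => c i j * (P.b j a : ℚ)) fun j hj => by
      rw [hst.coeff_eq_zero_of_notMem ha F hi hj, zero_mul]) l

theorem mem_box (hst : P.IsStandardForm z₀ D w ν c d α a) (ha : ∀ j, a j ≠ 0)
    (F : P.LocalLift D w) {i : Fin k} (hi : F.p = D.pts i) : ν i ∈ F.chart.box :=
  F.chart.mem_box_iff.2 fun l => by rw [hst.coeff_eq ha F hi]; exact (hst.boxCoeff i).1 _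

theorem mem_ball_of_eq_pts {p : ℂ} {i : Fin k} (hi : p = D.pts i) :
    p ∈ Metric.ball (0 : ℂ) 1 := hi ▸ D.pts_mem i

theorem f_gen_pow_mul (hst : P.IsStandardForm z₀ D w ν c d α a) (ha : ∀ j, a j ≠ 0)
    (F : P.LocalLift D w) {i : Fin k} (hi : F.p = D.pts i) (r : ℕ) {y : ℂ} (hy : y ∈ F.dom)
    (l : Fin n) : F.f (F.gen ^ r * y) l =
      exp (2 * Real.pi * I * (r * (c i (F.chart.ray l) : ℚ))) * F.f y l := by
  have hp := mem_ball_of_eq_pts hi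
  obtain ⟨κ, g, hκ, hg, hg0, hf⟩ := hst.exists_f_eq ha F hp l
  have hζ : (F.gen ^ r) ^ F.e = 1 := by rw [← pow_mul, mul_comm, pow_mul, F.gen_pow, one_pow]
  have hin : ∀ᶠ y in 𝓝 (0 : ℂ), y ∈ F.inner := F.isOpen_inner.mem_nhds (F.mem_inner_zero hp)
  rw [F.f_gen_mul hp l hg hg0 hf hζ
    (hin.mono fun y hy => hst.norm_f_mul F hζ (F.inner_subset_dom hy) l) hy]
  congr 1
  have he : (F.e : ℂ) ≠ 0 := by exact_mod_cast F.e_pos.ne'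
  rw [LocalLift.gen, ← Complex.exp_nat_mul, ← Complex.exp_nat_mul]
  rw [hi, ramExp_pts] at hκ
  have hκ' : (κ : ℂ) = F.e * (c i (F.chart.ray l) + zeroCount α (D.pts i) (F.chart.ray l)) := by
    exact_mod_cast congrArg (Rat.cast (K := ℂ)) hκ
  refine Complex.exp_eq_exp_iff_exists_int.2
    ⟨r * zeroCount α (D.pts i) (F.chart.ray l), ?_⟩
  rw [hκ']
  push_cast
  field_simp

theorem isSector (hst : P.IsStandardForm z₀ D w ν c d α a) (ha : ∀ j, a j ≠ 0) (i : Fin k) :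
    P.IsSector D w i (ν i) := by
  intro F hi
  refine ⟨hst.mem_box ha F hi, fun y hy => ?_⟩
  ext l
  have := hst.f_gen_pow_mul ha F hi 1 hy l
  rw [pow_one] at this
  rw [this, Chart.act, hst.coeff_eq ha F hi]
  simp

theorem exists_f_ne_zero (hst : P.IsStandardForm z₀ D w ν c d α a) (ha : ∀ j, a j ≠ 0)
    (F : P.LocalLift D w) (hp : F.p ∈ Metric.ball (0 : ℂ) 1) (l : Fin n) :
    ∃ y ∈ F.dom, F.f y l ≠ 0 := by
  obtain ⟨κ, g, hκ, hg, hg0, hf⟩ := hst.exists_f_eq ha F hp l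
  have hin : ∀ᶠ y in 𝓝 (0 : ℂ), y ∈ F.inner := F.isOpen_inner.mem_nhds (F.mem_inner_zero hp)
  obtain ⟨y, ⟨h1, h2, h3⟩, h4⟩ := (((hin.and (hf.and (hg.continuousAt.eventually_ne hg0))).filter_mono
    (nhdsWithin_le_nhds (s := {0}ᶜ))).and self_mem_nhdsWithin).exists
  exact ⟨y, F.inner_subset_dom h1, by rw [h2]; exact mul_ne_zero (pow_ne_zero _ h4) h3⟩

theorem sectorOrder_dvd_iff {c : Fin m → ℚ} {r : ℕ} :
    sectorOrder c ∣ r ↔ ∀ j, ∃ q : ℤ, (r : ℚ) * c j = q := by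
  rw [sectorOrder, Finset.lcm_dvd_iff]
  simp only [Finset.mem_univ, forall_true_left]
  refine forall_congr' fun j => ⟨fun ⟨s, hs⟩ => ⟨s * (c j).num, ?_⟩, fun ⟨q, hq⟩ => ?_⟩
  · have h3 : (c j) * (c j).den = (c j).num := Rat.mul_den_eq_num _
    rw [hs]; push_cast; rw [← h3]; ring
  · have h3 : (c j) * (c j).den = (c j).num := Rat.mul_den_eq_num _
    have h4 : (r : ℚ) * (c j).num = q * (c j).den := by rw [← h3, ← hq]; ring
    have h5 : (r : ℤ) * (c j).num = q * (c j).den := by exact_mod_cast h4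
    have h6 : ((c j).den : ℤ) ∣ r * (c j).num := ⟨q, by rw [h5]; ring⟩
    have h7 : IsCoprime ((c j).den : ℤ) (c j).num := by
      rw [Int.isCoprime_iff_nat_coprime]
      simpa using (c j).reduced.symm
    exact_mod_cast h7.dvd_of_dvd_mul_right h6

theorem isRepresentable_iff (hst : P.IsStandardForm z₀ D w ν c d α a) (ha : ∀ j, a j ≠ 0) :
    P.IsRepresentable D w ↔ ∀ i, D.ord i = sectorOrder (c i) := by
  -- the power `gen ^ r` acts trivially exactly when `r * c_{ij}` is integral for all `j`
  have key : ∀ i, ∀ F : P.LocalLift D w, F.p = D.pts i → ∀ r : ℕ,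
      (∀ y ∈ F.dom, F.f (F.gen ^ r * y) = F.f y) ↔ sectorOrder (c i) ∣ r := by
    intro i F hi r
    rw [sectorOrder_dvd_iff]
    constructor
    · intro h j
      by_cases hj : j ∈ Set.range F.chart.ray
      · obtain ⟨l, rfl⟩ := hj
        obtain ⟨y, hy, hne⟩ := hst.exists_f_ne_zero ha F (mem_ball_of_eq_pts hi) l
        have h1 := hst.f_gen_pow_mul ha F hi r hy l
        rw [h y hy] at h1
        obtain ⟨q, hq⟩ := Complex.exp_eq_one_iff.1 (mul_right_cancel₀ hne
          (h1.symm.trans (one_mul _).symm))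
        refine ⟨q, ?_⟩
        have h2 : ((r : ℂ) * (c i (F.chart.ray l) : ℚ)) = q :=
          mul_left_cancel₀ Complex.two_pi_I_ne_zero (hq.trans (mul_comm _ _))
        exact_mod_cast h2
      · exact ⟨0, by rw [hst.coeff_eq_zero_of_notMem ha F hi hj]; simp⟩
    · intro h y hy
      ext l
      rw [hst.f_gen_pow_mul ha F hi r hy l]
      obtain ⟨q, hq⟩ := h (F.chart.ray l)
      have h2 : ((r : ℂ) * (c i (F.chart.ray l) : ℚ)) = q := by exact_mod_cast hq
      rw [h2, mul_comm (2 * (Real.pi : ℂ) * I), Complex.exp_int_mul_two_pi_mul_I, one_mul]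
  constructor
  · intro h i
    obtain ⟨F, hF⟩ := exists_localLift hst ha (Metric.ball_subset_closedBall (D.pts_mem i))
    have he := F.localOrder.eq_ord hF
    have h1 := h i F hF (F.gen ^ sectorOrder (c i)) (by
      rw [← he, ← pow_mul, mul_comm, pow_mul, F.gen_pow, one_pow]) ((key i F hF _).2 dvd_rfl)
    have h2 := F.isPrimitiveRoot_gen.dvd_of_pow_eq_one _ h1
    rw [he] at h2
    exact Nat.dvd_antisymm h2 (hst.order_dvd i)
  · intro h i F hF ζ hζ hinv
    have he := F.localOrder.eq_ord hF
    rw [← he] at hζ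
    have : NeZero F.e := ⟨F.e_pos.ne'⟩
    obtain ⟨r, -, rfl⟩ := F.isPrimitiveRoot_gen.eq_pow_of_pow_eq_one hζ
    have h1 := (key i F hF r).1 hinv
    rw [← h i, ← he] at h1
    obtain ⟨q, rfl⟩ := h1
    rw [pow_mul, F.gen_pow, one_pow]

end IsStandardForm

end Standard

/-- At most one lattice vector can be the sector at a marked point. -/
theorem IsSector.unique {i : Fin k} {ν ν' : Fin n → ℤ} (F : P.LocalLift D w) (hF : F.p = D.pts i)
    (hne : ∀ l, ∃ y ∈ F.dom, F.f y l ≠ 0)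
    (h : P.IsSector D w i ν) (h' : P.IsSector D w i ν') : ν = ν' := by
  obtain ⟨hb, hf⟩ := h F hF
  obtain ⟨hb', hf'⟩ := h' F hF
  have hc : ∀ l, F.chart.coeff ν l = F.chart.coeff ν' l := by
    intro l
    obtain ⟨y, hy, hyl⟩ := hne l
    have e : exp (2 * Real.pi * I * ((F.chart.coeff ν l : ℚ) : ℂ)) * F.f y l =
        exp (2 * Real.pi * I * ((F.chart.coeff ν' l : ℚ) : ℂ)) * F.f y l :=
      congrFun ((hf y hy).symm.trans (hf' y hy)) l
    obtain ⟨q, hq⟩ := Complex.exp_eq_exp_iff_exists_int.1 (mul_right_cancel₀ hyl e)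
    have h2 : (F.chart.coeff ν l : ℂ) = F.chart.coeff ν' l + q := by
      refine mul_left_cancel₀ Complex.two_pi_I_ne_zero ?_
      rw [hq]; ring
    have h3 : F.chart.coeff ν l = F.chart.coeff ν' l + q := by exact_mod_cast h2
    have b1 := F.chart.mem_box_iff.1 hb l
    have b2 := F.chart.mem_box_iff.1 hb' l
    have q1 : (q : ℚ) < 1 := by linarith [b1.2, b2.1]
    have q2 : (-1 : ℚ) < q := by linarith [b1.1, b2.2]
    have : q = 0 := by
      have : q < 1 := by exact_mod_cast q1
      have : -1 < q := by exact_mod_cast q2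
      omega
    rw [h3, this]; simp
  ext a
  have := F.chart.sum_coeff ν a
  simp only [hc] at this
  exact_mod_cast this.symm.trans (F.chart.sum_coeff ν' a)

end LabeledPolytope

/-! ### Holomorphic maps are in standard form -/

/-- A nonvanishing holomorphic function of constant modulus on the unit circle is constant. -/
theorem eq_of_norm_eq_on_sphere {f : ℂ → ℂ} {C : ℝ}
    (hc : ContinuousOn f (Metric.closedBall 0 1)) (hd : DifferentiableOn ℂ f (Metric.ball 0 1))
    (hne : ∀ z ∈ Metric.closedBall (0 : ℂ) 1, f z ≠ 0)
    (hs : ∀ z ∈ Metric.sphere (0 : ℂ) 1, ‖f z‖ = C) {z : ℂ}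
    (hz : z ∈ Metric.closedBall (0 : ℂ) 1) : f z = f 1 := by
  have hcl : closure (Metric.ball (0 : ℂ) 1) = Metric.closedBall 0 1 := closure_ball _ one_ne_zero
  have hfr : frontier (Metric.ball (0 : ℂ) 1) = Metric.sphere 0 1 := frontier_ball _ one_ne_zero
  have h1 : DiffContOnCl ℂ f (Metric.ball 0 1) := ⟨hd, by rwa [hcl]⟩
  have h2 : DiffContOnCl ℂ (fun z => (f z)⁻¹) (Metric.ball 0 1) :=
    ⟨hd.inv fun z hz => hne z (Metric.ball_subset_closedBall hz), by
      rw [hcl]; exact hc.inv₀ hne⟩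
  have hC : 0 < C := by
    rw [← hs 1 (by simp)]; exact norm_pos_iff.2 (hne 1 (by simp))
  have b1 : ∀ z ∈ Metric.closedBall (0 : ℂ) 1, ‖f z‖ ≤ C := fun z hz =>
    Complex.norm_le_of_forall_mem_frontier_norm_le Metric.isBounded_ball h1
      (by rw [hfr]; exact fun z hz => (hs z hz).le) (by rwa [hcl])
  have b2 : ∀ z ∈ Metric.closedBall (0 : ℂ) 1, ‖(f z)⁻¹‖ ≤ C⁻¹ := fun z hz =>
    Complex.norm_le_of_forall_mem_frontier_norm_le Metric.isBounded_ball h2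
      (by rw [hfr]; exact fun z hz => by rw [norm_inv, hs z hz]) (by rwa [hcl])
  have b3 : ∀ z ∈ Metric.closedBall (0 : ℂ) 1, ‖f z‖ = C := fun z hz => by
    refine le_antisymm (b1 z hz) ?_
    have := b2 z hz
    rw [norm_inv] at this
    exact (inv_le_inv₀ (norm_pos_iff.2 (hne z hz)) hC).1 this
  have h0 : ∀ z ∈ closure (Metric.ball (0 : ℂ) 1), f z = f 0 := by
    have := Complex.eqOn_closure_of_isPreconnected_of_isMaxOn_norm (f := f) (c := 0)
      (convex_ball _ _).isPreconnected Metric.isOpen_ball h1 (Metric.mem_ball_self one_pos)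
      (fun z hz => by
        have hz := b3 z (Metric.ball_subset_closedBall hz)
        have h0 := b3 0 (by simp)
        simp [hz, h0])
    exact fun z hz => this hz
  rw [hcl] at h0
  rw [h0 z hz, h0 1 (by simp)]

theorem exists_tuple_with_multiplicities {m : ℕ} (S : Finset ℂ) (N : ℂ → Fin m → ℕ) :
    ∃ (d : Fin m → ℕ) (α : (j : Fin m) → Fin (d j) → ℂ), (∀ j s, α j s ∈ S) ∧
      ∀ p ∈ S, ∀ j, LabeledPolytope.zeroCount α p j = N p j := by
  classical
  let e : ∀ j : Fin m, (Σ p : S, Fin (N p j)) ≃ Fin (Fintype.card (Σ p : S, Fin (N p j))) :=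
    fun j => Fintype.equivFin _
  refine ⟨fun j => Fintype.card (Σ p : S, Fin (N p j)), fun j s => ((e j).symm s).1,
    fun j s => ((e j).symm s).1.2, fun p hp j => ?_⟩
  rw [LabeledPolytope.zeroCount]
  have : Finset.univ.filter (fun s => p = (((e j).symm s).1 : ℂ)) =
      Finset.univ.map ((⟨fun t : Fin (N p j) => (⟨⟨p, hp⟩, t⟩ : Σ p : S, Fin (N p j)),
        fun a b h => by simpa using h⟩ : Fin (N p j) ↪ _).trans (e j).toEmbedding) := by
    ext s
    obtain ⟨⟨⟨q, hq⟩, t⟩, rfl⟩ := (e j).surjective s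
    simp only [Finset.mem_filter, Finset.mem_univ, true_and, Equiv.symm_apply_apply,
      Finset.mem_map, Function.Embedding.trans_apply,
      Function.Embedding.coeFn_mk, EmbeddingLike.apply_eq_iff_eq]
    constructor
    · rintro rfl; exact ⟨t, rfl⟩
    · rintro ⟨t', h⟩
      exact congrArg (fun x : (Σ p : S, Fin (N p j)) => (x.1 : ℂ)) h
  rw [this]
  simp

namespace LabeledPolytope

variable {n m k : ℕ} {P : LabeledPolytope n m} {D : MarkedOrbiDisc k} {w : ℂ → P.X}

/-- The characters as functions on the toric orbifold (with junk values off the torus). -/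
noncomputable def chiX (x : P.X) (a : Fin n) : ℂ :=
  Quotient.lift (fun z : P.U => P.chi z.1 a) (fun _ _ h => (SameOrbit.chi_eq h a).symm) x

theorem Rep.chiX_eq {x : P.X} {z : Fin m → ℂ} (h : P.Rep x z) (a : Fin n) :
    chiX x a = P.chi z a := by
  obtain ⟨hz, rfl⟩ := h
  rfl

/-- The point `x` lies in the open torus orbit. -/
def InTorus (x : P.X) : Prop := ∀ z, P.Rep x z → ∀ j, z j ≠ 0

theorem Rep.inTorus_iff {x : P.X} {z : Fin m → ℂ} (h : P.Rep x z) :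
    InTorus x ↔ ∀ j, z j ≠ 0 :=
  ⟨fun hx => hx z h, fun hz _ h' j => (not_congr ((h.sameOrbit h').eq_zero_iff j)).2 (hz j)⟩

theorem Chart.homog_ne_zero_iff (s : P.Chart) (x : Fin n → ℂ) :
    (∀ j, s.homog x j ≠ 0) ↔ ∀ l, x l ≠ 0 := by
  constructor
  · intro h l; rw [← s.homog_ray x l]; exact h _
  · intro h j
    by_cases hj : j ∈ Set.range s.ray
    · obtain ⟨l, rfl⟩ := hj; rw [s.homog_ray]; exact h l
    · rw [s.homog_of_notMem _ hj]; exact one_ne_zero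

theorem Chart.norm_eq_of_sameOrbit_homog (s : P.Chart) {x x' : Fin n → ℂ}
    (h : P.SameOrbit (s.homog x) (s.homog x')) (l : Fin n) : ‖x' l‖ = ‖x l‖ := by
  classical
  rw [s.norm_eq_of_sameOrbit h l, s.homog_ray, Chart.offLog, Finset.sum_eq_zero, Real.exp_zero,
    mul_one]
  intro j _
  split_ifs with hj
  · rfl
  · rw [s.homog_of_notMem _ hj]; simp

namespace LocalLift

variable (F : P.LocalLift D w)

theorem inTorus_iff {y : ℂ} (hy : y ∈ F.dom) : InTorus (w (F.br y)) ↔ ∀ l, F.f y l ≠ 0 := by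
  rw [(F.rep hy).inTorus_iff, F.chart.homog_ne_zero_iff]

theorem tendsto_root_ne :
    Filter.Tendsto (fun z => (z - F.p) ^ ((F.e : ℂ)⁻¹)) (𝓝[≠] F.p) (𝓝[≠] 0) := by
  refine tendsto_nhdsWithin_iff.2 ⟨F.tendsto_root.mono_left nhdsWithin_le_nhds, ?_⟩
  filter_upwards [self_mem_nhdsWithin] with z hz h0
  have h1 := F.br_root z
  rw [Set.mem_singleton_iff] at h0
  rw [h0, F.br_zero] at h1
  exact hz h1.symm

theorem eventually_mem_inner (hp : F.p ∈ Metric.ball (0 : ℂ) 1) : ∀ᶠ y in 𝓝 (0 : ℂ), y ∈ F.inner :=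
  F.isOpen_inner.mem_nhds (F.mem_inner_zero hp)

/-- Near an interior point, a map with local lifts either stays away from the open torus orbit, or
lies in it except possibly at the point itself. -/
theorem eventually_inTorus_or (hp : F.p ∈ Metric.ball (0 : ℂ) 1) :
    (∀ᶠ z in 𝓝[≠] F.p, InTorus (w z)) ∨ ∀ᶠ z in 𝓝 F.p, ¬ InTorus (w z) := by
  by_cases h : ∃ l, ∀ᶠ y in 𝓝 (0 : ℂ), F.f y l = 0
  · right
    obtain ⟨l, hl⟩ := h
    filter_upwards [F.tendsto_root.eventually (hl.and (F.eventually_mem_inner hp))] with z hz hT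
    rw [← F.br_root z, F.inTorus_iff (F.inner_subset_dom hz.2)] at hT
    exact hT l hz.1
  · left
    rw [not_exists] at h
    have h1 : ∀ᶠ y in 𝓝[≠] (0 : ℂ), ∀ l, F.f y l ≠ 0 := Filter.eventually_all.2 fun l =>
      (F.analyticAt_apply (F.mem_inner_zero hp) l).eventually_eq_zero_or_eventually_ne_zero.resolve_left
        (h l)
    filter_upwards [F.tendsto_root_ne.eventually
      (h1.and ((F.eventually_mem_inner hp).filter_mono nhdsWithin_le_nhds))] with z hz
    rw [← F.br_root z, F.inTorus_iff (F.inner_subset_dom hz.2)]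
    exact hz.1

/-- The vanishing orders of a lift that lies generically in the torus: they are compatible with the
action of the local group. -/
theorem exists_orders (hp : F.p ∈ Metric.ball (0 : ℂ) 1)
    (hT : ∀ᶠ z in 𝓝[≠] F.p, InTorus (w z)) :
    ∃ (κ : Fin n → ℕ) (g : Fin n → ℂ → ℂ), (∀ l, AnalyticAt ℂ (g l) 0) ∧ (∀ l, g l 0 ≠ 0) ∧
      (∀ᶠ y in 𝓝 (0 : ℂ), ∀ l, F.f y l = y ^ κ l * g l y) ∧
      ∀ a, (F.e : ℤ) ∣ ∑ l, (κ l : ℤ) * P.b (F.chart.ray l) a := by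
  have hbr : Filter.Tendsto F.br (𝓝[≠] 0) (𝓝[≠] F.p) := by
    refine tendsto_nhdsWithin_iff.2 ⟨?_, ?_⟩
    · simpa using (F.continuous_br.tendsto 0).mono_left nhdsWithin_le_nhds
    · filter_upwards [self_mem_nhdsWithin] with y hy h
      have : y ^ F.e = 0 := by simpa [br] using h
      exact hy (eq_zero_of_pow_eq_zero this)
  have hne : ∀ᶠ y in 𝓝[≠] (0 : ℂ), ∀ l, F.f y l ≠ 0 := by
    filter_upwards [hbr.eventually hT, (F.eventually_mem_inner hp).filter_mono nhdsWithin_le_nhds]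
      with y h1 h2
    exact (F.inTorus_iff (F.inner_subset_dom h2)).1 h1
  have h1 : ∀ l, ∃ (κ : ℕ) (g : ℂ → ℂ), AnalyticAt ℂ g 0 ∧ g 0 ≠ 0 ∧
      ∀ᶠ y in 𝓝 (0 : ℂ), F.f y l = y ^ κ * g y := by
    intro l
    have := (F.analyticAt_apply (F.mem_inner_zero hp) l).exists_eventuallyEq_pow_smul_nonzero_iff.2
      (fun h => by
        obtain ⟨y, h1, h2⟩ := (hne.and (h.filter_mono nhdsWithin_le_nhds)).exists
        exact h1 l h2)
    simpa using this
  choose κ g hg hg0 hf using h1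
  refine ⟨κ, g, hg, hg0, Filter.eventually_all.2 hf, fun a => ?_⟩
  have hso : ∀ y ∈ F.dom, P.SameOrbit (F.chart.homog (F.f y)) (F.chart.homog (F.f (F.gen * y))) := by
    intro y hy
    have h2 := F.rep (F.mul_mem_dom F.gen_pow hy)
    rw [F.br_mul F.gen_pow] at h2
    exact (F.rep hy).sameOrbit h2
  obtain ⟨y, hy, hy'⟩ := (hne.and ((F.eventually_mem_inner hp).filter_mono nhdsWithin_le_nhds)).exists
  have hyd := F.inner_subset_dom hy'
  have h2 : ∀ l, F.f (F.gen * y) l = F.gen ^ κ l * F.f y l := fun l =>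
    F.f_gen_mul hp l (hg l) (hg0 l) (hf l) F.gen_pow
      ((F.eventually_mem_inner hp).mono fun y hy =>
        F.chart.norm_eq_of_sameOrbit_homog (hso y (F.inner_subset_dom hy)) l) hyd
  have h3 := (hso y hyd).chi_eq a
  rw [F.chart.chi_homog, F.chart.chi_homog] at h3
  simp only [h2, mul_zpow, Finset.prod_mul_distrib] at h3
  have h4 : ∏ l, F.f y l ^ P.b (F.chart.ray l) a ≠ 0 :=
    Finset.prod_ne_zero_iff.2 fun l _ => zpow_ne_zero _ (hy l)
  have h5 : ∏ l, (F.gen ^ κ l) ^ P.b (F.chart.ray l) a = 1 :=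
    mul_right_cancel₀ h4 (h3.trans (one_mul _).symm)
  have hgen : F.gen ≠ 0 := exp_ne_zero _
  have h6 : F.gen ^ (∑ l, (κ l : ℤ) * P.b (F.chart.ray l) a) = 1 := by
    rw [← h5]
    have : ∀ s : Finset (Fin n), F.gen ^ (∑ l ∈ s, (κ l : ℤ) * P.b (F.chart.ray l) a) =
        ∏ l ∈ s, (F.gen ^ κ l) ^ P.b (F.chart.ray l) a := by
      classical
      intro s
      induction s using Finset.induction_on with
      | empty => simp
      | insert l s hl ih =>
        rw [Finset.sum_insert hl, Finset.prod_insert hl, zpow_add₀ hgen, ih, zpow_mul,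
          zpow_natCast]
    exact this _
  exact (F.isPrimitiveRoot_gen.zpow_eq_one_iff_dvd _).1 h6

end LocalLift

/-- The entries of the standard form with trivial constants have modulus one on the circle. -/
theorem norm_blaschkeMap_one {c : Fin k → Fin m → ℚ} {d : Fin m → ℕ}
    {α : (j : Fin m) → Fin (d j) → ℂ} (hα : ∀ j s, α j s ∈ Metric.ball (0 : ℂ) 1) {z : ℂ}
    (hz : ‖z‖ = 1) (j : Fin m) : ‖blaschkeMap D.pts c d α 1 z j‖ = 1 := by
  simp only [blaschkeMap, Pi.one_apply, one_mul]
  rw [norm_mul, norm_prod, norm_prod,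
    Finset.prod_eq_one fun s _ => norm_blaschke_of_norm_eq_one (hα j s) hz,
    Finset.prod_eq_one fun i _ => ?_, one_mul]
  have := Complex.norm_cpow_real (blaschke (D.pts i) z) (c i j : ℝ)
  rw [norm_blaschke_of_norm_eq_one (D.pts_mem i) hz, Real.one_rpow] at this
  exact_mod_cast this

theorem blaschkeMap_eq_mul (pts : Fin k → ℂ) (c : Fin k → Fin m → ℚ) (d : Fin m → ℕ)
    (α : (j : Fin m) → Fin (d j) → ℂ) (a : Fin m → ℂ) (z : ℂ) (j : Fin m) :
    blaschkeMap pts c d α a z j = a j * blaschkeMap pts c d α 1 z j := by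
  simp [blaschkeMap, mul_assoc]

theorem IsHolomorphic.eventually_inTorus_of_sphere {u : Fin n → ℝ} (hu : u ∈ interior P.polytope)
    (hw : P.IsHolomorphic D (P.torusFiber u) w) {p : ℂ} (hp : p ∈ Metric.sphere (0 : ℂ) 1) :
    ∀ᶠ z in 𝓝[Metric.closedBall 0 1] p, InTorus (w z) := by
  obtain ⟨F, rfl⟩ := hw.2.1 p (Metric.sphere_subset_closedBall hp)
  obtain ⟨z, hz, hz'⟩ := hw.2.2 _ hp
  have hT : InTorus (w F.p) := hz.inTorus_iff.2 fun j h => by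
    have := hz' j
    rw [h] at this
    have h2 := ell_pos_of_mem_interior hu j
    norm_num at this
    linarith
  have he : F.e = 1 := F.localOrder.eq_one (D.ne_pts_of_norm_eq_one (by simpa using hp))
  rw [← F.br_zero, F.inTorus_iff F.zero_mem_dom] at hT
  have h1 : ∀ᶠ y in 𝓝[F.dom] 0, ∀ l, F.f y l ≠ 0 := Filter.eventually_all.2 fun l =>
    (F.continuousOn_apply l 0 F.zero_mem_dom).eventually_ne (hT l)
  have h3 : Filter.Tendsto (fun z => z - F.p) (𝓝[Metric.closedBall 0 1] F.p) (𝓝[F.dom] 0) := by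
    have hc : Continuous fun z : ℂ => z - F.p := by fun_prop
    have ht : Filter.Tendsto (fun z : ℂ => z - F.p) (𝓝 F.p) (𝓝 0) := by
      simpa using hc.tendsto F.p
    refine tendsto_nhdsWithin_iff.2 ⟨ht.mono_left nhdsWithin_le_nhds, ?_⟩
    filter_upwards [(ht.eventually (Metric.ball_mem_nhds 0 F.ε_pos)).filter_mono
      nhdsWithin_le_nhds, self_mem_nhdsWithin] with z h1 h2
    exact ⟨by simpa using h1, by simpa [LocalLift.br, he] using h2⟩
  filter_upwards [h3.eventually (h1.and self_mem_nhdsWithin)] with z hz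
  have := (F.inTorus_iff hz.2).2 hz.1
  simpa [LocalLift.br, he] using this

/-- A holomorphic map with boundary on a torus fibre meets the toric divisors in isolated points: the
points near which it does not, and those near which it stays inside them, form disjoint open sets
that cover the connected disc, and near the circle the map lies in the torus. -/
theorem IsHolomorphic.eventually_inTorus {u : Fin n → ℝ} (hu : u ∈ interior P.polytope)
    (hw : P.IsHolomorphic D (P.torusFiber u) w) {p : ℂ} (hp : p ∈ Metric.ball (0 : ℂ) 1) :
    ∀ᶠ z in 𝓝[≠] p, InTorus (w z) := by
  set A : Set ℂ := {p | ∀ᶠ z in 𝓝[≠] p, InTorus (w z)} with hA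
  set B : Set ℂ := {p | ∀ᶠ z in 𝓝 p, ¬ InTorus (w z)} with hB
  have hAo : IsOpen A := by
    refine isOpen_iff_mem_nhds.2 fun p hp => ?_
    have hp : ∀ᶠ z in 𝓝[≠] p, InTorus (w z) := hp
    have h1 := eventually_eventually_nhdsWithin.2 hp
    rw [eventually_nhdsWithin_iff] at h1
    filter_upwards [h1] with q hq
    by_cases h : q = p
    · rw [h]; exact hp
    · have h2 := hq h
      rw [IsOpen.nhdsWithin_eq isOpen_compl_singleton h] at h2
      exact h2.filter_mono nhdsWithin_le_nhds
  have hBo : IsOpen B := isOpen_iff_mem_nhds.2 fun p hp => eventually_eventually_nhds.2 hp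
  have hdis : Disjoint A B := Set.disjoint_left.2 fun p h1 h2 => by
    have h1 : ∀ᶠ z in 𝓝[≠] p, InTorus (w z) := h1
    have h2 : ∀ᶠ z in 𝓝 p, ¬ InTorus (w z) := h2
    obtain ⟨z, hz, hz'⟩ := (h1.and (h2.filter_mono nhdsWithin_le_nhds)).exists
    exact hz' hz
  have hcov : Metric.ball (0 : ℂ) 1 ⊆ A ∪ B := fun p hp => by
    obtain ⟨F, rfl⟩ := hw.2.1 p (Metric.ball_subset_closedBall hp)
    exact F.eventually_inTorus_or hp
  have hne : (Metric.ball (0 : ℂ) 1 ∩ A).Nonempty := by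
    have h1 := hw.eventually_inTorus_of_sphere hu (p := 1) (by simp)
    rw [eventually_nhdsWithin_iff] at h1
    have h2 := eventually_eventually_nhds.2 h1
    have h3 : ∃ᶠ z in 𝓝 (1 : ℂ), z ∈ Metric.ball (0 : ℂ) 1 := by
      rw [← mem_closure_iff_frequently, closure_ball _ one_ne_zero]
      simp
    obtain ⟨q, hq, hq'⟩ := (h3.and_eventually h2).exists
    refine ⟨q, hq, ?_⟩
    have : ∀ᶠ z in 𝓝 q, InTorus (w z) := by
      filter_upwards [hq', Metric.isOpen_ball.mem_nhds hq] with z h1 h2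
      exact h1 (Metric.ball_subset_closedBall h2)
    exact this.filter_mono nhdsWithin_le_nhds
  exact (convex_ball (0 : ℂ) 1).isPreconnected.subset_left_of_subset_union hAo hBo hdis hcov hne hp

theorem IsHolomorphic.finite_notInTorus {u : Fin n → ℝ} (hu : u ∈ interior P.polytope)
    (hw : P.IsHolomorphic D (P.torusFiber u) w) :
    {z | z ∈ Metric.closedBall (0 : ℂ) 1 ∧ ¬ InTorus (w z)}.Finite := by
  by_contra hinf
  obtain ⟨p, hp, hacc⟩ := Set.Infinite.exists_accPt_of_subset_isCompact hinf
    (isCompact_closedBall (0 : ℂ) 1) (fun z hz => hz.1)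
  rw [accPt_iff_frequently_nhdsNE] at hacc
  rcases (mem_closedBall_zero_iff.1 hp).lt_or_eq with h | h
  · obtain ⟨z, h1, h2⟩ := (hacc.and_eventually (hw.eventually_inTorus hu (by simpa using h))).exists
    exact h1.2 h2
  · have := hw.eventually_inTorus_of_sphere hu (p := p) (by simpa using h)
    rw [eventually_nhdsWithin_iff] at this
    obtain ⟨z, h1, h2⟩ := (hacc.and_eventually (this.filter_mono nhdsWithin_le_nhds)).exists
    exact h1.2 (h2 h1.1)

/-- A holomorphic map from a marked orbifold disc is in standard form: the quotient of the
characters of the map by those of the Blaschke product with the same vanishing orders is a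
nonvanishing holomorphic function of constant modulus on the circle. -/
theorem IsHolomorphic.exists_isStandardForm {u : Fin n → ℝ} (hu : u ∈ interior P.polytope)
    {z₀ : Fin m → ℂ} (hz₀ : ∀ j, z₀ j ≠ 0)
    (hL : {x : P.X | ∃ z ∈ realTorusOrbit z₀, P.Rep x z} = P.torusFiber u)
    (hw : P.IsHolomorphic D (P.torusFiber u) w) :
    ∃ (ν : Fin k → Fin n → ℤ) (c : Fin k → Fin m → ℚ) (d : Fin m → ℕ)
      (α : (j : Fin m) → Fin (d j) → ℂ) (a : Fin m → ℂ), P.IsStandardForm z₀ D w ν c d α a := by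
  classical
  have hbc : ∀ {p : ℂ}, p ∈ Metric.ball (0 : ℂ) 1 → p ∈ Metric.closedBall (0 : ℂ) 1 :=
    fun h => Metric.ball_subset_closedBall h
  have hex : ∀ p : Metric.ball (0 : ℂ) 1, ∃ F : P.LocalLift D w, F.p = p :=
    fun p => hw.2.1 p (hbc p.2)
  choose F hFp using hex
  have hmem : ∀ p, (F p).p ∈ Metric.ball (0 : ℂ) 1 := fun p => by rw [hFp]; exact p.2
  have hord := fun p => (F p).exists_orders (hmem p) (by
    rw [hFp]; exact hw.eventually_inTorus hu p.2)
  choose κ g hg hg0 hf hdvd using hord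
  -- the points mapped outside the torus, and the marked points
  set S : Finset ℂ := (hw.finite_notInTorus hu).toFinset ∪ Finset.univ.image D.pts with hS
  have hST : ∀ z ∈ Metric.closedBall (0 : ℂ) 1, z ∉ S → InTorus (w z) := by
    intro z hz hzS
    by_contra h
    exact hzS (Finset.mem_union_left _ (by simpa using ⟨by simpa using hz, h⟩))
  have hSpts : ∀ z, z ∉ S → ∀ i, z ≠ D.pts i := fun z hz i h =>
    hz (Finset.mem_union_right _ (by simp [h]))
  have hSb : ∀ z ∈ S, z ∈ Metric.ball (0 : ℂ) 1 := by
    intro z hz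
    rcases Finset.mem_union.1 hz with hz | hz
    · have hz : z ∈ Metric.closedBall (0 : ℂ) 1 ∧ ¬ InTorus (w z) := by simpa using hz
      by_contra hn
      have : z ∈ Metric.sphere (0 : ℂ) 1 := by
        have h1 := mem_closedBall_zero_iff.1 hz.1
        have h2 : ¬ ‖z‖ < 1 := by simpa using hn
        rw [mem_sphere_zero_iff_norm]; linarith
      exact hz.2 ((hw.eventually_inTorus_of_sphere hu this).self_of_nhdsWithin hz.1)
    · obtain ⟨i, -, rfl⟩ := Finset.mem_image.1 hz
      exact D.pts_mem i
  -- the vanishing orders in all homogeneous coordinates, in the uniformizing variable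
  let K : Metric.ball (0 : ℂ) 1 → Fin m → ℕ := fun p => Function.extend (F p).chart.ray (κ p) 0
  have hK1 : ∀ p l, K p ((F p).chart.ray l) = κ p l := fun p l =>
    (F p).chart.ray.injective.extend_apply _ _ _
  have hK2 : ∀ p j, j ∉ Set.range (F p).chart.ray → K p j = 0 := fun p j hj =>
    Function.extend_apply' _ _ _ hj
  have he0 : ∀ p, ((F p).e : ℚ) ≠ 0 := fun p => by exact_mod_cast (F p).e_pos.ne'
  have hmod : ∀ p j, (K p j : ℚ) = (F p).e * ((K p j % (F p).e : ℕ) / (F p).e +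
      (K p j / (F p).e : ℕ)) := fun p j => by
    have : ((K p j % (F p).e + (F p).e * (K p j / (F p).e) : ℕ) : ℚ) = K p j := by
      rw [Nat.mod_add_div]
    push_cast at this
    rw [mul_add, mul_div_cancel₀ _ (he0 p), this]
  -- the integral parts of the orders give the zeros `α`, the fractional parts the sectors
  let N : ℂ → Fin m → ℕ := fun z j => if h : z ∈ Metric.ball (0 : ℂ) 1 then
    K ⟨z, h⟩ j / (F ⟨z, h⟩).e else 0
  obtain ⟨d, α, hαS, hαN⟩ := exists_tuple_with_multiplicities S N
  have hα : ∀ j s, α j s ∈ Metric.ball (0 : ℂ) 1 := fun j s => hSb _ (hαS j s)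
  let pt : Fin k → Metric.ball (0 : ℂ) 1 := fun i => ⟨D.pts i, D.pts_mem i⟩
  let c : Fin k → Fin m → ℚ := fun i j => (K (pt i) j % (F (pt i)).e : ℕ) / (F (pt i)).e
  choose ν' hν' using hdvd
  let ν : Fin k → Fin n → ℤ := fun i a => ν' (pt i) a -
    ∑ l, ((κ (pt i) l / (F (pt i)).e : ℕ) : ℤ) * P.b ((F (pt i)).chart.ray l) a
  have hc1 : ∀ i l, c i ((F (pt i)).chart.ray l) =
      (κ (pt i) l : ℚ) / (F (pt i)).e - (κ (pt i) l / (F (pt i)).e : ℕ) := fun i l => by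
    have := hmod (pt i) ((F (pt i)).chart.ray l)
    simp only [c, hK1] at this ⊢
    rw [this]
    field_simp [he0 (pt i)]
    ring
  have hc2 : ∀ i j, j ∉ Set.range (F (pt i)).chart.ray → c i j = 0 := fun i j hj => by
    simp only [c, hK2 _ _ hj]; simp
  have hbox : ∀ i, P.IsBoxCoeff (ν i) (c i) := by
    intro i
    have hep : (0 : ℚ) < (F (pt i)).e := by exact_mod_cast (F (pt i)).e_pos
    refine ⟨fun j => ⟨by positivity, ?_⟩, fun a => ?_, (F (pt i)).chart, hc2 i⟩
    · rw [div_lt_one hep]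
      exact_mod_cast Nat.mod_lt _ (F (pt i)).e_pos
    · rw [(F (pt i)).chart.sum_eq_sum_ray (fun j => c i j * (P.b j a : ℚ))
        (fun j hj => by rw [hc2 i j hj, zero_mul])]
      simp only [hc1, sub_mul, Finset.sum_sub_distrib, ν]
      push_cast
      congr 1
      have := congrArg (Int.cast (R := ℚ)) (hν' (pt i) a)
      push_cast at this
      rw [← mul_right_inj' (he0 (pt i)), ← this, Finset.mul_sum]
      exact Finset.sum_congr rfl fun l _ => by field_simp [he0 (pt i)]
  have hsec : ∀ i, sectorOrder (c i) ∣ D.ord i := by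
    intro i
    rw [IsStandardForm.sectorOrder_dvd_iff]
    intro j
    refine ⟨((K (pt i) j % (F (pt i)).e : ℕ) : ℤ), ?_⟩
    rw [← (F (pt i)).localOrder.eq_ord (hFp (pt i))]
    simp only [c]
    rw [mul_div_cancel₀ _ (he0 _)]
    exact (Int.cast_natCast _).symm
  -- `K` is the vanishing order of the Blaschke product
  have hKord : ∀ p : Metric.ball (0 : ℂ) 1, ∀ j, (K p j : ℚ) =
      (F p).e * (ramExp D c (F p).p j + zeroCount α (F p).p j) := by
    intro p j
    rw [hFp]
    by_cases hpS : (p : ℂ) ∈ S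
    · have hN : zeroCount α p j = K p j / (F p).e := by
        rw [hαN _ hpS]; simp only [N]; rw [dif_pos p.2]
      rw [hN]
      by_cases hi : ∃ i, (p : ℂ) = D.pts i
      · obtain ⟨i, hi⟩ := hi
        have hpi : p = pt i := Subtype.ext hi
        rw [hi, ramExp_pts]
        subst hpi
        exact hmod _ j
      · push Not at hi
        have he : (F p).e = 1 := (F p).localOrder.eq_one (by rw [hFp]; exact hi)
        rw [ramExp_of_ne _ hi, he]; simp
    · rw [ramExp_of_ne _ (hSpts _ hpS)]
      have h1 : zeroCount α p j = 0 := by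
        rw [zeroCount, Finset.card_eq_zero, Finset.filter_eq_empty_iff]
        intro s _ h
        exact hpS (h ▸ hαS j s)
      have h2 : K p j = 0 := by
        by_cases hj : j ∈ Set.range (F p).chart.ray
        · obtain ⟨l, rfl⟩ := hj
          rw [hK1]
          by_contra hne
          have h3 := hST p (hbc p.2) hpS
          rw [← hFp p, ← (F p).br_zero, (F p).inTorus_iff (F p).zero_mem_dom] at h3
          have h4 := (hf p).self_of_nhds l
          rw [zero_pow hne, zero_mul] at h4
          exact h3 l h4
        · exact hK2 p j hj
      rw [h1, h2]; simp
  set W := blaschkeMap D.pts c d α 1 with hW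
  have hbr := fun p => exists_blaschkeMap_branch (P := P) (a := 1) hbox hsec hα
    (fun j => one_ne_zero) (F p).localOrder
  choose κ' V hV hκ' hWe using hbr
  have hKκ : ∀ p j, κ' p j = K p j := fun p j => by
    have := (hκ' p j).trans (hKord p j).symm
    exact_mod_cast this
  simp only [hKκ] at hWe
  -- the quotient `q` of the characters is `Q` in the uniformizing variable, where the powers of `y`
  -- have been cancelled
  let Q : Metric.ball (0 : ℂ) 1 → Fin n → ℂ → ℂ := fun p a y =>
    (∏ l, g p l y ^ P.b ((F p).chart.ray l) a) / exp (∑ j, V p j y * (P.b j a : ℂ))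
  have hQc : ∀ p a, AnalyticAt ℂ (Q p a) 0 := by
    intro p a
    refine AnalyticAt.div ?_ ?_ (exp_ne_zero _)
    · exact Finset.analyticAt_fun_prod _ fun l _ => (hg p l).fun_zpow (hg0 p l)
    · exact AnalyticAt.cexp (Finset.analyticAt_fun_sum _ fun j _ => (hV p j).mul analyticAt_const)
  have hQ0 : ∀ p a, Q p a 0 ≠ 0 := fun p a => div_ne_zero
    (Finset.prod_ne_zero_iff.2 fun l _ => zpow_ne_zero _ (hg0 p l)) (exp_ne_zero _)
  let q : Fin n → ℂ → ℂ := fun a z => chiX (w z) a / P.chi (W z) a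
  have hqQ : ∀ p a, ∀ᶠ y in 𝓝 (0 : ℂ), (y ≠ 0 ∨ ∀ j, K p j = 0) → q a ((F p).br y) = Q p a y := by
    intro p a
    filter_upwards [hf p, hWe p, (F p).eventually_mem_inner (hmem p)] with y h1 ⟨ζ, hζ, hζ1, h2⟩ h3 h4
    have e1 : chiX (w ((F p).br y)) a = ∏ l, (y ^ κ p l * g p l y) ^ P.b ((F p).chart.ray l) a := by
      rw [((F p).rep ((F p).inner_subset_dom h3)).chiX_eq, (F p).chart.chi_homog]
      exact Finset.prod_congr rfl fun l _ => by rw [h1 l]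
    have e2 : P.chi (W ((F p).br y)) a =
        (∏ l, (y ^ κ p l) ^ P.b ((F p).chart.ray l) a) * exp (∑ j, V p j y * (P.b j a : ℂ)) := by
      have : W ((F p).br y) = fun j => ζ j * (y ^ K p j * exp (V p j y)) := funext h2
      rw [this, chi_mul, hζ1, one_mul, chi_mul, chi_exp]
      congr 1
      rw [chi, (F p).chart.prod_eq_prod_ray _ fun j hj => by rw [hK2 p j hj, pow_zero, one_zpow]]
      exact Finset.prod_congr rfl fun l _ => by rw [hK1]
    simp only [q, e1, e2, mul_zpow, Finset.prod_mul_distrib, Q]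
    rw [mul_div_mul_left]
    refine Finset.prod_ne_zero_iff.2 fun l _ => zpow_ne_zero _ ?_
    rcases h4 with h4 | h4
    · exact pow_ne_zero _ h4
    · rw [← hK1, h4, pow_zero]; exact one_ne_zero
  have hlim : ∀ p : Metric.ball (0 : ℂ) 1, ∀ a, Filter.Tendsto (q a) (𝓝[≠] (p : ℂ)) (𝓝 (Q p a 0)) := by
    intro p a
    have h1 := (F p).tendsto_root_ne
    have h2 : Filter.Tendsto (Q p a) (𝓝[≠] 0) (𝓝 (Q p a 0)) :=
      (hQc p a).continuousAt.tendsto.mono_left nhdsWithin_le_nhds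
    rw [← hFp p]
    refine (h2.comp h1).congr' ?_
    have h3 : ∀ᶠ y in 𝓝[≠] (0 : ℂ), q a ((F p).br y) = Q p a y := by
      filter_upwards [(hqQ p a).filter_mono nhdsWithin_le_nhds, self_mem_nhdsWithin] with y h h'
      exact h (Or.inl h')
    filter_upwards [h1.eventually h3] with z hz
    rw [Function.comp_apply, ← hz, (F p).br_root]
  have hKS : ∀ p : Metric.ball (0 : ℂ) 1, (p : ℂ) ∉ S → ∀ j, K p j = 0 := by
    intro p hp j
    have := hKord p j
    rw [hFp, ramExp_of_ne _ (hSpts _ hp)] at this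
    have h1 : zeroCount α p j = 0 := by
      rw [zeroCount, Finset.card_eq_zero, Finset.filter_eq_empty_iff]
      intro s _ h
      exact hp (h ▸ hαS j s)
    rw [h1] at this
    exact_mod_cast (by simpa using this : (K p j : ℚ) = 0)
  have hana : ∀ p : Metric.ball (0 : ℂ) 1, (p : ℂ) ∉ S → ∀ a, AnalyticAt ℂ (q a) p ∧
      q a p = Q p a 0 := by
    intro p hp a
    have he : (F p).e = 1 := (F p).localOrder.eq_one (by rw [hFp]; exact hSpts _ hp)
    have hq := (hqQ p a).mono fun y h => h (Or.inr (hKS p hp))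
    have hsub : AnalyticAt ℂ (fun z : ℂ => z - p) p := analyticAt_id.sub analyticAt_const
    refine ⟨?_, ?_⟩
    · have h1 : AnalyticAt ℂ (fun z => Q p a (z - p)) p :=
        AnalyticAt.fun_comp (by simpa using hQc p a) hsub
      refine h1.congr ?_
      have ht : Filter.Tendsto (fun z : ℂ => z - p) (𝓝 (p : ℂ)) (𝓝 0) := by
        simpa using hsub.continuousAt.tendsto
      filter_upwards [ht.eventually hq] with z hz
      rw [← hz]
      simp [LocalLift.br, he, hFp]
    · have := hq.self_of_nhds
      rwa [(F p).br_zero, hFp] at this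
  -- the boundary values
  have hbd : ∀ p ∈ Metric.sphere (0 : ℂ) 1, ∀ a, ContinuousWithinAt (q a) (Metric.closedBall 0 1) p ∧
      q a p ≠ 0 := by
    intro p hp a
    have hpc := Metric.sphere_subset_closedBall hp
    have hp1 : ‖p‖ = 1 := by simpa using hp
    obtain ⟨G, rfl⟩ := hw.2.1 p hpc
    have hGe : G.e = 1 := G.localOrder.eq_one (D.ne_pts_of_norm_eq_one hp1)
    have hpS : G.p ∉ S := fun h => by
      have := hSb _ h; simp [hp1] at this
    have hT := hST _ hpc hpS
    have hT' := hT
    rw [← G.br_zero, G.inTorus_iff G.zero_mem_dom] at hT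
    have h1 : ContinuousWithinAt (fun y => ∏ l, G.f y l ^ P.b (G.chart.ray l) a) G.dom 0 :=
      tendsto_finsetProd _ fun l _ =>
        (G.continuousOn_apply l 0 G.zero_mem_dom).zpow₀ _ (Or.inl (hT l))
    have ht : Filter.Tendsto (fun z : ℂ => z - G.p) (𝓝 G.p) (𝓝 0) := by
      have hc : Continuous fun z : ℂ => z - G.p := by fun_prop
      simpa using hc.tendsto G.p
    have h3 : Filter.Tendsto (fun z => z - G.p) (𝓝[Metric.closedBall 0 1] G.p) (𝓝[G.dom] 0) := by
      refine tendsto_nhdsWithin_iff.2 ⟨ht.mono_left nhdsWithin_le_nhds, ?_⟩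
      filter_upwards [(ht.eventually (Metric.ball_mem_nhds 0 G.ε_pos)).filter_mono
        nhdsWithin_le_nhds, self_mem_nhdsWithin] with z h1 h2
      exact ⟨by simpa using h1, by simpa [LocalLift.br, hGe] using h2⟩
    have e1 : ∀ᶠ z in 𝓝[Metric.closedBall 0 1] G.p,
        ∏ l, G.f (z - G.p) l ^ P.b (G.chart.ray l) a = chiX (w z) a := by
      filter_upwards [h3.eventually self_mem_nhdsWithin] with z hz
      have := (G.rep hz).chiX_eq a
      rw [G.chart.chi_homog] at this
      rw [← this]
      simp [LocalLift.br, hGe]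
    have c1 : ContinuousWithinAt (fun z => chiX (w z) a) (Metric.closedBall 0 1) G.p := by
      have := (h1.tendsto.comp h3).congr' e1
      rw [ContinuousWithinAt]
      convert this using 2
      have h := (G.rep G.zero_mem_dom).chiX_eq a
      rwa [G.br_zero, G.chart.chi_homog] at h
    obtain ⟨κ₁, V₁, hV₁, hκ₁, hW₁⟩ := exists_blaschkeMap_branch (P := P) (a := 1) hbox hsec hα
      (fun j => one_ne_zero) G.localOrder
    have hκ₁0 : ∀ j, κ₁ j = 0 := fun j => by
      have h := hκ₁ j
      rw [ramExp_of_ne _ (hSpts _ hpS)] at h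
      have h1 : zeroCount α G.p j = 0 := by
        rw [zeroCount, Finset.card_eq_zero, Finset.filter_eq_empty_iff]
        intro s _ h
        exact hpS (h ▸ hαS j s)
      rw [h1] at h
      exact_mod_cast (by simpa using h : (κ₁ j : ℚ) = 0)
    have e2 : ∀ᶠ z in 𝓝 G.p, exp (∑ j, V₁ j (z - G.p) * (P.b j a : ℂ)) = P.chi (W z) a := by
      filter_upwards [ht.eventually hW₁] with z ⟨ζ, hζ, hζ1, h2⟩
      have hz : G.p + (z - G.p) ^ G.e = z := by simp [hGe]
      simp only [hz] at h2
      have : W z = fun j => ζ j * exp (V₁ j (z - G.p)) := funext fun j => by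
        rw [show W z j = _ from h2 j, hκ₁0, pow_zero, one_mul]
      rw [this, chi_mul, hζ1, one_mul, chi_exp]
    have c2 : ContinuousAt (fun z => P.chi (W z) a) G.p := by
      have : ContinuousAt (fun z => exp (∑ j, V₁ j (z - G.p) * (P.b j a : ℂ))) G.p := by
        refine ContinuousAt.cexp (tendsto_finsetSum _ fun j _ => ?_)
        refine Filter.Tendsto.mul_const _ ?_
        have := (hV₁ j).continuousAt.tendsto.comp ht
        simpa [Function.comp_def] using this
      exact this.congr e2
    have c3 : P.chi (W G.p) a ≠ 0 := by
      rw [← e2.self_of_nhds]; exact exp_ne_zero _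
    obtain ⟨z, hz⟩ := exists_rep (w G.p)
    refine ⟨c1.div c2.continuousWithinAt c3, div_ne_zero ?_ c3⟩
    rw [hz.chiX_eq]
    exact chi_ne_zero (hT' z hz) a
  -- the extension of `q` across the exceptional points
  let qh : Fin n → ℂ → ℂ := fun a z => if h : z ∈ Metric.ball (0 : ℂ) 1 then Q ⟨z, h⟩ a 0 else q a z
  have hqh : ∀ a z, z ∉ S → qh a z = q a z := by
    intro a z hz
    by_cases h : z ∈ Metric.ball (0 : ℂ) 1
    · simp only [qh, dif_pos h]; exact ((hana ⟨z, h⟩ hz a).2).symm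
    · simp only [qh, dif_neg h]
  have hSn : ∀ z : ℂ, ∀ᶠ z' in 𝓝[≠] z, z' ∉ S := fun z => by
    have h1 : (((S.erase z : Finset ℂ) : Set ℂ))ᶜ ∈ 𝓝 z :=
      (S.erase z).finite_toSet.isClosed.isOpen_compl.mem_nhds (by simp)
    filter_upwards [nhdsWithin_le_nhds h1, self_mem_nhdsWithin] with z' h h' h''
    exact h (Finset.mem_coe.2 (Finset.mem_erase.2 ⟨h', h''⟩))
  have hqhc : ∀ a, ∀ p ∈ Metric.ball (0 : ℂ) 1, ContinuousAt (qh a) p := by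
    intro a p hp
    rw [continuousAt_iff_punctured_nhds]
    have : qh a p = Q ⟨p, hp⟩ a 0 := dif_pos hp
    rw [this]
    refine (hlim ⟨p, hp⟩ a).congr' ?_
    filter_upwards [hSn p] with z hz using (hqh a z hz).symm
  have hSo : IsOpen ((S : Set ℂ)ᶜ) := S.finite_toSet.isClosed.isOpen_compl
  have hqhd1 : ∀ a, ∀ p ∈ Metric.ball (0 : ℂ) 1, p ∉ S → DifferentiableAt ℂ (qh a) p := by
    intro a p hp hpS
    refine ((hana ⟨p, hp⟩ hpS a).1.differentiableAt).congr_of_eventuallyEq ?_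
    filter_upwards [hSo.mem_nhds hpS] with z hz using hqh a z hz
  have hqhd : ∀ a, DifferentiableOn ℂ (qh a) (Metric.ball 0 1) := by
    intro a p hp
    have h1 : ∀ᶠ z in 𝓝[≠] p, DifferentiableAt ℂ (qh a) z := by
      filter_upwards [hSn p, nhdsWithin_le_nhds (Metric.isOpen_ball.mem_nhds hp)] with z h1 h2
      exact hqhd1 a z h2 h1
    exact (Complex.analyticAt_of_differentiable_on_punctured_nhds_of_continuousAt h1
      (hqhc a p hp)).differentiableAt.differentiableWithinAt
  have hsph : ∀ p ∈ Metric.closedBall (0 : ℂ) 1, p ∉ Metric.ball (0 : ℂ) 1 →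
      p ∈ Metric.sphere (0 : ℂ) 1 := by
    intro p h1 h2
    have h1 := mem_closedBall_zero_iff.1 h1
    have h2 : ¬ ‖p‖ < 1 := by simpa using h2
    rw [mem_sphere_zero_iff_norm]; linarith
  have hqhcc : ∀ a, ContinuousOn (qh a) (Metric.closedBall 0 1) := by
    intro a p hp
    by_cases hpb : p ∈ Metric.ball (0 : ℂ) 1
    · exact (hqhc a p hpb).continuousWithinAt
    · have hpS : p ∉ S := fun h => hpb (hSb p h)
      refine ((hbd p (hsph p hp hpb) a).1).congr_of_eventuallyEq ?_ (hqh a p hpS)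
      filter_upwards [nhdsWithin_le_nhds (hSo.mem_nhds hpS)] with z hz using hqh a z hz
  have hqh0 : ∀ a, ∀ z ∈ Metric.closedBall (0 : ℂ) 1, qh a z ≠ 0 := by
    intro a z hz
    by_cases h : z ∈ Metric.ball (0 : ℂ) 1
    · simp only [qh, dif_pos h]; exact hQ0 _ _
    · simp only [qh, dif_neg h]; exact (hbd z (hsph z hz h) a).2
  -- on the circle the torus fibre prescribes the moduli of the homogeneous coordinates, and those of
  -- `W` are `1`
  have hnorm : ∀ a, ∀ z ∈ Metric.sphere (0 : ℂ) 1, ‖qh a z‖ =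
      ∏ j, (Real.sqrt (2 * P.ell j u)) ^ P.b j a := by
    intro a z hz
    have hz1 : ‖z‖ = 1 := by simpa using hz
    have hzS : z ∉ S := fun h => by have := hSb _ h; simp [hz1] at this
    obtain ⟨x, hx, hx'⟩ := hw.2.2 z hz
    rw [hqh a z hzS]
    simp only [q]
    rw [hx.chiX_eq, norm_div]
    simp only [chi, norm_prod, norm_zpow]
    rw [Finset.prod_eq_one (f := fun j => ‖W z j‖ ^ P.b j a) fun j _ => by
      rw [hW, norm_blaschkeMap_one hα hz1, one_zpow], div_one]
    refine Finset.prod_congr rfl fun j _ => ?_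
    rw [← hx' j, mul_div_cancel₀ _ (two_ne_zero), Real.sqrt_sq (norm_nonneg _)]
  have hconst : ∀ a, ∀ z ∈ Metric.closedBall (0 : ℂ) 1, qh a z = qh a 1 := fun a z hz =>
    eq_of_norm_eq_on_sphere (hqhcc a) (hqhd a) (hqh0 a) (hnorm a) hz
  -- the constants
  have h1S : (1 : ℂ) ∉ S := fun h => by have := hSb _ h; simp at this
  have hw1 : w 1 ∈ P.torusFiber u := hw.2.2 1 (by simp)
  rw [← hL] at hw1
  obtain ⟨z₁, ⟨t, ht⟩, hz₁⟩ := hw1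
  have hW1 : ∀ j, ‖W 1 j‖ = 1 := fun j => norm_blaschkeMap_one hα (by simp) j
  have hW10 : ∀ j, W 1 j ≠ 0 := fun j => norm_ne_zero_iff.1 (by rw [hW1]; exact one_ne_zero)
  have hz₁0 : ∀ j, z₁ j ≠ 0 := fun j => by
    rw [ht]; exact mul_ne_zero (Circle.coe_ne_zero _) (hz₀ j)
  -- `W 1` has entries of modulus `1`, so that `A` lies in the same real torus orbit as `z₁`
  let A : Fin m → ℂ := fun j => z₁ j / W 1 j
  have hA0 : ∀ j, A j ≠ 0 := fun j => div_ne_zero (hz₁0 j) (hW10 j)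
  have hchiA : ∀ a, P.chi A a = qh a 1 := fun a => by
    rw [hqh a 1 h1S]
    simp only [q, A]
    rw [chi_div, hz₁.chiX_eq]
  have hC : ∀ j, ∃ r : Circle, (r : ℂ) = W 1 j := fun j =>
    ⟨⟨_, mem_sphere_zero_iff_norm.2 (hW1 j)⟩, rfl⟩
  choose r hr using hC
  refine ⟨ν, c, d, α, A, hbox, hsec, hα, ⟨fun j => t j / r j, fun j => ?_⟩, fun z hz => ?_⟩
  · simp only [A]
    rw [ht, ← hr, Circle.coe_div]
    ring
  · by_cases hzb : z ∈ Metric.ball (0 : ℂ) 1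
    · -- compare the leading coefficients of the two maps in the uniformizing coordinate
      set p : Metric.ball (0 : ℂ) 1 := ⟨z, hzb⟩
      have hzp : (F p).br 0 = z := by rw [(F p).br_zero, hFp]
      obtain ⟨ζ, hζ, hζ1, h2⟩ := (hWe p).self_of_nhds
      have h1 := (hf p).self_of_nhds
      have h2' : ∀ j, W z j = ζ j * (0 ^ K p j * exp (V p j 0)) := fun j => by
        rw [← h2 j]; exact congrArg (fun x => W x j) hzp.symm
      have hζ0 : ∀ j, ζ j ≠ 0 := fun j h => by simpa [h] using hζ j
      have hrep := (F p).rep (F p).zero_mem_dom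
      rw [hzp] at hrep
      refine hrep.of_sameOrbit (SameOrbit.symm ?_)
      let G : Fin m → ℂ := Function.extend (F p).chart.ray (fun l => g p l 0) 1
      have hG1 : ∀ l, G ((F p).chart.ray l) = g p l 0 := fun l =>
        (F p).chart.ray.injective.extend_apply _ _ _
      have hG2 : ∀ j, j ∉ Set.range (F p).chart.ray → G j = 1 := fun j hj =>
        Function.extend_apply' _ _ _ hj
      have hG0 : ∀ j, G j ≠ 0 := fun j => by
        by_cases hj : j ∈ Set.range (F p).chart.ray
        · obtain ⟨l, rfl⟩ := hj; rw [hG1]; exact hg0 p l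
        · rw [hG2 j hj]; exact one_ne_zero
      refine sameOrbit_of_chi (t := fun j => G j / ((A j * ζ j) * exp (V p j 0)))
        (fun j => div_ne_zero (hG0 j) (mul_ne_zero (mul_ne_zero (hA0 j) (hζ0 j)) (exp_ne_zero _)))
        (fun j => ?_) fun a => ?_
      · rw [blaschkeMap_eq_mul, ← hW, h2']
        have hexp := exp_ne_zero (V p j 0)
        have := hA0 j
        have := hζ0 j
        by_cases hj : j ∈ Set.range (F p).chart.ray
        · obtain ⟨l, rfl⟩ := hj
          rw [Chart.homog_ray, h1 l, hG1, hK1]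
          field_simp
        · rw [Chart.homog_of_notMem _ _ hj, hG2 j hj, hK2 p j hj]
          field_simp
      · rw [chi_div, chi_mul (fun j => A j * ζ j), chi_mul, hζ1, mul_one, hchiA, chi_exp]
        have e1 : P.chi G a = ∏ l, g p l 0 ^ P.b ((F p).chart.ray l) a := by
          rw [chi, (F p).chart.prod_eq_prod_ray _ fun j hj => by rw [hG2 j hj, one_zpow]]
          exact Finset.prod_congr rfl fun l _ => by rw [hG1]
        have e2 : qh a z = Q p a 0 := dif_pos hzb
        rw [← hconst a z hz, e2, e1]
        simp only [Q]
        rw [div_mul_cancel₀ _ (exp_ne_zero _), div_self]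
        exact Finset.prod_ne_zero_iff.2 fun l _ => zpow_ne_zero _ (hg0 p l)
    · have hzs := hsph z hz hzb
      have hz1 : ‖z‖ = 1 := by simpa using hzs
      have hzS : z ∉ S := fun h => hzb (hSb z h)
      obtain ⟨x, hx⟩ := exists_rep (w z)
      have hx0 := hST z hz hzS x hx
      have hWz : ∀ j, W z j ≠ 0 := fun j => norm_ne_zero_iff.1 (by
        rw [hW, norm_blaschkeMap_one hα hz1]; exact one_ne_zero)
      have hWA : ∀ j, blaschkeMap D.pts c d α A z j = A j * W z j := fun j =>
        blaschkeMap_eq_mul _ _ _ _ _ _ _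
      refine hx.of_sameOrbit (sameOrbit_of_chi_eq hx0
        (fun j => by rw [hWA]; exact mul_ne_zero (hA0 j) (hWz j)) fun a => ?_)
      rw [show blaschkeMap D.pts c d α A z = fun j => A j * W z j from funext hWA, chi_mul, hchiA,
        ← hconst a z hz, hqh a z hzS]
      simp only [q]
      rw [hx.chiX_eq, div_mul_cancel₀ _ (chi_ne_zero hWz a)]

end LabeledPolytope

/-! ### Logarithmic derivatives of the lifts -/

namespace LabeledPolytope

variable {n m k : ℕ} {P : LabeledPolytope n m} {D : MarkedOrbiDisc k} {w : ℂ → P.X}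
  {z₀ : Fin m → ℂ} {ν : Fin k → Fin n → ℤ} {c : Fin k → Fin m → ℚ}
  {d : Fin m → ℕ} {α : (j : Fin m) → Fin (d j) → ℂ} {a : Fin m → ℂ}

/-- The exceptional points of a standard form: the marked points and the zeros `α j s`. -/
noncomputable def exceptional (D : MarkedOrbiDisc k) (α : (j : Fin m) → Fin (d j) → ℂ) : Finset ℂ :=
  Finset.univ.image D.pts ∪ Finset.univ.image fun q : (j : Fin m) × Fin (d j) => α q.1 q.2

theorem mem_exceptional {z : ℂ} :
    z ∈ exceptional D α ↔ (∃ i, z = D.pts i) ∨ ∃ j s, z = α j s := by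
  simp only [exceptional, Finset.mem_union, Finset.mem_image, Finset.mem_univ, true_and,
    Sigma.exists, eq_comm (a := z)]

theorem ne_pts_of_notMem {z : ℂ} (hz : z ∉ exceptional D α) (i : Fin k) : z ≠ D.pts i :=
  fun h => hz (mem_exceptional.2 (Or.inl ⟨i, h⟩))

theorem ne_zeros_of_notMem {z : ℂ} (hz : z ∉ exceptional D α) (j : Fin m) (s : Fin (d j)) :
    z ≠ α j s := fun h => hz (mem_exceptional.2 (Or.inr ⟨j, s, h⟩))

theorem eventually_notMem_exceptional_of_notMem {z : ℂ} (hz : z ∉ exceptional D α) :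
    ∀ᶠ z' in 𝓝 z, z' ∉ exceptional D α :=
  (exceptional D α).finite_toSet.isClosed.isOpen_compl.mem_nhds hz

/-- The logarithmic derivative of the `j`-th coordinate of the standard form. -/
noncomputable def coordLogDeriv (D : MarkedOrbiDisc k) (c : Fin k → Fin m → ℚ)
    (α : (j : Fin m) → Fin (d j) → ℂ) (j : Fin m) (z : ℂ) : ℂ :=
  ∑ s, logDeriv (blaschke (α j s)) z + ∑ i, (c i j : ℂ) * logDeriv (blaschke (D.pts i)) z

/-- Near a point where the `j`-th coordinate of the standard form does not vanish, its modulus is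
that of the exponential of an analytic function. -/
theorem exists_coord_log (hα : ∀ j s, α j s ∈ Metric.ball (0 : ℂ) 1) (ha : ∀ j, a j ≠ 0) {z : ℂ}
    (hz : z ∈ Metric.closedBall (0 : ℂ) 1) {j : Fin m} (hj : blaschkeMap D.pts c d α a z j ≠ 0) :
    ∃ V : ℂ → ℂ, AnalyticAt ℂ V z ∧
      (∀ᶠ z' in 𝓝 z, ‖blaschkeMap D.pts c d α a z' j‖ = Real.exp (V z').re) ∧
      ∀ᶠ z' in 𝓝 z, deriv V z' = coordLogDeriv D c α j z' := by
  have hlog : ∀ β ∈ Metric.ball (0 : ℂ) 1, z ≠ β → ∃ L : ℂ → ℂ, AnalyticAt ℂ L z ∧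
      (∀ᶠ z' in 𝓝 z, exp (L z') = blaschke β z') ∧
      ∀ᶠ z' in 𝓝 z, HasDerivAt L (logDeriv (blaschke β) z') z' := by
    intro β hβ hne
    obtain ⟨L, hL, hLe⟩ := exists_analyticAt_log (analyticAt_blaschke hβ hz)
      (by rwa [Ne, blaschke_eq_zero_iff hβ hz])
    refine ⟨L, hL, hLe, ?_⟩
    filter_upwards [hLe.eventually_nhds, hL.eventually_analyticAt] with z' h1 h2
    have h3 : deriv (blaschke β) z' = blaschke β z' * deriv L z' := by
      rw [← Filter.EventuallyEq.deriv_eq h1, deriv_cexp h2.differentiableAt, h1.self_of_nhds]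
    have h4 : blaschke β z' ≠ 0 := by rw [← h1.self_of_nhds]; exact exp_ne_zero _
    have h5 : logDeriv (blaschke β) z' = deriv L z' := by
      rw [logDeriv_apply, h3, mul_div_cancel_left₀ _ h4]
    rw [h5]
    exact h2.differentiableAt.hasDerivAt
  have h0 := hj
  simp only [blaschkeMap] at h0
  have hzs : ∀ s, z ≠ α j s := fun s h => h0 (by
    rw [Finset.prod_eq_zero (Finset.mem_univ s) (by rw [blaschke_eq_zero_iff (hα j s) hz, h])]
    simp)
  have hzi : ∀ i, c i j ≠ 0 → z ≠ D.pts i := fun i hc h => h0 (by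
    rw [Finset.prod_eq_zero (f := fun i => blaschke (D.pts i) z ^ ((c i j : ℚ) : ℂ))
      (Finset.mem_univ i) (by
        rw [(blaschke_eq_zero_iff (D.pts_mem i) hz).2 h, Complex.zero_cpow (by exact_mod_cast hc)])]
    simp)
  choose L hL hLe hLd using fun s => hlog (α j s) (hα j s) (hzs s)
  have hM : ∀ i, ∃ L : ℂ → ℂ, AnalyticAt ℂ L z ∧
      (∀ᶠ z' in 𝓝 z, ‖blaschke (D.pts i) z' ^ ((c i j : ℚ) : ℂ)‖ = Real.exp (L z').re) ∧
      ∀ᶠ z' in 𝓝 z, HasDerivAt L ((c i j : ℂ) * logDeriv (blaschke (D.pts i)) z') z' := by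
    intro i
    by_cases hc : c i j = 0
    · exact ⟨0, analyticAt_const, by simp [hc], by simp [hc, hasDerivAt_zero]⟩
    · obtain ⟨L, hL, hLe, hLd⟩ := hlog _ (D.pts_mem i) (hzi i hc)
      refine ⟨fun z => c i j * L z, analyticAt_const.mul hL, ?_, ?_⟩
      · filter_upwards [hLe] with z' h
        have e1 : ((c i j : ℚ) : ℂ) = (((c i j : ℚ) : ℝ) : ℂ) := by push_cast; rfl
        rw [← h, e1, Complex.norm_cpow_real, Complex.norm_exp, ← Real.exp_mul,
          Complex.re_ofReal_mul, mul_comm]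
      · filter_upwards [hLd] with z' h using h.const_mul _
  choose M hM hMe hMd using hM
  refine ⟨fun z => log (a j) + (∑ s, L s z + ∑ i, M i z), ?_, ?_, ?_⟩
  · refine analyticAt_const.add (AnalyticAt.add ?_ ?_)
    · exact Finset.analyticAt_fun_sum _ fun s _ => hL s
    · exact Finset.analyticAt_fun_sum _ fun s _ => hM s
  · filter_upwards [Filter.eventually_all.2 hLe, Filter.eventually_all.2 hMe] with z' h1 h2
    simp only [blaschkeMap, norm_mul, norm_prod, h2, ← h1, Complex.norm_exp]
    rw [Complex.add_re, Complex.add_re, Real.exp_add, Real.exp_add, Complex.re_sum, Complex.re_sum,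
      Real.exp_sum, Real.exp_sum, ← Complex.norm_exp (log (a j)), Complex.exp_log (ha j), mul_assoc]
  · filter_upwards [Filter.eventually_all.2 hLd, Filter.eventually_all.2 hMd] with z' h1 h2
    refine HasDerivAt.deriv ?_
    exact ((HasDerivAt.fun_sum fun s _ => h1 s).add (HasDerivAt.fun_sum fun i _ => h2 i)).const_add _

theorem analyticAt_coordLogDeriv (hα : ∀ j s, α j s ∈ Metric.ball (0 : ℂ) 1) (ha : ∀ j, a j ≠ 0)
    {z : ℂ} (hz : z ∈ Metric.closedBall (0 : ℂ) 1) {j : Fin m}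
    (hj : blaschkeMap D.pts c d α a z j ≠ 0) : AnalyticAt ℂ (coordLogDeriv D c α j) z := by
  obtain ⟨V, hV, -, hd⟩ := exists_coord_log hα ha hz hj
  exact hV.deriv.congr hd

/-- The logarithmic derivative of the `l`-th coordinate of a lift to the chart `s`, with respect to
the coordinate of the disc. -/
noncomputable def Chart.liftLogDeriv (s : P.Chart) (D : MarkedOrbiDisc k) (c : Fin k → Fin m → ℚ)
    (α : (j : Fin m) → Fin (d j) → ℂ) (l : Fin n) (z : ℂ) : ℂ :=
  ∑ j, (s.coeff (P.b j) l : ℂ) * coordLogDeriv D c α j z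

theorem Chart.norm_eq_exp_of_sameOrbit (s : P.Chart) {W : Fin m → ℂ} {x : Fin n → ℂ}
    (hW : ∀ j, W j ≠ 0) (h : P.SameOrbit W (s.homog x)) (l : Fin n) :
    ‖x l‖ = Real.exp (∑ j, Real.log ‖W j‖ * (s.coeff (P.b j) l : ℝ)) := by
  classical
  rw [s.norm_eq_of_sameOrbit h, Chart.offLog, ← Real.exp_log (norm_pos_iff.2 (hW (s.ray l))),
    ← Real.exp_add]
  congr 1
  have h1 : ∑ j, (if j ∈ Set.range s.ray then Real.log ‖W j‖ * (s.coeff (P.b j) l : ℝ) else 0) =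
      Real.log ‖W (s.ray l)‖ := by
    rw [s.sum_eq_sum_ray _ fun j hj => if_neg hj, Finset.sum_eq_single l]
    · rw [if_pos ⟨l, rfl⟩, s.coeff_ray]; simp
    · intro r _ hr; rw [if_pos ⟨r, rfl⟩, s.coeff_ray]; simp [hr]
    · simp
  rw [← h1, ← Finset.sum_add_distrib]
  refine Finset.sum_congr rfl fun j _ => ?_
  split_ifs <;> simp

namespace IsStandardForm

theorem coord_ne_zero (hst : P.IsStandardForm z₀ D w ν c d α a) (ha : ∀ j, a j ≠ 0) {z : ℂ}
    (hz : z ∈ Metric.closedBall (0 : ℂ) 1) (he : z ∉ exceptional D α) (j : Fin m) :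
    blaschkeMap D.pts c d α a z j ≠ 0 := by
  rw [Ne, blaschkeMap_eq_zero_iff hst.boxCoeff hst.zeros_mem ha hz,
    ramExp_of_ne c (ne_pts_of_notMem he)]
  simp [zeroCount, ne_zeros_of_notMem he]

theorem f_ne_zero (hst : P.IsStandardForm z₀ D w ν c d α a) (ha : ∀ j, a j ≠ 0)
    (F : P.LocalLift D w) {y : ℂ} (hy : y ∈ F.dom) (he : F.br y ∉ exceptional D α) (l : Fin n) :
    F.f y l ≠ 0 := by
  rw [Ne, hst.f_eq_zero_iff F hy]
  exact hst.coord_ne_zero ha hy.2 he _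

theorem notMem_exceptional_of_norm_eq_one (hst : P.IsStandardForm z₀ D w ν c d α a) {z : ℂ}
    (hz : ‖z‖ = 1) : z ∉ exceptional D α := by
  rw [mem_exceptional]
  rintro (⟨i, h⟩ | ⟨j, s, h⟩)
  · exact D.ne_pts_of_norm_eq_one hz i h
  · have := hst.zeros_mem j s
    rw [← h] at this
    simp [hz] at this

end IsStandardForm

theorem LocalLift.hasDerivAt_br (F : P.LocalLift D w) (y : ℂ) :
    HasDerivAt F.br (F.e * y ^ (F.e - 1)) y := by
  unfold LocalLift.br
  exact (hasDerivAt_pow F.e y).const_add F.p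

theorem LocalLift.analyticAt_br (F : P.LocalLift D w) (y : ℂ) : AnalyticAt ℂ F.br y := by
  unfold LocalLift.br; fun_prop

theorem LocalLift.convex_inner (F : P.LocalLift D w) (he : F.e = 1) (y : ℂ) (r : ℝ) :
    Convex ℝ (F.inner ∩ Metric.ball y r) := by
  have h1 : F.inner = Metric.ball 0 F.ε ∩ Metric.ball (-F.p) 1 := by
    ext t
    simp [LocalLift.inner, LocalLift.br, he, dist_eq_norm, add_comm]
  rw [h1]
  exact ((convex_ball _ _).inter (convex_ball _ _)).inter (convex_ball _ _)

theorem LocalLift.mem_closure_inner (F : P.LocalLift D w) (he : F.e = 1) {y : ℂ} (hy : y ∈ F.dom) :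
    y ∈ closure F.inner := by
  have h1 : F.inner = Metric.ball 0 F.ε ∩ Metric.ball (-F.p) 1 := by
    ext t
    simp [LocalLift.inner, LocalLift.br, he, dist_eq_norm, add_comm]
  have h2 : y ∈ closure (Metric.ball (-F.p) 1) := by
    rw [closure_ball _ one_ne_zero]
    have := hy.2
    simpa [LocalLift.br, he, dist_eq_norm, add_comm] using this
  rw [h1]
  exact Metric.isOpen_ball.inter_closure ⟨by simpa using hy.1, h2⟩

namespace IsStandardForm

/-- Away from the exceptional points, a lift is a constant multiple of the exponential of an
analytic function whose derivative is explicit; at boundary points this includes an analytic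
extension of the lift across the boundary. -/
theorem exists_f_eq_exp (hst : P.IsStandardForm z₀ D w ν c d α a) (ha : ∀ j, a j ≠ 0)
    (F : P.LocalLift D w) {y : ℂ} (hy : y ∈ F.dom) (hin : y ∈ F.inner ∨ F.e = 1)
    (hex : F.br y ∉ exceptional D α) (l : Fin n) :
    ∃ g : ℂ → ℂ, AnalyticAt ℂ g y ∧ (∀ᶠ t in 𝓝[F.dom] y, F.f t l = g t) ∧
      ∀ᶠ t in 𝓝 y, HasDerivAt g
        (g t * (F.chart.liftLogDeriv D c α l (F.br t) * (F.e * t ^ (F.e - 1)))) t := by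
  have hW0 := hst.coord_ne_zero ha hy.2 hex
  choose V hV hVn hVd using fun j => exists_coord_log hst.zeros_mem ha hy.2 (hW0 j)
  have hbr := F.analyticAt_br y
  have hbc := hbr.continuousAt
  let L : ℂ → ℂ := fun t => ∑ j, (F.chart.coeff (P.b j) l : ℂ) * V j (F.br t)
  have hL : AnalyticAt ℂ L y := Finset.analyticAt_fun_sum _ fun j _ =>
    analyticAt_const.mul ((hV j).comp hbr)
  have hLd : ∀ᶠ t in 𝓝 y, HasDerivAt L
      (F.chart.liftLogDeriv D c α l (F.br t) * (F.e * t ^ (F.e - 1))) t := by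
    filter_upwards [hbc.eventually (Filter.eventually_all.2 hVd),
      hbc.eventually (Filter.eventually_all.2 fun j => (hV j).eventually_analyticAt)] with t h1 h2
    rw [Chart.liftLogDeriv, Finset.sum_mul]
    refine HasDerivAt.fun_sum fun j _ => ?_
    rw [mul_assoc]
    refine HasDerivAt.const_mul _ ?_
    rw [← h1 j]
    exact (h2 j).differentiableAt.hasDerivAt.comp t (F.hasDerivAt_br t)
  have hnorm : ∀ᶠ t in 𝓝 y, t ∈ F.dom → ‖F.f t l‖ = ‖exp (L t)‖ := by
    filter_upwards [hbc.eventually (Filter.eventually_all.2 hVn)] with t h1 htd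
    have h2 : ∀ j, blaschkeMap D.pts c d α a (F.br t) j ≠ 0 := fun j => by
      rw [← norm_ne_zero_iff, h1 j]; exact (Real.exp_pos _).ne'
    rw [F.chart.norm_eq_exp_of_sameOrbit h2 (hst.sameOrbit F htd) l, Complex.norm_exp,
      Complex.re_sum]
    congr 1
    refine Finset.sum_congr rfl fun j _ => ?_
    rw [h1 j, Real.log_exp, mul_comm]
    have : ((F.chart.coeff (P.b j) l : ℚ) : ℂ) = (((F.chart.coeff (P.b j) l : ℚ) : ℝ) : ℂ) := by
      push_cast; rfl
    rw [this, Complex.re_ofReal_mul]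
  -- a neighbourhood on which the interior part of the domain is connected
  obtain ⟨r, hr, hball, hconn, hcl⟩ : ∃ r > 0,
      (∀ t ∈ Metric.ball y r, (t ∈ F.dom → ‖F.f t l‖ = ‖exp (L t)‖) ∧ AnalyticAt ℂ L t) ∧
      IsPreconnected (F.inner ∩ Metric.ball y r) ∧
      ∀ t ∈ F.dom, t ∈ Metric.ball y r → t ∈ closure (F.inner ∩ Metric.ball y r) := by
    obtain ⟨r, hr, h⟩ := Metric.eventually_nhds_iff_ball.1 (hnorm.and hL.eventually_analyticAt)
    rcases hin with hin | he
    · obtain ⟨r', hr', h'⟩ := Metric.isOpen_iff.1 F.isOpen_inner y hin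
      refine ⟨min r r', lt_min hr hr', fun t ht => h t (Metric.ball_subset_ball (min_le_left _ _) ht),
        ?_, fun t _ ht => subset_closure ⟨h' (Metric.ball_subset_ball (min_le_right _ _) ht), ht⟩⟩
      rw [Set.inter_eq_right.2 ((Metric.ball_subset_ball (min_le_right _ _)).trans h')]
      exact (convex_ball _ _).isPreconnected
    · refine ⟨r, hr, h, (F.convex_inner he y r).isPreconnected, fun t htd ht => ?_⟩
      rw [Set.inter_comm]
      exact Metric.isOpen_ball.inter_closure ⟨ht, F.mem_closure_inner he htd⟩
  obtain ⟨t₀, ht₀⟩ : (F.inner ∩ Metric.ball y r).Nonempty :=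
    closure_nonempty_iff.1 ⟨y, hcl y hy (Metric.mem_ball_self hr)⟩
  let C : ℂ := F.f t₀ l * exp (-L t₀)
  have hop : IsOpen (F.inner ∩ Metric.ball y r) := F.isOpen_inner.inter Metric.isOpen_ball
  have hn1 : ∀ t ∈ F.inner ∩ Metric.ball y r, ‖F.f t l * exp (-L t)‖ = 1 := fun t ht => by
    rw [norm_mul, (hball t ht.2).1 (F.inner_subset_dom ht.1), ← norm_mul, ← Complex.exp_add]
    simp
  have hconst : Set.EqOn (fun t => F.f t l * exp (-L t)) (fun _ => C) (F.inner ∩ Metric.ball y r) := by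
    refine Complex.eqOn_of_isPreconnected_of_isMaxOn_norm hconn hop (fun t ht => ?_) ht₀ ?_
    · exact ((F.analyticAt_apply ht.1 l).differentiableAt.mul
        ((hball t ht.2).2.differentiableAt.neg.cexp)).differentiableWithinAt
    · intro t ht
      simp only [Set.mem_ofPred_eq, Function.comp]
      rw [hn1 t ht, hn1 t₀ ht₀]
  have hcont : ∀ t ∈ F.dom, t ∈ Metric.ball y r → F.f t l * exp (-L t) = C := by
    intro t htd ht
    have hc1 : ContinuousOn (fun t => F.f t l * exp (-L t)) (F.dom ∩ Metric.ball y r) := by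
      refine ((F.continuousOn_apply l).mono Set.inter_subset_left).mul fun t' ht' => ?_
      exact ((hball t' ht'.2).2.continuousAt.neg.cexp).continuousWithinAt
    have hsub : F.inner ∩ Metric.ball y r ⊆ F.dom ∩ Metric.ball y r :=
      Set.inter_subset_inter_left _ F.inner_subset_dom
    have h1 : Filter.Tendsto (fun t => F.f t l * exp (-L t)) (𝓝[F.inner ∩ Metric.ball y r] t)
        (𝓝 (F.f t l * exp (-L t))) := (hc1 t ⟨htd, ht⟩).mono hsub
    have h2 : Filter.Tendsto (fun t => F.f t l * exp (-L t)) (𝓝[F.inner ∩ Metric.ball y r] t)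
        (𝓝 C) := tendsto_const_nhds.congr' (by
      filter_upwards [self_mem_nhdsWithin] with t' ht' using (hconst ht').symm)
    have := mem_closure_iff_nhdsWithin_neBot.1 (hcl t htd ht)
    exact tendsto_nhds_unique h1 h2
  refine ⟨fun t => C * exp (L t), analyticAt_const.mul hL.cexp, ?_, ?_⟩
  · filter_upwards [self_mem_nhdsWithin, nhdsWithin_le_nhds (Metric.ball_mem_nhds y hr)] with t h1 h2
    rw [← hcont t h1 h2, mul_assoc, ← Complex.exp_add]
    simp
  · filter_upwards [hLd] with t ht
    have := (ht.cexp).const_mul C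
    refine this.congr_deriv ?_
    ring

/-- The logarithmic derivative of a lift at an interior point. -/
theorem hasDerivAt_f (hst : P.IsStandardForm z₀ D w ν c d α a) (ha : ∀ j, a j ≠ 0)
    (F : P.LocalLift D w) {y : ℂ} (hy : y ∈ F.inner) (hex : F.br y ∉ exceptional D α) (l : Fin n) :
    HasDerivAt (fun t => F.f t l)
      (F.f y l * (F.chart.liftLogDeriv D c α l (F.br y) * (F.e * y ^ (F.e - 1)))) y := by
  obtain ⟨g, -, h1, h2⟩ := hst.exists_f_eq_exp ha F (F.inner_subset_dom hy) (Or.inl hy) hex l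
  have h3 : ∀ᶠ t in 𝓝 y, F.f t l = g t := by
    filter_upwards [eventually_nhdsWithin_iff.1 h1, F.isOpen_inner.mem_nhds hy] with t h4 h5
    exact h4 (F.inner_subset_dom h5)
  rw [h3.self_of_nhds]
  exact h2.self_of_nhds.congr_of_eventuallyEq h3

end IsStandardForm

end LabeledPolytope

/-! ### Transition maps between lifts -/

namespace LabeledPolytope

variable {n m k : ℕ} {P : LabeledPolytope n m} {D : MarkedOrbiDisc k} {w : ℂ → P.X}
  {z₀ : Fin m → ℂ} {ν : Fin k → Fin n → ℤ} {c : Fin k → Fin m → ℚ}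
  {d : Fin m → ℕ} {α : (j : Fin m) → Fin (d j) → ℂ} {a : Fin m → ℂ}

/-- The transition map between two uniformizing charts near a point `x₀` of the torus, normalized
by its value `x₀'` at `x₀`. -/
noncomputable def Chart.transition (s s' : P.Chart) (x₀ x₀' x : Fin n → ℂ) (l : Fin n) : ℂ :=
  x₀' l * exp (∑ r, (s'.coeff (P.b (s.ray r)) l : ℂ) * log (x r / x₀ r))

theorem Chart.transition_self (s s' : P.Chart) {x₀ x₀' : Fin n → ℂ} (h : ∀ l, x₀ l ≠ 0) :
    s.transition s' x₀ x₀' x₀ = x₀' := by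
  ext l
  simp [Chart.transition, div_self (h _)]

theorem Chart.analyticAt_transition (s s' : P.Chart) {x₀ x₀' : Fin n → ℂ} (h : ∀ l, x₀ l ≠ 0) :
    AnalyticAt ℂ (s.transition s' x₀ x₀') x₀ := by
  rw [analyticAt_pi_iff]
  intro l
  refine analyticAt_const.mul (AnalyticAt.cexp ?_)
  refine Finset.analyticAt_fun_sum _ fun r _ => analyticAt_const.mul ?_
  refine AnalyticAt.clog (AnalyticAt.div ?_ analyticAt_const (h r)) (by simp [div_self (h r)])
  exact (ContinuousLinearMap.proj (R := ℂ) (φ := fun _ : Fin n => ℂ) r).analyticAt x₀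

theorem Chart.sameOrbit_transition (s s' : P.Chart) {x₀ x₀' x : Fin n → ℂ} (h : ∀ l, x₀ l ≠ 0)
    (h' : ∀ l, x₀' l ≠ 0) (hx : ∀ l, x l ≠ 0) (hs : P.SameOrbit (s.homog x₀) (s'.homog x₀')) :
    P.SameOrbit (s.homog x) (s'.homog (s.transition s' x₀ x₀' x)) := by
  have hne : ∀ (s : P.Chart) {x : Fin n → ℂ}, (∀ l, x l ≠ 0) → ∀ j, s.homog x j ≠ 0 := by
    intro s x hx j
    by_cases hj : j ∈ Set.range s.ray
    · obtain ⟨l, rfl⟩ := hj; rw [s.homog_ray]; exact hx l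
    · rw [s.homog_of_notMem x hj]; exact one_ne_zero
  refine sameOrbit_of_chi_eq (hne s hx) (hne s' fun l => mul_ne_zero (h' l) (exp_ne_zero _))
    fun b => ?_
  have e1 := hs.chi_eq b
  rw [s.chi_homog, s'.chi_homog] at e1 ⊢
  simp only [Chart.transition, mul_zpow, Finset.prod_mul_distrib, ← Complex.exp_int_mul]
  rw [e1, ← Complex.exp_sum]
  have e2 : ∑ l, (P.b (s'.ray l) b : ℂ) *
      ∑ r, (s'.coeff (P.b (s.ray r)) l : ℂ) * log (x r / x₀ r) =
      ∑ r, (P.b (s.ray r) b : ℂ) * log (x r / x₀ r) := by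
    simp only [Finset.mul_sum]
    rw [Finset.sum_comm]
    refine Finset.sum_congr rfl fun r _ => ?_
    have := s'.sum_coeff (P.b (s.ray r)) b
    have h3 : (∑ l, (s'.coeff (P.b (s.ray r)) l : ℂ) * (P.b (s'.ray l) b : ℂ)) =
        (P.b (s.ray r) b : ℂ) := by exact_mod_cast congrArg (Rat.cast (K := ℂ)) this
    rw [← h3, Finset.sum_mul]
    exact Finset.sum_congr rfl fun l _ => by ring
  rw [e2, Complex.exp_sum, ← Finset.prod_mul_distrib]
  refine Finset.prod_congr rfl fun r _ => ?_
  rw [Complex.exp_int_mul, Complex.exp_log (div_ne_zero (hx r) (h r)), div_zpow,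
    mul_div_cancel₀ _ (zpow_ne_zero _ (h r))]

namespace IsStandardForm

/-- Over an interior point off the exceptional set, every lift is glued to every lift whose
branched covering is a translation. -/
theorem exists_isGluing (hst : P.IsStandardForm z₀ D w ν c d α a) (ha : ∀ j, a j ≠ 0)
    (F F' : P.LocalLift D w) (he : F'.e = 1) {y : ℂ} (hy : y ∈ F.inner)
    (hy' : F.br y - F'.p ∈ F'.inner) (hex : F.br y ∉ exceptional D α) :
    ∃ φ, IsGluing F F' y (F.br y - F'.p) (fun t => F.br t - F'.p) φ := by
  have hbr' : ∀ t, F'.br (F.br t - F'.p) = F.br t := fun t => by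
    simp [LocalLift.br, he]
  have hf := hst.f_ne_zero ha F (F.inner_subset_dom hy) hex
  have hf' := hst.f_ne_zero ha F' (F'.inner_subset_dom hy') (by rwa [hbr'])
  have hα : AnalyticAt ℂ (fun t => F.br t - F'.p) y := (F.analyticAt_br y).sub analyticAt_const
  have hso : P.SameOrbit (F.chart.homog (F.f y)) (F'.chart.homog (F'.f (F.br y - F'.p))) := by
    have h1 := hst.sameOrbit F (F.inner_subset_dom hy)
    have h2 := hst.sameOrbit F' (F'.inner_subset_dom hy')
    rw [hbr'] at h2
    exact h1.symm.trans h2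
  have hne : ∀ᶠ x in 𝓝 (F.f y), ∀ l, x l ≠ 0 := Filter.eventually_all.2 fun l =>
    (continuous_apply l).continuousAt.eventually_ne (hf l)
  have hφ := F.chart.analyticAt_transition F'.chart (x₀' := F'.f (F.br y - F'.p)) hf
  have hSO : ∀ᶠ x in 𝓝 (F.f y), P.SameOrbit (F.chart.homog x) (F'.chart.homog
      (F.chart.transition F'.chart (F.f y) (F'.f (F.br y - F'.p)) x)) :=
    hne.mono fun x hx => F.chart.sameOrbit_transition F'.chart hf hf' hx hso
  refine ⟨F.chart.transition F'.chart (F.f y) (F'.f (F.br y - F'.p)), hy, hy',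
    ne_pts_of_notMem hex, rfl, hα, Filter.Eventually.of_forall hbr', hφ, hSO, ?_⟩
  -- both sides are analytic with equal moduli, and they agree at `y`
  have hin : ∀ᶠ t in 𝓝 y, t ∈ F.inner ∧ F.br t - F'.p ∈ F'.inner :=
    Filter.Eventually.and (F.isOpen_inner.mem_nhds hy)
      (hα.continuousAt.eventually (F'.isOpen_inner.mem_nhds hy'))
  have key : ∀ l, ∀ᶠ t in 𝓝 y, F'.f (F.br t - F'.p) l =
      F.chart.transition F'.chart (F.f y) (F'.f (F.br y - F'.p)) (F.f t) l := by
    intro l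
    have ht0 : ∀ x, F.chart.transition F'.chart (F.f y) (F'.f (F.br y - F'.p)) x l ≠ 0 :=
      fun x => mul_ne_zero (hf' l) (exp_ne_zero _)
    have hq : AnalyticAt ℂ (fun t => F'.f (F.br t - F'.p) l /
        F.chart.transition F'.chart (F.f y) (F'.f (F.br y - F'.p)) (F.f t) l) y := by
      refine AnalyticAt.fun_div ?_ ?_ (ht0 _)
      · exact AnalyticAt.fun_comp (f := fun t => F.br t - F'.p) (F'.analyticAt_apply hy' l) hα
      · exact AnalyticAt.fun_comp (g := fun x => F.chart.transition F'.chart (F.f y)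
          (F'.f (F.br y - F'.p)) x l) (analyticAt_pi_iff.1 hφ l) (F.analyticAt hy)
    have hq1 : ∀ᶠ t in 𝓝 y, ‖F'.f (F.br t - F'.p) l /
        F.chart.transition F'.chart (F.f y) (F'.f (F.br y - F'.p)) (F.f t) l‖ = 1 := by
      filter_upwards [hin, (F.analyticAt hy).continuousAt.eventually hSO] with t h1 h2
      rw [norm_div, div_eq_one_iff_eq (norm_ne_zero_iff.2 (ht0 _)),
        hst.norm_f F' (F'.inner_subset_dom h1.2), hbr']
      exact (F'.chart.norm_eq_of_sameOrbit
        ((hst.sameOrbit F (F.inner_subset_dom h1.1)).trans h2) l).symm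
    have hq2 := eventually_eq_of_norm_eq hq (by
      filter_upwards [hq1] with t ht
      rw [ht, hq1.self_of_nhds])
    filter_upwards [hq2] with t ht
    rw [F.chart.transition_self F'.chart hf, div_self (hf' l)] at ht
    rwa [div_eq_one_iff_eq (ht0 _)] at ht
  filter_upwards [Filter.eventually_all.2 key] with t ht using funext ht

end IsStandardForm

/-- Transition data at a point are transition data at the nearby points. -/
theorem IsGluing.eventually {F F' : P.LocalLift D w} {y y' : ℂ} {β : ℂ → ℂ}
    {φ : (Fin n → ℂ) → Fin n → ℂ} (h : IsGluing F F' y y' β φ) :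
    ∀ᶠ t in 𝓝 y, IsGluing F F' t (β t) β φ := by
  obtain ⟨hy, hy', hne, rfl, hβ, hbr, hφ, hSO, hf⟩ := h
  have hfc := (F.analyticAt hy).continuousAt
  have h1 : ∀ᶠ t in 𝓝 y, ∀ i, F.br t ≠ D.pts i := Filter.eventually_all.2 fun i =>
    F.continuous_br.continuousAt.eventually_ne (hne i)
  filter_upwards [F.isOpen_inner.mem_nhds hy,
    hβ.continuousAt.eventually (F'.isOpen_inner.mem_nhds hy'), h1, hβ.eventually_analyticAt,
    hbr.eventually_nhds, hfc.eventually hφ.eventually_analyticAt,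
    hfc.eventually hSO.eventually_nhds, hf.eventually_nhds] with t k1 k2 k3 k4 k5 k6 k7 k8
  exact ⟨k1, k2, k3, rfl, k4, k5, k6, k7, k8⟩

/-- The derivative of a transition map at a point of the torus. -/
theorem jac_eq {s s' : P.Chart} {φ : (Fin n → ℂ) → Fin n → ℂ} {x : Fin n → ℂ}
    (hφ : AnalyticAt ℂ φ x) (hx : ∀ l, x l ≠ 0) (hφx : ∀ l, φ x l ≠ 0)
    (hSO : ∀ᶠ t in 𝓝 x, P.SameOrbit (s.homog t) (s'.homog (φ t))) (l r : Fin n) :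
    jac φ x l r = φ x l * (s'.coeff (P.b (s.ray r)) l : ℂ) / x r := by
  classical
  have hd : DifferentiableAt ℂ φ x := hφ.differentiableAt
  have hdl : ∀ l, HasFDerivAt (fun t => φ t l)
      ((ContinuousLinearMap.proj (R := ℂ) (φ := fun _ : Fin n => ℂ) l).comp (fderiv ℂ φ x)) x :=
    fun l => hasFDerivAt_pi'.1 hd.hasFDerivAt l
  -- differentiate the monomials along the line `x + t e_r`
  have hline : HasDerivAt (fun t : ℂ => x + t • (Pi.single r 1 : Fin n → ℂ))
      (Pi.single r 1 : Fin n → ℂ) 0 := by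
    simpa using ((hasDerivAt_id (0 : ℂ)).smul_const (Pi.single r 1 : Fin n → ℂ)).const_add x
  have hφl : ∀ l, HasDerivAt (fun t : ℂ => φ (x + t • (Pi.single r 1 : Fin n → ℂ)) l)
      (jac φ x l r) 0 := fun l => by
    have h1 : HasFDerivAt (fun t => φ t l)
      ((ContinuousLinearMap.proj (R := ℂ) (φ := fun _ : Fin n => ℂ) l).comp (fderiv ℂ φ x))
      (x + (0 : ℂ) • (Pi.single r 1 : Fin n → ℂ)) := by simpa using hdl l
    exact h1.comp_hasDerivAt (0 : ℂ) hline
  have hxl : ∀ l, HasDerivAt (fun t : ℂ => (x + t • (Pi.single r 1 : Fin n → ℂ)) l)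
      ((Pi.single r 1 : Fin n → ℂ) l) 0 := fun l => hasDerivAt_pi.1 hline l
  have hcont : Filter.Tendsto (fun t : ℂ => x + t • (Pi.single r 1 : Fin n → ℂ)) (𝓝 0) (𝓝 x) := by
    have := hline.continuousAt.tendsto
    simpa using this
  have hzp : ∀ {u : ℂ → ℂ} {u' : ℂ} (N : ℤ), HasDerivAt u u' 0 → u 0 ≠ 0 →
      HasDerivAt (fun t => u t ^ N) (u 0 ^ N * (N * (u' / u 0))) 0 := by
    intro u u' N hu h0
    have := (hasDerivAt_zpow N (u 0) (Or.inl h0)).comp (0 : ℂ) hu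
    refine this.congr_deriv ?_
    rw [zpow_sub_one₀ h0]
    field_simp
  have hprod : ∀ {v : Fin n → ℂ → ℂ} {v' : Fin n → ℂ} (N : Fin n → ℤ),
      (∀ l, HasDerivAt (v l) (v' l) 0) → (∀ l, v l 0 ≠ 0) →
      HasDerivAt (fun t => ∏ l, v l t ^ N l)
        ((∏ l, v l 0 ^ N l) * ∑ l, N l * (v' l / v l 0)) 0 := by
    intro v v' N hv h0
    have := HasDerivAt.fun_finsetProd (u := Finset.univ) (f := fun l t => v l t ^ N l)
      (fun l _ => hzp (N l) (hv l) (h0 l))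
    refine this.congr_deriv ?_
    rw [Finset.mul_sum]
    refine Finset.sum_congr rfl fun l _ => ?_
    rw [smul_eq_mul, ← mul_assoc, Finset.prod_erase_mul _ _ (Finset.mem_univ l)]
  have hlog : ∀ b : Fin n, ∑ l, (P.b (s'.ray l) b : ℂ) * (jac φ x l r / φ x l) =
      P.b (s.ray r) b * (1 / x r) := by
    intro b
    have h1 := hprod (fun l => P.b (s'.ray l) b) hφl (by simpa using hφx)
    have h2 := hprod (fun l => P.b (s.ray l) b) hxl (by simpa using hx)
    have h3 : (fun t : ℂ => ∏ l, φ (x + t • (Pi.single r 1 : Fin n → ℂ)) l ^ P.b (s'.ray l) b)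
        =ᶠ[𝓝 0] fun t => ∏ l, (x + t • (Pi.single r 1 : Fin n → ℂ)) l ^ P.b (s.ray l) b := by
      filter_upwards [hcont.eventually hSO] with t ht
      have := ht.chi_eq b
      rw [s.chi_homog, s'.chi_homog] at this
      exact this
    have h4 := (h2.congr_of_eventuallyEq h3).unique h1
    have h5 := h3.self_of_nhds
    simp only [zero_smul, add_zero] at h4 h5
    rw [h5] at h4
    have h6 := mul_left_cancel₀ (Finset.prod_ne_zero_iff.2 fun l _ => zpow_ne_zero _ (hx l)) h4
    rw [← h6, Finset.sum_eq_single r]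
    · simp
    · intro l _ hl; simp [hl]
    · simp
  have hres : jac φ x l r / φ x l = (s'.coeff (P.b (s.ray r)) l : ℂ) * (1 / x r) := by
    have h1 : ∀ b : Fin n, ∑ l, (jac φ x l r / φ x l -
        (s'.coeff (P.b (s.ray r)) l : ℂ) * (1 / x r)) * (P.b (s'.ray l) b : ℂ) = 0 := by
      intro b
      have h2 := s'.sum_coeff (P.b (s.ray r)) b
      have h3 : (∑ l, (s'.coeff (P.b (s.ray r)) l : ℂ) * (P.b (s'.ray l) b : ℂ)) =
        (P.b (s.ray r) b : ℂ) := by exact_mod_cast congrArg (Rat.cast (K := ℂ)) h2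
      simp only [sub_mul, Finset.sum_sub_distrib]
      rw [sub_eq_zero]
      calc _ = ∑ l, (P.b (s'.ray l) b : ℂ) * (jac φ x l r / φ x l) :=
            Finset.sum_congr rfl fun _ _ => mul_comm _ _
        _ = _ := by
            rw [hlog b, ← h3, Finset.sum_mul]
            exact Finset.sum_congr rfl fun l _ => by ring
    exact sub_eq_zero.1 (congrFun (s'.eq_zero_of_sum h1) l)
  rw [div_eq_iff (hφx l)] at hres
  rw [hres]
  ring

end LabeledPolytope

/-! ### Frames of the pulled-back tangent bundle, and independence of the lift -/

namespace LabeledPolytope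

variable {n m k : ℕ} {P : LabeledPolytope n m} {D : MarkedOrbiDisc k} {w : ℂ → P.X}
  {z₀ : Fin m → ℂ} {ν : Fin k → Fin n → ℤ} {c : Fin k → Fin m → ℚ}
  {d : Fin m → ℕ} {α : (j : Fin m) → Fin (d j) → ℂ} {a : Fin m → ℂ}

/-- The matrix, over `ℂ`, of the linear map `N → ℤⁿ ⊗ ℚ` whose components are the dual basis of
the cone. -/
noncomputable def Chart.dualMat (s : P.Chart) : Matrix (Fin n) (Fin n) ℂ :=
  Matrix.of fun l b => ((s.mat⁻¹ b l : ℚ) : ℂ)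

theorem Chart.dualMat_eq_map (s : P.Chart) :
    s.dualMat = (s.mat⁻¹).transpose.map (algebraMap ℚ ℂ) := by
  ext l b; simp [Chart.dualMat]

theorem Chart.det_dualMat_ne_zero (s : P.Chart) : s.dualMat.det ≠ 0 := by
  have h := RingHom.map_det (algebraMap ℚ ℂ) (s.mat⁻¹).transpose
  rw [RingHom.mapMatrix_apply, ← s.dualMat_eq_map] at h
  rw [← h, Matrix.det_transpose, Ne, map_eq_zero]
  exact (Matrix.isUnit_nonsing_inv_det _ s.isUnit_det).ne_zero

theorem Chart.dualMat_mulVec (s : P.Chart) (v : Fin n → ℤ) :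
    s.dualMat.mulVec (fun b => (v b : ℂ)) = fun l => ((s.coeff v l : ℚ) : ℂ) := by
  ext l
  rw [s.coeff_def]
  push_cast
  simp only [Matrix.mulVec, dotProduct, Chart.dualMat, Matrix.of_apply]
  exact Finset.sum_congr rfl fun b _ => mul_comm _ _

theorem Chart.coeff_mul_dualMat (s s' : P.Chart) :
    (Matrix.of fun l r => ((s'.coeff (P.b (s.ray r)) l : ℚ) : ℂ)) * s.dualMat = s'.dualMat := by
  have h1 : (Matrix.of fun l r => ((s'.coeff (P.b (s.ray r)) l : ℚ) : ℂ)) =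
      (s.mat * s'.mat⁻¹).transpose.map (algebraMap ℚ ℂ) := by
    ext l r
    simp [s'.coeff_def, Matrix.mul_apply, Chart.mat, mul_comm]
  rw [h1, s.dualMat_eq_map, s'.dualMat_eq_map, ← Matrix.map_mul, ← Matrix.transpose_mul,
    ← Matrix.mul_assoc, Matrix.nonsing_inv_mul _ s.isUnit_det, Matrix.one_mul]

/-- The frame of the pulled-back tangent bundle given by the infinitesimal action of the complex
torus, written in the lift `F`. It is invertible where the lift avoids the toric divisors. -/
noncomputable def LocalLift.torusFrame (F : P.LocalLift D w) (y : ℂ) : Matrix (Fin n) (Fin n) ℂ :=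
  Matrix.diagonal (F.f y) * F.chart.dualMat

theorem LocalLift.det_torusFrame (F : P.LocalLift D w) (y : ℂ) :
    (F.torusFrame y).det = (∏ l, F.f y l) * F.chart.dualMat.det := by
  rw [torusFrame, Matrix.det_mul, Matrix.det_diagonal]

theorem LocalLift.torusFrame_mulVec (F : P.LocalLift D w) (y : ℂ) (v : Fin n → ℤ) :
    (F.torusFrame y).mulVec (fun b => (v b : ℂ)) = fun l => F.f y l * (F.chart.coeff v l : ℂ) := by
  rw [torusFrame, ← Matrix.mulVec_mulVec, F.chart.dualMat_mulVec]
  ext l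
  rw [Matrix.mulVec_diagonal]

theorem LocalLift.continuousOn_torusFrame (F : P.LocalLift D w) :
    ContinuousOn F.torusFrame F.dom := by
  refine ContinuousOn.mul ?_ continuousOn_const
  exact continuous_id.matrix_diagonal.comp_continuousOn F.continuousOn

namespace IsStandardForm

theorem det_torusFrame_ne_zero (hst : P.IsStandardForm z₀ D w ν c d α a) (ha : ∀ j, a j ≠ 0)
    (F : P.LocalLift D w) {y : ℂ} (hy : y ∈ F.dom) (hex : F.br y ∉ exceptional D α) :
    (F.torusFrame y).det ≠ 0 := by
  rw [F.det_torusFrame]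
  exact mul_ne_zero (Finset.prod_ne_zero_iff.2 fun l _ => hst.f_ne_zero ha F hy hex l)
    F.chart.det_dualMat_ne_zero

/-- The infinitesimal torus action is compatible with all transition maps. -/
theorem jac_mul_torusFrame (hst : P.IsStandardForm z₀ D w ν c d α a) (ha : ∀ j, a j ≠ 0)
    {F F' : P.LocalLift D w} {y y' : ℂ} {β : ℂ → ℂ} {φ : (Fin n → ℂ) → Fin n → ℂ}
    (h : IsGluing F F' y y' β φ) (hex : F.br y ∉ exceptional D α) :
    jac φ (F.f y) * F.torusFrame y = F'.torusFrame y' := by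
  obtain ⟨hy, hy', -, hβy, -, hbr, hφ, hSO, hf⟩ := h
  have hf0 := hst.f_ne_zero ha F (F.inner_subset_dom hy) hex
  have hyy : F'.f y' = φ (F.f y) := by rw [← hβy]; exact hf.self_of_nhds
  have hbry : F'.br y' = F.br y := by rw [← hβy]; exact hbr.self_of_nhds
  have hf0' := hst.f_ne_zero ha F' (F'.inner_subset_dom hy') (by rwa [hbry])
  have hJ : jac φ (F.f y) = Matrix.diagonal (F'.f y') *
      (Matrix.of fun l r => ((F'.chart.coeff (P.b (F.chart.ray r)) l : ℚ) : ℂ)) *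
      Matrix.diagonal (fun r => (F.f y r)⁻¹) := by
    ext l r
    rw [jac_eq hφ hf0 (by rwa [← hyy]) hSO, Matrix.mul_diagonal, Matrix.diagonal_mul, hyy,
      Matrix.of_apply, div_eq_mul_inv]
  have hD : Matrix.diagonal (fun r => (F.f y r)⁻¹) * Matrix.diagonal (F.f y) = 1 := by
    rw [Matrix.diagonal_mul_diagonal, ← Matrix.diagonal_one]
    congr 1
    ext l
    exact inv_mul_cancel₀ (hf0 l)
  rw [hJ, LocalLift.torusFrame, LocalLift.torusFrame, Matrix.mul_assoc, ← Matrix.mul_assoc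
    (Matrix.diagonal fun r => (F.f y r)⁻¹), hD, Matrix.one_mul, Matrix.mul_assoc,
    Chart.coeff_mul_dualMat]

end IsStandardForm

theorem LocalLift.finite_preimage_br (F : P.LocalLift D w) (S : Finset ℂ) :
    (F.br ⁻¹' S).Finite := by
  refine S.finite_toSet.preimage' fun z _ => ?_
  refine (Polynomial.nthRootsFinset F.e (z - F.p)).finite_toSet.subset fun y hy => ?_
  rw [Finset.mem_coe, Polynomial.mem_nthRootsFinset F.e_pos]
  exact eq_sub_of_add_eq' hy

theorem LocalLift.mem_closure_inner_diff (F : P.LocalLift D w) {y : ℂ} (hy : y ∈ F.dom)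
    (hin : y ∈ F.inner ∨ F.e = 1) (S : Finset ℂ) :
    y ∈ closure (F.inner ∩ (F.br ⁻¹' S)ᶜ) := by
  have hd : Dense (F.br ⁻¹' (S : Set ℂ))ᶜ := (F.finite_preimage_br S).countable.dense_compl ℝ
  have h1 : y ∈ closure F.inner := hin.elim (fun h => subset_closure h)
    fun h => F.mem_closure_inner h hy
  have h2 := hd.open_subset_closure_inter F.isOpen_inner
  exact closure_minimal h2 isClosed_closure h1

/-- A quantity attached to all lifts that is continuous over the unmarked points, and which does not
depend on the lift over the interior points off a finite set, depends on the image point only. -/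
theorem LocalLift.eq_of_eq_on_inner {X : Type*} [TopologicalSpace X] [T2Space X]
    (Φ : P.LocalLift D w → ℂ → X) (S : Finset ℂ)
    (hc : ∀ F : P.LocalLift D w, ContinuousOn (Φ F) {y | y ∈ F.dom ∧ ∀ i, F.br y ≠ D.pts i})
    (hinv : ∀ F F' : P.LocalLift D w, F'.e = 1 → ∀ y ∈ F.inner, F.br y - F'.p ∈ F'.inner →
      F.br y ∉ S → Φ F y = Φ F' (F.br y - F'.p))
    (F F' : P.LocalLift D w) (he : F'.e = 1) {y : ℂ} (hy : y ∈ F.dom)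
    (hin : y ∈ F.inner ∨ F.e = 1) (hy' : F.br y - F'.p ∈ F'.dom) (hpt : ∀ i, F.br y ≠ D.pts i) :
    Φ F y = Φ F' (F.br y - F'.p) := by
  classical
  have hbr' : ∀ t, F'.br (F.br t - F'.p) = F.br t := fun t => by simp [LocalLift.br, he]
  let S' : Finset ℂ := S ∪ Finset.univ.image D.pts
  have hS' : ∀ z, z ∉ S' → z ∉ S ∧ ∀ i, z ≠ D.pts i := fun z hz => by
    simp only [S', Finset.mem_union, Finset.mem_image, Finset.mem_univ, true_and, not_or,
      not_exists] at hz
    exact ⟨hz.1, fun i h => hz.2 i h.symm⟩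
  let A := F.inner ∩ (F.br ⁻¹' S')ᶜ
  have hA : (𝓝[A] y).NeBot := mem_closure_iff_nhdsWithin_neBot.1 (F.mem_closure_inner_diff hy hin S')
  have hAsub : A ⊆ {y | y ∈ F.dom ∧ ∀ i, F.br y ≠ D.pts i} := fun t ht =>
    ⟨F.inner_subset_dom ht.1, (hS' _ ht.2).2⟩
  have hβ : Filter.Tendsto (fun t => F.br t - F'.p) (𝓝 y) (𝓝 (F.br y - F'.p)) :=
    ((F.continuous_br.sub continuous_const).tendsto y)
  have hev : ∀ᶠ t in 𝓝[A] y, F.br t - F'.p ∈ F'.inner := by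
    filter_upwards [self_mem_nhdsWithin, nhdsWithin_le_nhds
      (hβ.norm.eventually (gt_mem_nhds hy'.1))] with t h1 h2
    exact ⟨h2, by rw [hbr']; exact h1.1.2⟩
  have h1 : Filter.Tendsto (Φ F) (𝓝[A] y) (𝓝 (Φ F y)) := (hc F y ⟨hy, hpt⟩).mono hAsub
  have h2 : Filter.Tendsto (fun t => Φ F' (F.br t - F'.p)) (𝓝[A] y) (𝓝 (Φ F' (F.br y - F'.p))) := by
    have h3 := hc F' (F.br y - F'.p) ⟨hy', fun i => by rw [hbr']; exact hpt i⟩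
    refine Filter.Tendsto.comp (g := Φ F') h3 (tendsto_nhdsWithin_iff.2
      ⟨hβ.mono_left nhdsWithin_le_nhds, ?_⟩)
    filter_upwards [hev, self_mem_nhdsWithin] with t k1 k2
    exact ⟨F'.inner_subset_dom k1, fun i => by rw [hbr']; exact (hS' _ k2.2).2 i⟩
  refine tendsto_nhds_unique (h1.congr' ?_) h2
  filter_upwards [hev, self_mem_nhdsWithin] with t k1 k2
  exact hinv F F' he t k2.1 k1 (hS' _ k2.2).1

end LabeledPolytope

/-! ### Elementary modifications along the zeros -/

/-- Given vectors `b j`, any `n` of which belonging to an index set in `𝒞` form a basis, and points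
`A q` labelled by indices `J q`, there is a matrix function `G` such that `G b_j` is divisible by
the polynomial `∏ (z - A q)` over the `q` with label `j`, the quotients `h j` still having the basis
property wherever the labels of the points at `z` belong to the index set. This is the process of
elementary modifications: each new point is inserted by means of the projection onto the line spanned
by the vector that is to become divisible. -/
theorem exists_elementary_modification {ι : Type*} {n m : ℕ} (J : ι → Fin m) (A : ι → ℂ)
    (b : Fin m → Fin n → ℂ) (𝒞 : Set (Fin n ↪ Fin m))
    (hb : ∀ s ∈ 𝒞, LinearIndependent ℂ fun l => b (s l)) (T : Finset ι)
    (hex : ∀ q ∈ T, ∃ s ∈ 𝒞, ∀ q' ∈ T, A q' = A q → J q' ∈ Set.range s) :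
    ∃ (G : ℂ → Matrix (Fin n) (Fin n) ℂ) (h : Fin m → ℂ → Fin n → ℂ),
      (∀ j, Differentiable ℂ (h j)) ∧
      (∀ j z, (G z).mulVec (b j) = (∏ q ∈ T, if J q = j then z - A q else 1) • h j z) ∧
      ∀ z, ∀ s ∈ 𝒞, (∀ q ∈ T, A q = z → J q ∈ Set.range s) →
        LinearIndependent ℂ fun l => h (s l) z := by
  classical
  induction T using Finset.induction_on with
  | empty => exact ⟨fun _ => 1, fun j _ => b j, fun j => differentiable_const _, by simp,
      fun z s hs _ => hb s hs⟩
  | insert q₀ T hq₀ ih =>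
    obtain ⟨G, h, hd, hG, hli⟩ := ih fun q hq => by
      obtain ⟨s, hs, h⟩ := hex q (Finset.mem_insert_of_mem hq)
      exact ⟨s, hs, fun q' hq' => h q' (Finset.mem_insert_of_mem hq')⟩
    obtain ⟨s₀, hs₀, hs₀'⟩ := hex q₀ (Finset.mem_insert_self _ _)
    set j₀ := J q₀ with hj₀
    set α := A q₀ with hα
    obtain ⟨l₀, hl₀⟩ := hs₀' q₀ (Finset.mem_insert_self _ _) rfl
    set v := h j₀ α with hv
    have hv0 : v ≠ 0 := by
      have := (hli α s₀ hs₀ fun q hq hqa => hs₀' q (Finset.mem_insert_of_mem hq) hqa).ne_zero l₀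
      simpa only [hl₀] using this
    obtain ⟨r, hr⟩ : ∃ r, v r ≠ 0 := by
      by_contra! hcon
      exact hv0 (funext hcon)
    -- `K z = (1 - Π) + (z - α) Π`, with `Π` the projection to the line spanned by `v`
    let K : ℂ → (Fin n → ℂ) → Fin n → ℂ := fun z x => x + ((z - α - 1) * (x r / v r)) • v
    let Km : ℂ → Matrix (Fin n) (Fin n) ℂ := fun z =>
      1 + Matrix.vecMulVec ((z - α - 1) • v) (Pi.single r (v r)⁻¹)
    have hKm : ∀ z x, (Km z).mulVec x = K z x := by
      intro z x
      simp only [Km, K]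
      rw [Matrix.add_mulVec, Matrix.one_mulVec, Matrix.vecMulVec_mulVec, single_dotProduct]
      ext l
      simp only [Pi.add_apply, Pi.smul_apply, smul_eq_mul, MulOpposite.smul_eq_mul_unop,
        MulOpposite.unop_op]
      ring
    let Ds := dslope (h j₀) α
    have hDs : Differentiable ℂ Ds := by
      rw [← differentiableOn_univ]
      exact (Complex.differentiableOn_dslope Filter.univ_mem).2 (hd j₀).differentiableOn
    have hDs' : ∀ z, h j₀ z = v + (z - α) • Ds z := fun z => by
      rw [sub_smul_dslope]; simp [v]
    -- `h' j₀` is the quotient of `K (h j₀)` by `z - α`, written by means of the difference quotient of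
    -- `h j₀`
    let h' : Fin m → ℂ → Fin n → ℂ := fun j z =>
      if j = j₀ then (h j z r / v r) • v + (Ds z - (Ds z r / v r) • v) else K z (h j z)
    have hh0 : ∀ z, h' j₀ z = (h j₀ z r / v r) • v + (Ds z - (Ds z r / v r) • v) := fun z =>
      if_pos rfl
    have hcoord : ∀ {u : ℂ → Fin n → ℂ}, Differentiable ℂ u → Differentiable ℂ fun z => u z r :=
      fun hu => differentiable_pi.1 hu r
    refine ⟨fun z => Km z * G z, h', fun j => ?_, fun j z => ?_, fun z s hs hall => ?_⟩
    · by_cases hj : j = j₀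
      · simp only [h', if_pos hj]
        exact (((hcoord (hd j)).div_const _).smul_const v).add
          (hDs.sub (((hcoord hDs).div_const _).smul_const v))
      · simp only [h', if_neg hj, K]
        refine (hd j).add (Differentiable.smul_const ?_ v)
        exact ((differentiable_id.sub_const α).sub_const 1).mul ((hcoord (hd j)).div_const _)
    · rw [← Matrix.mulVec_mulVec, hG, Matrix.mulVec_smul, hKm, Finset.prod_insert hq₀]
      by_cases hj : j = j₀
      · rw [if_pos (hj ▸ hj₀.symm), mul_comm, mul_smul]
        congr 1
        subst hj
        simp only [h', if_true]
        ext l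
        have e1 := congrFun (hDs' z) l
        have e2 := congrFun (hDs' z) r
        simp only [Pi.add_apply, Pi.smul_apply, smul_eq_mul, K, Pi.sub_apply] at e1 e2 ⊢
        rw [e1, e2]
        field_simp
        ring
      · rw [if_neg (fun h => hj (h.symm.trans hj₀.symm) : ¬ J q₀ = j), one_mul]
        simp only [h', if_neg hj]
    · have hold := hli z s hs fun q hq => hall q (Finset.mem_insert_of_mem hq)
      rw [Fintype.linearIndependent_iff] at hold ⊢
      intro e he
      -- off `α` the map `K` is invertible; at `α` its image is the kernel of the `r`-th coordinate, and
      -- `h' j₀`, whose `r`-th coordinate does not vanish, spans a complement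
      by_cases hz : z = α
      · obtain ⟨l₁, hl₁⟩ := hall q₀ (Finset.mem_insert_self _ _) hz.symm
        have hv' : h (s l₁) z = v := by rw [hl₁, hz]
        have hne : ∀ l, l ≠ l₁ → s l ≠ j₀ := fun l hl h => hl (s.injective (h.trans hl₁.symm))
        have hsum : ∀ i, ∑ l, e l * h' (s l) z i = 0 := fun i => by
          have := congrFun he i
          simpa [Finset.sum_apply] using this
        let x : Fin n → ℂ := ∑ l ∈ Finset.univ.erase l₁, e l • h (s l) z
        have hx : ∀ i, x i = ∑ l ∈ Finset.univ.erase l₁, e l * h (s l) z i := fun i => by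
          simp [x, Finset.sum_apply]
        have hsum' : ∀ i, e l₁ * (v i + (Ds z i - Ds z r / v r * v i)) +
            (x i - x r / v r * v i) = 0 := by
          intro i
          rw [← hsum i, ← Finset.add_sum_erase _ _ (Finset.mem_univ l₁)]
          congr 1
          · rw [hl₁, hh0, show h j₀ z = v by rw [hz]]
            simp [div_self hr]
          · rw [hx, hx, Finset.sum_div, Finset.sum_mul, ← Finset.sum_sub_distrib]
            refine Finset.sum_congr rfl fun l hl => ?_
            simp only [h', if_neg (hne l (Finset.ne_of_mem_erase hl)), K, hz, Pi.add_apply,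
              Pi.smul_apply, smul_eq_mul]
            ring
        have hel : e l₁ = 0 := by
          have := hsum' r
          rw [div_mul_cancel₀ _ hr, div_mul_cancel₀ _ hr, sub_self, sub_self, add_zero, add_zero]
            at this
          exact (mul_eq_zero.1 this).resolve_right hr
        have h3 := hold (Function.update e l₁ (-(x r / v r))) (by
          rw [← Finset.add_sum_erase _ _ (Finset.mem_univ l₁), Function.update_self, hv']
          have : ∑ l ∈ Finset.univ.erase l₁, Function.update e l₁ (-(x r / v r)) l • h (s l) z = x :=
            Finset.sum_congr rfl fun l hl => by
              rw [Function.update_of_ne (Finset.ne_of_mem_erase hl)]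
          rw [this]
          ext i
          have := hsum' i
          rw [hel] at this
          simp only [Pi.add_apply, Pi.smul_apply, smul_eq_mul, Pi.zero_apply]
          linear_combination this)
        intro l
        by_cases hl : l = l₁
        · rw [hl, hel]
        · have := h3 l
          rwa [Function.update_of_ne hl] at this
      · have hz' : z - α ≠ 0 := sub_ne_zero.2 hz
        let e' : Fin n → ℂ := fun l => if s l = j₀ then e l / (z - α) else e l
        have hK : ∀ l, e l • h' (s l) z = e' l • K z (h (s l) z) := by
          intro l
          by_cases hl : s l = j₀
          · simp only [e', if_pos hl]
            rw [hl, hh0]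
            ext i
            have e1 := congrFun (hDs' z) i
            have e2 := congrFun (hDs' z) r
            simp only [Pi.add_apply, Pi.smul_apply, smul_eq_mul, K, Pi.sub_apply] at e1 e2 ⊢
            rw [e1, e2]
            field_simp
            ring
          · simp only [h', e', if_neg hl]
        have hlin : ∑ l, e' l • K z (h (s l) z) = K z (∑ l, e' l • h (s l) z) := by
          simp only [← hKm, Matrix.mulVec_sum, Matrix.mulVec_smul]
        have h0 : K z (∑ l, e' l • h (s l) z) = 0 := by
          rw [← hlin, ← he]
          exact Finset.sum_congr rfl fun l _ => (hK l).symm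
        have hx0 : ∑ l, e' l • h (s l) z = 0 := by
          generalize (∑ l, e' l • h (s l) z) = x at h0
          have h1 : x r = 0 := by
            have := congrFun h0 r
            simp only [K, Pi.add_apply, Pi.smul_apply, smul_eq_mul, Pi.zero_apply] at this
            have h2 : (z - α) * x r = 0 := by
              field_simp at this
              linear_combination this
            exact (mul_eq_zero.1 h2).resolve_left hz'
          simpa [K, h1] using h0
        intro l
        have := hold e' hx0 l
        simp only [e'] at this
        split_ifs at this
        · exact (div_eq_zero_iff.1 this).resolve_right hz'
        · exact this

/-! ### Trivializations of the desingularized bundle -/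

theorem continuousWithinAt_matrix_inv {n : ℕ} {X : Type*} [TopologicalSpace X]
    {M : X → Matrix (Fin n) (Fin n) ℂ} {s : Set X} {x : X} (hM : ContinuousWithinAt M s x)
    (h : (M x).det ≠ 0) : ContinuousWithinAt (fun y => (M y)⁻¹) s x := by
  simp only [Matrix.inv_def, Ring.inverse_eq_inv']
  have hdet : Continuous fun N : Matrix (Fin n) (Fin n) ℂ => N.det := continuous_id.matrix_det
  have hadj : Continuous fun N : Matrix (Fin n) (Fin n) ℂ => N.adjugate :=
    continuous_id.matrix_adjugate
  exact (ContinuousWithinAt.inv₀ (hdet.continuousAt.comp_continuousWithinAt hM) h).smul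
    (hadj.continuousAt.comp_continuousWithinAt hM)

namespace LabeledPolytope

variable {n m k : ℕ} {P : LabeledPolytope n m} {D : MarkedOrbiDisc k} {w : ℂ → P.X}
  {z₀ : Fin m → ℂ} {ν : Fin k → Fin n → ℤ} {c : Fin k → Fin m → ℚ}
  {d : Fin m → ℕ} {α : (j : Fin m) → Fin (d j) → ℂ} {a : Fin m → ℂ}

/-- The monic polynomial with the zeros `α j s`. -/
noncomputable def zeroPoly (α : (j : Fin m) → Fin (d j) → ℂ) (j : Fin m) (z : ℂ) : ℂ :=
  ∏ s, (z - α j s)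

theorem zeroPoly_eq_zero_iff {j : Fin m} {z : ℂ} : zeroPoly α j z = 0 ↔ ∃ s, z = α j s := by
  simp [zeroPoly, Finset.prod_eq_zero_iff, sub_eq_zero]

theorem analyticAt_zeroPoly (j : Fin m) (z : ℂ) : AnalyticAt ℂ (zeroPoly α j) z :=
  Finset.analyticAt_fun_prod _ fun _ _ => analyticAt_id.sub analyticAt_const

theorem zeroPoly_ne_zero_of_notMem {z : ℂ} (hz : z ∉ exceptional D α) (j : Fin m) :
    zeroPoly α j z ≠ 0 := by
  rw [Ne, zeroPoly_eq_zero_iff]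
  exact fun ⟨s, h⟩ => ne_zeros_of_notMem hz j s h

theorem zeroPoly_eq_prod (j : Fin m) (z : ℂ) : zeroPoly α j z =
    ∏ q : (j : Fin m) × Fin (d j), if q.1 = j then z - α q.1 q.2 else 1 := by
  rw [Fintype.prod_sigma, Finset.prod_eq_single j]
  · simp [zeroPoly]
  · intro i _ hi; simp [hi]
  · simp

theorem Chart.continuousAt_offLog (hα : ∀ j s, α j s ∈ Metric.ball (0 : ℂ) 1) (ha : ∀ j, a j ≠ 0)
    (s : P.Chart) {z : ℂ} (hz : z ∈ Metric.closedBall (0 : ℂ) 1)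
    (hW : ∀ j, j ∉ Set.range s.ray → blaschkeMap D.pts c d α a z j ≠ 0) (l : Fin n) :
    ContinuousAt (fun z => s.offLog (blaschkeMap D.pts c d α a z) l) z := by
  unfold Chart.offLog
  refine tendsto_finsetSum _ fun j _ => ?_
  by_cases hj : j ∈ Set.range s.ray
  · simp only [if_pos hj]; exact tendsto_const_nhds
  · simp only [if_neg hj]
    refine Filter.Tendsto.mul_const _ ?_
    obtain ⟨V, hV, hn, -⟩ := exists_coord_log hα ha hz (hW j hj)
    have h1 : ContinuousAt (fun z => (V z).re) z :=
      Complex.continuous_re.continuousAt.comp hV.continuousAt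
    refine h1.congr ?_
    filter_upwards [hn] with z' h
    rw [h, Real.log_exp]

/-- The modulus of the standard form divided by the moduli of the polynomials `zeroPoly`. -/
noncomputable def normQuot (D : MarkedOrbiDisc k) (c : Fin k → Fin m → ℚ)
    (α : (j : Fin m) → Fin (d j) → ℂ) (a : Fin m → ℂ) (j : Fin m) (z : ℂ) : ℝ :=
  ‖a j‖ * (∏ s, ‖1 - conj (α j s) * z‖⁻¹) * ∏ i, ‖blaschke (D.pts i) z‖ ^ ((c i j : ℚ) : ℝ)

theorem norm_blaschkeMap (z : ℂ) (j : Fin m) :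
    ‖blaschkeMap D.pts c d α a z j‖ = ‖zeroPoly α j z‖ * normQuot D c α a j z := by
  have h1 : ∀ i, ‖blaschke (D.pts i) z ^ ((c i j : ℚ) : ℂ)‖ =
      ‖blaschke (D.pts i) z‖ ^ ((c i j : ℚ) : ℝ) := fun i => by
    have e1 : ((c i j : ℚ) : ℂ) = (((c i j : ℚ) : ℝ) : ℂ) := by push_cast; rfl
    rw [e1, Complex.norm_cpow_real]
  simp only [blaschkeMap, normQuot, zeroPoly, norm_mul, norm_prod, h1]
  have h2 : ∏ s, ‖blaschke (α j s) z‖ =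
      (∏ s, ‖z - α j s‖) * ∏ s, ‖1 - conj (α j s) * z‖⁻¹ := by
    rw [← Finset.prod_mul_distrib]
    exact Finset.prod_congr rfl fun s _ => by rw [blaschke, norm_div, div_eq_mul_inv]
  rw [h2]
  ring

theorem continuousAt_normQuot (hα : ∀ j s, α j s ∈ Metric.ball (0 : ℂ) 1) {z : ℂ}
    (hz : z ∈ Metric.closedBall (0 : ℂ) 1) (hp : ∀ i, z ≠ D.pts i) (j : Fin m) :
    ContinuousAt (normQuot D c α a j) z := by
  refine ContinuousAt.mul (ContinuousAt.mul continuousAt_const ?_) ?_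
  · refine tendsto_finsetProd _ fun s _ => ?_
    refine ContinuousAt.inv₀ ?_ (norm_ne_zero_iff.2 (one_sub_conj_mul_ne_zero (hα j s) hz))
    fun_prop
  · refine tendsto_finsetProd _ fun i _ => ?_
    refine ContinuousAt.rpow_const (analyticAt_blaschke (D.pts_mem i) hz).continuousAt.norm
      (Or.inl (norm_ne_zero_iff.2 ?_))
    rw [Ne, blaschke_eq_zero_iff (D.pts_mem i) hz]
    exact hp i

theorem normQuot_pos (hα : ∀ j s, α j s ∈ Metric.ball (0 : ℂ) 1) (ha : ∀ j, a j ≠ 0) {z : ℂ}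
    (hz : z ∈ Metric.closedBall (0 : ℂ) 1) (hp : ∀ i, z ≠ D.pts i) (j : Fin m) :
    0 < normQuot D c α a j z := by
  refine mul_pos (mul_pos (norm_pos_iff.2 (ha j)) (Finset.prod_pos fun s _ => ?_))
    (Finset.prod_pos fun i _ => ?_)
  · exact inv_pos.2 (norm_pos_iff.2 (one_sub_conj_mul_ne_zero (hα j s) hz))
  · refine Real.rpow_pos_of_pos (norm_pos_iff.2 ?_) _
    rw [Ne, blaschke_eq_zero_iff (D.pts_mem i) hz]
    exact hp i

/-- The quotient of the `l`-th coordinate of a lift by the corresponding polynomial, extended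
continuously across the zeros. -/
noncomputable def LocalLift.zeroQuot (α : (j : Fin m) → Fin (d j) → ℂ) (F : P.LocalLift D w)
    (l : Fin n) (y : ℂ) : ℂ :=
  open Classical in
  if zeroPoly α (F.chart.ray l) (F.br y) = 0 then
    Filter.limUnder (𝓝[≠] y) fun t => F.f t l / zeroPoly α (F.chart.ray l) (F.br t)
  else F.f y l / zeroPoly α (F.chart.ray l) (F.br y)

theorem LocalLift.eventually_br_notMem (F : P.LocalLift D w) (y : ℂ) (S : Finset ℂ) :
    ∀ᶠ t in 𝓝[≠] y, F.br t ∉ S := by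
  have h : (F.br ⁻¹' S \ {y})ᶜ ∈ 𝓝 y :=
    ((F.finite_preimage_br S).subset Set.sdiff_subset).isClosed.isOpen_compl.mem_nhds (by simp)
  filter_upwards [nhdsWithin_le_nhds h, self_mem_nhdsWithin] with t h1 h2 h3
  exact h1 ⟨h3, h2⟩

theorem LocalLift.eventually_zeroPoly_ne_zero (F : P.LocalLift D w) (y : ℂ) (j : Fin m) :
    ∀ᶠ t in 𝓝[≠] y, zeroPoly α j (F.br t) ≠ 0 :=
  (F.eventually_br_notMem y (exceptional D α)).mono fun _ h => zeroPoly_ne_zero_of_notMem h j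

namespace IsStandardForm

/-- At an unmarked point a coordinate of a lift is `zeroPoly` times the continuous nonvanishing function
`zeroQuot`: the quotient of their moduli is continuous and positive, also at the zeros. -/
theorem zeroQuot_spec (hst : P.IsStandardForm z₀ D w ν c d α a) (ha : ∀ j, a j ≠ 0)
    (F : P.LocalLift D w) (l : Fin n) {y : ℂ} (hy : y ∈ F.dom) (hp : ∀ i, F.br y ≠ D.pts i) :
    ContinuousWithinAt (F.zeroQuot α l) F.dom y ∧ F.zeroQuot α l y ≠ 0 ∧
      F.f y l = zeroPoly α (F.chart.ray l) (F.br y) * F.zeroQuot α l y := by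
  by_cases h0 : zeroPoly α (F.chart.ray l) (F.br y) = 0
  · have hin : y ∈ F.inner := by
      obtain ⟨s, hs⟩ := zeroPoly_eq_zero_iff.1 h0
      refine ⟨hy.1, ?_⟩
      rw [hs]
      exact hst.zeros_mem _ _
    have hN : AnalyticAt ℂ (fun t => zeroPoly α (F.chart.ray l) (F.br t)) y :=
      (analyticAt_zeroPoly _ _).comp (F.analyticAt_br y)
    have hψ : ContinuousAt (fun t => normQuot D c α a (F.chart.ray l) (F.br t) *
        Real.exp (F.chart.offLog (blaschkeMap D.pts c d α a (F.br t)) l)) y := by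
      refine ContinuousAt.mul ?_ (Real.continuous_exp.continuousAt.comp ?_)
      · exact ContinuousAt.comp (f := F.br) (continuousAt_normQuot hst.zeros_mem hy.2 hp _)
          F.continuous_br.continuousAt
      · exact ContinuousAt.comp (f := F.br) (F.chart.continuousAt_offLog hst.zeros_mem ha hy.2
          (fun j hj => hst.ne_zero_of_notMem F hy hj) l) F.continuous_br.continuousAt
    obtain ⟨g, hg, hg0, hfg⟩ := exists_analyticAt_factor (F.analyticAt_apply hin l) hN
      (F.eventually_zeroPoly_ne_zero y _) hψ
      (mul_pos (normQuot_pos hst.zeros_mem ha hy.2 hp _) (Real.exp_pos _)) (by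
        filter_upwards [F.isOpen_inner.mem_nhds hin] with t ht
        rw [hst.norm_f F (F.inner_subset_dom ht), norm_blaschkeMap, mul_assoc])
    have hlim : ∀ᶠ t in 𝓝[≠] y, F.zeroQuot α l t = g t := by
      filter_upwards [nhdsWithin_le_nhds hfg, F.eventually_zeroPoly_ne_zero y (F.chart.ray l)]
        with t h1 h2
      rw [LocalLift.zeroQuot, if_neg h2, h1, mul_div_cancel_left₀ _ h2]
    have hval : F.zeroQuot α l y = g y := by
      rw [LocalLift.zeroQuot, if_pos h0]
      refine Filter.Tendsto.limUnder_eq ?_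
      refine (hg.continuousAt.tendsto.mono_left nhdsWithin_le_nhds).congr' ?_
      filter_upwards [nhdsWithin_le_nhds hfg, F.eventually_zeroPoly_ne_zero y (F.chart.ray l)]
        with t h1 h2
      rw [h1, mul_div_cancel_left₀ _ h2]
    refine ⟨?_, hval ▸ hg0, ?_⟩
    · have : ContinuousAt (F.zeroQuot α l) y := by
        refine hg.continuousAt.congr ?_
        have := eventually_nhdsWithin_iff.1 hlim
        filter_upwards [this] with t ht
        by_cases hty : t = y
        · rw [hty, hval]
        · exact (ht hty).symm
      exact this.continuousWithinAt
    · rw [hval]; exact hfg.self_of_nhds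
  · have hc : ContinuousAt (fun t => zeroPoly α (F.chart.ray l) (F.br t)) y :=
      ((analyticAt_zeroPoly _ _).comp (F.analyticAt_br y)).continuousAt
    have hev : ∀ᶠ t in 𝓝 y, F.zeroQuot α l t = F.f t l / zeroPoly α (F.chart.ray l) (F.br t) :=
      (hc.eventually_ne h0).mono fun t ht => if_neg ht
    have hval := hev.self_of_nhds
    refine ⟨?_, ?_, ?_⟩
    · exact (ContinuousWithinAt.div (F.continuousOn_apply l y hy) hc.continuousWithinAt
        h0).congr_of_eventuallyEq (nhdsWithin_le_nhds hev) hval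
    · rw [hval]
      refine div_ne_zero ?_ h0
      rw [Ne, hst.f_eq_zero_iff F hy, ← norm_eq_zero, norm_blaschkeMap, mul_eq_zero, norm_eq_zero]
      rintro (h | h)
      · exact h0 h
      · exact (normQuot_pos hst.zeros_mem ha hy.2 hp _).ne' h
    · rw [hval, mul_div_cancel₀ _ h0]

/-- The weights of the local group on the fibre over a marked point. -/
theorem exists_isWeights (hst : P.IsStandardForm z₀ D w ν c d α a) (ha : ∀ j, a j ≠ 0)
    (F : P.LocalLift D w) {i : Fin k} (hi : F.p = D.pts i) :
    ∃ μ : Fin n → ℕ, IsWeights F μ ∧ ∀ l, (μ l : ℚ) = F.e * c i (F.chart.ray l) := by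
  have he : (0 : ℚ) < F.e := by exact_mod_cast F.e_pos
  have hdvd : sectorOrder (c i) ∣ F.e := by
    rw [F.localOrder.eq_ord hi]; exact hst.order_dvd i
  choose μ hμ using fun l => exists_nat_eq_mul_of_sectorOrder_dvd hdvd
    ((hst.boxCoeff i).1 (F.chart.ray l)).1
  refine ⟨μ, fun l => ⟨?_, fun y hy => ?_⟩, hμ⟩
  · have h1 : (μ l : ℚ) < F.e := by
      rw [hμ]
      exact mul_lt_of_lt_one_right he ((hst.boxCoeff i).1 _).2
    exact_mod_cast h1
  · have h1 := hst.f_gen_pow_mul ha F hi 1 hy l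
    rw [pow_one] at h1
    rw [h1, LocalLift.gen, ← Complex.exp_nat_mul]
    congr 2
    have h2 : (μ l : ℂ) = F.e * c i (F.chart.ray l) := by exact_mod_cast congrArg (Rat.cast (K := ℂ)) (hμ l)
    have h3 : (F.e : ℂ) ≠ 0 := by exact_mod_cast F.e_pos.ne'
    rw [h2]
    push_cast
    field_simp

end IsStandardForm

end LabeledPolytope

namespace LabeledPolytope

variable {n m k : ℕ} {P : LabeledPolytope n m} {D : MarkedOrbiDisc k} {w : ℂ → P.X}
  {z₀ : Fin m → ℂ} {ν : Fin k → Fin n → ℤ} {c : Fin k → Fin m → ℚ}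
  {d : Fin m → ℕ} {α : (j : Fin m) → Fin (d j) → ℂ} {a : Fin m → ℂ}

theorem analyticAt_jac {F : P.LocalLift D w} {y : ℂ} {φ : (Fin n → ℂ) → Fin n → ℂ}
    (hy : y ∈ F.inner) (hφ : AnalyticAt ℂ φ (F.f y)) (l r : Fin n) :
    AnalyticAt ℂ (fun t => jac φ (F.f t) l r) y := by
  have h1 : AnalyticAt ℂ (fun t => fderiv ℂ φ (F.f t)) y :=
    AnalyticAt.fun_comp hφ.fderiv (F.analyticAt hy)
  let E : ((Fin n → ℂ) →L[ℂ] (Fin n → ℂ)) →L[ℂ] ℂ :=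
    (ContinuousLinearMap.proj (R := ℂ) (φ := fun _ : Fin n => ℂ) l).comp
      (ContinuousLinearMap.apply ℂ (Fin n → ℂ) (Pi.single r (1 : ℂ) : Fin n → ℂ))
  exact AnalyticAt.fun_comp (E.analyticAt _) h1

theorem continuousAt_jac {F : P.LocalLift D w} {y : ℂ} {φ : (Fin n → ℂ) → Fin n → ℂ}
    (hy : y ∈ F.inner) (hφ : AnalyticAt ℂ φ (F.f y)) :
    ContinuousAt (fun t => jac φ (F.f t)) y :=
  continuousAt_pi.2 fun l => continuousAt_pi.2 fun r => (analyticAt_jac hy hφ l r).continuousAt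

theorem Chart.matrix_ext (s : P.Chart) {M N : Matrix (Fin n) (Fin n) ℂ}
    (h : ∀ l, M.mulVec (fun x => (P.b (s.ray l) x : ℂ)) = N.mulVec fun x => (P.b (s.ray l) x : ℂ)) :
    M = N := by
  have hdet : (s.mat.map (algebraMap ℚ ℂ)).det ≠ 0 := by
    have := RingHom.map_det (algebraMap ℚ ℂ) s.mat
    intro h0
    exact s.det_mat_ne_zero ((map_eq_zero (algebraMap ℚ ℂ)).1 (this.trans h0))
  have h1 : ∀ r, M r - N r = 0 := fun r => by
    refine Matrix.eq_zero_of_mulVec_eq_zero hdet ?_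
    ext l
    have := congrFun (h l) r
    simp only [Matrix.mulVec, dotProduct] at this
    simp [Matrix.mulVec, dotProduct, Chart.mat, mul_sub, Finset.sum_sub_distrib,
      mul_comm _ (M r _), mul_comm _ (N r _), this]
  ext r x
  exact congrFun (sub_eq_zero.1 (h1 r)) x

/-- The matrix with columns `h (s l) z`. -/
def colMat {m : ℕ} (h : Fin m → ℂ → Fin n → ℂ) (s : Fin n ↪ Fin m) (z : ℂ) :
    Matrix (Fin n) (Fin n) ℂ := Matrix.of fun r l => h (s l) z r

theorem det_colMat_ne_zero {h : Fin m → ℂ → Fin n → ℂ} {s : Fin n ↪ Fin m} {z : ℂ}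
    (hli : LinearIndependent ℂ fun l => h (s l) z) : (colMat h s z).det ≠ 0 := by
  have h1 : LinearIndependent ℂ (colMat h s z).col := hli
  exact ((Matrix.isUnit_iff_isUnit_det _).1 (Matrix.linearIndependent_cols_iff_isUnit.1 h1)).ne_zero

theorem continuous_colMat {h : Fin m → ℂ → Fin n → ℂ} (hd : ∀ j, Differentiable ℂ (h j))
    (s : Fin n ↪ Fin m) : Continuous (colMat h s) :=
  continuous_pi fun r => continuous_pi fun l => (continuous_apply r).comp (hd (s l)).continuous

theorem colMat_inv_mulVec {h : Fin m → ℂ → Fin n → ℂ} {s : Fin n ↪ Fin m} {z : ℂ}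
    (hdet : (colMat h s z).det ≠ 0) (l : Fin n) :
    (colMat h s z)⁻¹.mulVec (h (s l) z) = Pi.single l 1 := by
  have h1 : h (s l) z = (colMat h s z).mulVec (Pi.single l 1) := by
    rw [Matrix.mulVec_single_one]; rfl
  rw [h1, Matrix.mulVec_mulVec, Matrix.nonsing_inv_mul _ (isUnit_iff_ne_zero.2 hdet),
    Matrix.one_mulVec]

namespace IsStandardForm

theorem blaschkeMap_zeros_eq_zero {j : Fin m} (s : Fin (d j)) :
    blaschkeMap D.pts c d α a (α j s) j = 0 := by
  rw [← norm_eq_zero, norm_blaschkeMap, zeroPoly_eq_zero_iff.2 ⟨s, rfl⟩, norm_zero, zero_mul]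

theorem mem_range_of_eq_zeros (hst : P.IsStandardForm z₀ D w ν c d α a) (F : P.LocalLift D w)
    {y : ℂ} (hy : y ∈ F.dom) {j : Fin m} {s : Fin (d j)} (h : α j s = F.br y) :
    j ∈ Set.range F.chart.ray := by
  by_contra hj
  refine hst.ne_zero_of_notMem F hy hj ?_
  rw [← h]
  exact blaschkeMap_zeros_eq_zero s

/-- Vector functions `h j` and a matrix function as provided by the elementary modifications at all
the zeros `α j s`. -/
theorem exists_modification (hst : P.IsStandardForm z₀ D w ν c d α a) (ha : ∀ j, a j ≠ 0) :
    ∃ (G : ℂ → Matrix (Fin n) (Fin n) ℂ) (h : Fin m → ℂ → Fin n → ℂ),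
      (∀ j, Differentiable ℂ (h j)) ∧
      (∀ j z, (G z).mulVec (fun x => (P.b j x : ℂ)) = zeroPoly α j z • h j z) ∧
      ∀ F : P.LocalLift D w, ∀ y ∈ F.dom, (colMat h F.chart.ray (F.br y)).det ≠ 0 := by
  obtain ⟨G, h, h1, h2, h3⟩ := exists_elementary_modification
    (ι := (j : Fin m) × Fin (d j)) (fun q => q.1) (fun q => α q.1 q.2)
    (fun j x => (P.b j x : ℂ)) {r | ∃ s : P.Chart, s.ray = r} (by
      rintro _ ⟨s, rfl⟩
      rw [Fintype.linearIndependent_iff]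
      intro g hg l
      refine congrFun (s.eq_zero_of_sum (x := g) fun b => ?_) l
      simpa [Finset.sum_apply] using congrFun hg b) Finset.univ (by
      rintro ⟨j, s⟩ -
      obtain ⟨F, hF⟩ := exists_localLift hst ha (Metric.ball_subset_closedBall (hst.zeros_mem j s))
      refine ⟨F.chart.ray, ⟨F.chart, rfl⟩, ?_⟩
      rintro ⟨j', s'⟩ - h
      exact hst.mem_range_of_eq_zeros F F.zero_mem_dom (s := s') (h.trans (by rw [F.br_zero, hF])))
  refine ⟨G, h, h1, fun j z => by rw [h2, zeroPoly_eq_prod], fun F y hy => ?_⟩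
  refine det_colMat_ne_zero (h3 _ _ ⟨F.chart, rfl⟩ ?_)
  rintro ⟨j, s⟩ - h
  exact hst.mem_range_of_eq_zeros F hy h

/-- At a marked point the quotient `zeroQuot` is a monomial, with the weight of the local group as
its exponent, times a continuous nonvanishing function on the disc. -/
theorem exists_zeroQuot_eq_of_marked (hst : P.IsStandardForm z₀ D w ν c d α a) (ha : ∀ j, a j ≠ 0)
    (F : P.LocalLift D w) {i : Fin k} (hi : F.p = D.pts i) (l : Fin n) {μ : ℕ}
    (hμ : (μ : ℚ) = F.e * c i (F.chart.ray l)) :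
    ∃ u : ℂ → ℂ, ContinuousAt u 0 ∧ u 0 ≠ 0 ∧
      ∀ᶠ y in 𝓝[≠] (0 : ℂ), F.zeroQuot α l y = y ^ μ * u (y ^ F.e) := by
  classical
  have hp : F.p ∈ Metric.ball (0 : ℂ) 1 := mem_ball_of_eq_pts hi
  obtain ⟨κ, g, hκ, hg, hg0, hf⟩ := hst.exists_f_eq ha F hp l
  set Z := zeroCount α F.p (F.chart.ray l) with hZ
  have hκμ : κ = μ + F.e * Z := by
    have h1 : ramExp D c F.p (F.chart.ray l) = c i (F.chart.ray l) := by rw [hi, ramExp_pts]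
    rw [h1, mul_add, ← hμ] at hκ
    exact_mod_cast hκ
  let Q : ℂ → ℂ := fun ζ => ∏ s, if F.p = α (F.chart.ray l) s then 1 else
    F.p + ζ - α (F.chart.ray l) s
  have hQc : Continuous Q := by
    refine continuous_finsetProd _ fun s _ => ?_
    split_ifs
    · exact continuous_const
    · fun_prop
  have hQ0 : Q 0 ≠ 0 := by
    refine Finset.prod_ne_zero_iff.2 fun s _ => ?_
    split_ifs with h
    · exact one_ne_zero
    · rw [add_zero]; exact sub_ne_zero.2 h
  have hQ : ∀ ζ, zeroPoly α (F.chart.ray l) (F.p + ζ) = ζ ^ Z * Q ζ := by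
    intro ζ
    have h1 : ζ ^ Z = ∏ s, if F.p = α (F.chart.ray l) s then ζ else 1 := by
      rw [hZ, zeroCount, Finset.prod_ite, Finset.prod_const, Finset.prod_const_one, mul_one]
    rw [h1, ← Finset.prod_mul_distrib]
    refine Finset.prod_congr rfl fun s _ => ?_
    split_ifs with h
    · rw [mul_one, ← h, add_sub_cancel_left]
    · rw [one_mul]
  have hroot : Filter.Tendsto (fun ζ : ℂ => ζ ^ ((F.e : ℂ)⁻¹)) (𝓝 0) (𝓝 0) := by
    have h1 : Filter.Tendsto (fun ζ : ℂ => F.p + ζ) (𝓝 0) (𝓝 F.p) := by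
      have : Continuous fun ζ : ℂ => F.p + ζ := by fun_prop
      simpa using this.tendsto 0
    have h2 := F.tendsto_root.comp h1
    simpa [Function.comp_def] using h2
  have hr0 : (0 : ℂ) ^ ((F.e : ℂ)⁻¹) = 0 :=
    Complex.zero_cpow (inv_ne_zero (by exact_mod_cast F.e_pos.ne'))
  -- `g` is invariant under the local group, so that any branch of the root may be used
  refine ⟨fun ζ => g (ζ ^ ((F.e : ℂ)⁻¹)) / Q ζ, ?_, ?_, ?_⟩
  · refine ContinuousAt.div ?_ hQc.continuousAt hQ0
    refine ContinuousAt.comp (g := g) (f := fun ζ : ℂ => ζ ^ ((F.e : ℂ)⁻¹)) ?_ ?_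
    · rw [hr0]; exact hg.continuousAt
    · rw [ContinuousAt, hr0]; exact hroot
  · simp only [hr0]; exact div_ne_zero hg0 hQ0
  · have hpow : Filter.Tendsto (fun y : ℂ => y ^ F.e) (𝓝 0) (𝓝 0) := by
      have := (continuous_pow F.e : Continuous fun y : ℂ => y ^ F.e).tendsto 0
      rwa [zero_pow F.e_pos.ne'] at this
    have hdom : ∀ᶠ y in 𝓝 (0 : ℂ), y ∈ F.dom :=
      Filter.mem_of_superset (F.isOpen_inner.mem_nhds (F.mem_inner_zero hp)) F.inner_subset_dom
    filter_upwards [self_mem_nhdsWithin, nhdsWithin_le_nhds hf,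
      nhdsWithin_le_nhds ((hroot.comp hpow).eventually hf), nhdsWithin_le_nhds hdom,
      F.eventually_zeroPoly_ne_zero 0 (F.chart.ray l)] with y hy0 h1 h2 hyd h3
    have hy0' : y ≠ 0 := hy0
    simp only [Function.comp] at h2
    set y₁ := (y ^ F.e) ^ ((F.e : ℂ)⁻¹) with hy₁
    have hy₁e : y₁ ^ F.e = y ^ F.e := Complex.cpow_nat_inv_pow _ F.e_pos.ne'
    have hζ : (y₁ / y) ^ F.e = 1 := by
      rw [div_pow, hy₁e, div_self (pow_ne_zero _ hy0')]
    have hgy : g y₁ = g y := by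
      have h4 := F.f_gen_mul hp l hg hg0 hf hζ (hdom.mono fun t ht => hst.norm_f_mul F hζ ht l) hyd
      rw [div_mul_cancel₀ _ hy0', h2, h1, div_pow, ← mul_assoc,
        div_mul_cancel₀ _ (pow_ne_zero _ hy0')] at h4
      have hy₁0 : y₁ ≠ 0 := fun h => by
        rw [h, zero_pow F.e_pos.ne'] at hy₁e
        exact pow_ne_zero _ hy0' hy₁e.symm
      exact mul_left_cancel₀ (pow_ne_zero _ hy₁0) h4
    rw [LocalLift.zeroQuot, if_neg h3, hgy, h1]
    have h5 := hQ (y ^ F.e)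
    rw [show F.p + y ^ F.e = F.br y from rfl] at h5
    rw [h5] at h3 ⊢
    have h6 := left_ne_zero_of_mul h3
    have h7 := right_ne_zero_of_mul h3
    rw [hκμ, pow_add, pow_mul]
    field_simp

/-- The desingularized bundle has a global trivialization. -/
theorem nonempty_desingFrame (hst : P.IsStandardForm z₀ D w ν c d α a) (ha : ∀ j, a j ≠ 0) :
    Nonempty (DesingFrame D w) := by
  obtain ⟨G, h, hd, hG, hdet⟩ := hst.exists_modification ha
  let A : P.LocalLift D w → ℂ → Matrix (Fin n) (Fin n) ℂ := fun F y =>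
    Matrix.diagonal (fun l => F.zeroQuot α l y) * (colMat h F.chart.ray (F.br y))⁻¹
  have hcont : ∀ F : P.LocalLift D w, ∀ y ∈ F.dom, (∀ i, F.br y ≠ D.pts i) →
      ContinuousWithinAt (A F) F.dom y := by
    intro F y hy hp
    refine ContinuousWithinAt.mul ?_ (continuousWithinAt_matrix_inv ?_ (hdet F y hy))
    · refine continuous_id.matrix_diagonal.continuousAt.comp_continuousWithinAt ?_
      exact continuousWithinAt_pi.2 fun l => (hst.zeroQuot_spec ha F l hy hp).1
    · exact ((continuous_colMat hd _).comp F.continuous_br).continuousWithinAt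
  have hA0 : ∀ F : P.LocalLift D w, ∀ y ∈ F.dom, (∀ i, F.br y ≠ D.pts i) → (A F y).det ≠ 0 := by
    intro F y hy hp
    rw [Matrix.det_mul, Matrix.det_diagonal]
    refine mul_ne_zero (Finset.prod_ne_zero_iff.2 fun l _ => (hst.zeroQuot_spec ha F l hy hp).2.1) ?_
    exact (Matrix.isUnit_nonsing_inv_det _ (isUnit_iff_ne_zero.2 (hdet F y hy))).ne_zero
  -- the trivialization is the torus frame modified by the inverse of `G`, which is a function on the
  -- disc; hence it obeys the same transition rule as the torus frame
  have hAG : ∀ F : P.LocalLift D w, ∀ y ∈ F.dom, (∀ i, F.br y ≠ D.pts i) →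
      A F y * G (F.br y) = F.torusFrame y := by
    intro F y hy hp
    refine F.chart.matrix_ext fun l => ?_
    rw [← Matrix.mulVec_mulVec, hG, Matrix.mulVec_smul, ← Matrix.mulVec_mulVec,
      colMat_inv_mulVec (hdet F y hy), F.torusFrame_mulVec]
    ext r
    rw [Pi.smul_apply, Matrix.mulVec_diagonal, smul_eq_mul, F.chart.coeff_ray]
    by_cases hr : r = l
    · subst hr
      simp [(hst.zeroQuot_spec ha F r hy hp).2.2]
    · simp [hr, Ne.symm hr]
  have hglue : ∀ F F' : P.LocalLift D w, ∀ y y' β φ, IsGluing F F' y y' β φ →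
      F.br y ∉ exceptional D α → A F' y' = jac φ (F.f y) * A F y := by
    intro F F' y y' β φ hgl hex
    have h1 := hst.jac_mul_torusFrame ha hgl hex
    obtain ⟨hy, hy', hp, hβ, -, hbr, -⟩ := hgl
    have hbry : F'.br y' = F.br y := by rw [← hβ]; exact hbr.self_of_nhds
    have h2 := hAG F y (F.inner_subset_dom hy) hp
    have h3 := hAG F' y' (F'.inner_subset_dom hy') (by rwa [hbry])
    rw [hbry] at h3
    have hG0 : (G (F.br y)).det ≠ 0 := by
      have := hst.det_torusFrame_ne_zero ha F (F.inner_subset_dom hy) hex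
      rw [← h2, Matrix.det_mul] at this
      exact right_ne_zero_of_mul this
    have h4 : A F' y' * G (F.br y) = jac φ (F.f y) * A F y * G (F.br y) := by
      rw [h3, Matrix.mul_assoc, h2, h1]
    have hu : IsUnit (G (F.br y)).det := isUnit_iff_ne_zero.2 hG0
    rw [← Matrix.mul_nonsing_inv_cancel_right (G (F.br y)) (A F' y') hu, h4,
      Matrix.mul_nonsing_inv_cancel_right _ _ hu]
  refine ⟨⟨A, fun F y hy => (hcont F y hy.1 hy.2).mono fun _ h => h.1, hA0, ?_, ?_⟩⟩
  · -- at the zeros the transition rule follows by continuity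
    intro F F' y y' β φ hgl
    have hev := hgl.eventually
    obtain ⟨hy, hy', hp, hβ, hβa, hbr, hφ, -⟩ := hgl
    have hbry : F'.br y' = F.br y := by rw [← hβ]; exact hbr.self_of_nhds
    have hcA : ∀ F : P.LocalLift D w, ∀ y ∈ F.inner, (∀ i, F.br y ≠ D.pts i) →
        ContinuousAt (A F) y := fun F y hy hp => (hcont F y (F.inner_subset_dom hy) hp).continuousAt
      (Filter.mem_of_superset (F.isOpen_inner.mem_nhds hy) F.inner_subset_dom)
    have h1 : ContinuousAt (fun t => A F' (β t)) y := by
      refine ContinuousAt.comp (g := A F') (f := β) ?_ hβa.continuousAt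
      rw [hβ]
      exact hcA F' y' hy' (by rwa [hbry])
    have h2 : ContinuousAt (fun t => jac φ (F.f t) * A F t) y :=
      (continuousAt_jac hy hφ).mul (hcA F y hy hp)
    have h3 : (fun t => A F' (β t)) =ᶠ[𝓝[≠] y] fun t => jac φ (F.f t) * A F t := by
      have h4 := F.eventually_br_notMem y (exceptional D α)
      filter_upwards [nhdsWithin_le_nhds hev, h4] with t k1 k2
      exact hglue F F' t (β t) β φ k1 k2
    have h5 := ((h1.eventuallyEq_nhds_iff_eventuallyEq_nhdsNE h2).1 h3).self_of_nhds
    rw [← hβ]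
    exact h5
  · intro i F hi
    obtain ⟨μ, hμ, hμc⟩ := hst.exists_isWeights ha F hi
    choose u hu hu0 hue using fun l => hst.exists_zeroQuot_eq_of_marked ha F hi l (hμc l)
    have hd0 : (colMat h F.chart.ray F.p).det ≠ 0 := by
      have := hdet F 0 F.zero_mem_dom
      rwa [F.br_zero] at this
    refine ⟨μ, fun ζ => Matrix.diagonal (fun l => u l ζ) * (colMat h F.chart.ray (F.p + ζ))⁻¹, hμ,
      ?_, ?_, ?_⟩
    · refine ContinuousAt.mul ?_ ?_
      · exact continuous_id.matrix_diagonal.continuousAt.comp (continuousAt_pi.2 hu)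
      · rw [← continuousWithinAt_univ]
        refine continuousWithinAt_matrix_inv ?_ (by simpa using hd0)
        exact ((continuous_colMat hd _).comp (continuous_const.add continuous_id)).continuousWithinAt
    · simp only [add_zero]
      rw [Matrix.det_mul, Matrix.det_diagonal]
      refine mul_ne_zero (Finset.prod_ne_zero_iff.2 fun l _ => hu0 l) ?_
      exact (Matrix.isUnit_nonsing_inv_det _ (isUnit_iff_ne_zero.2 hd0)).ne_zero
    · filter_upwards [Filter.eventually_all.2 hue] with y hy
      simp only [A, hy]
      rw [← Matrix.mul_assoc, Matrix.diagonal_mul_diagonal]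
      rfl

end IsStandardForm

end LabeledPolytope

/-! ### The desingularized Maslov index -/

/-- A nonvanishing continuous function on the closed disc has a continuous logarithm. -/
theorem exists_continuous_log_closedBall {q : ℂ → ℂ}
    (hq : ContinuousOn q (Metric.closedBall (0 : ℂ) 1))
    (h0 : ∀ z ∈ Metric.closedBall (0 : ℂ) 1, q z ≠ 0) :
    ∃ L : ℂ → ℂ, Continuous L ∧ ∀ z ∈ Metric.closedBall (0 : ℂ) 1, exp (L z) = q z := by
  -- extend by the radial retraction to the disc
  let ρ : ℂ → ℂ := fun z => z / ((max 1 ‖z‖ : ℝ) : ℂ)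
  have hmax : ∀ z : ℂ, (0 : ℝ) < max 1 ‖z‖ := fun z => lt_max_of_lt_left one_pos
  have hρ : Continuous ρ := by
    refine continuous_id.div ?_ fun z => ?_
    · exact Complex.continuous_ofReal.comp (continuous_const.max continuous_norm)
    · exact_mod_cast (hmax z).ne'
  have hρm : ∀ z, ρ z ∈ Metric.closedBall (0 : ℂ) 1 := fun z => by
    rw [mem_closedBall_zero_iff]
    simp only [ρ, norm_div, Complex.norm_real, Real.norm_of_nonneg (hmax z).le]
    exact (div_le_one (hmax z)).2 (le_max_right _ _)
  have hρi : ∀ z ∈ Metric.closedBall (0 : ℂ) 1, ρ z = z := fun z hz => by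
    rw [mem_closedBall_zero_iff] at hz
    simp [ρ, max_eq_left hz]
  have hsc : IsSimplyConnected (Set.univ : Set ℂ) :=
    (Homeomorph.Set.univ ℂ).toHomotopyEquiv.simplyConnectedSpace
  obtain ⟨L, hL, hLe⟩ := Complex.exists_continuousOn_eqOn_exp_comp hsc isOpen_univ
    (g := q ∘ ρ) (hq.comp_continuous hρ hρm).continuousOn (by
      rintro ⟨z, -, hz⟩
      exact h0 _ (hρm z) hz)
  refine ⟨L, continuousOn_univ.1 hL, fun z hz => ?_⟩
  have := hLe (Set.mem_univ z)
  simpa [hρi z hz] using this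

/-- On the unit circle a Blaschke factor is `exp (i θ)` times the exponential of a periodic
function. -/
theorem blaschke_exp_mul_I {β : ℂ} (hβ : β ∈ Metric.ball (0 : ℂ) 1) (θ : ℝ) :
    blaschke β (exp (θ * I)) =
      exp (((θ - 2 * arg (1 - conj β * exp (θ * I)) : ℝ) : ℂ) * I) := by
  have hz : ‖exp (θ * I)‖ = 1 := Complex.norm_exp_ofReal_mul_I θ
  have hne := one_sub_conj_mul_ne_zero hβ (z := exp (θ * I)) (by simp [hz])
  set u := 1 - conj β * exp (θ * I) with hu
  have h1 : exp (θ * I) - β = exp (θ * I) * conj u := by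
    have h2 : exp (θ * I) * conj (exp (θ * I)) = 1 := by
      rw [Complex.mul_conj, Complex.normSq_eq_norm_sq, hz]; simp
    rw [hu, map_sub, map_mul, map_one, Complex.conj_conj]
    linear_combination β * h2
  have h3 : conj u = ‖u‖ * exp (-(arg u : ℂ) * I) := by
    conv_lhs => rw [← Complex.norm_mul_exp_arg_mul_I u]
    rw [map_mul, Complex.conj_ofReal, ← Complex.exp_conj]
    simp
  have h4 : u = ‖u‖ * exp (arg u * I) := (Complex.norm_mul_exp_arg_mul_I u).symm
  have h7 : exp (-(arg u : ℂ) * I) =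
      exp (((-2 * arg u : ℝ) : ℂ) * I) * exp (arg u * I) := by
    rw [← Complex.exp_add]
    congr 1
    push_cast
    ring
  have h8 : exp (((θ - 2 * arg u : ℝ) : ℂ) * I) = exp (θ * I) * exp (((-2 * arg u : ℝ) : ℂ) * I) := by
    rw [← Complex.exp_add]
    congr 1
    push_cast
    ring
  have h9 : exp (θ * I) * exp (((-2 * arg u : ℝ) : ℂ) * I) * u =
      exp (θ * I) * exp (((-2 * arg u : ℝ) : ℂ) * I) * (‖u‖ * exp (arg u * I)) := congrArg _ h4
  rw [blaschke, ← hu, h1, div_eq_iff hne, h3, h7, h8, h9]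
  ring

theorem continuous_arg_one_sub {β : ℂ} (hβ : β ∈ Metric.ball (0 : ℂ) 1) :
    Continuous fun θ : ℝ => arg (1 - conj β * exp (θ * I)) := by
  rw [continuous_iff_continuousAt]
  intro θ
  have h1 : ‖conj β * exp (θ * I)‖ < 1 := by
    rw [norm_mul, Complex.norm_exp_ofReal_mul_I, mul_one, RCLike.norm_conj]
    simpa using hβ
  have h2 : (1 - conj β * exp (θ * I)) ∈ Complex.slitPlane := by
    left
    rw [Complex.sub_re, Complex.one_re, sub_pos]
    exact (Complex.re_le_norm _).trans_lt h1
  exact ContinuousAt.comp (f := fun θ : ℝ => 1 - conj β * exp (θ * I))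
    (Complex.continuousAt_arg h2) (by fun_prop)

namespace LabeledPolytope

variable {n m k : ℕ} {P : LabeledPolytope n m} {D : MarkedOrbiDisc k} {w : ℂ → P.X}
  {z₀ : Fin m → ℂ} {ν : Fin k → Fin n → ℤ} {c : Fin k → Fin m → ℚ}
  {d : Fin m → ℕ} {α : (j : Fin m) → Fin (d j) → ℂ} {a : Fin m → ℂ}

/-- The closed disc without the exceptional points. -/
def regularDisc (D : MarkedOrbiDisc k) (α : (j : Fin m) → Fin (d j) → ℂ) : Set ℂ :=
  {z | z ∈ Metric.closedBall (0 : ℂ) 1 ∧ z ∉ exceptional D α}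

theorem closedBall_subset_closure_regularDisc :
    Metric.closedBall (0 : ℂ) 1 ⊆ closure (regularDisc D α) := by
  have hd : Dense ((exceptional D α : Set ℂ))ᶜ :=
    ((exceptional D α).finite_toSet).countable.dense_compl ℝ
  rw [← closure_ball (0 : ℂ) one_ne_zero]
  refine closure_minimal ((hd.open_subset_closure_inter Metric.isOpen_ball).trans ?_) isClosed_closure
  exact closure_mono fun z hz => ⟨Metric.ball_subset_closedBall hz.1, hz.2⟩

/-- The torus frame at the lift `F` in terms of a trivialization of the desingularized bundle. -/
noncomputable def DesingFrame.transfer (T : DesingFrame D w) (F : P.LocalLift D w) (y : ℂ) :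
    Matrix (Fin n) (Fin n) ℂ := (T.A F y)⁻¹ * F.torusFrame y

theorem DesingFrame.continuousOn_transfer (T : DesingFrame D w) (F : P.LocalLift D w) :
    ContinuousOn (T.transfer F) {y | y ∈ F.dom ∧ ∀ i, F.br y ≠ D.pts i} := fun y hy =>
  (continuousWithinAt_matrix_inv (T.continuousOn F y hy) (T.det_ne_zero F y hy.1 hy.2)).mul
    ((F.continuousOn_torusFrame y hy.1).mono fun _ h => h.1)

theorem DesingFrame.det_transfer (T : DesingFrame D w) (F : P.LocalLift D w) (y : ℂ) :
    (T.transfer F y).det = (∏ l, F.f y l) * F.chart.dualMat.det / (T.A F y).det := by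
  rw [transfer, Matrix.det_mul, F.det_torusFrame, Matrix.det_nonsing_inv, Ring.inverse_eq_inv',
    div_eq_inv_mul]

theorem IsWeights.eq {F : P.LocalLift D w} {μ μ' : Fin n → ℕ} (h : IsWeights F μ)
    (h' : IsWeights F μ') (hne : ∀ l, ∃ y ∈ F.dom, F.f y l ≠ 0) : μ = μ' := by
  ext l
  obtain ⟨y, hy, hy0⟩ := hne l
  have h1 := (h l).2 y hy
  rw [(h' l).2 y hy] at h1
  exact (F.isPrimitiveRoot_gen.pow_inj (h l).1 (h' l).1 (mul_right_cancel₀ hy0 h1).symm)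

namespace IsStandardForm

theorem transfer_eq (hst : P.IsStandardForm z₀ D w ν c d α a) (ha : ∀ j, a j ≠ 0)
    (T : DesingFrame D w) (F F' : P.LocalLift D w) (he : F'.e = 1) {y : ℂ} (hy : y ∈ F.dom)
    (hin : y ∈ F.inner ∨ F.e = 1) (hy' : F.br y - F'.p ∈ F'.dom) (hpt : ∀ i, F.br y ≠ D.pts i) :
    T.transfer F y = T.transfer F' (F.br y - F'.p) := by
  refine LocalLift.eq_of_eq_on_inner T.transfer (exceptional D α) T.continuousOn_transfer ?_ F F' he
    hy hin hy' hpt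
  intro F F' he y hy hy' hex
  obtain ⟨φ, hgl⟩ := hst.exists_isGluing ha F F' he hy hy' hex
  have h1 := T.glue F F' _ _ _ φ hgl
  have h2 := hst.jac_mul_torusFrame ha hgl hex
  have hbr' : F'.br (F.br y - F'.p) = F.br y := by simp [LocalLift.br, he]
  have h3 := T.det_ne_zero F' _ (F'.inner_subset_dom hy') fun i => by
    rw [hbr']; exact ne_pts_of_notMem hex i
  rw [h1, Matrix.det_mul] at h3
  have hJ : IsUnit (jac φ (F.f y)).det := isUnit_iff_ne_zero.2 (left_ne_zero_of_mul h3)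
  rw [DesingFrame.transfer, DesingFrame.transfer, h1, ← h2, Matrix.mul_inv_rev, Matrix.mul_assoc,
    ← Matrix.mul_assoc (jac φ (F.f y))⁻¹, Matrix.nonsing_inv_mul _ hJ, Matrix.one_mul]

/-- The determinant of a trivialization of the desingularized bundle vanishes to the same order as
the product of the quotients `zeroQuot`. -/
theorem exists_tendsto_prod_zeroQuot_div_det (hst : P.IsStandardForm z₀ D w ν c d α a)
    (ha : ∀ j, a j ≠ 0) (T : DesingFrame D w) (F : P.LocalLift D w) :
    ∃ v ≠ 0, Filter.Tendsto (fun y => (∏ l, F.zeroQuot α l y) / (T.A F y).det)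
      (𝓝[{y | y ∈ F.dom ∧ F.br y ∉ exceptional D α}] 0) (𝓝 v) := by
  by_cases hp : ∃ i, F.p = D.pts i
  · obtain ⟨i, hi⟩ := hp
    obtain ⟨μ, B, hμ, hB, hB0, hA⟩ := T.extend i F hi
    obtain ⟨μ', hμ', hμc⟩ := hst.exists_isWeights ha F hi
    obtain rfl := hμ.eq hμ' (hst.exists_f_ne_zero ha F (mem_ball_of_eq_pts hi))
    choose u hu hu0 hue using fun l => hst.exists_zeroQuot_eq_of_marked ha F hi l (hμc l)
    refine ⟨(∏ l, u l 0) / (B 0).det,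
      div_ne_zero (Finset.prod_ne_zero_iff.2 fun l _ => hu0 l) hB0, ?_⟩
    have hsub : {y | y ∈ F.dom ∧ F.br y ∉ exceptional D α} ⊆ {0}ᶜ := by
      rintro y ⟨-, hy⟩ rfl
      refine hy (mem_exceptional.2 (Or.inl ⟨i, ?_⟩))
      rw [F.br_zero, hi]
    have hpow : Filter.Tendsto (fun y : ℂ => y ^ F.e) (𝓝[≠] 0) (𝓝 0) := by
      have := (continuous_pow F.e : Continuous fun y : ℂ => y ^ F.e).tendsto 0
      rw [zero_pow F.e_pos.ne'] at this
      exact this.mono_left nhdsWithin_le_nhds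
    have hlim : Filter.Tendsto (fun y : ℂ => (∏ l, u l (y ^ F.e)) / (B (y ^ F.e)).det) (𝓝[≠] 0)
        (𝓝 ((∏ l, u l 0) / (B 0).det)) := by
      refine Filter.Tendsto.div (tendsto_finsetProd _ fun l _ => (hu l).tendsto.comp hpow) ?_ hB0
      exact (continuous_id.matrix_det.continuousAt.comp hB).tendsto.comp hpow
    refine (hlim.congr' ?_).mono_left (nhdsWithin_mono _ hsub)
    filter_upwards [self_mem_nhdsWithin, hA, Filter.eventually_all.2 hue] with y hy h1 h2
    have hy0 : y ≠ 0 := hy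
    rw [h1, Matrix.det_mul, Matrix.det_diagonal]
    simp only [h2, Finset.prod_mul_distrib]
    rw [mul_div_mul_left _ _ (Finset.prod_ne_zero_iff.2 fun l _ => pow_ne_zero _ hy0)]
  · push Not at hp
    have hp0 : ∀ i, F.br 0 ≠ D.pts i := fun i => by rw [F.br_zero]; exact hp i
    have hspec := fun l => hst.zeroQuot_spec ha F l F.zero_mem_dom hp0
    have hdet := T.det_ne_zero F 0 F.zero_mem_dom hp0
    refine ⟨(∏ l, F.zeroQuot α l 0) / (T.A F 0).det,
      div_ne_zero (Finset.prod_ne_zero_iff.2 fun l _ => (hspec l).2.1) hdet, ?_⟩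
    refine Filter.Tendsto.div (tendsto_finsetProd _ fun l _ => ?_) ?_ hdet
    · exact (hspec l).1.mono fun _ h => h.1
    · have h1 : ContinuousWithinAt (T.A F) {y | y ∈ F.dom ∧ F.br y ∉ exceptional D α} 0 :=
        (T.continuousOn F 0 ⟨F.zero_mem_dom, hp0⟩).mono
          fun y hy => ⟨hy.1, ne_pts_of_notMem hy.2⟩
      exact continuous_id.matrix_det.continuousAt.comp_continuousWithinAt h1

/-- Every trivialization of the desingularized bundle induces a function on the disc, whose values
compare the trivialization with the torus frame, and whose determinant is the product of the
Blaschke factors with a continuous nonvanishing function. -/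
theorem exists_transfer (hst : P.IsStandardForm z₀ D w ν c d α a) (ha : ∀ j, a j ≠ 0)
    (T : DesingFrame D w) :
    ∃ (R : ℂ → Matrix (Fin n) (Fin n) ℂ) (L : ℂ → ℂ), Continuous L ∧
      (∀ F : P.LocalLift D w, ‖F.p‖ = 1 → T.transfer F 0 = R F.p) ∧
      ContinuousOn R (Metric.sphere 0 1) ∧
      ∀ z ∈ Metric.sphere (0 : ℂ) 1, (R z).det = exp (L z) * ∏ j, ∏ s, blaschke (α j s) z := by
  classical
  obtain ⟨F₀, -⟩ := exists_localLift hst ha (Metric.mem_closedBall_self zero_le_one)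
  have : Nonempty (P.LocalLift D w) := ⟨F₀⟩
  choose! F hF using fun z (hz : z ∈ Metric.closedBall (0 : ℂ) 1) => exists_localLift hst ha hz
  let R : ℂ → Matrix (Fin n) (Fin n) ℂ := fun z => T.transfer (F z) 0
  have hR : ∀ G : P.LocalLift D w, ∀ y ∈ G.dom, (y ∈ G.inner ∨ G.e = 1) →
      (∀ i, G.br y ≠ D.pts i) → T.transfer G y = R (G.br y) := by
    intro G y hy hin hp
    have hFp := hF (G.br y) hy.2
    have he : (F (G.br y)).e = 1 := (F (G.br y)).localOrder.eq_one (by rw [hFp]; exact hp)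
    have h0 : G.br y - (F (G.br y)).p = 0 := by rw [hFp, sub_self]
    have := hst.transfer_eq ha T G (F (G.br y)) he hy hin
      (by rw [h0]; exact (F (G.br y)).zero_mem_dom) hp
    rwa [h0] at this
  let q : ℂ → ℂ := fun z => (R z).det / ∏ j, ∏ s, blaschke (α j s) z
  have hbl : ∀ z ∈ regularDisc D α, ∏ j, ∏ s, blaschke (α j s) z ≠ 0 := fun z hz =>
    Finset.prod_ne_zero_iff.2 fun j _ => Finset.prod_ne_zero_iff.2 fun s _ => by
      rw [Ne, blaschke_eq_zero_iff (hst.zeros_mem j s) hz.1]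
      exact ne_zeros_of_notMem hz.2 j s
  have hroot : ∀ p ∈ Metric.closedBall (0 : ℂ) 1, ∀ᶠ z in 𝓝[regularDisc D α] p,
      (z - p) ^ (((F p).e : ℂ)⁻¹) ∈ (F p).dom ∧ (F p).br ((z - p) ^ (((F p).e : ℂ)⁻¹)) = z ∧
      ((z - p) ^ (((F p).e : ℂ)⁻¹) ∈ (F p).inner ∨ (F p).e = 1) := by
    intro p hp
    have hFp := hF p hp
    have ht := (F p).tendsto_root
    rw [hFp] at ht
    have hb := (F p).br_root
    rw [hFp] at hb
    have hε : ∀ᶠ z in 𝓝 p, ‖(z - p) ^ (((F p).e : ℂ)⁻¹)‖ < (F p).ε := by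
      have := ht.norm
      rw [norm_zero] at this
      exact this.eventually (gt_mem_nhds (F p).ε_pos)
    by_cases hp1 : p ∈ Metric.ball (0 : ℂ) 1
    · filter_upwards [nhdsWithin_le_nhds hε, self_mem_nhdsWithin,
        nhdsWithin_le_nhds (Metric.isOpen_ball.mem_nhds hp1)] with z h1 h2 h3
      exact ⟨⟨h1, by rw [hb]; exact h2.1⟩, hb z, Or.inl ⟨h1, by rw [hb]; exact h3⟩⟩
    · have hpn : ‖p‖ = 1 := le_antisymm (by simpa using hp) (by simpa using hp1)
      have he : (F p).e = 1 := (F p).localOrder.eq_one (by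
        rw [hFp]; exact D.ne_pts_of_norm_eq_one hpn)
      filter_upwards [nhdsWithin_le_nhds hε, self_mem_nhdsWithin] with z h1 h2
      exact ⟨⟨h1, by rw [hb]; exact h2.1⟩, hb z, Or.inr he⟩
  have hlim : ∀ p ∈ Metric.closedBall (0 : ℂ) 1,
      ∃ v ≠ 0, Filter.Tendsto q (𝓝[regularDisc D α] p) (𝓝 v) := by
    intro p hp
    set G := F p with hG
    have hGp : G.p = p := hF p hp
    obtain ⟨v, hv0, hv⟩ := hst.exists_tendsto_prod_zeroQuot_div_det ha T G
    -- the remaining factors are continuous and nonzero at `p`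
    let K : ℂ → ℂ := fun z => (∏ l, ∏ s, (1 - conj (α (G.chart.ray l) s) * z)) /
      ∏ j, if j ∈ Set.range G.chart.ray then 1 else ∏ s, blaschke (α j s) z
    have hK1 : (∏ l, ∏ s, (1 - conj (α (G.chart.ray l) s) * p)) ≠ 0 :=
      Finset.prod_ne_zero_iff.2 fun l _ => Finset.prod_ne_zero_iff.2 fun s _ =>
        one_sub_conj_mul_ne_zero (hst.zeros_mem _ s) hp
    have hK2 : (∏ j, if j ∈ Set.range G.chart.ray then 1 else ∏ s, blaschke (α j s) p) ≠ 0 := by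
      refine Finset.prod_ne_zero_iff.2 fun j _ => ?_
      split_ifs with hj
      · exact one_ne_zero
      · refine Finset.prod_ne_zero_iff.2 fun s _ => ?_
        rw [Ne, blaschke_eq_zero_iff (hst.zeros_mem j s) hp]
        intro h
        exact hj (hst.mem_range_of_eq_zeros G G.zero_mem_dom (s := s) (by rw [G.br_zero, hGp, h]))
    have hK : ContinuousAt K p := by
      refine ContinuousAt.div ?_ ?_ hK2
      · exact tendsto_finsetProd _ fun l _ => tendsto_finsetProd _ fun s _ =>
          (by fun_prop : Continuous fun z => 1 - conj (α (G.chart.ray l) s) * z).continuousAt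
      · refine tendsto_finsetProd _ fun j _ => ?_
        by_cases hj : j ∈ Set.range G.chart.ray
        · simp only [if_pos hj]; exact tendsto_const_nhds
        · simp only [if_neg hj]
          exact tendsto_finsetProd _ fun s _ =>
            (analyticAt_blaschke (hst.zeros_mem j s) hp).continuousAt
    refine ⟨v * G.chart.dualMat.det * K p,
      mul_ne_zero (mul_ne_zero hv0 G.chart.det_dualMat_ne_zero) (div_ne_zero hK1 hK2), ?_⟩
    have hrt : Filter.Tendsto (fun z => (z - p) ^ ((G.e : ℂ)⁻¹)) (𝓝[regularDisc D α] p)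
        (𝓝[{y | y ∈ G.dom ∧ G.br y ∉ exceptional D α}] 0) := by
      rw [tendsto_nhdsWithin_iff]
      refine ⟨?_, ?_⟩
      · have := G.tendsto_root
        rw [hGp] at this
        exact this.mono_left nhdsWithin_le_nhds
      · filter_upwards [hroot p hp, self_mem_nhdsWithin] with z h1 h2
        refine ⟨h1.1, ?_⟩
        rw [h1.2.1]
        exact h2.2
    refine (((hv.comp hrt).mul_const _).mul (hK.tendsto.mono_left nhdsWithin_le_nhds)).congr' ?_
    filter_upwards [hroot p hp, self_mem_nhdsWithin] with z ⟨h1, h2, h3⟩ hz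
    set y := (z - p) ^ ((G.e : ℂ)⁻¹) with hy
    have hpt : ∀ i, G.br y ≠ D.pts i := fun i => by rw [h2]; exact ne_pts_of_notMem hz.2 i
    have h4 : R z = T.transfer G y := by rw [hR G y h1 h3 hpt, h2]
    have hspec := fun l => (hst.zeroQuot_spec ha G l h1 hpt).2.2
    rw [h2] at hspec
    simp only [Function.comp, q, h4, T.det_transfer, K, ← hy]
    have e1 : ∏ j, ∏ s, blaschke (α j s) z = (∏ l, ∏ s, blaschke (α (G.chart.ray l) s) z) *
        ∏ j, if j ∈ Set.range G.chart.ray then 1 else ∏ s, blaschke (α j s) z := by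
      have e2 := G.chart.prod_eq_prod_ray
        (fun j => if j ∈ Set.range G.chart.ray then ∏ s, blaschke (α j s) z else 1)
        (fun j hj => if_neg hj)
      simp only [Set.mem_range_self, if_true] at e2
      rw [← e2, ← Finset.prod_mul_distrib]
      refine Finset.prod_congr rfl fun j _ => ?_
      split_ifs <;> simp
    have e3 : ∏ l, ∏ s, blaschke (α (G.chart.ray l) s) z =
        (∏ l, zeroPoly α (G.chart.ray l) z) /
          ∏ l, ∏ s, (1 - conj (α (G.chart.ray l) s) * z) := by
      simp only [blaschke, zeroPoly, ← Finset.prod_div_distrib]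
    have e4 : ∏ l, G.f y l = (∏ l, zeroPoly α (G.chart.ray l) z) * ∏ l, G.zeroQuot α l y := by
      rw [← Finset.prod_mul_distrib]
      exact Finset.prod_congr rfl fun l _ => hspec l
    have hne1 : ∏ l, zeroPoly α (G.chart.ray l) z ≠ 0 :=
      Finset.prod_ne_zero_iff.2 fun l _ => zeroPoly_ne_zero_of_notMem hz.2 _
    have hne2 : (∏ l, ∏ s, (1 - conj (α (G.chart.ray l) s) * z)) ≠ 0 :=
      Finset.prod_ne_zero_iff.2 fun l _ => Finset.prod_ne_zero_iff.2 fun s _ =>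
        one_sub_conj_mul_ne_zero (hst.zeros_mem _ s) hz.1
    have hne3 := hbl z hz
    rw [e1] at hne3
    have hne4 := right_ne_zero_of_mul hne3
    have hne5 := T.det_ne_zero G y h1 hpt
    rw [e1, e3, e4]
    generalize (∏ l, ∏ s, (1 - conj (α (G.chart.ray l) s) * z)) = X at hne2 ⊢
    field_simp
  have hqt : ContinuousOn (extendFrom (regularDisc D α) q) (Metric.closedBall 0 1) :=
    continuousOn_extendFrom closedBall_subset_closure_regularDisc
      fun z hz => by obtain ⟨v, -, hv⟩ := hlim z hz; exact ⟨v, hv⟩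
  obtain ⟨L, hL, hLe⟩ := exists_continuous_log_closedBall hqt fun z hz => by
    obtain ⟨v, hv0, hv⟩ := hlim z hz
    rw [extendFrom_eq (closedBall_subset_closure_regularDisc hz) hv]
    exact hv0
  have hreg : ∀ z ∈ Metric.sphere (0 : ℂ) 1, z ∈ regularDisc D α := fun z hz =>
    ⟨Metric.sphere_subset_closedBall hz, hst.notMem_exceptional_of_norm_eq_one (by simpa using hz)⟩
  refine ⟨R, L, hL, fun G hG => ?_, fun p hp => ?_, fun z hz => ?_⟩
  · have he : G.e = 1 := G.localOrder.eq_one (D.ne_pts_of_norm_eq_one hG)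
    have := hR G 0 G.zero_mem_dom (Or.inr he) (by
      rw [G.br_zero]; exact D.ne_pts_of_norm_eq_one hG)
    rwa [G.br_zero] at this
  · have hpc := Metric.sphere_subset_closedBall hp
    have hpn : ‖p‖ = 1 := by simpa using hp
    have hFp := hF p hpc
    have he : (F p).e = 1 := (F p).localOrder.eq_one (by
      rw [hFp]; exact D.ne_pts_of_norm_eq_one hpn)
    have h0 := T.continuousOn_transfer (F p) 0 ⟨(F p).zero_mem_dom, by
      rw [(F p).br_zero, hFp]; exact D.ne_pts_of_norm_eq_one hpn⟩
    have h1 : Filter.Tendsto (fun z => z - p) (𝓝[Metric.sphere 0 1] p)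
        (𝓝[{y | y ∈ (F p).dom ∧ ∀ i, (F p).br y ≠ D.pts i}] 0) := by
      rw [tendsto_nhdsWithin_iff]
      have h2 : Filter.Tendsto (fun z => z - p) (𝓝 p) (𝓝 0) := by
        have : Continuous fun z : ℂ => z - p := by fun_prop
        simpa using this.tendsto p
      refine ⟨h2.mono_left nhdsWithin_le_nhds, ?_⟩
      have h3 := h2.norm
      rw [norm_zero] at h3
      filter_upwards [nhdsWithin_le_nhds (h3.eventually (gt_mem_nhds (F p).ε_pos)),
        self_mem_nhdsWithin] with z h4 h5
      have hbz : (F p).br (z - p) = z := by simp [LocalLift.br, he, hFp]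
      refine ⟨⟨h4, by rw [hbz]; exact Metric.sphere_subset_closedBall h5⟩, fun i => ?_⟩
      rw [hbz]
      exact D.ne_pts_of_norm_eq_one (by simpa using h5) i
    refine Filter.Tendsto.congr' ?_ (Filter.Tendsto.comp h0 h1)
    filter_upwards [h1.eventually self_mem_nhdsWithin] with z hz
    have hbz : (F p).br (z - p) = z := by simp [LocalLift.br, he, hFp]
    have := hR (F p) (z - p) hz.1 (Or.inr he) hz.2
    rwa [hbz] at this
  · obtain ⟨v, -, hv⟩ := hlim z (Metric.sphere_subset_closedBall hz)
    have hvq : q z = v := by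
      have h1 : Filter.Tendsto q (pure z) (𝓝 v) := hv.mono_left (pure_le_nhdsWithin (hreg z hz))
      exact tendsto_nhds_unique (tendsto_pure_nhds q z) h1
    rw [hLe z (Metric.sphere_subset_closedBall hz), extendFrom_eq
      (closedBall_subset_closure_regularDisc (Metric.sphere_subset_closedBall hz)) hv, ← hvq]
    exact (div_mul_cancel₀ _ (hbl z (hreg z hz))).symm

end IsStandardForm

/-- The tangent space of the torus through `x` is the image of `i ℝⁿ` under the infinitesimal torus
action. -/
theorem LocalLift.mem_torusTangent_iff (F : P.LocalLift D w) (y : ℂ) (ξ : Fin n → ℂ) :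
    ξ ∈ torusTangent (F.f y) ↔
      ∃ t : Fin n → ℝ, ξ = (F.torusFrame y).mulVec fun x => I * (t x : ℂ) := by
  have hM : ∀ t : Fin n → ℝ, ∀ l, F.chart.dualMat.mulVec (fun x => I * (t x : ℂ)) l =
      I * ((∑ x, ((F.chart.mat⁻¹ x l : ℚ) : ℝ) * t x : ℝ) : ℂ) := by
    intro t l
    simp only [Matrix.mulVec, dotProduct, Chart.dualMat, Matrix.of_apply]
    push_cast
    rw [Finset.mul_sum]
    exact Finset.sum_congr rfl fun x _ => by ring
  constructor
  · rintro ⟨t, ht⟩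
    refine ⟨fun x => ∑ r, t r * ((F.chart.mat r x : ℚ) : ℝ), ?_⟩
    ext l
    have h1 : (∑ x, ((F.chart.mat⁻¹ x l : ℚ) : ℝ) * ∑ r, t r * ((F.chart.mat r x : ℚ) : ℝ)) = t l := by
      have h2 : F.chart.mat * F.chart.mat⁻¹ = 1 := Matrix.mul_nonsing_inv _ F.chart.isUnit_det
      simp only [Finset.mul_sum]
      rw [Finset.sum_comm]
      calc _ = ∑ r, t r * (((F.chart.mat * F.chart.mat⁻¹) r l : ℚ) : ℝ) := by
            refine Finset.sum_congr rfl fun r _ => ?_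
            rw [Matrix.mul_apply]
            push_cast
            rw [Finset.mul_sum]
            exact Finset.sum_congr rfl fun x _ => by ring
        _ = t l := by
            rw [h2, Finset.sum_eq_single l]
            · simp
            · intro r _ hr; simp [hr]
            · simp
    rw [LocalLift.torusFrame, ← Matrix.mulVec_mulVec, Matrix.mulVec_diagonal, hM, h1, ht]
    ring
  · rintro ⟨t, rfl⟩
    refine ⟨fun l => ∑ x, ((F.chart.mat⁻¹ x l : ℚ) : ℝ) * t x, fun l => ?_⟩
    rw [LocalLift.torusFrame, ← Matrix.mulVec_mulVec, Matrix.mulVec_diagonal, hM]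
    ring

/-- In any trivialization the boundary condition is the image of `ℝⁿ` under `i R`, where `det R` is the
product of the `∑ d j` Blaschke factors and the exponential of a function on the whole disc, so that
`det²` has the rotation number `∑ 2 d j`. -/
theorem IsStandardForm.hasDesingularizedMaslovIndex (hst : P.IsStandardForm z₀ D w ν c d α a)
    (ha : ∀ j, a j ≠ 0) : HasDesingularizedMaslovIndex D w (∑ j, 2 * (d j : ℤ)) := by
  have hsph : ∀ θ : ℝ, exp (θ * I) ∈ Metric.sphere (0 : ℂ) 1 := fun θ => by
    simp [Complex.norm_exp_ofReal_mul_I]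
  -- the boundary loop is the image of `ℝⁿ` under `i R`
  have hloop : ∀ (T : DesingFrame D w) (R : ℂ → Matrix (Fin n) (Fin n) ℂ),
      (∀ F : P.LocalLift D w, ‖F.p‖ = 1 → T.transfer F 0 = R F.p) →
      ∀ θ : ℝ, ∀ F : P.LocalLift D w, F.p = exp (θ * I) →
        {ξ | (T.A F 0).mulVec ξ ∈ torusTangent (F.f 0)} =
          {ξ | ∃ t : Fin n → ℝ, ξ = (I • R (exp (θ * I))).mulVec fun l => (t l : ℂ)} := by
    intro T R hR θ F hF
    have hn : ‖F.p‖ = 1 := by rw [hF]; exact Complex.norm_exp_ofReal_mul_I θ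
    have hA : IsUnit (T.A F 0).det := isUnit_iff_ne_zero.2
      (T.det_ne_zero F 0 F.zero_mem_dom (by rw [F.br_zero]; exact D.ne_pts_of_norm_eq_one hn))
    have hRF : T.A F 0 * R (exp (θ * I)) = F.torusFrame 0 := by
      rw [← hF, ← hR F hn, DesingFrame.transfer, ← Matrix.mul_assoc, Matrix.mul_nonsing_inv _ hA,
        Matrix.one_mul]
    ext ξ
    rw [Set.mem_ofPred_eq, Set.mem_ofPred_eq, F.mem_torusTangent_iff]
    refine exists_congr fun t => ?_
    have h1 : (fun x => I * (t x : ℂ)) = I • fun x => (t x : ℂ) := rfl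
    have h2 : (F.torusFrame 0).mulVec (fun x => I * (t x : ℂ)) =
        (T.A F 0).mulVec ((I • R (exp (θ * I))).mulVec fun l => (t l : ℂ)) := by
      rw [← hRF, h1, Matrix.mulVec_smul, Matrix.mulVec_mulVec, Matrix.mul_smul, Matrix.smul_mulVec]
    rw [h2]
    exact (Matrix.mulVec_injective_of_isUnit ((Matrix.isUnit_iff_isUnit_det _).2 hA)).eq_iff
  refine ⟨?_, fun T Λ hΛ => ?_⟩
  · obtain ⟨T⟩ := hst.nonempty_desingFrame ha
    obtain ⟨R, L, -, hR, -⟩ := hst.exists_transfer ha T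
    exact ⟨T, fun θ => {ξ | ∃ t : Fin n → ℝ, ξ = (I • R (exp (θ * I))).mulVec fun l => (t l : ℂ)},
      fun θ F hF => (hloop T R hR θ F hF).symm⟩
  · obtain ⟨R, L, hL, hR, hRc, hdet⟩ := hst.exists_transfer ha T
    let ψ : ℝ → ℝ := fun θ => n * Real.pi / 2 + (L (exp (θ * I))).im +
      ∑ j, ∑ s, (θ - 2 * arg (1 - conj (α j s) * exp (θ * I)))
    have hexp : Continuous fun θ : ℝ => exp (θ * I) := by fun_prop
    have hD : ∀ θ : ℝ, (I • R (exp (θ * I))).det =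
        exp ((L (exp (θ * I))).re) * exp (ψ θ * I) := by
      intro θ
      rw [Matrix.det_smul, hdet _ (hsph θ), Fintype.card_fin]
      have h1 : I ^ n = exp (((n * Real.pi / 2 : ℝ) : ℂ) * I) := by
        have : I = exp (Real.pi / 2 * I) := Complex.exp_pi_div_two_mul_I.symm
        conv_lhs => rw [this]
        rw [← Complex.exp_nat_mul]
        congr 1
        push_cast
        ring
      have h2 : ∏ j, ∏ s, blaschke (α j s) (exp (θ * I)) =
          exp (((∑ j, ∑ s, (θ - 2 * arg (1 - conj (α j s) * exp (θ * I))) : ℝ) : ℂ) * I) := by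
        simp only [blaschke_exp_mul_I (hst.zeros_mem _ _), ← Complex.exp_sum, ← Finset.sum_mul]
        push_cast
        rfl
      rw [h1, h2]
      conv_lhs => rw [← Complex.re_add_im (L (exp (θ * I)))]
      rw [← Complex.exp_add, ← Complex.exp_add, ← Complex.exp_add]
      congr 1
      simp only [ψ]
      push_cast
      ring
    have hnorm : ∀ θ : ℝ, ((‖(I • R (exp (θ * I))).det‖ : ℝ) : ℂ) = exp ((L (exp (θ * I))).re) := by
      intro θ
      rw [hD, norm_mul, Complex.norm_exp_ofReal_mul_I, mul_one, Complex.norm_exp, Complex.ofReal_re,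
        Complex.ofReal_exp]
    refine ⟨fun θ => I • R (exp (θ * I)), fun θ => 2 * ψ θ, ?_, ?_, ?_, ?_, ?_, ?_⟩
    · exact (hRc.comp_continuous hexp hsph).const_smul I
    · refine continuous_const.mul ((continuous_const.add ?_).add ?_)
      · exact Complex.continuous_im.comp (hL.comp hexp)
      · refine continuous_finsetSum _ fun j _ => continuous_finsetSum _ fun s _ => ?_
        exact continuous_id.sub (continuous_const.mul (continuous_arg_one_sub (hst.zeros_mem j s)))
    · intro θ
      rw [hD]
      exact mul_ne_zero (exp_ne_zero _) (exp_ne_zero _)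
    · intro θ
      obtain ⟨F, hF⟩ := exists_localLift hst ha (Metric.sphere_subset_closedBall (hsph θ))
      rw [hΛ θ F hF, hloop T R hR θ F hF]
    · intro θ
      rw [hnorm, hD, mul_pow, ← Complex.exp_nat_mul (ψ θ * I)]
      congr 2
      push_cast
      ring
    · have hper : exp (((2 * Real.pi : ℝ) : ℂ) * I) = 1 := by
        push_cast
        exact Complex.exp_two_pi_mul_I
      have hper0 : exp (((0 : ℝ) : ℂ) * I) = 1 := by simp
      simp only [ψ, hper, hper0, Finset.sum_sub_distrib, Finset.sum_const, Finset.card_univ,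
        Fintype.card_fin, nsmul_eq_mul, mul_zero]
      push_cast
      rw [← Finset.mul_sum, ← Finset.sum_mul]
      ring

end LabeledPolytope

/-! ### The trace of a connection as a form on the disc -/

namespace LabeledPolytope

variable {n m k : ℕ} {P : LabeledPolytope n m} {D : MarkedOrbiDisc k} {w : ℂ → P.X}
  {z₀ : Fin m → ℂ} {ν : Fin k → Fin n → ℤ} {c : Fin k → Fin m → ℚ}
  {d : Fin m → ℕ} {α : (j : Fin m) → Fin (d j) → ℂ} {a : Fin m → ℂ}

/-- The correction to the trace of a connection in the chart `s`: the sum of the logarithmic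
derivatives of the coordinates of the lift, minus that of the homogeneous coordinates. Only the
coordinates outside the cone contribute, so that it has no pole where the chart is defined. -/
noncomputable def Chart.offForm (s : P.Chart) (D : MarkedOrbiDisc k) (c : Fin k → Fin m → ℚ)
    (α : (j : Fin m) → Fin (d j) → ℂ) (z : ℂ) : ℂ :=
  open Classical in
  ∑ j, if j ∈ Set.range s.ray then 0 else
    ((∑ l, (s.coeff (P.b j) l : ℂ)) - 1) * coordLogDeriv D c α j z

theorem Chart.sum_liftLogDeriv (s : P.Chart) (z : ℂ) :
    ∑ l, s.liftLogDeriv D c α l z = s.offForm D c α z + ∑ j, coordLogDeriv D c α j z := by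
  classical
  simp only [Chart.liftLogDeriv, Chart.offForm]
  rw [Finset.sum_comm, ← Finset.sum_add_distrib]
  refine Finset.sum_congr rfl fun j _ => ?_
  rw [← Finset.sum_mul]
  split_ifs with hj
  · obtain ⟨r, rfl⟩ := hj
    have : ∑ l, ((s.coeff (P.b (s.ray r)) l : ℚ) : ℂ) = 1 := by
      rw [Finset.sum_eq_single r]
      · rw [s.coeff_ray]; simp
      · intro l _ hl; rw [s.coeff_ray]; simp [Ne.symm hl]
      · simp
    rw [this]; ring
  · ring

theorem IsStandardForm.analyticAt_offForm (hst : P.IsStandardForm z₀ D w ν c d α a)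
    (ha : ∀ j, a j ≠ 0) (F : P.LocalLift D w) {y : ℂ} (hy : y ∈ F.dom) :
    AnalyticAt ℂ (F.chart.offForm D c α) (F.br y) := by
  unfold Chart.offForm
  refine Finset.analyticAt_fun_sum _ fun j _ => ?_
  by_cases hj : j ∈ Set.range F.chart.ray
  · simp only [if_pos hj]; exact analyticAt_const
  · simp only [if_neg hj]
    exact analyticAt_const.mul
      (analyticAt_coordLogDeriv hst.zeros_mem ha hy.2 (hst.ne_zero_of_notMem F hy hj))

theorem IsStandardForm.hasDerivAt_jac (hst : P.IsStandardForm z₀ D w ν c d α a)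
    (ha : ∀ j, a j ≠ 0) {F F' : P.LocalLift D w} {y y' : ℂ} {β : ℂ → ℂ}
    {φ : (Fin n → ℂ) → Fin n → ℂ} (h : IsGluing F F' y y' β φ)
    (hex : F.br y ∉ exceptional D α) (he : F'.e = 1) (l r : Fin n) :
    HasDerivAt (fun t => jac φ (F.f t) l r)
      (jac φ (F.f y) l r * ((F'.chart.liftLogDeriv D c α l (F.br y) -
        F.chart.liftLogDeriv D c α r (F.br y)) * (F.e * y ^ (F.e - 1)))) y := by
  have hev := h.eventually
  obtain ⟨hy, hy', hp, hβ, hβa, hbr, hφ, hSO, hff⟩ := h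
  have hexn : ∀ᶠ t in 𝓝 y, F.br t ∉ exceptional D α :=
    F.continuous_br.continuousAt.eventually (eventually_notMem_exceptional_of_notMem hex)
  have hform : ∀ᶠ t in 𝓝 y, jac φ (F.f t) l r =
      F'.f (β t) l * (F'.chart.coeff (P.b (F.chart.ray r)) l : ℂ) / F.f t r := by
    filter_upwards [hev, hexn, F.isOpen_inner.mem_nhds hy] with t ht h1 h2
    obtain ⟨k1, k2, -, -, -, k6, k7, k8, k9⟩ := ht
    have hf0 := hst.f_ne_zero ha F (F.inner_subset_dom h2) h1
    have hf0' := hst.f_ne_zero ha F' (F'.inner_subset_dom k2) (by rwa [k6.self_of_nhds])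
    rw [k9.self_of_nhds] at hf0'
    rw [jac_eq k7 hf0 hf0' k8, k9.self_of_nhds]
  have hbry : F'.br y' = F.br y := by rw [← hβ]; exact hbr.self_of_nhds
  have hf0 := hst.f_ne_zero ha F (F.inner_subset_dom hy) hex r
  have hβd : HasDerivAt β (F.e * y ^ (F.e - 1)) y := by
    have h1 : β =ᶠ[𝓝 y] fun t => F.br t - F'.p := by
      filter_upwards [hbr] with t ht
      rw [← ht]; simp [LocalLift.br, he]
    exact ((F.hasDerivAt_br y).sub_const F'.p).congr_of_eventuallyEq h1
  have hf' := hst.hasDerivAt_f ha F' hy' (by rwa [hbry]) l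
  rw [hbry, he] at hf'
  have hf'β : HasDerivAt (fun t => F'.f (β t) l)
      (F'.f y' l * F'.chart.liftLogDeriv D c α l (F.br y) * (F.e * y ^ (F.e - 1))) y := by
    have h1 : HasDerivAt (fun t => F'.f t l)
        (F'.f y' l * F'.chart.liftLogDeriv D c α l (F.br y)) (β y) := by
      rw [hβ]; simpa using hf'
    exact h1.comp y hβd
  have hf := hst.hasDerivAt_f ha F hy hex r
  have hd := ((hf'β.mul_const ((F'.chart.coeff (P.b (F.chart.ray r)) l : ℚ) : ℂ)).div hf hf0)
  refine (hd.congr_of_eventuallyEq hform).congr_deriv ?_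
  rw [hform.self_of_nhds, hβ]
  field_simp

/-- The trace of a connection in a lift, corrected so as to become independent of the lift. -/
noncomputable def OrthogonalConnection.connForm (C : OrthogonalConnection D w)
    (c : Fin k → Fin m → ℚ) (α : (j : Fin m) → Fin (d j) → ℂ) (F : P.LocalLift D w) (y u : ℂ) : ℂ :=
  (C.Γ F y u).trace + F.chart.offForm D c α (F.br y) * (F.e * y ^ (F.e - 1) * u)

theorem OrthogonalConnection.connForm_eq (C : OrthogonalConnection D w) (F : P.LocalLift D w)
    (y u : ℂ) : C.connForm c α F y u =
      (u.re : ℂ) * C.connForm c α F y 1 + (u.im : ℂ) * C.connForm c α F y I := by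
  have h1 : u = u.re • (1 : ℂ) + u.im • I := by
    simp [Complex.re_add_im]
  have h2 : C.Γ F y u = u.re • C.Γ F y 1 + u.im • C.Γ F y I := by
    conv_lhs => rw [h1]
    rw [map_add, map_smul, map_smul]
  simp only [connForm]
  rw [h2, Matrix.trace_add, Matrix.trace_smul, Matrix.trace_smul]
  simp only [Complex.real_smul]
  have hu := Complex.re_add_im u
  linear_combination (-(F.chart.offForm D c α (F.br y) * (F.e * y ^ (F.e - 1)))) * hu

theorem OrthogonalConnection.contDiffOn_connForm (hst : P.IsStandardForm z₀ D w ν c d α a)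
    (ha : ∀ j, a j ≠ 0) (C : OrthogonalConnection D w) (F : P.LocalLift D w) (u : ℂ) :
    ContDiffOn ℝ ∞ (fun y => C.connForm c α F y u) F.dom := by
  refine ContDiffOn.add ?_ ?_
  · simp only [Matrix.trace, Matrix.diag]
    exact ContDiffOn.sum fun l _ => C.Γ_smooth F u l l
  · intro y hy
    have h1 : AnalyticAt ℂ (fun y => F.chart.offForm D c α (F.br y) * (F.e * y ^ (F.e - 1) * u)) y := by
      refine AnalyticAt.mul ((hst.analyticAt_offForm ha F hy).comp (F.analyticAt_br y)) ?_
      fun_prop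
    exact (h1.restrictScalars (𝕜 := ℝ)).contDiffAt.contDiffWithinAt

/-- The trace of a connection changes by the logarithmic derivative of the determinant of the transition
map, which is the difference of the sums of the logarithmic derivatives of the coordinates of the
two lifts. The correction in `connForm` compensates for this. -/
theorem OrthogonalConnection.connForm_eq_of_isGluing (hst : P.IsStandardForm z₀ D w ν c d α a)
    (ha : ∀ j, a j ≠ 0) (C : OrthogonalConnection D w) {F F' : P.LocalLift D w} (he : F'.e = 1)
    {y : ℂ} (hy : y ∈ F.inner) (hy' : F.br y - F'.p ∈ F'.inner)
    (hex : F.br y ∉ exceptional D α) (u : ℂ) :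
    C.connForm c α F y u = C.connForm c α F' (F.br y - F'.p) (F.e * y ^ (F.e - 1) * u) := by
  obtain ⟨φ, hgl⟩ := hst.exists_isGluing ha F F' he hy hy' hex
  have hJE := hst.jac_mul_torusFrame ha hgl hex
  have hbr' : F'.br (F.br y - F'.p) = F.br y := by simp [LocalLift.br, he]
  have hJdet : (jac φ (F.f y)).det ≠ 0 := by
    have := hst.det_torusFrame_ne_zero ha F' (F'.inner_subset_dom hy') (by rwa [hbr'])
    rw [← hJE, Matrix.det_mul] at this
    exact left_ne_zero_of_mul this
  have hJ : IsUnit (jac φ (F.f y)).det := isUnit_iff_ne_zero.2 hJdet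
  have hΓ := C.Γ_glue F F' _ _ _ φ hgl u
  have hder : deriv (fun t => F.br t - F'.p) y = F.e * y ^ (F.e - 1) :=
    ((F.hasDerivAt_br y).sub_const F'.p).deriv
  rw [hder] at hΓ
  set J := jac φ (F.f y) with hJdef
  set b : ℂ := F.e * y ^ (F.e - 1) with hb
  have hdJ : (Matrix.of fun r s => fderiv ℝ (fun t => jac φ (F.f t) r s) y u) =
      Matrix.diagonal (fun l => F'.chart.liftLogDeriv D c α l (F.br y) * (b * u)) * J -
        J * Matrix.diagonal (fun l => F.chart.liftLogDeriv D c α l (F.br y) * (b * u)) := by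
    ext l r
    have h1 := (hst.hasDerivAt_jac ha hgl hex he l r).complexToReal_fderiv.fderiv
    rw [Matrix.of_apply, h1, Matrix.sub_apply, Matrix.diagonal_mul, Matrix.mul_diagonal]
    simp
    ring
  rw [hdJ] at hΓ
  have htr : (C.Γ F' (F.br y - F'.p) (b * u)).trace = (C.Γ F y u).trace -
      (∑ l, F'.chart.liftLogDeriv D c α l (F.br y) * (b * u) -
        ∑ l, F.chart.liftLogDeriv D c α l (F.br y) * (b * u)) := by
    have h1 : C.Γ F' (F.br y - F'.p) (b * u) =
        C.Γ F' (F.br y - F'.p) (b * u) * J * J⁻¹ := by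
      rw [Matrix.mul_assoc, Matrix.mul_nonsing_inv _ hJ, Matrix.mul_one]
    rw [h1, hΓ, Matrix.sub_mul, Matrix.sub_mul, Matrix.trace_sub, Matrix.trace_sub, Matrix.mul_assoc
      _ J J⁻¹, Matrix.mul_nonsing_inv _ hJ, Matrix.mul_one, Matrix.trace_diagonal,
      Matrix.trace_mul_comm (J * C.Γ F y u), ← Matrix.mul_assoc, Matrix.nonsing_inv_mul _ hJ,
      Matrix.one_mul, Matrix.trace_mul_comm (J * Matrix.diagonal _), ← Matrix.mul_assoc,
      Matrix.nonsing_inv_mul _ hJ, Matrix.one_mul, Matrix.trace_diagonal]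
  simp only [connForm]
  rw [htr, hbr', ← Finset.sum_mul, ← Finset.sum_mul, F.chart.sum_liftLogDeriv,
    F'.chart.sum_liftLogDeriv, he]
  simp
  ring

theorem LocalLift.deriv_br_ne_zero (F : P.LocalLift D w) {y : ℂ} (hp : ∀ i, F.br y ≠ D.pts i) :
    (F.e : ℂ) * y ^ (F.e - 1) ≠ 0 := by
  have he : (F.e : ℂ) ≠ 0 := by exact_mod_cast F.e_pos.ne'
  refine mul_ne_zero he ?_
  by_cases hy : y = 0
  · subst hy
    rw [F.localOrder.eq_one (by simpa using hp)]
    simp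
  · exact pow_ne_zero _ hy

/-- The corrected traces of a connection in all lifts come from one form on the disc. -/
theorem OrthogonalConnection.connForm_eq_connForm (hst : P.IsStandardForm z₀ D w ν c d α a)
    (ha : ∀ j, a j ≠ 0) (C : OrthogonalConnection D w) (F F' : P.LocalLift D w) (he : F'.e = 1)
    {y : ℂ} (hy : y ∈ F.dom) (hin : y ∈ F.inner ∨ F.e = 1) (hy' : F.br y - F'.p ∈ F'.dom)
    (hpt : ∀ i, F.br y ≠ D.pts i) (u : ℂ) :
    C.connForm c α F y u = C.connForm c α F' (F.br y - F'.p) (F.e * y ^ (F.e - 1) * u) := by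
  set Φ : P.LocalLift D w → ℂ → ℂ → ℂ := fun F y v =>
    C.connForm c α F y ((F.e * y ^ (F.e - 1) : ℂ)⁻¹ * v) with hΦ
  have hc : ∀ (v : ℂ) (F : P.LocalLift D w),
      ContinuousOn (fun y => Φ F y v) {y | y ∈ F.dom ∧ ∀ i, F.br y ≠ D.pts i} := by
    intro v F
    have h0 : ∀ v, ContinuousOn (fun y => C.connForm c α F y v)
        {y | y ∈ F.dom ∧ ∀ i, F.br y ≠ D.pts i} := fun v =>
      (C.contDiffOn_connForm hst ha F v).continuousOn.mono fun y hy => hy.1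
    have h1 : ContinuousOn (fun y : ℂ => ((F.e : ℂ) * y ^ (F.e - 1))⁻¹ * v)
        {y | y ∈ F.dom ∧ ∀ i, F.br y ≠ D.pts i} := by
      refine ContinuousOn.mul (ContinuousOn.inv₀ (by fun_prop) ?_) continuousOn_const
      exact fun y hy => F.deriv_br_ne_zero hy.2
    have h2 : (fun y => Φ F y v) = fun y =>
        ((((F.e : ℂ) * y ^ (F.e - 1))⁻¹ * v).re : ℂ) * C.connForm c α F y 1 +
        ((((F.e : ℂ) * y ^ (F.e - 1))⁻¹ * v).im : ℂ) * C.connForm c α F y I :=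
      funext fun y => C.connForm_eq F y _
    rw [h2]
    exact ((Complex.continuous_ofReal.comp Complex.continuous_re).comp_continuousOn h1).mul (h0 1)
      |>.add (((Complex.continuous_ofReal.comp Complex.continuous_im).comp_continuousOn h1).mul
        (h0 I))
  have key := fun v => LocalLift.eq_of_eq_on_inner (fun F y => Φ F y v) (exceptional D α) (hc v)
    (fun F F' he y hy hy' hex => ?_) F F' he hy hin hy' hpt
  · have h := key (F.e * y ^ (F.e - 1) * u)
    simp only [hΦ, he] at h
    rw [inv_mul_cancel_left₀ (F.deriv_br_ne_zero hpt)] at h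
    simpa using h
  · have hpt : ∀ i, F.br y ≠ D.pts i := ne_pts_of_notMem hex
    simp only [hΦ]
    rw [C.connForm_eq_of_isGluing hst ha he hy hy' hex, he,
      mul_inv_cancel_left₀ (F.deriv_br_ne_zero hpt)]
    simp

end LabeledPolytope

/-! ### Stokes' theorem on the disc for forms with weak singularities -/

section Stokes

open MeasureTheory Set

theorem integrableOn_comp_polarCoord_symm {f : ℂ → ℂ} (hf : Integrable f) :
    IntegrableOn (fun p : ℝ × ℝ => p.1 • f (Complex.polarCoord.symm p)) polarCoord.target := by
  have h1 : Integrable (fun p => f (measurableEquivRealProd.symm p)) :=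
    (Complex.volume_preserving_equiv_real_prod.symm.integrable_comp_emb
      measurableEquivRealProd.symm.measurableEmbedding).2 hf
  have h2 := (integrableOn_image_iff_integrableOn_abs_det_fderiv_smul volume
    polarCoord.open_target.measurableSet
    (fun p _ => (hasFDerivAt_polarCoord_symm p).hasFDerivWithinAt) polarCoord.symm.injOn
    (fun p => f (measurableEquivRealProd.symm p))).1 h1.integrableOn
  refine h2.congr_fun (fun p hp => ?_) polarCoord.open_target.measurableSet
  have hp1 : 0 < p.1 := hp.1
  simp only [det_fderivPolarCoordSymm, abs_of_pos hp1]
  rw [measurableEquivRealProd_symm_polarCoord_symm_apply]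

/-- Stokes' theorem for a form that is continuous on the closed disc, proved in polar coordinates. -/
theorem integral_ball_curl_of_continuousOn {a₁ a₂ : ℂ → ℂ} {a₁' a₂' : ℂ → ℂ →L[ℝ] ℂ} {S : Set ℂ}
    (hS : S.Countable) (h₁ : ContinuousOn a₁ (Metric.closedBall 0 1))
    (h₂ : ContinuousOn a₂ (Metric.closedBall 0 1))
    (hd₁ : ∀ z ∈ Metric.ball (0 : ℂ) 1 \ S, HasFDerivAt a₁ (a₁' z) z)
    (hd₂ : ∀ z ∈ Metric.ball (0 : ℂ) 1 \ S, HasFDerivAt a₂ (a₂' z) z)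
    (hi : IntegrableOn (fun z => a₂' z 1 - a₁' z I) (Metric.ball 0 1)) :
    ∫ z in Metric.ball (0 : ℂ) 1, (a₂' z 1 - a₁' z I) =
      ∫ θ in (-Real.pi)..Real.pi,
        (-(Real.sin θ : ℂ) * a₁ (exp (θ * I)) + (Real.cos θ : ℂ) * a₂ (exp (θ * I))) := by
  set Z : ℝ × ℝ → ℂ := fun p => (p.1 : ℂ) * (Real.cos p.2 + Real.sin p.2 * I) with hZ
  have hZsymm : ∀ p, Complex.polarCoord.symm p = Z p := fun p => Complex.polarCoord_symm_apply p
  have hZnorm : ∀ p, ‖Z p‖ = |p.1| := fun p => by rw [← hZsymm, Complex.norm_polarCoord_symm]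
  have hcos : ∀ p : ℝ × ℝ, HasFDerivAt (fun p : ℝ × ℝ => (Real.cos p.2 : ℂ))
      ((ContinuousLinearMap.snd ℝ ℝ ℝ).smulRight (-(Real.sin p.2 : ℂ))) p := fun p => by
    have h := (Real.hasDerivAt_cos p.2).ofReal_comp
    have hs : HasFDerivAt (fun p : ℝ × ℝ => p.2) (ContinuousLinearMap.snd ℝ ℝ ℝ) p := hasFDerivAt_snd
    refine (h.hasFDerivAt.comp p hs).congr_fderiv ?_
    ext <;> simp
  have hsin : ∀ p : ℝ × ℝ, HasFDerivAt (fun p : ℝ × ℝ => (Real.sin p.2 : ℂ))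
      ((ContinuousLinearMap.snd ℝ ℝ ℝ).smulRight (Real.cos p.2 : ℂ)) p := fun p => by
    have h := (Real.hasDerivAt_sin p.2).ofReal_comp
    have hs : HasFDerivAt (fun p : ℝ × ℝ => p.2) (ContinuousLinearMap.snd ℝ ℝ ℝ) p := hasFDerivAt_snd
    refine (h.hasFDerivAt.comp p hs).congr_fderiv ?_
    ext <;> simp
  have hrad : ∀ p : ℝ × ℝ, HasFDerivAt (fun p : ℝ × ℝ => (p.1 : ℂ))
      ((ContinuousLinearMap.fst ℝ ℝ ℝ).smulRight (1 : ℂ)) p := fun p => by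
    have h := (Complex.ofRealCLM.hasFDerivAt (x := p.1))
    have hs : HasFDerivAt (fun p : ℝ × ℝ => p.1) (ContinuousLinearMap.fst ℝ ℝ ℝ) p := hasFDerivAt_fst
    refine (h.comp p hs).congr_fderiv ?_
    ext <;> simp
  have hZc : Continuous Z := by fun_prop
  -- the vector field `(f, g)` in polar coordinates has the divergence `r (∂₁ a₂ - ∂₂ a₁)`
  set f : ℝ × ℝ → ℂ := fun p =>
    (p.1 : ℂ) * (-(Real.sin p.2 : ℂ) * a₁ (Z p) + (Real.cos p.2 : ℂ) * a₂ (Z p)) with hf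
  set g : ℝ × ℝ → ℂ := fun p =>
    -((Real.cos p.2 : ℂ) * a₁ (Z p) + (Real.sin p.2 : ℂ) * a₂ (Z p)) with hg
  set Q : Set (ℝ × ℝ) := Ioo 0 1 ×ˢ Ioo (-Real.pi) Real.pi with hQ
  have hQt : Q ⊆ polarCoord.target := fun p hp => ⟨hp.1.1, hp.2⟩
  have hQZ : ∀ p ∈ Q, Z p ∈ Metric.ball (0 : ℂ) 1 := fun p hp => by
    rw [mem_ball_zero_iff, hZnorm, abs_of_pos hp.1.1]; exact hp.1.2
  -- both components are differentiable in the open rectangle, off the preimage of `S`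
  have hdiff : ∀ p ∈ Q \ (Q ∩ Z ⁻¹' S), DifferentiableAt ℝ f p ∧ DifferentiableAt ℝ g p ∧
      fderiv ℝ f p (1, 0) + fderiv ℝ g p (0, 1) = p.1 • (a₂' (Z p) 1 - a₁' (Z p) I) := by
    intro p hp
    have hpS : Z p ∉ S := fun h => hp.2 ⟨hp.1, h⟩
    have hZd : HasFDerivAt Z (((ContinuousLinearMap.fst ℝ ℝ ℝ).smulRight
        ((Real.cos p.2 : ℂ) + Real.sin p.2 * I)) + ((ContinuousLinearMap.snd ℝ ℝ ℝ).smulRight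
        ((p.1 : ℂ) * (-Real.sin p.2 + Real.cos p.2 * I)))) p := by
      refine ((hrad p).mul ((hcos p).add ((hsin p).mul_const I))).congr_fderiv ?_
      ext <;> (simp; try ring)
    have hA₁ := (hd₁ (Z p) ⟨hQZ p hp.1, hpS⟩).comp p hZd
    have hA₂ := (hd₂ (Z p) ⟨hQZ p hp.1, hpS⟩).comp p hZd
    have hF := (hrad p).mul (((hsin p).neg.mul hA₁).add ((hcos p).mul hA₂))
    have hG := (((hcos p).mul hA₁).add ((hsin p).mul hA₂)).neg
    refine ⟨hF.differentiableAt, hG.differentiableAt, ?_⟩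
    have e₁ := hF.fderiv
    have e₂ := hG.fderiv
    have hlin : ∀ (L : ℂ →L[ℝ] ℂ) (x y : ℝ), L (x + y * I) = x * L 1 + y * L I := fun L x y => by
      have : (x + y * I : ℂ) = x • (1 : ℂ) + y • I := by simp
      rw [this, map_add, map_smul, map_smul]; simp
    have e₃ : ∀ L : ℂ →L[ℝ] ℂ, L ((p.1 : ℂ) * (-Real.sin p.2 + Real.cos p.2 * I)) =
        p.1 * (-Real.sin p.2 * L 1 + Real.cos p.2 * L I) := fun L => by
      have : (p.1 : ℂ) * (-Real.sin p.2 + Real.cos p.2 * I) =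
        ((p.1 * (-Real.sin p.2) : ℝ) : ℂ) + ((p.1 * Real.cos p.2 : ℝ) : ℂ) * I := by push_cast; ring
      rw [this, hlin]; push_cast; ring
    have hsc : (Real.sin p.2 : ℂ) ^ 2 + (Real.cos p.2 : ℂ) ^ 2 = 1 := by
      exact_mod_cast Real.sin_sq_add_cos_sq p.2
    have E₁ : fderiv ℝ f p (1, 0) = _ := congrArg (fun L => L (1, 0)) e₁
    have E₂ : fderiv ℝ g p (0, 1) = _ := congrArg (fun L => L (0, 1)) e₂
    rw [E₁, E₂]
    simp only [add_apply, smul_apply, ContinuousLinearMap.comp_apply,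
      ContinuousLinearMap.smulRight_apply, ContinuousLinearMap.coe_fst',
      ContinuousLinearMap.coe_snd', neg_apply, Function.comp, one_smul, zero_smul, add_zero,
      zero_add, hlin, e₃, smul_eq_mul, Complex.real_smul, mul_zero, mul_one, smul_neg,
      Pi.neg_apply, Pi.mul_apply, Pi.add_apply]
    linear_combination (p.1 : ℂ) * (a₂' (Z p) 1 - a₁' (Z p) I) * hsc
  have hQae : Icc ((0 : ℝ), -Real.pi) (1, Real.pi) =ᵐ[volume] Q := by
    rw [← Icc_prod_Icc, hQ]
    exact (Measure.set_prod_ae_eq Ioo_ae_eq_Icc Ioo_ae_eq_Icc).symm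
  have hcount : (Q ∩ Z ⁻¹' S).Countable := by
    refine MapsTo.countable_of_injOn (f := Z) (t := S) (fun p hp => hp.2) ?_ hS
    intro p hp q hq hpq
    rw [← hZsymm, ← hZsymm] at hpq
    exact Complex.polarCoord.symm.injOn (hQt hp.1) (hQt hq.1) hpq
  have hmaps : MapsTo Z (Icc ((0 : ℝ), -Real.pi) (1, Real.pi)) (Metric.closedBall 0 1) := by
    intro p hp
    rw [mem_closedBall_zero_iff, hZnorm, abs_of_nonneg hp.1.1]
    exact hp.2.1
  have hc₁ := h₁.comp hZc.continuousOn hmaps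
  have hc₂ := h₂.comp hZc.continuousOn hmaps
  have hcosc : Continuous fun p : ℝ × ℝ => (Real.cos p.2 : ℂ) := by fun_prop
  have hsinc : Continuous fun p : ℝ × ℝ => (Real.sin p.2 : ℂ) := by fun_prop
  have hrc : Continuous fun p : ℝ × ℝ => (p.1 : ℂ) := by fun_prop
  set K : ℂ → ℂ := (Metric.ball (0 : ℂ) 1).indicator fun z => a₂' z 1 - a₁' z I with hK
  have hKi : Integrable K := (integrable_indicator_iff measurableSet_ball).2 hi
  have hQK : ∀ p ∈ Q, p.1 • K (Complex.polarCoord.symm p) = p.1 • (a₂' (Z p) 1 - a₁' (Z p) I) :=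
    fun p hp => by rw [hZsymm, hK, indicator_of_mem (hQZ p hp)]
  have hQm : MeasurableSet Q := measurableSet_Ioo.prod measurableSet_Ioo
  have hcae : ∀ᵐ p ∂(volume.restrict Q), p ∉ Q ∩ Z ⁻¹' S :=
    ae_restrict_of_ae (hcount.ae_notMem volume)
  have hae : ∀ᵐ p ∂(volume.restrict Q), p.1 • K (Complex.polarCoord.symm p) =
      fderiv ℝ f p (1, 0) + fderiv ℝ g p (0, 1) := by
    filter_upwards [hcae, ae_restrict_mem hQm] with p hp hpQ
    rw [hQK p hpQ, (hdiff p ⟨hpQ, hp⟩).2.2]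
  have hint : IntegrableOn (fun p => fderiv ℝ f p (1, 0) + fderiv ℝ g p (0, 1)) Q :=
    ((integrableOn_comp_polarCoord_symm hKi).mono_set hQt).congr hae
  have hdiv := integral_divergence_prod_Icc_of_hasFDerivAt_off_countable_of_le f g
    (fderiv ℝ f) (fderiv ℝ g) (0, -Real.pi) (1, Real.pi)
    ⟨zero_le_one, by linarith [Real.pi_pos]⟩ (Q ∩ Z ⁻¹' S) hcount
    (hrc.continuousOn.mul ((hsinc.neg.continuousOn.mul hc₁).add (hcosc.continuousOn.mul hc₂)))
    ((hcosc.continuousOn.mul hc₁).add (hsinc.continuousOn.mul hc₂)).neg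
    (fun p hp => (hdiff p hp).1.hasFDerivAt) (fun p hp => (hdiff p hp).2.1.hasFDerivAt)
    (hint.congr_set_ae hQae)
  have hper : ∀ x : ℝ, g (x, Real.pi) = g (x, -Real.pi) := fun x => by
    simp [hg, hZ]
  have hzero : ∀ y : ℝ, f (0, y) = 0 := fun y => by simp [hf]
  have hone : ∀ y : ℝ, f (1, y) = -(Real.sin y : ℂ) * a₁ (exp (y * I)) +
      (Real.cos y : ℂ) * a₂ (exp (y * I)) := fun y => by
    have : Z (1, y) = exp (y * I) := by simp [hZ, Complex.exp_mul_I]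
    simp only [hf, this, Complex.ofReal_one, one_mul]
  have hleft : ∫ z in Metric.ball (0 : ℂ) 1, (a₂' z 1 - a₁' z I) =
      ∫ p in Q, (fderiv ℝ f p (1, 0) + fderiv ℝ g p (0, 1)) := by
    rw [← integral_indicator measurableSet_ball, ← hK, ← Complex.integral_comp_polarCoord_symm,
      ← integral_congr_ae hae]
    refine setIntegral_eq_of_subset_of_forall_sdiff_eq_zero
      polarCoord.open_target.measurableSet hQt fun p hp => ?_
    have : Complex.polarCoord.symm p ∉ Metric.ball (0 : ℂ) 1 := by
      rw [hZsymm, mem_ball_zero_iff, hZnorm]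
      intro h
      have hp1 : (0 : ℝ) < p.1 := hp.1.1
      rw [abs_of_pos hp1] at h
      exact hp.2 ⟨⟨hp1, h⟩, hp.1.2⟩
    rw [hK, indicator_of_notMem this, smul_zero]
  rw [hleft, ← setIntegral_congr_set hQae, hdiv]
  simp only [hper, hzero, hone]
  simp

open Filter

/-- Stokes' theorem for the form `a₁ dx + a₂ dy`, which may be singular at the points of the finite
set `S`, provided that it is small enough there. -/
theorem integral_ball_curl {a₁ a₂ : ℂ → ℂ} {a₁' a₂' : ℂ → ℂ →L[ℝ] ℂ} {S : Finset ℂ}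
    (hS : ∀ p ∈ S, ‖p‖ < 1)
    (h₁ : ContinuousOn a₁ (Metric.closedBall 0 1 \ S))
    (h₂ : ContinuousOn a₂ (Metric.closedBall 0 1 \ S))
    (hd₁ : ∀ z ∈ Metric.ball (0 : ℂ) 1 \ S, HasFDerivAt a₁ (a₁' z) z)
    (hd₂ : ∀ z ∈ Metric.ball (0 : ℂ) 1 \ S, HasFDerivAt a₂ (a₂' z) z)
    (hi : IntegrableOn (fun z => a₂' z 1 - a₁' z I) (Metric.ball 0 1))
    (hi₁ : ∀ p ∈ S, IntegrableOn (fun z => ‖a₁ z‖ / ‖z - p‖) (Metric.ball 0 1))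
    (hi₂ : ∀ p ∈ S, IntegrableOn (fun z => ‖a₂ z‖ / ‖z - p‖) (Metric.ball 0 1))
    (hp₁ : ∀ p ∈ S, Tendsto (fun z => (z - p) ^ 2 * a₁ z) (𝓝[≠] p) (𝓝 0))
    (hp₂ : ∀ p ∈ S, Tendsto (fun z => (z - p) ^ 2 * a₂ z) (𝓝[≠] p) (𝓝 0)) :
    ∫ z in Metric.ball (0 : ℂ) 1, (a₂' z 1 - a₁' z I) =
      ∫ θ in (-Real.pi)..Real.pi,
        (-(Real.sin θ : ℂ) * a₁ (exp (θ * I)) + (Real.cos θ : ℂ) * a₂ (exp (θ * I))) := by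
  classical
  -- a cut-off function, `1` away from `S` in the limit, vanishing to second order on `S`
  set q : ℂ → ℂ := fun z => ∏ p ∈ S, (z - p) with hq
  have hqd : ∀ z, HasDerivAt q (deriv q z) z := fun z =>
    (by fun_prop : Differentiable ℂ q).differentiableAt.hasDerivAt
  have hqc : Continuous q := by fun_prop
  have hqc' : Continuous (deriv q) := by
    have : ContDiff ℂ 1 q := by fun_prop
    exact this.continuous_deriv le_rfl
  have hq0 : ∀ z, z ∉ S → q z ≠ 0 := fun z hz =>
    Finset.prod_ne_zero_iff.2 fun p hp => sub_ne_zero.2 fun h => hz (h ▸ hp)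
  have hqS : ∀ z ∈ S, q z = 0 := fun z hz => Finset.prod_eq_zero hz (sub_self z)
  have hqlog : ∀ z, z ∉ S → ‖deriv q z‖ / ‖q z‖ ≤ ∑ p ∈ S, 1 / ‖z - p‖ := by
    intro z hz
    have h1 : logDeriv q z = ∑ p ∈ S, logDeriv (fun z => z - p) z :=
      logDeriv_prod (fun p hp => sub_ne_zero.2 fun h => hz (h ▸ hp)) (fun p hp => by fun_prop)
    rw [← norm_div, ← logDeriv_apply, h1]
    refine (norm_sum_le _ _).trans (Finset.sum_le_sum fun p _ => ?_)
    simp [logDeriv_apply]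
  set ε : ℕ → ℝ := fun N => 1 / ((N : ℝ) + 1) with hε
  have hεpos : ∀ N, 0 < ε N := fun N => Nat.one_div_pos_of_nat
  set η : ℕ → ℂ → ℝ := fun N z => ‖q z‖ ^ 2 / (‖q z‖ ^ 2 + ε N) with hη
  set η' : ℕ → ℂ → ℂ → ℝ := fun N z u =>
    ε N / (‖q z‖ ^ 2 + ε N) ^ 2 * (2 * (conj (q z) * (deriv q z * u)).re) with hη'
  have hden : ∀ N z, 0 < ‖q z‖ ^ 2 + ε N := fun N z => by have := hεpos N; positivity
  have hηc : ∀ N, Continuous (η N) := fun N => by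
    refine Continuous.div (by fun_prop) (by fun_prop) fun z => (hden N z).ne'
  have hη'c : ∀ N u, Continuous fun z => η' N z u := fun N u => by
    refine Continuous.mul (Continuous.div (by fun_prop) (by fun_prop) fun z =>
      pow_ne_zero _ (hden N z).ne') ?_
    have : Continuous fun z => conj (q z) := Complex.continuous_conj.comp hqc
    fun_prop
  have hηd : ∀ N z, ∃ L : ℂ →L[ℝ] ℝ, HasFDerivAt (η N) L z ∧ ∀ u, L u = η' N z u := by
    intro N z
    have h1 := ((hqd z).hasFDerivAt.restrictScalars ℝ).norm_sq
    have h2 := h1.mul ((hasFDerivAt_inv (hden N z).ne').comp z (h1.add_const (ε N)))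
    refine ⟨_, h2, fun u => ?_⟩
    have h3 := (hden N z).ne'
    simp [hη', Complex.inner]
    field_simp
    ring
  choose L hL hLη' using hηd
  have hη01 : ∀ N z, |η N z| ≤ 1 := fun N z => by
    rw [hη, abs_of_nonneg (div_nonneg (by positivity) (hden N z).le), div_le_one (hden N z)]
    linarith [hεpos N]
  -- a bound for the gradient of the cut-off function that does not depend on `N`
  have hη'le : ∀ N z, z ∉ S → ∀ u : ℂ, ‖u‖ = 1 → |η' N z u| ≤ 2 * ∑ p ∈ S, 1 / ‖z - p‖ := by
    intro N z hz u hu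
    have hqz : 0 < ‖q z‖ := norm_pos_iff.2 (hq0 z hz)
    have h1 : |(conj (q z) * (deriv q z * u)).re| ≤ ‖q z‖ * ‖deriv q z‖ := by
      refine (Complex.abs_re_le_norm _).trans ?_
      simp [hu]
    have h2 : ε N / (‖q z‖ ^ 2 + ε N) ^ 2 ≤ 1 / ‖q z‖ ^ 2 := by
      rw [div_le_div_iff₀ (pow_pos (hden N z) 2) (by positivity)]
      nlinarith [hεpos N, sq_nonneg (‖q z‖ ^ 2), sq_nonneg (ε N), mul_pos (hεpos N) (pow_pos hqz 2)]
    have h3 : 0 ≤ ε N / (‖q z‖ ^ 2 + ε N) ^ 2 := div_nonneg (hεpos N).le (by positivity)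
    calc |η' N z u| = ε N / (‖q z‖ ^ 2 + ε N) ^ 2 * (2 * |(conj (q z) * (deriv q z * u)).re|) := by
          simp only [hη']
          rw [abs_mul, abs_mul, abs_of_nonneg h3, abs_two]
      _ ≤ 1 / ‖q z‖ ^ 2 * (2 * (‖q z‖ * ‖deriv q z‖)) := by gcongr
      _ = 2 * (‖deriv q z‖ / ‖q z‖) := by field_simp
      _ ≤ _ := by gcongr; exact hqlog z hz
  have hcont : ∀ (N : ℕ) (f : ℂ → ℂ), ContinuousOn f (Metric.closedBall 0 1 \ S) →
      (∀ p ∈ S, Tendsto (fun z => (z - p) ^ 2 * f z) (𝓝[≠] p) (𝓝 0)) →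
      ContinuousOn (fun z => (η N z : ℂ) * f z) (Metric.closedBall 0 1) := by
    intro N f hf hfp z hz
    have hηC : Continuous fun z => (η N z : ℂ) := Complex.continuous_ofReal.comp (hηc N)
    by_cases hzS : z ∈ S
    · refine ContinuousAt.continuousWithinAt ?_
      rw [continuousAt_iff_punctured_nhds]
      have h0 : η N z = 0 := by simp [hη, hqS z hzS]
      simp only [h0, Complex.ofReal_zero, zero_mul]
      set r : ℂ → ℂ := fun t => ∏ p ∈ S.erase z, (t - p) with hr
      have hrc : Continuous r := by fun_prop
      have hqr : ∀ t, q t = (t - z) * r t := fun t => (Finset.mul_prod_erase S (fun p => t - p) hzS).symm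
      have hlim : Tendsto (fun t => ‖(t - z) ^ 2 * f t‖ * (‖r t‖ ^ 2 / ε N)) (𝓝[≠] z) (𝓝 0) := by
        have h1 := (hfp z hzS).norm.mul
          (((hrc.norm.pow 2).div_const (ε N)).tendsto z |>.mono_left nhdsWithin_le_nhds)
        simpa using h1
      refine squeeze_zero_norm (fun t => ?_) hlim
      rw [norm_mul, Complex.norm_real, Real.norm_eq_abs,
        abs_of_nonneg (div_nonneg (by positivity) (hden N t).le)]
      have h2 : ‖q t‖ ^ 2 / (‖q t‖ ^ 2 + ε N) ≤ ‖q t‖ ^ 2 / ε N :=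
        div_le_div_of_nonneg_left (by positivity) (hεpos N) (by nlinarith [sq_nonneg ‖q t‖])
      calc ‖q t‖ ^ 2 / (‖q t‖ ^ 2 + ε N) * ‖f t‖ ≤ ‖q t‖ ^ 2 / ε N * ‖f t‖ := by gcongr
        _ = ‖(t - z) ^ 2 * f t‖ * (‖r t‖ ^ 2 / ε N) := by
          rw [hqr, norm_mul, norm_mul, norm_pow]; ring
    · have hfz : ContinuousWithinAt f (Metric.closedBall 0 1) z := by
        refine (hf z ⟨hz, hzS⟩).mono_of_mem_nhdsWithin ?_
        exact inter_mem_nhdsWithin _ (S.finite_toSet.isClosed.isOpen_compl.mem_nhds hzS)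
      exact hηC.continuousWithinAt.mul hfz
  have hderiv : ∀ (N : ℕ) (f : ℂ → ℂ) (f' : ℂ → ℂ →L[ℝ] ℂ),
      (∀ z ∈ Metric.ball (0 : ℂ) 1 \ S, HasFDerivAt f (f' z) z) →
      ∀ z ∈ Metric.ball (0 : ℂ) 1 \ S, HasFDerivAt (fun z => (η N z : ℂ) * f z)
        ((η N z : ℂ) • f' z + f z • Complex.ofRealCLM.comp (L N z)) z := fun N f f' hf z hz =>
    (Complex.ofRealCLM.hasFDerivAt.comp z (hL N z)).mul (hf z hz)
  have hae : Metric.ball (0 : ℂ) 1 =ᵐ[volume] (Metric.ball (0 : ℂ) 1 \ S : Set ℂ) :=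
    (sdiff_null_ae_eq_self (S.finite_toSet.measure_zero volume)).symm
  have hBm : MeasurableSet (Metric.ball (0 : ℂ) 1 \ S : Set ℂ) :=
    measurableSet_ball.diff S.finite_toSet.measurableSet
  have hres : volume.restrict (Metric.ball (0 : ℂ) 1) =
      volume.restrict (Metric.ball (0 : ℂ) 1 \ S : Set ℂ) := Measure.restrict_congr_set hae
  have hsub : (Metric.ball (0 : ℂ) 1 \ S : Set ℂ) ⊆ Metric.closedBall 0 1 \ S :=
    sdiff_subset_sdiff_left Metric.ball_subset_closedBall
  have hm₁ : AEStronglyMeasurable a₁ (volume.restrict (Metric.ball (0 : ℂ) 1)) := by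
    rw [hres]; exact (h₁.mono hsub).aestronglyMeasurable hBm
  have hm₂ : AEStronglyMeasurable a₂ (volume.restrict (Metric.ball (0 : ℂ) 1)) := by
    rw [hres]; exact (h₂.mono hsub).aestronglyMeasurable hBm
  set κ : ℕ → ℂ → ℂ := fun N z => ((η N z : ℂ) • a₂' z + a₂ z • Complex.ofRealCLM.comp (L N z)) 1 -
      ((η N z : ℂ) • a₁' z + a₁ z • Complex.ofRealCLM.comp (L N z)) I with hκ
  have hκ_eq : ∀ N z, κ N z = (η N z : ℂ) * (a₂' z 1 - a₁' z I) +
      (a₂ z * η' N z 1 - a₁ z * η' N z I) := by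
    intro N z
    simp only [hκ, add_apply, smul_apply, ContinuousLinearMap.comp_apply, Complex.ofRealCLM_apply,
      smul_eq_mul, hLη']
    ring
  set B : ℂ → ℝ := fun z => ‖a₂' z 1 - a₁' z I‖ +
    ∑ p ∈ S, 2 * (‖a₂ z‖ / ‖z - p‖ + ‖a₁ z‖ / ‖z - p‖) with hB
  have hBi : IntegrableOn B (Metric.ball 0 1) :=
    hi.norm.add (integrable_finsetSum _ fun p hp => ((hi₂ p hp).add (hi₁ p hp)).const_mul 2)
  have hκm : ∀ N, AEStronglyMeasurable (κ N) (volume.restrict (Metric.ball (0 : ℂ) 1)) := by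
    intro N
    rw [show κ N = _ from funext (hκ_eq N)]
    have hc : ∀ u, AEStronglyMeasurable (fun z => (η' N z u : ℂ))
        (volume.restrict (Metric.ball (0 : ℂ) 1)) := fun u =>
      (Complex.continuous_ofReal.comp (hη'c N u)).aestronglyMeasurable
    exact ((Complex.continuous_ofReal.comp (hηc N)).aestronglyMeasurable.mul
      hi.aestronglyMeasurable).add ((hm₂.mul (hc 1)).sub (hm₁.mul (hc I)))
  have hnotS : ∀ᵐ z ∂(volume.restrict (Metric.ball (0 : ℂ) 1)), z ∉ S :=
    ae_restrict_of_ae (S.countable_toSet.ae_notMem volume)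
  have hκB : ∀ N, ∀ᵐ z ∂(volume.restrict (Metric.ball (0 : ℂ) 1)), ‖κ N z‖ ≤ B z := by
    intro N
    filter_upwards [hnotS] with z hz
    rw [hκ_eq]
    have e₁ := hη'le N z hz 1 (by simp)
    have e₂ := hη'le N z hz I (by simp)
    calc _ ≤ ‖(η N z : ℂ) * (a₂' z 1 - a₁' z I)‖ + (‖a₂ z * η' N z 1‖ + ‖a₁ z * η' N z I‖) :=
          (norm_add_le _ _).trans (add_le_add_right (norm_sub_le _ _) _)
      _ = |η N z| * ‖a₂' z 1 - a₁' z I‖ + (‖a₂ z‖ * |η' N z 1| + ‖a₁ z‖ * |η' N z I|) := by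
          simp
      _ ≤ 1 * ‖a₂' z 1 - a₁' z I‖ + (‖a₂ z‖ * (2 * ∑ p ∈ S, 1 / ‖z - p‖) +
            ‖a₁ z‖ * (2 * ∑ p ∈ S, 1 / ‖z - p‖)) := by
          gcongr
          exact hη01 N z
      _ = B z := by
          simp only [hB, Finset.mul_sum, one_mul]
          rw [← Finset.sum_add_distrib]
          congr 1
          exact Finset.sum_congr rfl fun p _ => by ring
  have hκi : ∀ N, IntegrableOn (κ N) (Metric.ball 0 1) := fun N =>
    Integrable.mono' hBi (hκm N) (hκB N)
  have hεlim : Tendsto ε atTop (𝓝 0) := tendsto_one_div_add_atTop_nhds_zero_nat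
  have hηlim : ∀ z, z ∉ S → Tendsto (fun N => η N z) atTop (𝓝 1) := by
    intro z hz
    have hqz : ‖q z‖ ^ 2 ≠ 0 := pow_ne_zero _ (norm_ne_zero_iff.2 (hq0 z hz))
    have h1 := (tendsto_const_nhds (x := ‖q z‖ ^ 2)).div (hεlim.const_add (‖q z‖ ^ 2))
      (by simpa using hqz)
    have h2 : ‖q z‖ ^ 2 / (‖q z‖ ^ 2 + 0) = 1 := by rw [add_zero, div_self hqz]
    rw [h2] at h1
    exact h1
  have hη'lim : ∀ z, z ∉ S → ∀ u, Tendsto (fun N => η' N z u) atTop (𝓝 0) := by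
    intro z hz u
    have hqz : ‖q z‖ ^ 2 ≠ 0 := pow_ne_zero _ (norm_ne_zero_iff.2 (hq0 z hz))
    have h1 := (hεlim.div ((hεlim.const_add (‖q z‖ ^ 2)).pow 2)
      (by simpa using hqz)).mul_const (2 * (conj (q z) * (deriv q z * u)).re)
    rw [zero_div, zero_mul] at h1
    exact h1
  have hleft : Tendsto (fun N => ∫ z in Metric.ball (0 : ℂ) 1, κ N z) atTop
      (𝓝 (∫ z in Metric.ball (0 : ℂ) 1, (a₂' z 1 - a₁' z I))) := by
    refine tendsto_integral_of_dominated_convergence B hκm hBi hκB ?_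
    filter_upwards [hnotS] with z hz
    simp only [hκ_eq]
    have h0 : ∀ u, Tendsto (fun N => (η' N z u : ℂ)) atTop (𝓝 0) := fun u => by
      exact_mod_cast (Complex.continuous_ofReal.tendsto 0).comp (hη'lim z hz u)
    have h1 : Tendsto (fun N => (η N z : ℂ)) atTop (𝓝 1) := by
      exact_mod_cast (Complex.continuous_ofReal.tendsto 1).comp (hηlim z hz)
    have h2 := (h1.mul_const (a₂' z 1 - a₁' z I)).add
      (((h0 1).const_mul (a₂ z)).sub ((h0 I).const_mul (a₁ z)))
    simpa using h2
  have hcircS : ∀ θ : ℝ, exp (θ * I) ∉ S := fun θ h => by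
    have := hS _ h
    simp [Complex.norm_exp_ofReal_mul_I] at this
  have hcirc : Continuous fun θ : ℝ => exp (θ * I) := by fun_prop
  have hcircm : ∀ θ : ℝ, exp (θ * I) ∈ Metric.closedBall (0 : ℂ) 1 \ S := fun θ =>
    ⟨by simp [Complex.norm_exp_ofReal_mul_I], hcircS θ⟩
  set b : ℝ → ℂ := fun θ => -(Real.sin θ : ℂ) * a₁ (exp (θ * I)) +
    (Real.cos θ : ℂ) * a₂ (exp (θ * I)) with hb
  have hbc : Continuous b := by
    have e₁ : Continuous fun θ : ℝ => a₁ (exp (θ * I)) := h₁.comp_continuous hcirc hcircm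
    have e₂ : Continuous fun θ : ℝ => a₂ (exp (θ * I)) := h₂.comp_continuous hcirc hcircm
    have e₃ : Continuous fun θ : ℝ => (Real.sin θ : ℂ) := by fun_prop
    have e₄ : Continuous fun θ : ℝ => (Real.cos θ : ℂ) := by fun_prop
    exact (e₃.neg.mul e₁).add (e₄.mul e₂)
  have hright : Tendsto (fun N => ∫ θ in (-Real.pi)..Real.pi, (η N (exp (θ * I)) : ℂ) * b θ) atTop
      (𝓝 (∫ θ in (-Real.pi)..Real.pi, b θ)) := by
    refine intervalIntegral.tendsto_integral_filter_of_dominated_convergence (fun θ => ‖b θ‖)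
      (Eventually.of_forall fun N => ?_) (Eventually.of_forall fun N => ?_)
      (hbc.norm.intervalIntegrable _ _) ?_
    · have : Continuous fun θ : ℝ => (η N (exp (θ * I)) : ℂ) * b θ :=
        (Complex.continuous_ofReal.comp ((hηc N).comp hcirc)).mul hbc
      exact this.aestronglyMeasurable
    · refine Eventually.of_forall fun θ _ => ?_
      rw [norm_mul, Complex.norm_real]
      exact mul_le_of_le_one_left (norm_nonneg _) (hη01 N _)
    · refine Eventually.of_forall fun θ _ => ?_
      have := ((Complex.continuous_ofReal.tendsto 1).comp (hηlim _ (hcircS θ))).mul_const (b θ)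
      simpa using this
  refine tendsto_nhds_unique hleft (hright.congr fun N => ?_)
  have := integral_ball_curl_of_continuousOn S.countable_toSet (hcont N a₁ h₁ hp₁)
    (hcont N a₂ h₂ hp₂) (hderiv N a₁ a₁' hd₁) (hderiv N a₂ a₂' hd₂) (hκi N)
  rw [this]
  refine intervalIntegral.integral_congr fun θ _ => ?_
  simp only [hb]
  ring

end Stokes

/-! ### The curvature of an orthogonal connection -/

section MatrixDeriv

variable {n : ℕ}

/-- The derivative of a matrix-valued function in the direction `v`. -/
noncomputable def matDeriv (M : ℂ → Matrix (Fin n) (Fin n) ℂ) (y v : ℂ) : Matrix (Fin n) (Fin n) ℂ :=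
  Matrix.of fun a c => fderiv ℝ (fun t => M t a c) y v

/-- Entrywise real differentiability of a matrix-valued function. -/
def MatDiffAt (M : ℂ → Matrix (Fin n) (Fin n) ℂ) (y : ℂ) : Prop :=
  ∀ a c, DifferentiableAt ℝ (fun t => M t a c) y

variable {M N : ℂ → Matrix (Fin n) (Fin n) ℂ} {y : ℂ}

theorem MatDiffAt.mul (hM : MatDiffAt M y) (hN : MatDiffAt N y) :
    MatDiffAt (fun t => M t * N t) y := fun a c => by
  simp only [Matrix.mul_apply]
  exact DifferentiableAt.fun_sum fun b _ => (hM a b).mul (hN b c)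

theorem MatDiffAt.conjTranspose (hM : MatDiffAt M y) : MatDiffAt (fun t => (M t).conjTranspose) y :=
  fun a c => (Complex.conjCLE.differentiable _).comp y (hM c a)

theorem matDeriv_congr (h : M =ᶠ[𝓝 y] N) (v : ℂ) : matDeriv M y v = matDeriv N y v := by
  ext a c
  simp only [matDeriv, Matrix.of_apply]
  have h1 : (fun t => M t a c) =ᶠ[𝓝 y] fun t => N t a c := h.mono fun t ht => by simp only [ht]
  rw [h1.fderiv_eq]

theorem matDeriv_add (hM : MatDiffAt M y) (hN : MatDiffAt N y) (v : ℂ) :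
    matDeriv (fun t => M t + N t) y v = matDeriv M y v + matDeriv N y v := by
  ext a c
  simp only [matDeriv, Matrix.of_apply, Matrix.add_apply]
  rw [fderiv_fun_add (hM a c) (hN a c)]
  rfl

theorem matDeriv_mul (hM : MatDiffAt M y) (hN : MatDiffAt N y) (v : ℂ) :
    matDeriv (fun t => M t * N t) y v = matDeriv M y v * N y + M y * matDeriv N y v := by
  ext a c
  simp only [matDeriv, Matrix.of_apply, Matrix.mul_apply, Matrix.add_apply]
  have h := (HasFDerivAt.fun_sum (u := Finset.univ)
    fun b _ => (hM a b).hasFDerivAt.mul (hN b c).hasFDerivAt).fderiv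
  refine (congrArg (fun L => L v) h).trans ?_
  rw [sum_apply, ← Finset.sum_add_distrib]
  refine Finset.sum_congr rfl fun b _ => ?_
  simp
  ring

theorem matDeriv_conjTranspose (hM : MatDiffAt M y) (v : ℂ) :
    matDeriv (fun t => (M t).conjTranspose) y v = (matDeriv M y v).conjTranspose := by
  ext a c
  simp only [matDeriv, Matrix.of_apply, Matrix.conjTranspose_apply]
  have h := (Complex.conjCLE.toContinuousLinearMap.hasFDerivAt.comp y (hM c a).hasFDerivAt).fderiv
  have h2 : fderiv ℝ (fun t => star (M t c a)) y v = _ := congrArg (fun L => L v) h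
  rw [h2]
  rfl

theorem matDeriv_comm (hM : ∀ a c, ContDiffAt ℝ 2 (fun t => M t a c) y) (u v : ℂ) :
    matDeriv (fun t => matDeriv M t u) y v = matDeriv (fun t => matDeriv M t v) y u := by
  ext a c
  simp only [matDeriv, Matrix.of_apply]
  have h1 : DifferentiableAt ℝ (fderiv ℝ fun t => M t a c) y :=
    ((hM a c).fderiv_right (m := 1) (by norm_num)).differentiableAt (by norm_num)
  rw [fderiv_clm_apply h1 (differentiableAt_const _), fderiv_clm_apply h1 (differentiableAt_const _)]
  have h2 := ((hM a c).isSymmSndFDerivAt (by simp)).eq u v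
  simp [h2]

end MatrixDeriv

namespace LabeledPolytope

variable {n m k : ℕ} {P : LabeledPolytope n m} {D : MarkedOrbiDisc k} {w : ℂ → P.X}
  {z₀ : Fin m → ℂ} {ν : Fin k → Fin n → ℤ} {c : Fin k → Fin m → ℚ}
  {d : Fin m → ℕ} {α : (j : Fin m) → Fin (d j) → ℂ} {a : Fin m → ℂ}

namespace OrthogonalConnection

variable (C : OrthogonalConnection D w) (F : P.LocalLift D w) {y : ℂ}

theorem contDiffAt_h (hy : y ∈ F.inner) (r s : Fin n) :
    ContDiffAt ℝ ∞ (fun t => C.h F t r s) y :=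
  (C.h_smooth F r s).contDiffAt
    (Filter.mem_of_superset (F.isOpen_inner.mem_nhds hy) fun _ h => F.inner_subset_dom h)

theorem contDiffAt_Γ (hy : y ∈ F.inner) (v : ℂ) (r s : Fin n) :
    ContDiffAt ℝ ∞ (fun t => C.Γ F t v r s) y :=
  (C.Γ_smooth F v r s).contDiffAt
    (Filter.mem_of_superset (F.isOpen_inner.mem_nhds hy) fun _ h => F.inner_subset_dom h)

theorem matDiffAt_h (hy : y ∈ F.inner) : MatDiffAt (C.h F) y := fun r s =>
  (C.contDiffAt_h F hy r s).differentiableAt (by simp)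

theorem matDiffAt_Γ (hy : y ∈ F.inner) (v : ℂ) : MatDiffAt (fun t => C.Γ F t v) y := fun r s =>
  (C.contDiffAt_Γ F hy v r s).differentiableAt (by simp)

/-- The curvature of a unitary connection is skew-Hermitian, because the second derivatives of the
metric are symmetric. -/
theorem curvature_skew (hy : y ∈ F.inner) :
    (curvature (C.Γ F) y).conjTranspose * C.h F y + C.h F y * curvature (C.Γ F) y = 0 := by
  have hu : ∀ v, ∀ᶠ t in 𝓝 y, matDeriv (C.h F) t v =
      (C.Γ F t v).conjTranspose * C.h F t + C.h F t * C.Γ F t v := fun v => by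
    filter_upwards [F.isOpen_inner.mem_nhds hy] with t ht
    exact C.unitary F t ht v
  have hh := C.matDiffAt_h F hy
  have hΓ := C.matDiffAt_Γ F hy
  have hder : ∀ u v, matDeriv (fun t => matDeriv (C.h F) t u) y v =
      (matDeriv (fun t => C.Γ F t u) y v).conjTranspose * C.h F y +
        (C.Γ F y u).conjTranspose * matDeriv (C.h F) y v +
        (matDeriv (C.h F) y v * C.Γ F y u + C.h F y * matDeriv (fun t => C.Γ F t u) y v) := by
    intro u v
    rw [matDeriv_congr (hu u), matDeriv_add ((hΓ u).conjTranspose.mul hh) (hh.mul (hΓ u)),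
      matDeriv_mul (hΓ u).conjTranspose hh, matDeriv_mul hh (hΓ u), matDeriv_conjTranspose (hΓ u)]
  have hsym := matDeriv_comm (fun r s => contDiffAt_infty.1 (C.contDiffAt_h F hy r s) 2)
    1 I
  rw [hder, hder, (hu 1).self_of_nhds, (hu I).self_of_nhds] at hsym
  have hR : curvature (C.Γ F) y = matDeriv (fun t => C.Γ F t I) y 1 -
      matDeriv (fun t => C.Γ F t 1) y I + (C.Γ F y 1 * C.Γ F y I - C.Γ F y I * C.Γ F y 1) := rfl
  rw [hR]
  simp only [Matrix.conjTranspose_add, Matrix.conjTranspose_sub, Matrix.conjTranspose_mul]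
  linear_combination (norm := noncomm_ring) -hsym

/-- The trace of the curvature is imaginary, as the curvature is skew-Hermitian for the metric. -/
theorem re_trace_curvature (hy : y ∈ F.inner) : (curvature (C.Γ F) y).trace.re = 0 := by
  set R := curvature (C.Γ F) y
  have h1 : R.conjTranspose * C.h F y + C.h F y * R = 0 := C.curvature_skew F hy
  have hu : IsUnit (C.h F y).det := by
    have := (C.h_posDef F y (F.inner_subset_dom hy)).det_pos
    exact isUnit_iff_ne_zero.2 this.ne'
  have h2 : R.conjTranspose = -(C.h F y * R * (C.h F y)⁻¹) := by
    have h3 : R.conjTranspose * C.h F y = -(C.h F y * R) := eq_neg_of_add_eq_zero_left h1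
    rw [← Matrix.neg_mul, ← h3, Matrix.mul_assoc, Matrix.mul_nonsing_inv _ hu, Matrix.mul_one]
  have h4 := congrArg Matrix.trace h2
  rw [Matrix.trace_conjTranspose, Matrix.trace_neg, Matrix.trace_mul_comm, ← Matrix.mul_assoc,
    Matrix.nonsing_inv_mul _ hu, Matrix.one_mul] at h4
  have h5 := congrArg Complex.re h4
  simp at h5
  linarith

/-- The trace of the curvature is the exterior derivative of the corrected trace of the
connection, as the correction is holomorphic. -/
theorem trace_curvature (hst : P.IsStandardForm z₀ D w ν c d α a) (ha : ∀ j, a j ≠ 0)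
    (hy : y ∈ F.inner) : (curvature (C.Γ F) y).trace =
      fderiv ℝ (fun t => C.connForm c α F t I) y 1 - fderiv ℝ (fun t => C.connForm c α F t 1) y I := by
  have hg : AnalyticAt ℂ (fun t => F.chart.offForm D c α (F.br t) * (F.e * t ^ (F.e - 1))) y :=
    ((hst.analyticAt_offForm ha F (F.inner_subset_dom hy)).comp (F.analyticAt_br y)).mul
      (by fun_prop)
  have hd : ∀ u v, fderiv ℝ (fun t => C.connForm c α F t u) y v =
      (matDeriv (fun t => C.Γ F t u) y v).trace +
        deriv (fun t => F.chart.offForm D c α (F.br t) * (F.e * t ^ (F.e - 1))) y * v * u := by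
    intro u v
    have h1 : HasFDerivAt (fun t => (C.Γ F t u).trace)
        (∑ l, fderiv ℝ (fun t => C.Γ F t u l l) y) y :=
      HasFDerivAt.fun_sum fun l _ => (C.matDiffAt_Γ F hy u l l).hasFDerivAt
    have h2 := (hg.differentiableAt.hasDerivAt.mul_const u).complexToReal_fderiv
    have h3 := (h1.add h2).fderiv
    have h4 : (fun t => C.connForm c α F t u) = fun t => (C.Γ F t u).trace +
        F.chart.offForm D c α (F.br t) * (F.e * t ^ (F.e - 1)) * u := by
      funext t; simp only [connForm]; ring
    rw [h4]
    refine (congrArg (fun L => L v) h3).trans ?_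
    simp [Matrix.trace, matDeriv]
    ring
  have hR : curvature (C.Γ F) y = matDeriv (fun t => C.Γ F t I) y 1 -
      matDeriv (fun t => C.Γ F t 1) y I + (C.Γ F y 1 * C.Γ F y I - C.Γ F y I * C.Γ F y 1) := rfl
  rw [hd, hd, hR, Matrix.trace_add, Matrix.trace_sub, Matrix.trace_sub,
    Matrix.trace_mul_comm (C.Γ F y 1)]
  ring

end OrthogonalConnection

end LabeledPolytope

/-! ### Integrability and winding numbers on the disc -/

section Analysis

open MeasureTheory Set Filter

/-- A function on the disc with singularities of order less than `2` is integrable. -/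
theorem integrableOn_ball_of_isolated_singularities {E : Type*} [NormedAddCommGroup E] {f : ℂ → E}
    (hf : AEStronglyMeasurable f (volume.restrict (Metric.ball 0 1)))
    (h : ∀ p ∈ Metric.closedBall (0 : ℂ) 1, ∃ (K β : ℝ), β < 2 ∧
      ∀ᶠ z in 𝓝[≠] p, z ∈ Metric.ball (0 : ℂ) 1 → ‖f z‖ ≤ K * ‖z - p‖ ^ (-β)) :
    IntegrableOn f (Metric.ball 0 1) := by
  have hloc : ∀ p : ℂ, ∃ r > 0, p ∈ Metric.closedBall (0 : ℂ) 1 →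
      IntegrableOn f (Metric.ball p r ∩ Metric.ball 0 1) := by
    intro p
    by_cases hp : p ∈ Metric.closedBall (0 : ℂ) 1
    swap
    · exact ⟨1, one_pos, fun h => absurd h hp⟩
    obtain ⟨K, β, hβ, hev⟩ := h p hp
    obtain ⟨r, hr, hball⟩ := Metric.eventually_nhds_iff_ball.1 (eventually_nhdsWithin_iff.1 hev)
    refine ⟨r, hr, fun _ => ?_⟩
    have h0 : IntegrableOn (fun x : ℂ => K * ‖x‖ ^ (-β)) (Metric.ball 0 r) := by
      refine integrableOn_ball_of_norm_le_rpow (by simp) (C := |K|) (α := β) (by simpa using hβ)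
        (Eventually.of_forall fun x => ?_) ?_
      · rw [norm_mul, Real.norm_eq_abs, Real.norm_eq_abs,
          abs_of_nonneg (Real.rpow_nonneg (norm_nonneg x) _)]
      · exact (by fun_prop : Measurable fun x : ℂ => K * ‖x‖ ^ (-β)).aestronglyMeasurable
    have h1 : IntegrableOn (fun z : ℂ => K * ‖z - p‖ ^ (-β)) (Metric.ball p r) := by
      have h2 := ((measurePreserving_sub_right volume p).integrableOn_comp_preimage
        (MeasurableEquiv.subRight p).measurableEmbedding (s := Metric.ball 0 r)).2 h0
      refine h2.congr_set_ae (Eventually.of_forall fun z => ?_)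
      simp only [eq_iff_iff]
      change z ∈ Metric.ball p r ↔ z - p ∈ Metric.ball (0 : ℂ) r
      rw [mem_ball_zero_iff, mem_ball_iff_norm]
    refine Integrable.mono' (h1.mono_set inter_subset_left)
      (hf.mono_measure (Measure.restrict_mono inter_subset_right le_rfl)) ?_
    have hne : ∀ᵐ z ∂(volume.restrict (Metric.ball p r ∩ Metric.ball (0 : ℂ) 1)), z ≠ p :=
      ae_restrict_of_ae (by simp [ae_iff])
    filter_upwards [hne, ae_restrict_mem (measurableSet_ball.inter measurableSet_ball)] with z hz hzb
    exact hball z hzb.1 hz hzb.2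
  choose r hr hint using hloc
  obtain ⟨t, ht, hcov⟩ := (isCompact_closedBall (0 : ℂ) 1).elim_nhds_subcover
    (fun p => Metric.ball p (r p)) fun p _ => Metric.ball_mem_nhds p (hr p)
  have h1 : IntegrableOn f (⋃ p ∈ t, Metric.ball p (r p) ∩ Metric.ball 0 1) :=
    (integrableOn_finset_iUnion).2 fun p hp => hint p (ht p hp)
  refine h1.mono_set fun z hz => ?_
  obtain ⟨p, hp, hzp⟩ := mem_iUnion₂.1 (hcov (Metric.ball_subset_closedBall hz))
  exact mem_iUnion₂.2 ⟨p, hp, hzp, hz⟩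

theorem logDeriv_blaschke_exp_mul_I {β : ℂ} (hβ : β ∈ Metric.ball (0 : ℂ) 1) (θ : ℝ) :
    logDeriv (blaschke β) (exp (θ * I)) * (I * exp (θ * I)) =
      I + I * β * exp (-(θ * I)) / (1 - β * exp (-(θ * I))) +
        I * conj β * exp (θ * I) / (1 - conj β * exp (θ * I)) := by
  have hβ1 : ‖β‖ < 1 := by simpa using hβ
  have hz : ‖exp (θ * I)‖ = 1 := Complex.norm_exp_ofReal_mul_I θ
  have hz' : ‖exp (-(θ * I))‖ = 1 := by
    have := Complex.norm_exp_ofReal_mul_I (-θ); simpa using this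
  have hne : ∀ x y : ℂ, ‖x‖ < 1 → ‖y‖ = 1 → 1 - x * y ≠ 0 := fun x y hx hy h0 => by
    have : ‖x * y‖ = 1 := by rw [← sub_eq_zero.1 h0, norm_one]
    rw [norm_mul, hy, mul_one] at this
    exact hx.ne this
  have h1 := hne β _ hβ1 hz'
  have h2 := hne (conj β) _ (by simpa using hβ1) hz
  rw [Complex.exp_neg] at h1 ⊢
  set z := exp (θ * I) with hzd
  have hz0 : z ≠ 0 := exp_ne_zero _
  have h3 : z - β ≠ 0 := fun h0 => h1 (by rw [← sub_eq_zero.1 h0, mul_inv_cancel₀ hz0, sub_self])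
  have hd : HasDerivAt (blaschke β) ((1 * (1 - conj β * z) - (z - β) * (-(conj β * 1))) /
      (1 - conj β * z) ^ 2) z :=
    ((hasDerivAt_id z).sub_const β).div (((hasDerivAt_id z).const_mul (conj β)).const_sub 1) h2
  rw [logDeriv_apply, hd.deriv, blaschke]
  have h4 : 1 - β * z⁻¹ = (z - β) / z := by field_simp
  rw [h4]
  field_simp
  ring

theorem integral_logDeriv_blaschke {β : ℂ} (hβ : β ∈ Metric.ball (0 : ℂ) 1) :
    IntervalIntegrable (fun θ : ℝ => logDeriv (blaschke β) (exp (θ * I)) * (I * exp (θ * I)))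
      volume (-Real.pi) Real.pi ∧
    ∫ θ in (-Real.pi)..Real.pi, logDeriv (blaschke β) (exp (θ * I)) * (I * exp (θ * I)) =
      2 * Real.pi * I := by
  have hβ1 : ‖β‖ < 1 := by simpa using hβ
  have hslit : ∀ x y : ℂ, ‖x‖ < 1 → ‖y‖ = 1 → 1 - x * y ∈ slitPlane := fun x y hx hy => by
    left
    have : (x * y).re ≤ ‖x * y‖ := Complex.re_le_norm _
    rw [norm_mul, hy, mul_one] at this
    simp only [sub_re, one_re]
    linarith
  have hn : ∀ θ : ℝ, ‖exp (θ * I)‖ = 1 := Complex.norm_exp_ofReal_mul_I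
  have hn' : ∀ θ : ℝ, ‖exp (-(θ * I))‖ = 1 := fun θ => by
    have := Complex.norm_exp_ofReal_mul_I (-θ); simpa using this
  have hs := fun θ => hslit β _ hβ1 (hn' θ)
  have hs' := fun θ => hslit (conj β) _ (by simpa using hβ1) (hn θ)
  simp only [logDeriv_blaschke_exp_mul_I hβ]
  set f : ℝ → ℂ := fun θ => I + I * β * exp (-(θ * I)) / (1 - β * exp (-(θ * I))) +
        I * conj β * exp (θ * I) / (1 - conj β * exp (θ * I)) with hf
  have hc : Continuous f := by
    refine (continuous_const.add (Continuous.div (by fun_prop) (by fun_prop) fun θ =>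
      slitPlane_ne_zero (hs θ))).add (Continuous.div (by fun_prop) (by fun_prop) fun θ =>
      slitPlane_ne_zero (hs' θ))
  refine ⟨hc.intervalIntegrable _ _, ?_⟩
  have hd : ∀ θ : ℝ, HasDerivAt (fun θ : ℝ => θ * I + log (1 - β * exp (-(θ * I))) -
      log (1 - conj β * exp (θ * I))) (f θ) θ := by
    intro θ
    have e0 : HasDerivAt (fun θ : ℝ => (θ : ℂ) * I) I θ := by
      simpa using (Complex.ofRealCLM.hasDerivAt (x := θ)).mul_const I
    have e0' : HasDerivAt (fun θ : ℝ => -((θ : ℂ) * I)) (-I) θ := e0.neg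
    have e1 := ((e0'.cexp.const_mul β).const_sub 1).clog_real (hs θ)
    have e2 := ((e0.cexp.const_mul (conj β)).const_sub 1).clog_real (hs' θ)
    refine ((e0.add e1).sub e2).congr_deriv ?_
    simp only [hf]
    ring
  rw [intervalIntegral.integral_eq_sub_of_hasDerivAt (fun θ _ => hd θ) (hc.intervalIntegrable _ _)]
  have e1 : exp ((Real.pi : ℂ) * I) = -1 := Complex.exp_pi_mul_I
  have e2 : exp (-((Real.pi : ℂ) * I)) = -1 := by rw [Complex.exp_neg, e1]; norm_num
  simp only [Complex.ofReal_neg, neg_mul, neg_neg, e1, e2]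
  ring

end Analysis

/-! ### The Chern-Weil integral as a boundary integral -/

namespace LabeledPolytope

variable {n m k : ℕ} {P : LabeledPolytope n m} {D : MarkedOrbiDisc k} {w : ℂ → P.X}
  {z₀ : Fin m → ℂ} {ν : Fin k → Fin n → ℤ} {c : Fin k → Fin m → ℚ}
  {d : Fin m → ℕ} {α : (j : Fin m) → Fin (d j) → ℂ} {a : Fin m → ℂ}

namespace OrthogonalConnection

open Classical in
/-- The corrected trace of a connection, as a form on the disc without the marked points. -/
noncomputable def form (C : OrthogonalConnection D w) (c : Fin k → Fin m → ℚ)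
    (α : (j : Fin m) → Fin (d j) → ℂ) (z u : ℂ) : ℂ :=
  if h : ∃ F : P.LocalLift D w, F.p = z then C.connForm c α h.choose 0 u else 0

variable (C : OrthogonalConnection D w) (F : P.LocalLift D w)

theorem connForm_eq_form (hst : P.IsStandardForm z₀ D w ν c d α a) (ha : ∀ j, a j ≠ 0) {y : ℂ}
    (hy : y ∈ F.dom) (hin : y ∈ F.inner ∨ F.e = 1) (hpt : ∀ i, F.br y ≠ D.pts i) (u : ℂ) :
    C.connForm c α F y u = C.form c α (F.br y) (F.e * y ^ (F.e - 1) * u) := by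
  have hex : ∃ F' : P.LocalLift D w, F'.p = F.br y := exists_localLift hst ha hy.2
  rw [form, dif_pos hex]
  set F' := hex.choose
  have hp : F'.p = F.br y := hex.choose_spec
  have he : F'.e = 1 := F'.localOrder.eq_one (by rwa [hp])
  have h0 : F.br y - F'.p = 0 := by rw [hp, sub_self]
  have h := C.connForm_eq_connForm hst ha F F' he hy hin (by rw [h0]; exact F'.zero_mem_dom) hpt u
  rwa [h0] at h

theorem form_eq (z u : ℂ) :
    C.form c α z u = (u.re : ℂ) * C.form c α z 1 + (u.im : ℂ) * C.form c α z I := by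
  unfold form
  split_ifs with h
  · exact C.connForm_eq _ _ _
  · simp

theorem form_eq_connForm (hst : P.IsStandardForm z₀ D w ν c d α a) (ha : ∀ j, a j ≠ 0)
    (hpt : ∀ i, F.p ≠ D.pts i) {z : ℂ} (hz : z ∈ Metric.closedBall (0 : ℂ) 1)
    (hzp : z ∈ Metric.ball F.p F.ε) (u : ℂ) :
    C.form c α z u = C.connForm c α F (z - F.p) u := by
  have he : F.e = 1 := F.localOrder.eq_one hpt
  have hbr : F.br (z - F.p) = z := by simp [LocalLift.br, he]
  have hy : z - F.p ∈ F.dom := ⟨by rwa [← mem_ball_iff_norm], by rwa [hbr]⟩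
  rw [C.connForm_eq_form F hst ha hy (Or.inr he) ?_ u, hbr, he]
  · simp
  · intro i hi
    have h1 := F.isolated (z - F.p) hy.1 i hi
    rw [h1, F.br_zero] at hi
    exact hpt i hi

theorem contDiffAt_connForm (hst : P.IsStandardForm z₀ D w ν c d α a) (ha : ∀ j, a j ≠ 0)
    {y : ℂ} (hy : y ∈ F.inner) (u : ℂ) : ContDiffAt ℝ ∞ (fun y => C.connForm c α F y u) y :=
  (C.contDiffOn_connForm hst ha F u).contDiffAt
    (Filter.mem_of_superset (F.isOpen_inner.mem_nhds hy) fun _ h => F.inner_subset_dom h)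

theorem hasFDerivAt_form (hst : P.IsStandardForm z₀ D w ν c d α a) (ha : ∀ j, a j ≠ 0)
    (hpt : ∀ i, F.p ≠ D.pts i) {z : ℂ} (hz : z ∈ Metric.ball (0 : ℂ) 1)
    (hzp : z ∈ Metric.ball F.p F.ε) (u : ℂ) :
    HasFDerivAt (fun z => C.form c α z u)
      (fderiv ℝ (fun y => C.connForm c α F y u) (z - F.p)) z := by
  have he : F.e = 1 := F.localOrder.eq_one hpt
  have hbr : F.br (z - F.p) = z := by simp [LocalLift.br, he]
  have hy : z - F.p ∈ F.inner := ⟨by rwa [← mem_ball_iff_norm], by rwa [hbr]⟩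
  have h1 := ((C.contDiffAt_connForm F hst ha hy u).differentiableAt (by simp)).hasFDerivAt
  have h2 : HasFDerivAt (fun z : ℂ => z - F.p) (.id ℝ ℂ) z := (hasFDerivAt_id z).sub_const F.p
  refine (h1.comp z h2).congr_of_eventuallyEq ?_
  filter_upwards [Metric.isOpen_ball.mem_nhds hz, Metric.isOpen_ball.mem_nhds hzp] with t h3 h4
  exact C.form_eq_connForm F hst ha hpt (Metric.ball_subset_closedBall h3) h4 u

/-- The exterior derivative of the form, as a function of the point. -/
noncomputable def curl (C : OrthogonalConnection D w) (c : Fin k → Fin m → ℚ)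
    (α : (j : Fin m) → Fin (d j) → ℂ) (z : ℂ) : ℂ :=
  fderiv ℝ (fun z => C.form c α z I) z 1 - fderiv ℝ (fun z => C.form c α z 1) z I

theorem differentiableAt_form (hst : P.IsStandardForm z₀ D w ν c d α a) (ha : ∀ j, a j ≠ 0) {z : ℂ}
    (hz : z ∈ Metric.ball (0 : ℂ) 1) (hpt : ∀ i, z ≠ D.pts i) (u : ℂ) :
    DifferentiableAt ℝ (fun z => C.form c α z u) z := by
  obtain ⟨F, rfl⟩ := exists_localLift hst ha (Metric.ball_subset_closedBall hz)
  exact (C.hasFDerivAt_form F hst ha hpt hz (Metric.mem_ball_self F.ε_pos) u).differentiableAt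

/-- The exterior derivative of the form is the trace of the curvature; in a uniformizing disc it is
multiplied by the Jacobian of the branched covering. -/
theorem trace_curvature_eq_curl (hst : P.IsStandardForm z₀ D w ν c d α a) (ha : ∀ j, a j ≠ 0)
    {y : ℂ} (hy : y ∈ F.inner) (hpt : ∀ i, F.br y ≠ D.pts i) :
    (curvature (C.Γ F) y).trace =
      (‖(F.e : ℂ) * y ^ (F.e - 1)‖ ^ 2 : ℝ) * C.curl c α (F.br y) := by
  rw [C.trace_curvature F hst ha hy]
  set b : ℂ → ℂ := fun t => F.e * t ^ (F.e - 1) with hb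
  have hbd : HasDerivAt b (deriv b y) y := (by fun_prop : DifferentiableAt ℂ b y).hasDerivAt
  have hbr := (F.hasDerivAt_br y).complexToReal_fderiv
  have hA : ∀ u, HasFDerivAt (fun t => C.form c α (F.br t) u) _ y := fun u =>
    (C.differentiableAt_form hst ha hy.2 hpt u).hasFDerivAt.comp y hbr
  have hev : ∀ᶠ t in 𝓝 y, t ∈ F.inner ∧ ∀ i, F.br t ≠ D.pts i := by
    exact (F.isOpen_inner.eventually_mem hy).and
      (Filter.eventually_all.2 fun i => F.continuous_br.continuousAt.eventually_ne (hpt i))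
  have hre : HasFDerivAt (fun t => ((b t).re : ℂ))
      (Complex.ofRealCLM.comp (Complex.reCLM.comp (deriv b y • (1 : ℂ →L[ℝ] ℂ)))) y :=
    Complex.ofRealCLM.hasFDerivAt.comp y
      (Complex.reCLM.hasFDerivAt.comp y hbd.complexToReal_fderiv)
  have him : HasFDerivAt (fun t => ((b t).im : ℂ))
      (Complex.ofRealCLM.comp (Complex.imCLM.comp (deriv b y • (1 : ℂ →L[ℝ] ℂ)))) y :=
    Complex.ofRealCLM.hasFDerivAt.comp y
      (Complex.imCLM.hasFDerivAt.comp y hbd.complexToReal_fderiv)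
  have e1 : (fun t => C.connForm c α F t 1) =ᶠ[𝓝 y] fun t =>
      ((b t).re : ℂ) * C.form c α (F.br t) 1 + ((b t).im : ℂ) * C.form c α (F.br t) I := by
    filter_upwards [hev] with t ht
    rw [C.connForm_eq_form F hst ha (F.inner_subset_dom ht.1) (Or.inl ht.1) ht.2, form_eq, mul_one]
  have e2 : (fun t => C.connForm c α F t I) =ᶠ[𝓝 y] fun t =>
      -((b t).im : ℂ) * C.form c α (F.br t) 1 + ((b t).re : ℂ) * C.form c α (F.br t) I := by
    filter_upwards [hev] with t ht
    rw [C.connForm_eq_form F hst ha (F.inner_subset_dom ht.1) (Or.inl ht.1) ht.2, form_eq,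
      Complex.mul_I_re, Complex.mul_I_im, Complex.ofReal_neg]
  have h1 := ((hre.mul (hA 1)).add (him.mul (hA I))).congr_of_eventuallyEq e1
  have h2 := ((him.neg.mul (hA 1)).add (hre.mul (hA I))).congr_of_eventuallyEq e2
  rw [h1.fderiv, h2.fderiv, Complex.sq_norm, Complex.normSq_apply, curl]
  have hlin : ∀ (L : ℂ →L[ℝ] ℂ) (v : ℂ), L v = v.re * L 1 + v.im * L I := fun L v => by
    conv_lhs => rw [show v = v.re • (1 : ℂ) + v.im • I by simp, map_add, map_smul, map_smul]
    simp
  simp only [add_apply, smul_apply, ContinuousLinearMap.comp_apply, neg_apply,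
    Complex.ofRealCLM_apply, Complex.reCLM_apply, Complex.imCLM_apply, smul_eq_mul,
    one_apply_eq_self, mul_one, Pi.neg_apply, Complex.mul_I_re, Complex.mul_I_im]
  have hby : (F.e : ℂ) * y ^ (F.e - 1) = b y := rfl
  rw [hby]
  have hI : ∀ L : ℂ →L[ℝ] ℂ, L (b y * I) = -((b y).im : ℂ) * L 1 + ((b y).re : ℂ) * L I := fun L => by
    rw [hlin L, Complex.mul_I_re, Complex.mul_I_im, Complex.ofReal_neg]
  rw [hI, hI, hlin _ (b y), hlin (fderiv ℝ (fun z => C.form c α z I) (F.br y)) (b y)]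
  push_cast
  ring

open Filter MeasureTheory Set in
/-- In the uniformizing disc of order `e` at a marked point `p` the form and its exterior derivative are
bounded; on the disc they are therefore of order at most `|z - p| ^ (-β)` and `|z - p| ^ (-2β)` with
`β = 1 - 1 / e`. -/
theorem exists_bound_at_pts (hst : P.IsStandardForm z₀ D w ν c d α a) (ha : ∀ j, a j ≠ 0)
    (i : Fin k) : ∃ (K β : ℝ), 0 ≤ β ∧ β < 1 ∧
      (∀ᶠ z in 𝓝[≠] (D.pts i), ‖C.form c α z 1‖ ≤ K * ‖z - D.pts i‖ ^ (-β)) ∧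
      (∀ᶠ z in 𝓝[≠] (D.pts i), ‖C.form c α z I‖ ≤ K * ‖z - D.pts i‖ ^ (-β)) ∧
      ∀ᶠ z in 𝓝[≠] (D.pts i), ‖C.curl c α z‖ ≤ K * ‖z - D.pts i‖ ^ (-(2 * β)) := by
  obtain ⟨F, hF⟩ := exists_localLift hst ha (Metric.ball_subset_closedBall (D.pts_mem i))
  rw [← hF]
  have he0 : 0 < F.e := F.e_pos
  have heR : (0 : ℝ) < F.e := by exact_mod_cast he0
  have he1 : (1 : ℝ) ≤ F.e := by exact_mod_cast he0
  have h0in : (0 : ℂ) ∈ F.inner := ⟨by simpa using F.ε_pos, by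
    rw [F.br_zero, hF]; exact D.pts_mem i⟩
  have hbd : ∀ u, ∃ K, ∀ᶠ y in 𝓝 (0 : ℂ), ‖C.connForm c α F y u‖ ≤ K := fun u => by
    have h1 := (C.contDiffAt_connForm F hst ha h0in u).continuousAt.norm
    exact ⟨_, (h1.eventually (gt_mem_nhds (lt_add_one _))).mono fun _ h => le_of_lt h⟩
  have hbR : ∃ K, ∀ᶠ y in 𝓝 (0 : ℂ), ‖(curvature (C.Γ F) y).trace‖ ≤ K := by
    have h2 : ∀ u v, ContinuousAt (fun y => fderiv ℝ (fun t => C.connForm c α F t u) y v) 0 :=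
      fun u v => (((C.contDiffAt_connForm F hst ha h0in u).fderiv_right (m := 1)
        (by norm_cast)).continuousAt.clm_apply continuousAt_const)
    have h3 := ((h2 I 1).sub (h2 1 I)).norm
    obtain ⟨K, hK⟩ := Tendsto.isBoundedUnder_le h3
    refine ⟨K, ?_⟩
    filter_upwards [eventually_map.1 hK, F.isOpen_inner.mem_nhds h0in] with y hy hyin
    rw [C.trace_curvature F hst ha hyin]
    exact hy
  obtain ⟨K₁, hK₁⟩ := hbd 1
  obtain ⟨K₂, hK₂⟩ := hbd I
  obtain ⟨K₃, hK₃⟩ := hbR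
  set K : ℝ := |K₁| + |K₂| + |K₃| with hK
  have hev : ∀ᶠ z in 𝓝[≠] F.p, ∃ y ∈ F.inner, F.br y = z ∧ (∀ i, F.br y ≠ D.pts i) ∧
      ‖z - F.p‖ = ‖y‖ ^ F.e ∧ 0 < ‖y‖ ∧ ‖C.connForm c α F y 1‖ ≤ K ∧ ‖C.connForm c α F y I‖ ≤ K ∧
      ‖(curvature (C.Γ F) y).trace‖ ≤ K := by
    filter_upwards [nhdsWithin_le_nhds (F.tendsto_root.eventually hK₁),
      nhdsWithin_le_nhds (F.tendsto_root.eventually hK₂),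
      nhdsWithin_le_nhds (F.tendsto_root.eventually hK₃),
      nhdsWithin_le_nhds (F.tendsto_root.eventually (F.isOpen_inner.mem_nhds h0in)),
      self_mem_nhdsWithin] with z h1 h2 h3 h4 h5
    set y := (z - F.p) ^ ((F.e : ℂ)⁻¹) with hy
    have hbr : F.br y = z := F.br_root z
    have hyp : z - F.p = y ^ F.e := by rw [← hbr]; simp [LocalLift.br]
    have hy0 : y ≠ 0 := fun h => h5 (by
      rw [mem_singleton_iff, ← sub_eq_zero, hyp, h, zero_pow he0.ne'])
    refine ⟨y, h4, hbr, fun i' hi' => hy0 (F.isolated y h4.1 i' hi'), by rw [hyp, norm_pow],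
      norm_pos_iff.2 hy0, ?_, ?_, ?_⟩
    · exact h1.trans ((le_abs_self _).trans (by rw [hK]; nlinarith [abs_nonneg K₂, abs_nonneg K₃]))
    · exact h2.trans ((le_abs_self _).trans (by rw [hK]; nlinarith [abs_nonneg K₁, abs_nonneg K₃]))
    · exact h3.trans ((le_abs_self _).trans (by rw [hK]; nlinarith [abs_nonneg K₁, abs_nonneg K₂]))
  -- the derivative of the branched covering is of order `1 - 1/e` in the coordinate of the disc
  have hpow : ∀ y : ℂ, 0 < ‖y‖ → (‖y‖ ^ F.e) ^ (-(((F.e : ℝ) - 1) / F.e)) = (‖y‖ ^ (F.e - 1))⁻¹ := by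
    intro y hy
    rw [← Real.rpow_natCast ‖y‖ F.e, ← Real.rpow_mul hy.le, ← Real.rpow_natCast ‖y‖ (F.e - 1),
      ← Real.rpow_neg hy.le, Nat.cast_sub he0]
    congr 1
    field_simp
    simp
  have hjac : ∀ y : ℂ, ‖y‖ ^ (F.e - 1) ≤ ‖(F.e : ℂ) * y ^ (F.e - 1)‖ := fun y => by
    rw [norm_mul, norm_pow, Complex.norm_natCast]
    exact le_mul_of_one_le_left (by positivity) he1
  have hform : ∀ u : ℂ, ‖u‖ = 1 → ∀ᶠ z in 𝓝[≠] F.p,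
      ‖C.form c α z u‖ ≤ (2 * K) * ‖z - F.p‖ ^ (-(((F.e : ℝ) - 1) / F.e)) := by
    intro u hu
    filter_upwards [hev] with z hz
    obtain ⟨y, hyin, hbr, hpt, hnorm, hy0, h1, h2, -⟩ := hz
    have hb := F.deriv_br_ne_zero hpt
    set b : ℂ := F.e * y ^ (F.e - 1) with hbd
    have h3 := C.connForm_eq_form F hst ha (F.inner_subset_dom hyin) (Or.inl hyin) hpt (b⁻¹ * u)
    rw [← hbd, mul_inv_cancel_left₀ hb, hbr] at h3
    rw [← h3, C.connForm_eq, hnorm, hpow y hy0]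
    have h4 : ‖b⁻¹ * u‖ ≤ (‖y‖ ^ (F.e - 1))⁻¹ := by
      rw [norm_mul, hu, mul_one, norm_inv]
      exact inv_anti₀ (by positivity) (hjac y)
    have h5 := (Complex.abs_re_le_norm (b⁻¹ * u)).trans h4
    have h6 := (Complex.abs_im_le_norm (b⁻¹ * u)).trans h4
    refine (norm_add_le _ _).trans ?_
    rw [norm_mul, norm_mul, Complex.norm_real, Complex.norm_real, Real.norm_eq_abs, Real.norm_eq_abs]
    have h7 := mul_le_mul h5 h1 (norm_nonneg _) (by positivity)
    have h8 := mul_le_mul h6 h2 (norm_nonneg _) (by positivity)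
    linarith
  refine ⟨2 * K, ((F.e : ℝ) - 1) / F.e, div_nonneg (by linarith) heR.le,
    by rw [div_lt_one heR]; linarith, hform 1 (by simp), hform I (by simp), ?_⟩
  filter_upwards [hev] with z hz
  obtain ⟨y, hyin, hbr, hpt, hnorm, hy0, -, -, h1⟩ := hz
  have h2 := C.trace_curvature_eq_curl F hst ha hyin hpt
  rw [hbr] at h2
  have hyp : 0 < ‖y‖ ^ (F.e - 1) := by positivity
  have h3 : (‖y‖ ^ (F.e - 1)) ^ 2 * ‖C.curl c α z‖ ≤ K := by
    refine le_trans ?_ h1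
    rw [h2, norm_mul, Complex.norm_real, Real.norm_eq_abs, abs_of_nonneg (by positivity)]
    have := hjac y
    gcongr
  have h4 : (‖z - F.p‖ : ℝ) ^ (-(2 * (((F.e : ℝ) - 1) / F.e))) = ((‖y‖ ^ (F.e - 1)) ^ 2)⁻¹ := by
    rw [hnorm, show -(2 * (((F.e : ℝ) - 1) / F.e)) = (-(((F.e : ℝ) - 1) / F.e)) * (2 : ℕ) by
      push_cast; ring, Real.rpow_mul (by positivity), hpow y hy0, Real.rpow_natCast, inv_pow]
  rw [h4, ← div_eq_mul_inv, le_div_iff₀ (by positivity)]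
  have hK0 : 0 ≤ K := by positivity
  linarith

open Filter MeasureTheory Set in
/-- At a point of the circle this relies on the smoothness of the connection up to the boundary. -/
theorem exists_bound_curl (hst : P.IsStandardForm z₀ D w ν c d α a) (ha : ∀ j, a j ≠ 0)
    {p : ℂ} (hp : p ∈ Metric.closedBall (0 : ℂ) 1) (hpt : ∀ i, p ≠ D.pts i) :
    ∃ K, ∀ᶠ z in 𝓝 p, z ∈ Metric.ball (0 : ℂ) 1 → ‖C.curl c α z‖ ≤ K := by
  obtain ⟨F, rfl⟩ := exists_localLift hst ha hp
  have he : F.e = 1 := F.localOrder.eq_one hpt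
  have hdom : F.dom = Metric.ball 0 F.ε ∩ Metric.closedBall (-F.p) 1 := by
    ext t
    simp [LocalLift.dom, LocalLift.br, he, dist_eq_norm, add_comm]
  have huniq : UniqueDiffOn ℝ F.dom := by
    refine uniqueDiffOn_convex ?_ ?_
    · rw [hdom]; exact (convex_ball _ _).inter (convex_closedBall _ _)
    · obtain ⟨t, ht⟩ : F.inner.Nonempty :=
        closure_nonempty_iff.1 ⟨0, F.mem_closure_inner he F.zero_mem_dom⟩
      exact ⟨t, mem_interior.2 ⟨F.inner, F.inner_subset_dom, F.isOpen_inner, ht⟩⟩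
  have hc : ∀ u v, ContinuousWithinAt
      (fun y => fderivWithin ℝ (fun t => C.connForm c α F t u) F.dom y v) F.dom 0 := fun u v =>
    (((C.contDiffOn_connForm hst ha F u).continuousOn_fderivWithin huniq (by simp)) 0
      F.zero_mem_dom).clm_apply continuousWithinAt_const
  obtain ⟨K, h1⟩ := Tendsto.isBoundedUnder_le ((hc I 1).sub (hc 1 I)).norm
  have h2 : Tendsto (fun z => z - F.p) (𝓝 F.p) (𝓝 0) := by
    have : Continuous fun z : ℂ => z - F.p := by fun_prop
    simpa using this.tendsto F.p
  refine ⟨K, ?_⟩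
  filter_upwards [h2.eventually (eventually_nhdsWithin_iff.1 (eventually_map.1 h1)),
    Metric.ball_mem_nhds F.p F.ε_pos] with z h3 h4 h5
  have hbr : F.br (z - F.p) = z := by simp [LocalLift.br, he]
  have hy : z - F.p ∈ F.inner := ⟨by rwa [← mem_ball_iff_norm], by rwa [hbr]⟩
  have hnhds : F.dom ∈ 𝓝 (z - F.p) :=
    mem_of_superset (F.isOpen_inner.mem_nhds hy) F.inner_subset_dom
  have h6 := h3 (F.inner_subset_dom hy)
  simp only [Pi.sub_apply] at h6
  rw [fderivWithin_of_mem_nhds hnhds, fderivWithin_of_mem_nhds hnhds] at h6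
  rw [curl, (C.hasFDerivAt_form F hst ha hpt h5 h4 I).fderiv,
    (C.hasFDerivAt_form F hst ha hpt h5 h4 1).fderiv]
  exact h6

theorem continuousWithinAt_form (hst : P.IsStandardForm z₀ D w ν c d α a) (ha : ∀ j, a j ≠ 0)
    {p : ℂ} (hp : p ∈ Metric.closedBall (0 : ℂ) 1) (hpt : ∀ i, p ≠ D.pts i) (u : ℂ) :
    ContinuousWithinAt (fun z => C.form c α z u) (Metric.closedBall 0 1) p := by
  obtain ⟨F, rfl⟩ := exists_localLift hst ha hp
  have he : F.e = 1 := F.localOrder.eq_one hpt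
  have h1 := (C.contDiffOn_connForm hst ha F u).continuousOn 0 F.zero_mem_dom
  have h2 : ContinuousWithinAt (fun z => C.connForm c α F (z - F.p) u)
      (Metric.closedBall 0 1 ∩ Metric.ball F.p F.ε) F.p := by
    refine ContinuousWithinAt.comp (g := fun y => C.connForm c α F y u) (f := fun z => z - F.p)
      (t := F.dom) (by rwa [sub_self]) (by fun_prop) ?_
    intro z hz
    exact ⟨by rw [← mem_ball_iff_norm]; exact hz.2, by simpa [LocalLift.br, he] using hz.1⟩
  have h3 := h2.congr (g := fun z => C.form c α z u)
    (fun z hz => C.form_eq_connForm F hst ha hpt hz.1 hz.2 u)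
    (C.form_eq_connForm F hst ha hpt hp (Metric.mem_ball_self F.ε_pos) u)
  exact h3.mono_of_mem_nhdsWithin (Filter.inter_mem self_mem_nhdsWithin
    (nhdsWithin_le_nhds (Metric.ball_mem_nhds _ F.ε_pos)))

end OrthogonalConnection

end LabeledPolytope

namespace LabeledPolytope

variable {n m k : ℕ} {P : LabeledPolytope n m} {D : MarkedOrbiDisc k} {w : ℂ → P.X}
  {z₀ : Fin m → ℂ} {ν : Fin k → Fin n → ℤ} {c : Fin k → Fin m → ℚ}
  {d : Fin m → ℕ} {α : (j : Fin m) → Fin (d j) → ℂ} {a : Fin m → ℂ}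

open Filter in
/-- The derivative of a component of a lift along the boundary circle. -/
theorem IsStandardForm.deriv_boundary (hst : P.IsStandardForm z₀ D w ν c d α a)
    (ha : ∀ j, a j ≠ 0) (F : P.LocalLift D w) (he : F.e = 1) {y : ℂ} (hy : y ∈ F.dom)
    (hbr1 : ‖F.br y‖ = 1) (l : Fin n) :
    deriv (fun t : ℝ => I * F.f (F.br y * exp (t * I) - F.p) l) 0 =
      I * (F.f y l * F.chart.liftLogDeriv D c α l (F.br y) * (I * F.br y)) := by
  have hex := hst.notMem_exceptional_of_norm_eq_one hbr1
  obtain ⟨g, -, hg1, hg2⟩ := hst.exists_f_eq_exp ha F hy (Or.inr he) hex l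
  have hcurve : HasDerivAt (fun t : ℝ => F.br y * exp (t * I) - F.p) (I * F.br y) 0 := by
    have e0 : HasDerivAt (fun θ : ℝ => (θ : ℂ) * I) I 0 := by
      simpa using (Complex.ofRealCLM.hasDerivAt (x := (0 : ℝ))).mul_const I
    have e1 := (e0.cexp.const_mul (F.br y)).sub_const F.p
    refine e1.congr_deriv ?_
    simp [mul_comm]
  have hcurve0 : F.br y * exp (((0 : ℝ) : ℂ) * I) - F.p = y := by simp [LocalLift.br, he]
  have hlim := hcurve.continuousAt.tendsto
  rw [hcurve0] at hlim
  have hcurvemem : ∀ᶠ t : ℝ in 𝓝 0, F.br y * exp (t * I) - F.p ∈ F.dom := by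
    filter_upwards [hlim.norm.eventually (gt_mem_nhds hy.1)] with t ht
    refine ⟨ht, ?_⟩
    have : F.br (F.br y * exp (t * I) - F.p) = F.br y * exp (t * I) := by
      simp [LocalLift.br, he]
    rw [this, mem_closedBall_zero_iff, norm_mul, hbr1, Complex.norm_exp_ofReal_mul_I, one_mul]
  have hfg : (fun t : ℝ => I * F.f (F.br y * exp (t * I) - F.p) l) =ᶠ[𝓝 0]
      fun t : ℝ => I * g (F.br y * exp (t * I) - F.p) := by
    filter_upwards [(tendsto_nhdsWithin_iff.2 ⟨hlim, hcurvemem⟩).eventually hg1] with t ht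
    rw [ht]
  have hg0 : F.f y l = g y := hg1.self_of_nhdsWithin hy
  have hgd := hg2.self_of_nhds
  rw [he, ← hg0] at hgd
  have hgd' : HasDerivAt g (F.f y l * F.chart.liftLogDeriv D c α l (F.br y))
      (F.br y * exp (((0 : ℝ) : ℂ) * I) - F.p) := by
    rw [hcurve0]
    refine hgd.congr_deriv ?_
    simp
  have hd := (hgd'.comp (0 : ℝ) hcurve).const_mul I
  rw [hfg.deriv_eq]
  exact hd.deriv

namespace OrthogonalConnection

variable (C : OrthogonalConnection D w)

theorem continuousAt_curl (hst : P.IsStandardForm z₀ D w ν c d α a) (ha : ∀ j, a j ≠ 0) {z : ℂ}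
    (hz : z ∈ Metric.ball (0 : ℂ) 1) (hpt : ∀ i, z ≠ D.pts i) :
    ContinuousAt (C.curl c α) z := by
  obtain ⟨F, rfl⟩ := exists_localLift hst ha (Metric.ball_subset_closedBall hz)
  have h0in : (0 : ℂ) ∈ F.inner := ⟨by simpa using F.ε_pos, by rwa [F.br_zero]⟩
  have h1 : ∀ u, ContDiffAt ℝ ∞ (fun z => C.form c α z u) F.p := fun u => by
    have h2 : ContDiffAt ℝ ∞ (fun z => C.connForm c α F (z - F.p) u) F.p := by
      refine ContDiffAt.comp (g := fun y => C.connForm c α F y u) F.p ?_ (by fun_prop)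
      rw [sub_self]
      exact C.contDiffAt_connForm F hst ha h0in u
    refine h2.congr_of_eventuallyEq ?_
    filter_upwards [Metric.isOpen_ball.mem_nhds hz, Metric.ball_mem_nhds F.p F.ε_pos] with t h3 h4
    exact C.form_eq_connForm F hst ha hpt (Metric.ball_subset_closedBall h3) h4 u
  have h2 : ∀ u v, ContinuousAt (fun z => fderiv ℝ (fun z => C.form c α z u) z v) F.p := fun u v =>
    (((h1 u).fderiv_right (m := 1) (by norm_cast)).continuousAt.clm_apply continuousAt_const)
  exact (h2 I 1).sub (h2 1 I)

theorem IsCurvatureDensity.eq_curl {C : OrthogonalConnection D w} {κ : ℂ → ℂ}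
    (hκ : C.IsCurvatureDensity κ) (hst : P.IsStandardForm z₀ D w ν c d α a) (ha : ∀ j, a j ≠ 0)
    {z : ℂ} (hz : z ∈ Metric.ball (0 : ℂ) 1) (hpt : ∀ i, z ≠ D.pts i) :
    κ z = C.curl c α z := by
  obtain ⟨F, rfl⟩ := exists_localLift hst ha (Metric.ball_subset_closedBall hz)
  have h0in : (0 : ℂ) ∈ F.inner := ⟨by simpa using F.ε_pos, by rwa [F.br_zero]⟩
  rw [hκ F hz hpt, C.trace_curvature_eq_curl F hst ha h0in (by rwa [F.br_zero]), F.br_zero,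
    F.localOrder.eq_one hpt]
  simp

open MeasureTheory Set Filter

/-- The integral of the curvature is the integral of the corrected trace over the boundary. -/
theorem integral_curvature {κ : ℂ → ℂ} (hκ : C.IsCurvatureDensity κ)
    (hst : P.IsStandardForm z₀ D w ν c d α a) (ha : ∀ j, a j ≠ 0) :
    IntegrableOn κ (Metric.ball 0 1) ∧ ∫ z in Metric.ball (0 : ℂ) 1, κ z =
      ∫ θ in (-Real.pi)..Real.pi, C.form c α (exp (θ * I)) (I * exp (θ * I)) := by
  classical
  set S : Finset ℂ := Finset.univ.image D.pts with hS
  have hSp : ∀ {z}, z ∉ S → ∀ i, z ≠ D.pts i := fun hz i hi =>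
    hz (Finset.mem_image.2 ⟨i, Finset.mem_univ _, hi.symm⟩)
  have hSp' : ∀ p ∈ S, ∃ i, D.pts i = p := fun p hp => by
    obtain ⟨i, -, hi⟩ := Finset.mem_image.1 hp
    exact ⟨i, hi⟩
  have hres : volume.restrict (Metric.ball (0 : ℂ) 1) =
      volume.restrict (Metric.ball (0 : ℂ) 1 \ S : Set ℂ) :=
    Measure.restrict_congr_set (sdiff_null_ae_eq_self (S.finite_toSet.measure_zero volume)).symm
  have hBm : MeasurableSet (Metric.ball (0 : ℂ) 1 \ S : Set ℂ) :=
    measurableSet_ball.diff S.finite_toSet.measurableSet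
  have hcont : ∀ u, ContinuousOn (fun z => C.form c α z u) (Metric.closedBall 0 1 \ S) :=
    fun u z hz => (C.continuousWithinAt_form hst ha hz.1 (hSp hz.2) u).mono sdiff_subset
  have hsub : (Metric.ball (0 : ℂ) 1 \ S : Set ℂ) ⊆ Metric.closedBall 0 1 \ S :=
    sdiff_subset_sdiff_left Metric.ball_subset_closedBall
  have hm : ∀ u, AEStronglyMeasurable (fun z => C.form c α z u)
      (volume.restrict (Metric.ball (0 : ℂ) 1)) := fun u => by
    rw [hres]; exact ((hcont u).mono hsub).aestronglyMeasurable hBm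
  have hmc : AEStronglyMeasurable (C.curl c α) (volume.restrict (Metric.ball (0 : ℂ) 1)) := by
    rw [hres]
    exact ContinuousOn.aestronglyMeasurable (fun z hz =>
      (C.continuousAt_curl hst ha hz.1 (hSp hz.2)).continuousWithinAt) hBm
  have hbound : ∀ p ∈ S, ∃ (K β : ℝ), 0 ≤ β ∧ β < 1 ∧
      (∀ u ∈ ({1, I} : Set ℂ), ∀ᶠ z in 𝓝[≠] p, ‖C.form c α z u‖ ≤ K * ‖z - p‖ ^ (-β)) ∧
      ∀ᶠ z in 𝓝[≠] p, ‖C.curl c α z‖ ≤ K * ‖z - p‖ ^ (-(2 * β)) := by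
    intro p hp
    obtain ⟨i, rfl⟩ := hSp' p hp
    obtain ⟨K, β, h1, h2, h3, h4, h5⟩ := C.exists_bound_at_pts hst ha i
    refine ⟨K, β, h1, h2, ?_, h5⟩
    rintro u (rfl | rfl)
    exacts [h3, h4]
  have hic : IntegrableOn (C.curl c α) (Metric.ball 0 1) := by
    refine integrableOn_ball_of_isolated_singularities hmc fun p hp => ?_
    by_cases hpS : p ∈ S
    · obtain ⟨K, β, h1, h2, -, h3⟩ := hbound p hpS
      exact ⟨K, 2 * β, by linarith, h3.mono fun z hz _ => hz⟩
    · obtain ⟨K, hK⟩ := C.exists_bound_curl hst ha hp (hSp hpS)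
      exact ⟨K, 0, by norm_num, nhdsWithin_le_nhds (hK.mono fun z hz hz1 => by simpa using hz hz1)⟩
  have hif : ∀ u ∈ ({1, I} : Set ℂ), ∀ p ∈ S,
      IntegrableOn (fun z => ‖C.form c α z u‖ / ‖z - p‖) (Metric.ball 0 1) := by
    intro u hu p hp
    have hmd : AEStronglyMeasurable (fun z => ‖C.form c α z u‖ / ‖z - p‖)
        (volume.restrict (Metric.ball (0 : ℂ) 1)) := by
      simp only [div_eq_mul_inv]
      exact (hm u).norm.mul (by fun_prop : Measurable fun z : ℂ => ‖z - p‖⁻¹).aestronglyMeasurable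
    refine integrableOn_ball_of_isolated_singularities hmd fun q hq => ?_
    by_cases hqp : q = p
    · subst hqp
      obtain ⟨K, β, h1, h2, h3, -⟩ := hbound q hp
      refine ⟨K, β + 1, by linarith, ?_⟩
      filter_upwards [h3 u hu, self_mem_nhdsWithin] with z h4 h5 _
      have h6 : 0 < ‖z - q‖ := norm_pos_iff.2 (sub_ne_zero.2 h5)
      rw [norm_div, norm_norm, norm_norm, div_le_iff₀ h6, neg_add, Real.rpow_add h6,
        Real.rpow_neg_one, mul_assoc, mul_assoc, inv_mul_cancel₀ h6.ne', mul_one]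
      exact h4
    · obtain ⟨K, β, hβ, h3⟩ : ∃ (K β : ℝ), β < 2 ∧ ∀ᶠ z in 𝓝[≠] q,
          z ∈ Metric.ball (0 : ℂ) 1 → ‖C.form c α z u‖ ≤ K * ‖z - q‖ ^ (-β) := by
        by_cases hqS : q ∈ S
        · obtain ⟨K, β, h1, h2, h3, -⟩ := hbound q hqS
          exact ⟨K, β, by linarith, (h3 u hu).mono fun z hz _ => hz⟩
        · obtain ⟨K, hK⟩ := Tendsto.isBoundedUnder_le
            (C.continuousWithinAt_form hst ha hq (hSp hqS) u).norm
          refine ⟨K, 0, by norm_num, nhdsWithin_le_nhds ?_⟩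
          filter_upwards [eventually_nhdsWithin_iff.1 (eventually_map.1 hK)] with z hz hz1
          simpa using hz (Metric.ball_subset_closedBall hz1)
      have h4 : ∀ᶠ z in 𝓝 q, ‖q - p‖ / 2 < ‖z - p‖ := by
        have : Continuous fun z : ℂ => ‖z - p‖ := by fun_prop
        refine this.continuousAt.eventually (lt_mem_nhds ?_)
        have := norm_pos_iff.2 (sub_ne_zero.2 hqp)
        linarith
      refine ⟨(‖q - p‖ / 2)⁻¹ * K, β, hβ, ?_⟩
      filter_upwards [h3, nhdsWithin_le_nhds h4] with z h5 h6 h7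
      have h8 : 0 < ‖q - p‖ / 2 := by
        have := norm_pos_iff.2 (sub_ne_zero.2 hqp)
        linarith
      rw [norm_div, norm_norm, norm_norm, div_eq_inv_mul, mul_assoc]
      exact mul_le_mul (inv_anti₀ h8 h6.le) (h5 h7) (norm_nonneg _) (by positivity)
  have hpt0 : ∀ u ∈ ({1, I} : Set ℂ), ∀ p ∈ S,
      Tendsto (fun z => (z - p) ^ 2 * C.form c α z u) (𝓝[≠] p) (𝓝 0) := by
    intro u hu p hp
    obtain ⟨K, β, h1, h2, h3, -⟩ := hbound p hp
    have h4 : Tendsto (fun z : ℂ => ‖z - p‖ * K) (𝓝[≠] p) (𝓝 0) := by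
      have : Continuous fun z : ℂ => ‖z - p‖ * K := by fun_prop
      simpa using (this.tendsto p).mono_left nhdsWithin_le_nhds
    refine squeeze_zero_norm' ?_ h4
    have h5 : ∀ᶠ z in 𝓝[≠] p, z ∈ Metric.ball p 1 :=
      nhdsWithin_le_nhds (Metric.ball_mem_nhds p one_pos)
    filter_upwards [h3 u hu, h5, self_mem_nhdsWithin] with z h6 h7 h8
    have h9 : 0 < ‖z - p‖ := norm_pos_iff.2 (sub_ne_zero.2 h8)
    rw [mem_ball_iff_norm] at h7
    have h10 : ‖z - p‖ ^ 1 * ‖z - p‖ ^ (-β) ≤ 1 := by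
      rw [← Real.rpow_natCast, ← Real.rpow_add h9]
      exact Real.rpow_le_one h9.le h7.le (by push_cast; linarith)
    have hK : 0 ≤ K := by
      by_contra hK
      have := h6.trans_lt (mul_neg_of_neg_of_pos (not_le.1 hK) (Real.rpow_pos_of_pos h9 _))
      exact absurd this (not_lt.2 (norm_nonneg _))
    calc ‖(z - p) ^ 2 * C.form c α z u‖ ≤ ‖z - p‖ ^ 2 * (K * ‖z - p‖ ^ (-β)) := by
          rw [norm_mul, norm_pow]; gcongr
      _ = ‖z - p‖ * K * (‖z - p‖ ^ 1 * ‖z - p‖ ^ (-β)) := by ring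
      _ ≤ ‖z - p‖ * K * 1 := by gcongr
      _ = _ := mul_one _
  have hst1 := integral_ball_curl (S := S) (fun p hp => by
      obtain ⟨i, rfl⟩ := hSp' p hp; simpa using D.pts_mem i) (hcont 1) (hcont I)
    (fun z hz => (C.differentiableAt_form hst ha hz.1 (hSp hz.2) 1).hasFDerivAt)
    (fun z hz => (C.differentiableAt_form hst ha hz.1 (hSp hz.2) I).hasFDerivAt) hic
    (hif 1 (by simp)) (hif I (by simp)) (hpt0 1 (by simp)) (hpt0 I (by simp))
  have hae : ∀ᵐ z ∂(volume.restrict (Metric.ball (0 : ℂ) 1)), κ z = C.curl c α z := by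
    have hnotS : ∀ᵐ z ∂(volume.restrict (Metric.ball (0 : ℂ) 1)), z ∉ S :=
      ae_restrict_of_ae (S.countable_toSet.ae_notMem volume)
    filter_upwards [hnotS, ae_restrict_mem measurableSet_ball] with z h1 h2
    exact hκ.eq_curl hst ha h2 (hSp h1)
  refine ⟨hic.congr (hae.mono fun z hz => hz.symm), ?_⟩
  rw [integral_congr_ae hae]
  refine hst1.trans (intervalIntegral.integral_congr fun θ _ => ?_)
  have h1 : (I * exp (θ * I)).re = -Real.sin θ := by
    rw [Complex.I_mul_re, Complex.exp_ofReal_mul_I_im]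
  have h2 : (I * exp (θ * I)).im = Real.cos θ := by
    rw [Complex.I_mul_im, Complex.exp_ofReal_mul_I_re]
  rw [C.form_eq (exp (θ * I)) (I * exp (θ * I)), h1, h2, Complex.ofReal_neg]

/-- Along the boundary the connection preserves the Lagrangian subbundle, so that its trace is, up to
a real form, minus the sum of the logarithmic derivatives of the homogeneous coordinates. -/
theorem im_form_boundary (hst : P.IsStandardForm z₀ D w ν c d α a) (ha : ∀ j, a j ≠ 0) {z : ℂ}
    (hz : ‖z‖ = 1) :
    (C.form c α z (I * z)).im = -(∑ j, coordLogDeriv D c α j z * (I * z)).im := by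
  obtain ⟨F, rfl⟩ := exists_localLift hst ha (p := z) (by simp [hz])
  have hpt := D.ne_pts_of_norm_eq_one hz
  have he : F.e = 1 := F.localOrder.eq_one hpt
  have hex := hst.notMem_exceptional_of_norm_eq_one hz
  rw [← F.br_zero] at hex
  have h0 : ∀ l, F.f 0 l ≠ 0 := hst.f_ne_zero ha F F.zero_mem_dom hex
  have hbr1 : ‖F.br 0‖ = 1 := by rwa [F.br_zero]
  have hdiag : ∀ l, ((C.Γ F 0 (I * F.p)) l l + F.chart.liftLogDeriv D c α l F.p * (I * F.p)).im = 0 := by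
    intro l
    obtain ⟨t, ht⟩ := C.preserves F he 0 F.zero_mem_dom hbr1 l
    have ht' := ht l
    rw [hst.deriv_boundary ha F he F.zero_mem_dom hbr1] at ht'
    rw [F.br_zero] at ht'
    simp only [Pi.add_apply, Pi.single_eq_same, Matrix.mulVec_single, Matrix.col_apply,
      Pi.smul_apply, MulOpposite.smul_eq_mul_unop, MulOpposite.unop_op] at ht'
    have h2 : (C.Γ F 0 (I * F.p)) l l + F.chart.liftLogDeriv D c α l F.p * (I * F.p) = (t l : ℂ) := by
      have h3 : I * F.f 0 l ≠ 0 := mul_ne_zero Complex.I_ne_zero (h0 l)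
      refine mul_right_cancel₀ h3 ?_
      linear_combination ht'
    rw [h2, Complex.ofReal_im]
  -- the correction turns the sum over the chart coordinates into the sum over all homogeneous
  -- coordinates
  have hsum : C.form c α F.p (I * F.p) + ∑ j, coordLogDeriv D c α j F.p * (I * F.p) =
      ∑ l, ((C.Γ F 0 (I * F.p)) l l + F.chart.liftLogDeriv D c α l F.p * (I * F.p)) := by
    have h1 := C.connForm_eq_form F hst ha F.zero_mem_dom (Or.inr he) (by rwa [F.br_zero])
      (I * F.p)
    rw [F.br_zero, he] at h1
    simp only [Nat.cast_one, tsub_self, pow_zero, mul_one, one_mul] at h1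
    rw [← h1, connForm, Finset.sum_add_distrib, ← Finset.sum_mul, ← Finset.sum_mul,
      F.chart.sum_liftLogDeriv, F.br_zero, he, Matrix.trace]
    simp
    ring
  have him := congrArg Complex.im hsum
  rw [Complex.add_im, Complex.im_sum Finset.univ fun l => ((C.Γ F 0 (I * F.p)) l l +
    F.chart.liftLogDeriv D c α l F.p * (I * F.p)), Finset.sum_eq_zero fun l _ => hdiag l] at him
  linarith

/-- The real part of the integrand vanishes. The imaginary part of the integral is a boundary integral,
which counts the zeros of the homogeneous coordinates, the marked points being zeros of the
fractional orders `c i j`. -/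
theorem integral_curvature_eq (C : OrthogonalConnection D w) {κ : ℂ → ℂ}
    (hκ : C.IsCurvatureDensity κ) (hst : P.IsStandardForm z₀ D w ν c d α a) (ha : ∀ j, a j ≠ 0) :
    ∫ z in Metric.ball (0 : ℂ) 1, κ z =
      -(2 * Real.pi * I) * ∑ j, ((d j : ℂ) + ∑ i, (c i j : ℂ)) := by
  classical
  obtain ⟨hi, hint⟩ := C.integral_curvature hκ hst ha
  -- the real part vanishes, as the trace of the curvature is imaginary
  have hre : (∫ z in Metric.ball (0 : ℂ) 1, κ z).re = 0 := by
    have h1 : ∀ᵐ z ∂(volume.restrict (Metric.ball (0 : ℂ) 1)), (κ z).re = 0 := by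
      have hnotS : ∀ᵐ z ∂(volume.restrict (Metric.ball (0 : ℂ) 1)),
          z ∉ Finset.univ.image D.pts :=
        ae_restrict_of_ae ((Finset.univ.image D.pts).countable_toSet.ae_notMem volume)
      filter_upwards [hnotS, ae_restrict_mem measurableSet_ball] with z h1 h2
      obtain ⟨F, rfl⟩ := exists_localLift hst ha (Metric.ball_subset_closedBall h2)
      rw [hκ F h2 fun i hi => h1 (Finset.mem_image.2 ⟨i, Finset.mem_univ _, hi.symm⟩)]
      exact C.re_trace_curvature F ⟨by simpa using F.ε_pos, by rwa [F.br_zero]⟩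
    have h2 : ∫ z in Metric.ball (0 : ℂ) 1, (κ z).re = (∫ z in Metric.ball (0 : ℂ) 1, κ z).re :=
      integral_re hi
    rw [← h2, integral_congr_ae h1]
    simp
  have hcont : Continuous fun θ : ℝ => C.form c α (exp (θ * I)) (I * exp (θ * I)) := by
    have h1 : ∀ u, Continuous fun θ : ℝ => C.form c α (exp (θ * I)) u := fun u => by
      refine continuous_iff_continuousAt.2 fun θ => ?_
      have h2 := C.continuousWithinAt_form hst ha (p := exp (θ * I))
        (by simp [Complex.norm_exp_ofReal_mul_I])
        (D.ne_pts_of_norm_eq_one (Complex.norm_exp_ofReal_mul_I θ)) u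
      refine Tendsto.comp h2 (tendsto_nhdsWithin_iff.2 ⟨?_, Eventually.of_forall fun θ => by
        simp [Complex.norm_exp_ofReal_mul_I]⟩)
      exact (by fun_prop : Continuous fun θ : ℝ => exp (θ * I)).continuousAt
    rw [show (fun θ : ℝ => C.form c α (exp (θ * I)) (I * exp (θ * I))) = fun θ : ℝ =>
      ((I * exp (θ * I)).re : ℂ) * C.form c α (exp (θ * I)) 1 +
      ((I * exp (θ * I)).im : ℂ) * C.form c α (exp (θ * I)) I from funext fun θ => C.form_eq _ _]
    have h3 : Continuous fun θ : ℝ => I * exp (θ * I) := by fun_prop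
    exact ((Complex.continuous_ofReal.comp (Complex.continuous_re.comp h3)).mul (h1 1)).add
      ((Complex.continuous_ofReal.comp (Complex.continuous_im.comp h3)).mul (h1 I))
  have hterm : ∀ j, IntervalIntegrable
      (fun θ : ℝ => coordLogDeriv D c α j (exp (θ * I)) * (I * exp (θ * I))) volume
      (-Real.pi) Real.pi ∧ ∫ θ in (-Real.pi)..Real.pi,
        coordLogDeriv D c α j (exp (θ * I)) * (I * exp (θ * I)) =
      2 * Real.pi * I * ((d j : ℂ) + ∑ i, (c i j : ℂ)) := by
    intro j
    have e1 : (fun θ : ℝ => coordLogDeriv D c α j (exp (θ * I)) * (I * exp (θ * I))) =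
        fun θ : ℝ => ∑ s, logDeriv (blaschke (α j s)) (exp (θ * I)) * (I * exp (θ * I)) +
          ∑ i, (c i j : ℂ) *
            (logDeriv (blaschke (D.pts i)) (exp (θ * I)) * (I * exp (θ * I))) := by
      funext θ
      rw [coordLogDeriv, add_mul, Finset.sum_mul, Finset.sum_mul]
      simp only [mul_assoc]
    have i1 := fun s => integral_logDeriv_blaschke (hst.zeros_mem j s)
    have i2 := fun i => integral_logDeriv_blaschke (D.pts_mem i)
    have j1 : IntervalIntegrable (fun θ : ℝ => ∑ s, logDeriv (blaschke (α j s)) (exp (θ * I)) *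
        (I * exp (θ * I))) volume (-Real.pi) Real.pi := by
      have := IntervalIntegrable.sum Finset.univ fun s _ => (i1 s).1
      convert! this using 1
      ext θ; simp
    have j2 : IntervalIntegrable (fun θ : ℝ => ∑ i, (c i j : ℂ) *
        (logDeriv (blaschke (D.pts i)) (exp (θ * I)) * (I * exp (θ * I)))) volume
        (-Real.pi) Real.pi := by
      have := IntervalIntegrable.sum Finset.univ fun i _ => (i2 i).1.const_mul (c i j : ℂ)
      convert! this using 1
      ext θ; simp
    rw [e1]
    refine ⟨j1.add j2, ?_⟩
    rw [intervalIntegral.integral_add j1 j2,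
      intervalIntegral.integral_finsetSum fun s _ => (i1 s).1,
      intervalIntegral.integral_finsetSum fun i _ => (i2 i).1.const_mul (c i j : ℂ)]
    simp only [intervalIntegral.integral_const_mul, (i1 _).2, (i2 _).2]
    rw [Finset.sum_const, ← Finset.sum_mul]
    simp
    ring
  have hsumi : IntervalIntegrable (fun θ : ℝ => ∑ j, coordLogDeriv D c α j (exp (θ * I)) *
      (I * exp (θ * I))) volume (-Real.pi) Real.pi := by
    have := IntervalIntegrable.sum Finset.univ fun j _ => (hterm j).1
    convert! this using 1
    ext θ; simp
  have him : (∫ z in Metric.ball (0 : ℂ) 1, κ z).im =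
      -(2 * Real.pi * I * ∑ j, ((d j : ℂ) + ∑ i, (c i j : ℂ))).im := by
    rw [hint, ← Complex.imCLM_apply, ← Complex.imCLM.intervalIntegral_comp_comm
      (hcont.intervalIntegrable _ _)]
    simp only [Complex.imCLM_apply, C.im_form_boundary hst ha (Complex.norm_exp_ofReal_mul_I _)]
    rw [intervalIntegral.integral_neg]
    congr 1
    have := Complex.imCLM.intervalIntegral_comp_comm hsumi
    simp only [Complex.imCLM_apply] at this
    rw [this, intervalIntegral.integral_finsetSum fun j _ => (hterm j).1]
    simp only [(hterm _).2]
    rw [Finset.mul_sum]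
  have hreal : ∑ j, ((d j : ℂ) + ∑ i, (c i j : ℂ)) =
      ((∑ j, ((d j : ℝ) + ∑ i, (c i j : ℝ)) : ℝ) : ℂ) := by push_cast; rfl
  rw [hreal] at him ⊢
  apply Complex.ext
  · rw [hre]; simp
  · rw [him]; simp

end OrthogonalConnection

end LabeledPolytope

/-! ### A metric on the pulled-back tangent orbibundle -/

namespace LabeledPolytope

variable {n m k : ℕ} {P : LabeledPolytope n m} {D : MarkedOrbiDisc k} {w : ℂ → P.X}
  {z₀ : Fin m → ℂ} {ν : Fin k → Fin n → ℤ} {c : Fin k → Fin m → ℚ}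
  {d : Fin m → ℕ} {α : (j : Fin m) → Fin (d j) → ℂ} {a : Fin m → ℂ}

/-- The infinitesimal action of `b_j`, written in the lift `F`. -/
noncomputable def LocalLift.torusVec (F : P.LocalLift D w) (y : ℂ) (j : Fin m) : Fin n → ℂ :=
  fun l => F.f y l * (F.chart.coeff (P.b j) l : ℂ)

/-- The dual metric `∑ j, p j / ‖W j‖² · b_j ⊗ b̄_j`, where `W` are the homogeneous coordinates of the
disc and `b_j` stands for its infinitesimal action. The terms of the cone of the chart are rewritten
so as to make sense also where their coordinates vanish. -/
noncomputable def dualMetric (W : ℂ → Fin m → ℂ) (p : Fin m → ℂ → ℝ) (F : P.LocalLift D w) (y : ℂ) :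
    Matrix (Fin n) (Fin n) ℂ :=
  open Classical in
  Matrix.diagonal (fun l => ((Real.exp (2 * F.chart.offLog (W (F.br y)) l) *
    p (F.chart.ray l) (F.br y) : ℝ) : ℂ)) +
  ∑ j, (if j ∈ Set.range F.chart.ray then 0 else
    ((p j (F.br y) / ‖W (F.br y) j‖ ^ 2 : ℝ) : ℂ)) •
      Matrix.vecMulVec (F.torusVec y j) (star (F.torusVec y j))

namespace IsStandardForm

variable {p : Fin m → ℂ → ℝ}

theorem dualMetric_posDef (hp : ∀ j, ∀ z ∈ Metric.closedBall (0 : ℂ) 1, 0 < p j z)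
    (F : P.LocalLift D w) {y : ℂ} (hy : y ∈ F.dom) (W : ℂ → Fin m → ℂ) :
    (dualMetric W p F y).PosDef := by
  classical
  unfold dualMetric
  refine Matrix.PosDef.add_posSemidef ?_ ?_
  · refine Matrix.PosDef.diagonal fun l => ?_
    exact_mod_cast mul_pos (Real.exp_pos _) (hp _ _ hy.2)
  · refine Matrix.posSemidef_sum _ fun j _ => ?_
    refine (Matrix.posSemidef_vecMulVec_self_star _).smul ?_
    split_ifs
    · exact le_rfl
    · exact_mod_cast div_nonneg (hp _ _ hy.2).le (by positivity)

/-- Off the exceptional points the dual metric is a sum over all facets. -/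
theorem dualMetric_eq (hst : P.IsStandardForm z₀ D w ν c d α a) (ha : ∀ j, a j ≠ 0)
    (F : P.LocalLift D w) {y : ℂ} (hy : y ∈ F.dom) (hex : F.br y ∉ exceptional D α) :
    dualMetric (blaschkeMap D.pts c d α a) p F y =
      ∑ j, ((p j (F.br y) / ‖blaschkeMap D.pts c d α a (F.br y) j‖ ^ 2 : ℝ) : ℂ) •
        Matrix.vecMulVec (F.torusVec y j) (star (F.torusVec y j)) := by
  classical
  set W := blaschkeMap D.pts c d α a
  have h1 : Matrix.diagonal (fun l => ((Real.exp (2 * F.chart.offLog (W (F.br y)) l) *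
      p (F.chart.ray l) (F.br y) : ℝ) : ℂ)) =
      ∑ j, (if j ∈ Set.range F.chart.ray then
        ((p j (F.br y) / ‖W (F.br y) j‖ ^ 2 : ℝ) : ℂ) •
          Matrix.vecMulVec (F.torusVec y j) (star (F.torusVec y j)) else 0) := by
    rw [F.chart.sum_eq_sum_ray _ fun j hj => if_neg hj]
    ext l l'
    simp only [Matrix.sum_apply, if_pos (Set.mem_range_self _), Matrix.smul_apply,
      Matrix.vecMulVec_apply, Pi.star_apply, LocalLift.torusVec, F.chart.coeff_ray]
    rw [Finset.sum_eq_single l]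
    · by_cases hll : l = l'
      · subst hll
        have hW0 := norm_pos_iff.2 (hst.coord_ne_zero ha hy.2 hex (F.chart.ray l))
        have hn := hst.norm_f F hy l
        have h2 : F.f y l * conj (F.f y l) = ((‖F.f y l‖ ^ 2 : ℝ) : ℂ) := by
          rw [Complex.mul_conj, Complex.normSq_eq_norm_sq]
        have h3 : Real.exp (2 * F.chart.offLog (W (F.br y)) l) =
            ‖F.f y l‖ ^ 2 / ‖W (F.br y) (F.chart.ray l)‖ ^ 2 := by
          rw [hn, mul_pow, two_mul, Real.exp_add, ← sq, mul_div_cancel_left₀ _ (by positivity)]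
        rw [Matrix.diagonal_apply_eq, h3]
        simp only [if_true, Rat.cast_one, mul_one, smul_eq_mul]
        rw [← starRingEnd_apply, h2]
        push_cast
        ring
      · rw [Matrix.diagonal_apply_ne _ hll]
        simp [hll]
    · intro r _ hr
      simp [hr]
    · simp
  rw [dualMetric, h1, ← Finset.sum_add_distrib]
  refine Finset.sum_congr rfl fun j _ => ?_
  split_ifs <;> simp

end IsStandardForm

end LabeledPolytope

namespace LabeledPolytope

variable {n m k : ℕ} {P : LabeledPolytope n m} {D : MarkedOrbiDisc k} {w : ℂ → P.X}
  {z₀ : Fin m → ℂ} {ν : Fin k → Fin n → ℤ} {c : Fin k → Fin m → ℚ}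
  {d : Fin m → ℕ} {α : (j : Fin m) → Fin (d j) → ℂ} {a : Fin m → ℂ}

theorem contDiffAt_norm_coord (hα : ∀ j s, α j s ∈ Metric.ball (0 : ℂ) 1) (ha : ∀ j, a j ≠ 0)
    {z : ℂ} (hz : z ∈ Metric.closedBall (0 : ℂ) 1) {j : Fin m}
    (hj : blaschkeMap D.pts c d α a z j ≠ 0) :
    ContDiffAt ℝ ∞ (fun z => ‖blaschkeMap D.pts c d α a z j‖) z := by
  obtain ⟨V, hV, hn, -⟩ := exists_coord_log hα ha hz hj
  have h1 : ContDiffAt ℝ ∞ (fun z => Real.exp (V z).re) z :=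
    (Complex.reCLM.contDiff.contDiffAt.comp z (hV.restrictScalars (𝕜 := ℝ)).contDiffAt).exp
  exact h1.congr_of_eventuallyEq hn

theorem Chart.contDiffAt_offLog (hα : ∀ j s, α j s ∈ Metric.ball (0 : ℂ) 1) (ha : ∀ j, a j ≠ 0)
    (s : P.Chart) {z : ℂ} (hz : z ∈ Metric.closedBall (0 : ℂ) 1)
    (hW : ∀ j, j ∉ Set.range s.ray → blaschkeMap D.pts c d α a z j ≠ 0) (l : Fin n) :
    ContDiffAt ℝ ∞ (fun z => s.offLog (blaschkeMap D.pts c d α a z) l) z := by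
  unfold Chart.offLog
  refine ContDiffAt.sum fun j _ => ?_
  by_cases hj : j ∈ Set.range s.ray
  · simp only [if_pos hj]; exact contDiffAt_const
  · simp only [if_neg hj]
    exact ((contDiffAt_norm_coord hα ha hz (hW j hj)).log (norm_ne_zero_iff.2 (hW j hj))).mul
      contDiffAt_const

namespace IsStandardForm

variable {p : Fin m → ℂ → ℝ}

theorem contDiffOn_dualMetric (hst : P.IsStandardForm z₀ D w ν c d α a) (ha : ∀ j, a j ≠ 0)
    (hps : ∀ j, ∀ z ∈ Metric.closedBall (0 : ℂ) 1, ContDiffAt ℝ ∞ (p j) z)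
    (F : P.LocalLift D w) (r s : Fin n) :
    ContDiffOn ℝ ∞ (fun y => dualMetric (blaschkeMap D.pts c d α a) p F y r s) F.dom := by
  classical
  intro y hy
  have hbr : ContDiffAt ℝ ∞ F.br y := ((F.analyticAt_br y).restrictScalars (𝕜 := ℝ)).contDiffAt
  have hW0 := fun j (hj : j ∉ Set.range F.chart.ray) => hst.ne_zero_of_notMem F hy hj
  have hp : ∀ j, ContDiffAt ℝ ∞ (fun t => p j (F.br t)) y := fun j => (hps j _ hy.2).comp y hbr
  have hf : ∀ l, ContDiffWithinAt ℝ ∞ (fun t => F.f t l) F.dom y := fun l =>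
    (contDiffOn_pi.1 F.contDiffOn l) y hy
  simp only [dualMetric, Matrix.add_apply, Matrix.sum_apply, Matrix.smul_apply]
  refine ContDiffWithinAt.add ?_ (ContDiffWithinAt.sum fun j _ => ?_)
  · by_cases hrs : r = s
    · subst hrs
      simp only [Matrix.diagonal_apply_eq]
      refine (Complex.ofRealCLM.contDiff.contDiffAt.comp y (ContDiffAt.mul
        (ContDiffAt.exp (contDiffAt_const.mul ?_)) (hp _))).contDiffWithinAt
      exact (F.chart.contDiffAt_offLog hst.zeros_mem ha hy.2 hW0 r).comp y hbr
    · simp only [Matrix.diagonal_apply_ne _ hrs]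
      exact contDiffWithinAt_const
  · by_cases hj : j ∈ Set.range F.chart.ray
    · simp only [if_pos hj, zero_smul]
      exact contDiffWithinAt_const
    · simp only [if_neg hj, Matrix.vecMulVec_apply, Pi.star_apply, LocalLift.torusVec, smul_eq_mul]
      have h1 := (contDiffAt_norm_coord hst.zeros_mem ha hy.2 (hW0 j hj)).comp y hbr
      refine ContDiffWithinAt.mul (Complex.ofRealCLM.contDiff.contDiffAt.comp y ((hp j).div
        (h1.pow 2) (pow_ne_zero _ (norm_ne_zero_iff.2 (hW0 j hj))))).contDiffWithinAt ?_
      refine ((hf r).mul contDiffWithinAt_const).mul ?_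
      exact (Complex.conjCLE.toContinuousLinearMap.contDiff.contDiffAt).comp_contDiffWithinAt y
        ((hf s).mul contDiffWithinAt_const)

theorem jac_mulVec_torusVec (hst : P.IsStandardForm z₀ D w ν c d α a) (ha : ∀ j, a j ≠ 0)
    {F F' : P.LocalLift D w} {y y' : ℂ} {β : ℂ → ℂ} {φ : (Fin n → ℂ) → Fin n → ℂ}
    (h : IsGluing F F' y y' β φ) (hex : F.br y ∉ exceptional D α) (j : Fin m) :
    (jac φ (F.f y)).mulVec (F.torusVec y j) = F'.torusVec y' j := by
  have h1 : ∀ (F : P.LocalLift D w) y,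
      F.torusVec y j = (F.torusFrame y).mulVec fun b => (P.b j b : ℂ) := fun F y => by
    rw [F.torusFrame_mulVec]; rfl
  rw [h1, h1, Matrix.mulVec_mulVec, hst.jac_mul_torusFrame ha h hex]

/-- The dual metric is compatible with all transition maps. -/
theorem dualMetric_glue (hst : P.IsStandardForm z₀ D w ν c d α a) (ha : ∀ j, a j ≠ 0)
    (hps : ∀ j, ∀ z ∈ Metric.closedBall (0 : ℂ) 1, ContDiffAt ℝ ∞ (p j) z)
    {F F' : P.LocalLift D w} {y y' : ℂ} {β : ℂ → ℂ} {φ : (Fin n → ℂ) → Fin n → ℂ}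
    (h : IsGluing F F' y y' β φ) :
    jac φ (F.f y) * dualMetric (blaschkeMap D.pts c d α a) p F y * (jac φ (F.f y)).conjTranspose =
      dualMetric (blaschkeMap D.pts c d α a) p F' y' := by
  set N := dualMetric (P := P) (D := D) (w := w) (blaschkeMap D.pts c d α a) p with hN
  have hreg : ∀ {t}, IsGluing F F' t (β t) β φ → F.br t ∉ exceptional D α →
      jac φ (F.f t) * N F t * (jac φ (F.f t)).conjTranspose = N F' (β t) := by
    intro t ht hex
    have hbr : F'.br (β t) = F.br t := ht.2.2.2.2.2.1.self_of_nhds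
    rw [hN, hst.dualMetric_eq ha F (F.inner_subset_dom ht.1) hex,
      hst.dualMetric_eq ha F' (F'.inner_subset_dom ht.2.1) (by rwa [hbr]), hbr,
      Finset.mul_sum, Finset.sum_mul]
    refine Finset.sum_congr rfl fun j _ => ?_
    rw [Matrix.mul_smul, Matrix.smul_mul, Matrix.mul_vecMulVec, Matrix.vecMulVec_mul,
      hst.jac_mulVec_torusVec ha ht hex, ← Matrix.star_mulVec, hst.jac_mulVec_torusVec ha ht hex]
  have hev := h.eventually
  obtain ⟨hy, hy', -, hβ, hβa, -, hφ, -, -⟩ := h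
  have hcN : ∀ (F : P.LocalLift D w) {y}, y ∈ F.inner → ContinuousAt (N F) y := fun F y hy =>
    continuousAt_pi.2 fun r => continuousAt_pi.2 fun s =>
      ((hst.contDiffOn_dualMetric ha hps F r s).continuousOn).continuousAt
        (Filter.mem_of_superset (F.isOpen_inner.mem_nhds hy) F.inner_subset_dom)
  have h1 : ContinuousAt (fun t => N F' (β t)) y :=
    ContinuousAt.comp (g := N F') (f := β) (by rw [hβ]; exact hcN F' hy') hβa.continuousAt
  have h2 : ContinuousAt (fun t => jac φ (F.f t) * N F t * (jac φ (F.f t)).conjTranspose) y := by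
    have h3 := continuousAt_jac hy hφ
    have h4 : ContinuousAt (fun t => (jac φ (F.f t)).conjTranspose) y :=
      (continuous_id.matrix_conjTranspose).continuousAt.comp h3
    exact (h3.mul (hcN F hy)).mul h4
  have h5 : (fun t => jac φ (F.f t) * N F t * (jac φ (F.f t)).conjTranspose) =ᶠ[𝓝[≠] y]
      fun t => N F' (β t) := by
    filter_upwards [nhdsWithin_le_nhds hev, F.eventually_br_notMem y (exceptional D α)] with t k1 k2
    exact hreg k1 k2
  have h6 := ((h2.eventuallyEq_nhds_iff_eventuallyEq_nhdsNE h1).1 h5).self_of_nhds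
  rw [← hβ]
  exact h6

end IsStandardForm

end LabeledPolytope

/-! ### The Chern connection of the metric -/

section MatrixDeriv

variable {n : ℕ} {M N : ℂ → Matrix (Fin n) (Fin n) ℂ} {y : ℂ}

/-- The complex derivative `∂M = (∂₁ M - i ∂₂ M) / 2` of a matrix-valued function. -/
noncomputable def matPartial (M : ℂ → Matrix (Fin n) (Fin n) ℂ) (y : ℂ) : Matrix (Fin n) (Fin n) ℂ :=
  (1 / 2 : ℂ) • (matDeriv M y 1 - I • matDeriv M y I)

theorem matDeriv_eq (M : ℂ → Matrix (Fin n) (Fin n) ℂ) (y v : ℂ) :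
    matDeriv M y v = (v.re : ℂ) • matDeriv M y 1 + (v.im : ℂ) • matDeriv M y I := by
  ext a c
  simp only [matDeriv, Matrix.of_apply, Matrix.add_apply, Matrix.smul_apply, smul_eq_mul]
  conv_lhs => rw [show v = v.re • (1 : ℂ) + v.im • I by simp, map_add, map_smul, map_smul]
  simp

theorem matDeriv_conjTranspose_of_hermitian (hM : MatDiffAt M y)
    (hh : ∀ᶠ t in 𝓝 y, (M t).conjTranspose = M t) (v : ℂ) :
    (matDeriv M y v).conjTranspose = matDeriv M y v := by
  rw [← matDeriv_conjTranspose hM]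
  exact matDeriv_congr hh v

/-- The derivative of a Hermitian matrix-valued function in terms of its complex derivative. -/
theorem matDeriv_eq_matPartial (hM : MatDiffAt M y)
    (hh : ∀ᶠ t in 𝓝 y, (M t).conjTranspose = M t) (v : ℂ) :
    matDeriv M y v = v • matPartial M y + conj v • (matPartial M y).conjTranspose := by
  have h1 := matDeriv_conjTranspose_of_hermitian hM hh 1
  have h2 := matDeriv_conjTranspose_of_hermitian hM hh I
  rw [matDeriv_eq]
  simp only [matPartial, Matrix.conjTranspose_smul, Matrix.conjTranspose_sub, h1, h2]
  ext a c
  simp only [Matrix.add_apply, Matrix.smul_apply, Matrix.sub_apply, smul_eq_mul]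
  have hv : v = v.re + v.im * I := (Complex.re_add_im v).symm
  have hv' : conj v = v.re - v.im * I := by
    apply Complex.ext <;> simp
  rw [hv', show v * _ = (v.re + v.im * I) * _ from congrArg (· * _) hv]
  simp only [star_def, map_div₀, map_one, map_ofNat, Complex.conj_I]
  ring_nf
  simp only [Complex.I_sq]
  ring

/-- The complex derivative of `J N Jᴴ` for holomorphic `J`. -/
theorem matPartial_conj {J : ℂ → Matrix (Fin n) (Fin n) ℂ} {J' : Matrix (Fin n) (Fin n) ℂ}
    (hJ : ∀ a c, HasDerivAt (fun t => J t a c) (J' a c) y) (hN : MatDiffAt N y) :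
    matPartial (fun t => J t * N t * (J t).conjTranspose) y =
      J' * N y * (J y).conjTranspose + J y * matPartial N y * (J y).conjTranspose := by
  have hJd : MatDiffAt J y := fun a c =>
    (hJ a c).complexToReal_fderiv.differentiableAt
  have hJv : ∀ v, matDeriv J y v = v • J' := fun v => by
    ext a c
    rw [matDeriv, Matrix.of_apply, (hJ a c).complexToReal_fderiv.fderiv]
    simp [mul_comm]
  have h1 : ∀ v, matDeriv (fun t => J t * N t * (J t).conjTranspose) y v =
      (v • J' * N y + J y * matDeriv N y v) * (J y).conjTranspose +
        J y * N y * (v • J').conjTranspose := fun v => by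
    rw [matDeriv_mul (hJd.mul hN) hJd.conjTranspose, matDeriv_mul hJd hN,
      matDeriv_conjTranspose hJd, hJv]
  rw [matPartial, h1, h1, matPartial]
  simp only [Matrix.conjTranspose_smul, one_smul, Complex.star_def, Complex.conj_I,
    Matrix.add_mul, Matrix.mul_sub, Matrix.sub_mul, Matrix.smul_mul, Matrix.mul_smul, smul_add,
    smul_sub, smul_smul]
  ext a c
  simp only [Matrix.add_apply, Matrix.smul_apply, Matrix.sub_apply, smul_eq_mul]
  ring_nf
  simp only [Complex.I_sq]
  ring

/-- The chain rule for a holomorphic change of coordinate. -/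
theorem matPartial_comp {β : ℂ → ℂ} {β' : ℂ} (hβ : HasDerivAt β β' y) (hM : MatDiffAt M (β y)) :
    matPartial (fun t => M (β t)) y = β' • matPartial M (β y) := by
  have h1 : ∀ v, matDeriv (fun t => M (β t)) y v = matDeriv M (β y) (β' * v) := fun v => by
    ext a c
    have h2 := ((hM a c).hasFDerivAt.comp y hβ.complexToReal_fderiv).fderiv
    have h3 : fderiv ℝ (fun t => M (β t) a c) y v = _ := congrArg (fun L => L v) h2
    simp only [matDeriv, Matrix.of_apply]
    rw [h3]
    simp
  rw [matPartial, h1, h1, matDeriv_eq M _ (β' * 1), matDeriv_eq M _ (β' * I), matPartial]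
  ext a c
  simp only [Matrix.add_apply, Matrix.smul_apply, Matrix.sub_apply, smul_eq_mul, mul_one,
    Complex.mul_I_re, Complex.mul_I_im, Complex.ofReal_neg]
  linear_combination (norm := skip) (1 / 2 : ℂ) * (matDeriv M (β y) 1 a c - I * matDeriv M (β y) I a c)
    * Complex.re_add_im β'
  ring_nf
  simp only [Complex.I_sq]
  ring

theorem matPartial_congr (h : M =ᶠ[𝓝 y] N) : matPartial M y = matPartial N y := by
  rw [matPartial, matPartial, matDeriv_congr h, matDeriv_congr h]

theorem contDiffWithinAt_matrix_inv {S : Set ℂ}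
    (hM : ∀ a c, ContDiffWithinAt ℝ ∞ (fun t => M t a c) S y) (h0 : (M y).det ≠ 0) (a c : Fin n) :
    ContDiffWithinAt ℝ ∞ (fun t => (M t)⁻¹ a c) S y := by
  have hdet : ∀ A : ℂ → Matrix (Fin n) (Fin n) ℂ,
      (∀ a c, ContDiffWithinAt ℝ ∞ (fun t => A t a c) S y) →
      ContDiffWithinAt ℝ ∞ (fun t => (A t).det) S y := fun A hA => by
    simp only [Matrix.det_apply]
    exact ContDiffWithinAt.sum fun σ _ =>
      (contDiffWithinAt_prod fun i _ => hA (σ i) i).const_smul (Equiv.Perm.sign σ)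
  have h1 : (fun t => (M t)⁻¹ a c) = fun t => (M t).det⁻¹ *
      ((M t).updateRow c (Pi.single a 1)).det := by
    funext t
    rw [Matrix.inv_def, Matrix.smul_apply, Matrix.adjugate_apply, Ring.inverse_eq_inv, smul_eq_mul]
  rw [h1]
  refine ((hdet M hM).inv h0).mul (hdet _ fun i l => ?_)
  by_cases hi : i = c
  · subst hi
    simp only [Matrix.updateRow_self]
    exact contDiffWithinAt_const
  · simp only [Matrix.updateRow_ne hi]
    exact hM i l

theorem matDeriv_inv (hM : MatDiffAt M y) (h0 : ∀ᶠ t in 𝓝 y, IsUnit (M t).det)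
    (hMi : MatDiffAt (fun t => (M t)⁻¹) y) (v : ℂ) :
    matDeriv (fun t => (M t)⁻¹) y v = -((M y)⁻¹ * matDeriv M y v * (M y)⁻¹) := by
  have h1 : matDeriv (fun t => M t * (M t)⁻¹) y v = 0 := by
    rw [matDeriv_congr (N := fun _ => 1) (h0.mono fun t ht => Matrix.mul_nonsing_inv _ ht)]
    ext a c
    simp [matDeriv]
  rw [matDeriv_mul hM hMi] at h1
  have h2 := h0.self_of_nhds
  have h3 : M y * matDeriv (fun t => (M t)⁻¹) y v = -(matDeriv M y v * (M y)⁻¹) :=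
    eq_neg_of_add_eq_zero_right h1
  rw [← Matrix.nonsing_inv_mul_cancel_left (M y) (matDeriv (fun t => (M t)⁻¹) y v) h2, h3,
    Matrix.mul_neg, Matrix.mul_assoc]

end MatrixDeriv

namespace LabeledPolytope

variable {n m k : ℕ} {P : LabeledPolytope n m} {D : MarkedOrbiDisc k} {w : ℂ → P.X}
  {z₀ : Fin m → ℂ} {ν : Fin k → Fin n → ℤ} {c : Fin k → Fin m → ℚ}
  {d : Fin m → ℕ} {α : (j : Fin m) → Fin (d j) → ℂ} {a : Fin m → ℂ}

/-- Weights for the dual metric: positive functions which equal `‖W j‖²` near the boundary circle,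
so that the dual metric becomes `∑ j, b_j ⊗ b̄_j` there. -/
structure IsMetricWeight (D : MarkedOrbiDisc k) (α : (j : Fin m) → Fin (d j) → ℂ)
    (W : ℂ → Fin m → ℂ) (p : Fin m → ℂ → ℝ) (R : ℝ) : Prop where
  pos : ∀ j, ∀ z ∈ Metric.closedBall (0 : ℂ) 1, 0 < p j z
  smooth : ∀ j, ∀ z ∈ Metric.closedBall (0 : ℂ) 1, ContDiffAt ℝ ∞ (p j) z
  lt_one : R < 1
  norm_le : ∀ z ∈ exceptional D α, ‖z‖ ≤ R
  eq_sq : ∀ j z, R < ‖z‖ → p j z = ‖W z j‖ ^ 2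

/-- The real symmetric matrix of the dual metric at the boundary, in the frame of the torus action on
the coordinates of the chart. -/
noncomputable def Chart.gram (s : P.Chart) : Matrix (Fin n) (Fin n) ℝ :=
  Matrix.of fun l l' => ∑ j, (s.coeff (P.b j) l : ℝ) * (s.coeff (P.b j) l' : ℝ)

/-- The connection matrix of the Chern connection. On the boundary circle, where the derivative of
the metric is not available, its limit is given explicitly. -/
noncomputable def chernForm (D : MarkedOrbiDisc k) {w : ℂ → P.X} (c : Fin k → Fin m → ℚ)
    (α : (j : Fin m) → Fin (d j) → ℂ) (W : ℂ → Fin m → ℂ) (p : Fin m → ℂ → ℝ)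
    (F : P.LocalLift D w) (y : ℂ) : Matrix (Fin n) (Fin n) ℂ :=
  open Classical in
  if ‖F.br y‖ < 1 then -(matPartial (dualMetric W p F) y * (dualMetric W p F y)⁻¹)
  else -Matrix.diagonal fun l => F.chart.liftLogDeriv D c α l (F.br y) * (F.e * y ^ (F.e - 1))

namespace IsStandardForm

variable {p : Fin m → ℂ → ℝ} {R : ℝ}

/-- Near the circle the weights cancel the moduli of the homogeneous coordinates, so that the dual
metric is constant in the frame of the torus action on the coordinates of the chart. -/
theorem dualMetric_eq_gram (hst : P.IsStandardForm z₀ D w ν c d α a) (ha : ∀ j, a j ≠ 0)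
    (hp : IsMetricWeight D α (blaschkeMap D.pts c d α a) p R)
    (F : P.LocalLift D w) {y : ℂ} (hy : y ∈ F.dom) (hR : R < ‖F.br y‖) :
    dualMetric (blaschkeMap D.pts c d α a) p F y =
      Matrix.diagonal (F.f y) * F.chart.gram.map Complex.ofReal *
        (Matrix.diagonal (F.f y)).conjTranspose := by
  have hex : F.br y ∉ exceptional D α := fun h => absurd (hp.norm_le _ h) (not_le.2 hR)
  rw [hst.dualMetric_eq ha F hy hex, Matrix.diagonal_conjTranspose]
  ext l l'
  rw [Matrix.mul_diagonal, Matrix.diagonal_mul, Matrix.sum_apply]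
  simp only [Matrix.map_apply, Chart.gram, Matrix.of_apply, Complex.ofReal_sum]
  rw [Finset.mul_sum, Finset.sum_mul]
  refine Finset.sum_congr rfl fun j _ => ?_
  have hW := norm_ne_zero_iff.2 (hst.coord_ne_zero ha hy.2 hex j)
  rw [hp.eq_sq j _ hR, div_self (pow_ne_zero 2 hW)]
  simp [Matrix.vecMulVec_apply, LocalLift.torusVec]
  ring

theorem isUnit_det_dualMetric (hp : IsMetricWeight D α (blaschkeMap D.pts c d α a) p R)
    (F : P.LocalLift D w) {y : ℂ} (hy : y ∈ F.dom) :
    IsUnit (dualMetric (blaschkeMap D.pts c d α a) p F y).det :=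
  isUnit_iff_ne_zero.2 (dualMetric_posDef hp.pos F hy _).det_pos.ne'

theorem contDiffAt_dualMetric (hst : P.IsStandardForm z₀ D w ν c d α a) (ha : ∀ j, a j ≠ 0)
    (hp : IsMetricWeight D α (blaschkeMap D.pts c d α a) p R)
    (F : P.LocalLift D w) {y : ℂ} (hy : y ∈ F.inner) (r s : Fin n) :
    ContDiffAt ℝ ∞ (fun t => dualMetric (blaschkeMap D.pts c d α a) p F t r s) y :=
  (hst.contDiffOn_dualMetric ha hp.smooth F r s).contDiffAt
    (Filter.mem_of_superset (F.isOpen_inner.mem_nhds hy) fun _ h => F.inner_subset_dom h)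

theorem matDiffAt_dualMetric (hst : P.IsStandardForm z₀ D w ν c d α a) (ha : ∀ j, a j ≠ 0)
    (hp : IsMetricWeight D α (blaschkeMap D.pts c d α a) p R)
    (F : P.LocalLift D w) {y : ℂ} (hy : y ∈ F.inner) :
    MatDiffAt (dualMetric (blaschkeMap D.pts c d α a) p F) y := fun r s =>
  (hst.contDiffAt_dualMetric ha hp F hy r s).differentiableAt (by simp)

/-- Near the circle the Chern connection is the one for which the infinitesimal torus action is
parallel. -/
theorem matPartial_dualMetric_mul_inv (hst : P.IsStandardForm z₀ D w ν c d α a)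
    (ha : ∀ j, a j ≠ 0) (hp : IsMetricWeight D α (blaschkeMap D.pts c d α a) p R)
    (F : P.LocalLift D w) {y : ℂ} (hy : y ∈ F.inner) (hR : R < ‖F.br y‖) :
    matPartial (dualMetric (blaschkeMap D.pts c d α a) p F) y *
      (dualMetric (blaschkeMap D.pts c d α a) p F y)⁻¹ =
      Matrix.diagonal fun l => F.chart.liftLogDeriv D c α l (F.br y) * (F.e * y ^ (F.e - 1)) := by
  have hex : F.br y ∉ exceptional D α := fun h => absurd (hp.norm_le _ h) (not_le.2 hR)
  have hydom := F.inner_subset_dom hy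
  set L : Fin n → ℂ := fun l => F.chart.liftLogDeriv D c α l (F.br y) * (F.e * y ^ (F.e - 1))
  have hev : dualMetric (blaschkeMap D.pts c d α a) p F =ᶠ[𝓝 y] fun t =>
      Matrix.diagonal (F.f t) * F.chart.gram.map Complex.ofReal *
        (Matrix.diagonal (F.f t)).conjTranspose := by
    filter_upwards [F.isOpen_inner.mem_nhds hy,
      F.continuous_br.norm.continuousAt.eventually (lt_mem_nhds hR)] with t h1 h2
    exact hst.dualMetric_eq_gram ha hp F (F.inner_subset_dom h1) h2
  have hJ : ∀ r s, HasDerivAt (fun t => Matrix.diagonal (F.f t) r s)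
      ((Matrix.diagonal L * Matrix.diagonal (F.f y)) r s) y := by
    intro r s
    rw [Matrix.diagonal_mul_diagonal]
    by_cases hrs : r = s
    · subst hrs
      simp only [Matrix.diagonal_apply_eq]
      exact (hst.hasDerivAt_f ha F hy hex r).congr_deriv (mul_comm _ _)
    · simp only [Matrix.diagonal_apply_ne _ hrs]
      exact hasDerivAt_const _ _
  have h0 : matPartial (fun _ : ℂ => F.chart.gram.map Complex.ofReal) y = 0 := by
    ext r s; simp [matPartial, matDeriv]
  rw [matPartial_congr hev, matPartial_conj (N := fun _ => F.chart.gram.map Complex.ofReal) hJ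
    fun r s => differentiableAt_const _, h0,
    Matrix.mul_zero, Matrix.zero_mul, add_zero]
  have hg := hst.dualMetric_eq_gram ha hp F hydom hR
  have hi := Matrix.mul_nonsing_inv _ (isUnit_det_dualMetric hp F hydom)
  rw [show ∀ A B K E V : Matrix (Fin n) (Fin n) ℂ, A * B * K * E * V = A * (B * K * E * V) from
    fun A B K E V => by simp only [Matrix.mul_assoc], ← hg, hi, Matrix.mul_one]

theorem chernForm_of_mem_inner {W : ℂ → Fin m → ℂ} {F : P.LocalLift D w} {y : ℂ}
    (hy : y ∈ F.inner) : chernForm D c α W p F y =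
      -(matPartial (dualMetric W p F) y * (dualMetric W p F y)⁻¹) := by
  rw [chernForm, if_pos (by simpa using hy.2)]

theorem chernForm_near_boundary (hst : P.IsStandardForm z₀ D w ν c d α a) (ha : ∀ j, a j ≠ 0)
    (hp : IsMetricWeight D α (blaschkeMap D.pts c d α a) p R)
    (F : P.LocalLift D w) {y : ℂ} (hy : y ∈ F.dom) (hR : R < ‖F.br y‖) :
    chernForm D c α (blaschkeMap D.pts c d α a) p F y =
      -Matrix.diagonal fun l => F.chart.liftLogDeriv D c α l (F.br y) * (F.e * y ^ (F.e - 1)) := by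
  rw [chernForm]
  split_ifs with h
  · rw [hst.matPartial_dualMetric_mul_inv ha hp F ⟨hy.1, by simpa using h⟩ hR]
  · rfl

theorem contDiffOn_chernForm (hst : P.IsStandardForm z₀ D w ν c d α a) (ha : ∀ j, a j ≠ 0)
    (hp : IsMetricWeight D α (blaschkeMap D.pts c d α a) p R) (F : P.LocalLift D w) (r s : Fin n) :
    ContDiffOn ℝ ∞ (fun y => chernForm D c α (blaschkeMap D.pts c d α a) p F y r s) F.dom := by
  intro y hy
  by_cases hin : y ∈ F.inner
  · have hN := fun r s => hst.contDiffAt_dualMetric ha hp F hin r s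
    have h1 : ∀ r s, ContDiffAt ℝ ∞
        (fun t => matPartial (dualMetric (blaschkeMap D.pts c d α a) p F) t r s) y := fun r s => by
      have h2 : ∀ v : ℂ, ContDiffAt ℝ ∞
          (fun t => fderiv ℝ (fun t => dualMetric (blaschkeMap D.pts c d α a) p F t r s) t v) y :=
        fun v => ((hN r s).fderiv_right (m := ∞) (by simp)).clm_apply contDiffAt_const
      exact contDiffAt_const.mul ((h2 1).sub (contDiffAt_const.mul (h2 I)))
    have h3 : ∀ r s, ContDiffAt ℝ ∞
        (fun t => (dualMetric (blaschkeMap D.pts c d α a) p F t)⁻¹ r s) y := fun r s =>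
      (contDiffWithinAt_matrix_inv (S := Set.univ) (fun r s => (hN r s).contDiffWithinAt)
        (isUnit_det_dualMetric hp F hy).ne_zero r s).contDiffAt Filter.univ_mem
    have h4 : ContDiffAt ℝ ∞ (fun t =>
        (-(matPartial (dualMetric (blaschkeMap D.pts c d α a) p F) t *
          (dualMetric (blaschkeMap D.pts c d α a) p F t)⁻¹)) r s) y := by
      simp only [Matrix.neg_apply, Matrix.mul_apply]
      exact (ContDiffAt.sum fun l _ => (h1 r l).mul (h3 l s)).neg
    refine (h4.congr_of_eventuallyEq ?_).contDiffWithinAt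
    filter_upwards [F.isOpen_inner.mem_nhds hin] with t ht
    rw [chernForm_of_mem_inner ht]
  · have hbr : ‖F.br y‖ = 1 := by
      refine le_antisymm (by simpa using hy.2) (not_lt.1 fun h => hin ⟨hy.1, by simpa using h⟩)
    have hR : R < ‖F.br y‖ := by rw [hbr]; exact hp.lt_one
    have hex : F.br y ∉ exceptional D α := hst.notMem_exceptional_of_norm_eq_one hbr
    have h1 : ContDiffAt ℝ ∞ (fun t => (-Matrix.diagonal fun l =>
        F.chart.liftLogDeriv D c α l (F.br t) * (F.e * t ^ (F.e - 1)) :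
          Matrix (Fin n) (Fin n) ℂ) r s) y := by
      simp only [Matrix.neg_apply]
      refine ContDiffAt.neg ?_
      by_cases hrs : r = s
      · subst hrs
        simp only [Matrix.diagonal_apply_eq]
        have h2 : AnalyticAt ℂ (F.chart.liftLogDeriv D c α r) (F.br y) := by
          unfold Chart.liftLogDeriv
          exact Finset.analyticAt_fun_sum _ fun j _ => analyticAt_const.mul
            (analyticAt_coordLogDeriv hst.zeros_mem ha hy.2 (hst.coord_ne_zero ha hy.2 hex j))
        have h3 : AnalyticAt ℂ (fun t => F.chart.liftLogDeriv D c α r (F.br t) *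
            (F.e * t ^ (F.e - 1))) y := (h2.comp (F.analyticAt_br y)).mul (by fun_prop)
        exact (h3.restrictScalars (𝕜 := ℝ)).contDiffAt
      · simp only [Matrix.diagonal_apply_ne _ hrs]
        exact contDiffAt_const
    have h2 : ∀ᶠ t in 𝓝[F.dom] y, R < ‖F.br t‖ :=
      nhdsWithin_le_nhds (F.continuous_br.norm.continuousAt.eventually (lt_mem_nhds hR))
    refine h1.contDiffWithinAt.congr_of_eventuallyEq ?_ ?_
    · filter_upwards [h2, self_mem_nhdsWithin] with t h3 h4
      rw [hst.chernForm_near_boundary ha hp F h4 h3]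
    · rw [hst.chernForm_near_boundary ha hp F hy hR]

/-- The transition matrix `J` is holomorphic, so that `∂(J N Jᴴ) = (∂J) N Jᴴ + J (∂N) Jᴴ`. -/
theorem chernForm_glue (hst : P.IsStandardForm z₀ D w ν c d α a) (ha : ∀ j, a j ≠ 0)
    (hp : IsMetricWeight D α (blaschkeMap D.pts c d α a) p R)
    {F F' : P.LocalLift D w} {y y' : ℂ} {β : ℂ → ℂ} {φ : (Fin n → ℂ) → Fin n → ℂ}
    (h : IsGluing F F' y y' β φ) (v : ℂ) :
    ((deriv β y * v) • chernForm D c α (blaschkeMap D.pts c d α a) p F' y') * jac φ (F.f y) =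
      jac φ (F.f y) * (v • chernForm D c α (blaschkeMap D.pts c d α a) p F y) -
        Matrix.of fun r s => fderiv ℝ (fun t => jac φ (F.f t) r s) y v := by
  set N := dualMetric (P := P) (D := D) (w := w) (blaschkeMap D.pts c d α a) p with hN
  set J := jac φ (F.f y) with hJdef
  have hglue := hst.dualMetric_glue ha hp.smooth h
  have hev : (fun t => N F' (β t)) =ᶠ[𝓝 y]
      fun t => jac φ (F.f t) * N F t * (jac φ (F.f t)).conjTranspose := by
    filter_upwards [h.eventually] with t ht
    exact (hst.dualMetric_glue ha hp.smooth ht).symm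
  obtain ⟨hy, hy', -, hβ, hβa, -, hφ, -, -⟩ := h
  set J' : Matrix (Fin n) (Fin n) ℂ := Matrix.of fun r s => deriv (fun t => jac φ (F.f t) r s) y
    with hJ'
  have hJd : ∀ r s, HasDerivAt (fun t => jac φ (F.f t) r s) (J' r s) y := fun r s =>
    (analyticAt_jac hy hφ r s).differentiableAt.hasDerivAt
  have hJv : (Matrix.of fun r s => fderiv ℝ (fun t => jac φ (F.f t) r s) y v) = v • J' := by
    ext r s
    rw [Matrix.of_apply, (hJd r s).complexToReal_fderiv.fderiv]
    simp [mul_comm]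
  have hpart := matPartial_congr hev
  rw [matPartial_comp hβa.differentiableAt.hasDerivAt
    (by rw [hβ]; exact hst.matDiffAt_dualMetric ha hp F' hy'), hβ,
    matPartial_conj hJd (hst.matDiffAt_dualMetric ha hp F hy)] at hpart
  rw [hJv, chernForm_of_mem_inner hy, chernForm_of_mem_inner hy', ← hN]
  have hNu : IsUnit (N F y).det := isUnit_det_dualMetric hp F (F.inner_subset_dom hy)
  have hNu' : IsUnit (N F' y').det := isUnit_det_dualMetric hp F' (F'.inner_subset_dom hy')
  set X := N F y * J.conjTranspose with hX
  have hJX : J * X = N F' y' := by rw [hX, ← Matrix.mul_assoc, hglue]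
  have hJu : IsUnit J.det := by
    rw [← hJX, Matrix.det_mul] at hNu'
    exact isUnit_of_mul_isUnit_left hNu'
  have hXu : IsUnit X.det := by
    rw [← hJX, Matrix.det_mul] at hNu'
    exact isUnit_of_mul_isUnit_right hNu'
  have h1 : deriv β y • matPartial (N F') y' =
      (J' + J * (matPartial (N F) y * (N F y)⁻¹)) * X := by
    rw [hpart, hX, Matrix.add_mul, ← Matrix.mul_assoc, Matrix.mul_assoc J, Matrix.mul_assoc J,
      Matrix.mul_assoc (matPartial (N F) y), ← Matrix.mul_assoc ((N F y)⁻¹),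
      Matrix.nonsing_inv_mul _ hNu, Matrix.one_mul]
  have h2 : X * ((N F' y')⁻¹ * J) = 1 := by
    rw [← hJX, Matrix.mul_inv_rev, Matrix.mul_assoc X⁻¹, Matrix.nonsing_inv_mul _ hJu, Matrix.mul_one,
      Matrix.mul_nonsing_inv _ hXu]
  have h3 : (deriv β y • matPartial (N F') y') * ((N F' y')⁻¹ * J) =
      J' + J * (matPartial (N F) y * (N F y)⁻¹) := by
    rw [h1, Matrix.mul_assoc, h2, Matrix.mul_one]
  have h4 : ((deriv β y * v) • -(matPartial (N F') y' * (N F' y')⁻¹)) * J =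
      -(v • ((deriv β y • matPartial (N F') y') * ((N F' y')⁻¹ * J))) := by
    simp only [Matrix.smul_mul, Matrix.neg_mul, smul_neg, smul_smul, Matrix.mul_assoc,
      mul_comm v]
  rw [h4, h3, Matrix.mul_smul, Matrix.mul_neg, smul_add, smul_neg]
  abel

/-- The dual metric `N` is Hermitian, so that `dN = ∂N + (∂N)ᴴ`, where `∂N = -Γ N`. -/
theorem chernForm_unitary (hst : P.IsStandardForm z₀ D w ν c d α a) (ha : ∀ j, a j ≠ 0)
    (hp : IsMetricWeight D α (blaschkeMap D.pts c d α a) p R)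
    (F : P.LocalLift D w) {y : ℂ} (hy : y ∈ F.inner) (v : ℂ) :
    matDeriv (fun t => (dualMetric (blaschkeMap D.pts c d α a) p F t)⁻¹) y v =
      (v • chernForm D c α (blaschkeMap D.pts c d α a) p F y).conjTranspose *
        (dualMetric (blaschkeMap D.pts c d α a) p F y)⁻¹ +
      (dualMetric (blaschkeMap D.pts c d α a) p F y)⁻¹ *
        (v • chernForm D c α (blaschkeMap D.pts c d α a) p F y) := by
  set N := dualMetric (P := P) (D := D) (w := w) (blaschkeMap D.pts c d α a) p with hN
  have hev : ∀ᶠ t in 𝓝 y, t ∈ F.inner := F.isOpen_inner.eventually_mem hy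
  have hherm : ∀ t ∈ F.inner, (N F t).conjTranspose = N F t := fun t ht =>
    (dualMetric_posDef hp.pos F (F.inner_subset_dom ht) _).isHermitian
  have hu : ∀ t ∈ F.inner, IsUnit (N F t).det := fun t ht =>
    isUnit_det_dualMetric hp F (F.inner_subset_dom ht)
  have hNd := hst.matDiffAt_dualMetric ha hp F hy
  have hNi : MatDiffAt (fun t => (N F t)⁻¹) y := fun r s =>
    ((contDiffWithinAt_matrix_inv (S := Set.univ)
      (fun r s => (hst.contDiffAt_dualMetric ha hp F hy r s).contDiffWithinAt)
      (hu y hy).ne_zero r s).contDiffAt Filter.univ_mem).differentiableAt (by simp)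
  rw [matDeriv_inv hNd (hev.mono hu) hNi, matDeriv_eq_matPartial hNd (hev.mono hherm),
    chernForm_of_mem_inner hy, ← hN]
  have h1 : ((N F y)⁻¹).conjTranspose = (N F y)⁻¹ := by
    rw [Matrix.conjTranspose_nonsing_inv, hherm y hy]
  simp only [Matrix.conjTranspose_smul, Matrix.conjTranspose_neg, Matrix.conjTranspose_mul, h1,
    Matrix.mul_add, Matrix.add_mul, Matrix.smul_mul, Matrix.mul_smul, Matrix.neg_mul,
    Matrix.mul_neg, smul_neg, Matrix.mul_assoc, neg_add, Complex.star_def]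
  abel

/-- At the boundary the metric is real on the Lagrangian subbundle, as `chart.gram` is real. -/
theorem dualMetric_lagrangian (hst : P.IsStandardForm z₀ D w ν c d α a) (ha : ∀ j, a j ≠ 0)
    (hp : IsMetricWeight D α (blaschkeMap D.pts c d α a) p R)
    (F : P.LocalLift D w) {y : ℂ} (hy : y ∈ F.dom) (hbr : ‖F.br y‖ = 1) {ξ η : Fin n → ℂ}
    (hξ : ξ ∈ torusTangent (F.f y)) (hη : η ∈ torusTangent (F.f y)) :
    (star ξ ⬝ᵥ ((dualMetric (blaschkeMap D.pts c d α a) p F y)⁻¹).mulVec η).im = 0 := by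
  obtain ⟨t, ht⟩ := hξ
  obtain ⟨t', ht'⟩ := hη
  have hR : R < ‖F.br y‖ := by rw [hbr]; exact hp.lt_one
  have hex : F.br y ∉ exceptional D α := hst.notMem_exceptional_of_norm_eq_one hbr
  have hf0 := hst.f_ne_zero ha F hy hex
  have hu := isUnit_det_dualMetric hp F hy
  have hN := hst.dualMetric_eq_gram ha hp F hy hR
  set N := dualMetric (blaschkeMap D.pts c d α a) p F y
  have hgram : IsUnit F.chart.gram.det := by
    rw [hN, Matrix.det_mul, Matrix.det_mul] at hu
    have h1 := isUnit_of_mul_isUnit_right (isUnit_of_mul_isUnit_left hu)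
    have h2 : (F.chart.gram.map Complex.ofReal).det = ((F.chart.gram.det : ℝ) : ℂ) :=
      (RingHom.map_det Complex.ofRealHom F.chart.gram).symm
    rw [h2] at h1
    exact isUnit_iff_ne_zero.2 (by exact_mod_cast h1.ne_zero)
  set x : Fin n → ℝ := (F.chart.gram)⁻¹.mulVec t' with hx
  have hgx : F.chart.gram.mulVec x = t' := by
    rw [hx, Matrix.mulVec_mulVec, Matrix.mul_nonsing_inv _ hgram, Matrix.one_mulVec]
  -- the solution of `N ζ = η`
  set ζ : Fin n → ℂ := fun l => I * x l / conj (F.f y l) with hζ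
  have hNζ : N.mulVec ζ = η := by
    have hf0' : ∀ l, conj (F.f y l) ≠ 0 := fun l => by simpa using hf0 l
    rw [hN, Matrix.diagonal_conjTranspose, ← Matrix.mulVec_mulVec, ← Matrix.mulVec_mulVec]
    have h1 : (Matrix.diagonal (star (F.f y))).mulVec ζ = fun l => I * (x l : ℂ) := by
      ext l
      rw [Matrix.mulVec_diagonal]
      exact mul_div_cancel₀ _ (hf0' l)
    have h2 : (F.chart.gram.map Complex.ofReal).mulVec (fun l => I * (x l : ℂ)) =
        fun l => I * (t' l : ℂ) := by
      ext l
      rw [← hgx]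
      simp only [Matrix.mulVec, dotProduct, Matrix.map_apply, Complex.ofReal_sum, Complex.ofReal_mul]
      rw [Finset.mul_sum]
      exact Finset.sum_congr rfl fun r _ => by ring
    rw [h1, h2]
    ext l
    rw [Matrix.mulVec_diagonal, ht']
    ring
  have hNinv : N⁻¹.mulVec η = ζ := by
    rw [← hNζ, Matrix.mulVec_mulVec, Matrix.nonsing_inv_mul _ hu, Matrix.one_mulVec]
  rw [hNinv]
  have h3 : star ξ ⬝ᵥ ζ = ((∑ l, t l * x l : ℝ) : ℂ) := by
    simp only [dotProduct, Complex.ofReal_sum]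
    refine Finset.sum_congr rfl fun l _ => ?_
    have h4 : conj (F.f y l) ≠ 0 := by simpa using hf0 l
    rw [Pi.star_apply, ht, hζ]
    simp only [Complex.star_def, map_mul, Complex.conj_I, Complex.conj_ofReal]
    field_simp
    push_cast
    linear_combination (-(t l : ℂ) * x l) * Complex.I_sq
  rw [h3, Complex.ofReal_im]

/-- The Chern connection preserves the Lagrangian subbundle along the boundary: the derivative of
each basis section is cancelled by the connection matrix. -/
theorem chernForm_preserves (hst : P.IsStandardForm z₀ D w ν c d α a) (ha : ∀ j, a j ≠ 0)
    (hp : IsMetricWeight D α (blaschkeMap D.pts c d α a) p R)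
    (F : P.LocalLift D w) (he : F.e = 1) {y : ℂ} (hy : y ∈ F.dom) (hbr : ‖F.br y‖ = 1) (l : Fin n) :
    Pi.single l (deriv (fun t : ℝ => I * F.f (F.br y * exp (t * I) - F.p) l) 0) +
      ((I * F.br y) • chernForm D c α (blaschkeMap D.pts c d α a) p F y).mulVec
        (Pi.single l (I * F.f y l)) ∈ torusTangent (F.f y) := by
  have hR : R < ‖F.br y‖ := by rw [hbr]; exact hp.lt_one
  refine ⟨0, fun r => ?_⟩
  rw [hst.deriv_boundary ha F he hy hbr, hst.chernForm_near_boundary ha hp F hy hR, he,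
    Matrix.smul_mulVec, Matrix.neg_mulVec, Pi.add_apply, Pi.smul_apply, Pi.neg_apply,
    Matrix.mulVec_diagonal]
  by_cases hr : r = l
  · subst hr
    simp
    ring
  · simp [hr]

theorem exists_isMetricWeight (hst : P.IsStandardForm z₀ D w ν c d α a) (ha : ∀ j, a j ≠ 0) :
    ∃ (p : Fin m → ℂ → ℝ) (R : ℝ), IsMetricWeight D α (blaschkeMap D.pts c d α a) p R := by
  have hlt : ∀ z ∈ exceptional D α, ‖z‖ < 1 := by
    intro z hz
    rcases mem_exceptional.1 hz with ⟨i, rfl⟩ | ⟨j, s, rfl⟩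
    · simpa using D.pts_mem i
    · simpa using hst.zeros_mem j s
  obtain ⟨r, hr1, hr0, hr⟩ : ∃ r : ℝ, r < 1 ∧ 0 < r ∧ ∀ z ∈ exceptional D α, ‖z‖ < r := by
    have h1 : ∀ᶠ r : ℝ in 𝓝[<] 1, ∀ z ∈ exceptional D α, ‖z‖ < r :=
      (Filter.eventually_all_finset _).2 fun z hz => nhdsWithin_le_nhds (lt_mem_nhds (hlt z hz))
    have h2 : ∀ᶠ r : ℝ in 𝓝[<] 1, (0 : ℝ) < r := nhdsWithin_le_nhds (lt_mem_nhds one_pos)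
    obtain ⟨r, h3, h4, h5⟩ := (h1.and (h2.and self_mem_nhdsWithin)).exists
    exact ⟨r, h5, h4, h3⟩
  obtain ⟨R, hrR, hR1⟩ := exists_between hr1
  have hden : 0 < R ^ 2 - r ^ 2 := by nlinarith
  -- a cut-off function: `0` near the exceptional points, `1` near the boundary
  set ρ : ℂ → ℝ := fun z => Real.smoothTransition ((‖z‖ ^ 2 - r ^ 2) / (R ^ 2 - r ^ 2)) with hρ
  have hρs : ContDiff ℝ ∞ ρ := Real.smoothTransition.contDiff.comp
    (((contDiff_norm_sq ℝ).sub contDiff_const).div_const _)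
  have hρ0 : ∀ z : ℂ, ‖z‖ ≤ r → ρ z = 0 := fun z hz =>
    Real.smoothTransition.zero_of_nonpos (div_nonpos_of_nonpos_of_nonneg
      (by nlinarith [norm_nonneg z]) hden.le)
  have hρ1 : ∀ z : ℂ, R < ‖z‖ → ρ z = 1 := fun z hz =>
    Real.smoothTransition.one_of_one_le ((one_le_div hden).2 (by nlinarith))
  have hρn : ∀ z, 0 ≤ ρ z := fun z => Real.smoothTransition.nonneg _
  have hρl : ∀ z, ρ z ≤ 1 := fun z => Real.smoothTransition.le_one _
  have hex : ∀ z : ℂ, r ≤ ‖z‖ → z ∉ exceptional D α := fun z hz h =>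
    absurd (hr z h) (not_lt.2 hz)
  refine ⟨fun j z => (1 - ρ z) + ρ z * ‖blaschkeMap D.pts c d α a z j‖ ^ 2, R, ?_, ?_, hR1,
    fun z hz => (hr z hz).le.trans hrR.le, ?_⟩
  · intro j z hz
    rcases (hρl z).lt_or_eq with h | h
    · have := mul_nonneg (hρn z) (sq_nonneg ‖blaschkeMap D.pts c d α a z j‖)
      linarith
    · have h1 : r ≤ ‖z‖ := by
        by_contra h2
        rw [hρ0 z (not_le.1 h2).le] at h
        exact zero_ne_one h
      have h2 := norm_pos_iff.2 (hst.coord_ne_zero ha hz (hex z h1) j)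
      rw [h]
      positivity
  · intro j z hz
    rcases lt_or_ge ‖z‖ r with h | h
    · refine (contDiffAt_const (c := (1 : ℝ))).congr_of_eventuallyEq ?_
      have h1 : ∀ᶠ z' : ℂ in 𝓝 z, ‖z'‖ < r := continuous_norm.continuousAt.eventually (gt_mem_nhds h)
      filter_upwards [h1] with z' h2
      rw [hρ0 z' h2.le]
      simp
    · exact (contDiffAt_const.sub hρs.contDiffAt).add (hρs.contDiffAt.mul
        ((contDiffAt_norm_coord hst.zeros_mem ha hz (hst.coord_ne_zero ha hz (hex z h) j)).pow 2))
  · intro j z hz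
    simp only [hρ1 z hz]
    ring

/-- The Chern connection of the metric inverse to `dualMetric` preserves the Lagrangian subbundle. -/
theorem nonempty_orthogonalConnection (hst : P.IsStandardForm z₀ D w ν c d α a)
    (ha : ∀ j, a j ≠ 0) : Nonempty (OrthogonalConnection D w) := by
  obtain ⟨p, R, hp⟩ := hst.exists_isMetricWeight ha
  set W := blaschkeMap D.pts c d α a with hW
  refine ⟨{
    h := fun F y => (dualMetric W p F y)⁻¹
    Γ := fun F y => (LinearMap.toSpanSingleton ℂ _ (chernForm D c α W p F y)).restrictScalars ℝ
    h_smooth := fun F r s y hy => contDiffWithinAt_matrix_inv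
      (fun r s => hst.contDiffOn_dualMetric ha hp.smooth F r s y hy)
      (isUnit_det_dualMetric hp F hy).ne_zero r s
    Γ_smooth := fun F v r s => contDiffOn_const.mul (hst.contDiffOn_chernForm ha hp F r s)
    h_posDef := fun F y hy => (dualMetric_posDef hp.pos F hy W).inv
    h_glue := ?_
    Γ_glue := fun F F' y y' β φ h v => hst.chernForm_glue ha hp h v
    unitary := fun F y hy v => hst.chernForm_unitary ha hp F hy v
    lagrangian := fun F _ y hy hbr ξ hξ η hη => hst.dualMetric_lagrangian ha hp F hy hbr hξ hη
    preserves := fun F he y hy hbr l => hst.chernForm_preserves ha hp F he hy hbr l }⟩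
  intro F F' y y' β φ h
  have h1 := hst.dualMetric_glue ha hp.smooth h
  have hu := isUnit_det_dualMetric hp F' (F'.inner_subset_dom h.2.1)
  have hu0 := isUnit_det_dualMetric hp F (F.inner_subset_dom h.1)
  rw [← h1, Matrix.det_mul, Matrix.det_mul] at hu
  have hJ : IsUnit (jac φ (F.f y)).det := isUnit_of_mul_isUnit_left (isUnit_of_mul_isUnit_left hu)
  have hJ' : IsUnit (jac φ (F.f y)).conjTranspose.det := isUnit_of_mul_isUnit_right hu
  rw [hW, ← h1, Matrix.mul_inv_rev, Matrix.mul_inv_rev, ← Matrix.mul_assoc,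
    Matrix.mul_nonsing_inv _ hJ', Matrix.one_mul, Matrix.mul_assoc, Matrix.nonsing_inv_mul _ hJ,
    Matrix.mul_one]

theorem hasChernWeilMaslovIndex (hst : P.IsStandardForm z₀ D w ν c d α a)
    (ha : ∀ j, a j ≠ 0) : HasChernWeilMaslovIndex D w
      (∑ j, 2 * (d j : ℝ) + 2 * ∑ i, ((P.age (ν i) : ℚ) : ℝ)) := by
  refine ⟨?_, fun C κ hκ => ⟨(C.integral_curvature hκ hst ha).1, ?_⟩⟩
  · obtain ⟨C⟩ := hst.nonempty_orthogonalConnection ha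
    refine ⟨C, C.curl c α, fun F hF hpt => ?_⟩
    have h0in : (0 : ℂ) ∈ F.inner := ⟨by simpa using F.ε_pos, by rwa [F.br_zero]⟩
    rw [C.trace_curvature_eq_curl F hst ha h0in (by rwa [F.br_zero]), F.br_zero,
      F.localOrder.eq_one hpt]
    simp
  · rw [C.integral_curvature_eq hκ hst ha]
    have hpi : (Real.pi : ℂ) ≠ 0 := by exact_mod_cast Real.pi_ne_zero
    have hage : ∀ i, P.age (ν i) = ∑ j, c i j := fun i => (hst.boxCoeff i).age_eq
    simp only [hage]
    push_cast
    rw [Finset.sum_add_distrib, Finset.sum_comm (f := fun j i => (c i j : ℂ)), ← Finset.mul_sum]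
    field_simp
    linear_combination (-(∑ j, (d j : ℂ) + ∑ i, ∑ j, (c i j : ℂ))) * Complex.I_sq

end IsStandardForm

end LabeledPolytope

/-! ### The classification of holomorphic orbifold discs -/

namespace LabeledPolytope

theorem ne_zero_of_torusFiber_eq {n m : ℕ} {P : LabeledPolytope n m} {u : Fin n → ℝ}
    (hu : u ∈ interior P.polytope) {z₀ : Fin m → ℂ} (hz₀ : z₀ ∈ P.U)
    (hL : {x : P.X | ∃ z ∈ realTorusOrbit z₀, P.Rep x z} = P.torusFiber u) (j : Fin m) :
    z₀ j ≠ 0 := by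
  have h0 : (Quotient.mk P.orbitSetoid ⟨z₀, hz₀⟩ : P.X) ∈ P.torusFiber u := by
    rw [← hL]
    exact ⟨z₀, ⟨1, fun j => by simp⟩, hz₀, rfl⟩
  obtain ⟨z, hz, hzu⟩ := h0
  have hrep : P.Rep (Quotient.mk P.orbitSetoid ⟨z₀, hz₀⟩) z₀ := ⟨hz₀, rfl⟩
  intro h
  have h1 : z j = 0 := ((hz.sameOrbit hrep).eq_zero_iff j).1 h
  have h2 := hzu j
  have h3 := ell_pos_of_mem_interior hu j
  rw [h1] at h2
  simp at h2
  linarith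

end LabeledPolytope

theorem mainTheorem1 {n m k : ℕ} (P : LabeledPolytope n m)
    (u : Fin n → ℝ) (hu : u ∈ interior P.polytope)
    (z₀ : Fin m → ℂ) (hz₀ : z₀ ∈ P.U)
    (hL : {x : P.X | ∃ z ∈ realTorusOrbit z₀, P.Rep x z} = P.torusFiber u)
    (D : MarkedOrbiDisc k) (w : ℂ → P.X) :
    (P.IsHolomorphic D (P.torusFiber u) w →
      (∀ i, ∃! ν, P.IsSector D w i ν) ∧
      ∀ ν : Fin k → Fin n → ℤ, (∀ i, P.IsSector D w i (ν i)) →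
        (∀ i, ν i ∈ P.Box) ∧
        ∃ (c : Fin k → Fin m → ℚ) (d : Fin m → ℕ) (α : (j : Fin m) → Fin (d j) → ℂ)
          (a : Fin m → ℂ), P.IsStandardForm z₀ D w ν c d α a) ∧
    (∀ (ν : Fin k → Fin n → ℤ) (c : Fin k → Fin m → ℚ) (d : Fin m → ℕ)
      (α : (j : Fin m) → Fin (d j) → ℂ) (a : Fin m → ℂ), P.IsStandardForm z₀ D w ν c d α a →
        P.IsHolomorphic D (P.torusFiber u) w ∧
        (∀ i, P.IsSector D w i (ν i)) ∧
        (P.IsRepresentable D w ↔ ∀ i, D.ord i = sectorOrder (c i)) ∧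
        LabeledPolytope.HasDesingularizedMaslovIndex D w (∑ j, 2 * (d j : ℤ)) ∧
        LabeledPolytope.HasChernWeilMaslovIndex D w
          (∑ j, 2 * (d j : ℝ) + 2 * ∑ i, ((P.age (ν i) : ℚ) : ℝ))) := by
  have hz : ∀ j, z₀ j ≠ 0 := LabeledPolytope.ne_zero_of_torusFiber_eq hu hz₀ hL
  have ha : ∀ {a : Fin m → ℂ}, a ∈ realTorusOrbit z₀ → ∀ j, a j ≠ 0 := by
    rintro a ⟨t, ht⟩ j
    rw [ht j]
    exact mul_ne_zero (Circle.coe_ne_zero _) (hz j)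
  refine ⟨fun hw => ?_, fun ν c d α a hst => ?_⟩
  · obtain ⟨ν, c, d, α, a, hst⟩ := hw.exists_isStandardForm hu hz hL
    have ha' := ha hst.const_mem
    have huniq : ∀ i ν', P.IsSector D w i ν' → ν' = ν i := by
      intro i ν' h
      obtain ⟨F, hF⟩ := LabeledPolytope.exists_localLift hst ha'
        (Metric.ball_subset_closedBall (D.pts_mem i))
      exact LabeledPolytope.IsSector.unique F hF
        (hst.exists_f_ne_zero ha' F (hF ▸ D.pts_mem i)) h (hst.isSector ha' i)
    refine ⟨fun i => ⟨ν i, hst.isSector ha' i, huniq i⟩, fun ν' hν' => ?_⟩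
    obtain rfl : ν' = ν := funext fun i => huniq i _ (hν' i)
    refine ⟨fun i => ?_, c, d, α, a, hst⟩
    obtain ⟨F, hF⟩ := LabeledPolytope.exists_localLift hst ha'
      (Metric.ball_subset_closedBall (D.pts_mem i))
    exact ⟨F.chart, hst.mem_box ha' F hF⟩
  · have ha' := ha hst.const_mem
    exact ⟨hst.isHolomorphic ha' hL, hst.isSector ha', hst.isRepresentable_iff ha',
      hst.hasDesingularizedMaslovIndex ha', hst.hasChernWeilMaslovIndex ha'⟩
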